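/- **Rings and complexes.** For $n\ge 1$ let $A_n$ be the path ring (over $\mathbb Z$) of the quiver with vertices $1,\dots,n$ and one arrow $(i|j)$ for each ordered pair with $|i-j|=1$, modulo $(i|i{\pm}1|i{\pm}2)=0$ and $(i|i{-}1|i)=(i|i{+}1|i)$, with the additional relations $(1|2|1|2)=0=(2|1|2|1)$ for $n=2$, and $A_1=\mathbb Z[X_1]/(X_1^2)$. Put $X_i=(i|j|i)$ for a neighbour $j$ of $i$ and $X_0=X_{n+1}=0$. Grade $A_n$ by path length ($\deg X_i=2$), and let $P_i=A_n(i)$, ${}_iP=(i)A_n$. Consider the complexes of graded $A_n$-bimodules, with $A_n$ in cohomological degree $0$, $$R_i:\ 0\to P_i\otimes_{\mathbb Z}{}_iP\xrightarrow{\ \beta_i\ }A_n\to 0,\qquad R_i':\ 0\to A_n\xrightarrow{\ \gamma_i\ }P_i\otimes_{\mathbb Z}{}_iP\{-2\}\to 0,$$ where $\beta_i$ is the multiplication, $\gamma_i(1)=(i)\otimes X_i+X_i\otimes(i)+\sum_{|j-i|=1}(j|i)\otimes(i|j)$, and $\{-2\}$ lowers the internal degree by $2$. Let $\mathcal C(A_n)$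 be the homotopy category of bounded complexes of graded left $A_n$-modules, let $\mathcal R_i=R_i\otimes_{A_n}-$ and $\mathcal R_i'=R_i'\otimes_{A_n}-$ be the resulting endofunctors of $\mathcal C(A_n)$, and for a word $g=s_1\cdots s_k$ in the letters $\sigma_i^{\pm1}$ $(1\le i\le n)$ let $F_g=F_{s_1}\circ\dots\circ F_{s_k}$, where $F_{\sigma_i}=\mathcal R_i$, $F_{\sigma_i^{-1}}=\mathcal R_i'$ and $F_\emptyset=\mathrm{Id}$. Natural transformations of internal degree $d$ between endofunctors $F,G$ of $\mathcal C(A_n)$ are natural transformations from $F$ to $G$ followed by the shift of the internal grading by $d$; let $\mathrm{Fun}(A_n)$ have as objects the exact endofunctors of $\mathcal C(A_n)$ that commute with the shift of the internal grading, and as morphisms the homogeneous natural transformations. **Braid cobordisms.** The category $\mathcal{BC}^c_{n+1}$ has as objects the (unreduced) words in $\sigma_1^{\pm1},\dots,\sigma_n^{\pm1}$. A movie is a finite sequence of steps, each replacing a subword, in arbitrary position, by one of the following moves: (I) $\emptyset\leftrightarrow\sigma_i^{a}\sigma_i^{-a}$; $\sigma_i^a\sigma_j^b\to\sigma_j^b\sigma_i^a$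 for $|i-j|>1$; $\sigma_i^a\sigma_j^b\sigma_i^c\to\sigma_j^c\sigma_i^b\sigma_j^a$ for $|i-j|=1$ and $b\in\{a,c\}$; (II) $\emptyset\leftrightarrow\sigma_i^{a}$ (all exponents are $\pm1$). Morphisms are movies modulo the equivalence relation, compatible with composition and with placing words to the left or to the right, that is generated by the following equalities and by the same equalities with both movies run backwards. 1–10 (moves of type I only): * a move of type I followed by its inverse is the identity; * $\sigma_i^a\to\sigma_i^a(\sigma_i^{-a}\sigma_i^{a})=(\sigma_i^a\sigma_i^{-a})\sigma_i^a\to\sigma_i^a$ is the identity; * the two ways of reversing $\sigma_i^a\sigma_j^b\sigma_k^c$, with pairwise distant $i,j,k$, agree; * for $|i-j|>1$, creating $\sigma_i^a\sigma_i^{-a}$ to the right of $\sigma_j^b$ and moving $\sigma_j^b$ to the right past it equals creating it on the left; * for $|i-j|=1$ and $k$ distant from $i$ and $j$, moving $\sigma_k^d$ past $\sigma_i^a\sigma_j^b\sigma_i^c$ commutes with the braid move of this word; * for $|i-j|=1$, whenever the braid moves are defined, creating $\sigma_i^c\sigma_i^{-c}$ to the right of $\sigma_i^a\sigma_j^b$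 and applying the braid move to the first three letters equals creating $\sigma_j^c\sigma_j^{-c}$ to the left and applying the braid move to the last three letters; and, likewise, creating $\sigma_i^{-a}\sigma_i^{a}$ to the left of $\sigma_j^b\sigma_i^c$ and applying the braid move to the last three letters equals creating $\sigma_j^{-a}\sigma_j^{a}$ to the right and applying the braid move to the first three letters; * for $p,q$ and $q,r$ adjacent and $p,r$ distant, whenever the braid moves are defined, the two sequences from $\sigma_p^a\sigma_q^b\sigma_p^d\sigma_r^c\sigma_q^e\sigma_p^f$ to $\sigma_r^f\sigma_q^e\sigma_r^d\sigma_p^c\sigma_q^b\sigma_r^a$, each made of four braid moves and commutations of distant letters, that begin with the braid move of the first three letters, respectively with the exchange of the third and the fourth letter, agree. 11–14 (with one move of type II): * $(\sigma_j^b\to\sigma_i^a\sigma_j^b\to\sigma_j^b\sigma_i^a)=(\sigma_j^b\to\sigma_j^b\sigma_i^a)$ for $|i-j|>1$; * $(\emptyset\to\sigma_i^a\sigma_i^{-a}\to\sigma_i^{a})=(\emptyset\to\sigma_i^a)$ and $(\emptyset\to\sigma_i^{-a}\sigma_i^{a}\to\sigma_i^{a})=(\emptyset\to\sigma_i^a)$;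 * $(\sigma_i^a\sigma_j^a\to\sigma_i^a\sigma_j^a\sigma_i^c\to\sigma_j^c\sigma_i^a\sigma_j^a)=(\sigma_i^a\sigma_j^a\to\sigma_j^c\sigma_i^a\sigma_j^a)$ for $|i-j|=1$; * $(\emptyset\to\sigma_i^a\sigma_i^{-a}\to\sigma_i^a\sigma_j^b\sigma_i^{-a}\to\sigma_j^{-a}\sigma_i^b\sigma_j^a)=(\emptyset\to\sigma_j^{-a}\sigma_j^{a}\to\sigma_j^{-a}\sigma_i^b\sigma_j^a)$ for $|i-j|=1$. 15 (locality): two steps in disjoint parts of a word commute. The product $S_2\circ S_1:g_2g_1\to h_2h_1$ of $S_2:g_2\to h_2$ and $S_1:g_1\to h_1$ is obtained by juxtaposition. A step is a negative branch point if it inserts some $\sigma_i^{-1}$ or removes some $\sigma_i$ by a move of type II; $p_-(S)$ is the number of negative branch points of a movie $S$. **Theorem.** All functors $F_g$ are exact, and the assignment $g\mapsto F_g$ extends to a projective monoidal functor from $\mathcal{BC}^c_{n+1}$ to $\mathrm{Fun}(A_n)$: to each morphism $S:g\to h$ of $\mathcal{BC}^c_{n+1}$, that is, to each braid movie modulo braid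 movie moves 1–15, one can assign a natural transformation $F_S:F_g\to F_h$, considered up to an overall sign, such that $$F_{\mathrm{id}_g}=\pm\mathrm{id},\qquad F_{TS}=\pm F_TF_S,\qquad F_{S_2\circ S_1}=\pm F_{S_2}\circ F_{S_1},$$ the last equality being taken along the canonical isomorphisms $F_{gh}\cong F_g\circ F_h$ and with horizontal composition on the right hand side. Moreover, $F_S$ has internal degree $2p_-(S)$ for every movie $S$. For all $i$ the movies $\emptyset\to\sigma_i$ and $\sigma_i^{-1}\to\emptyset$ are sent, up to sign, to the transformations $\mathrm{Id}\to\mathcal R_i$ and $\mathcal R_i'\to\mathrm{Id}$ induced by the maps of complexes that are the identity on $A_n$, and the movies $\sigma_i\to\emptyset$ and $\emptyset\to\sigma_i^{-1}$ (negative branch points) are sent, up to sign, to the transformations $\mathcal R_i\to\mathrm{Id}$ and $\mathrm{Id}\to\mathcal R_i'$ of internal degree $2$ induced by the maps of complexes that are given on $A_n$ by $\delta_i:A_n\to A_n$, the multiplication by $X_{i-1}-X_{i+1}$. -/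

import Mathlib

open CategoryTheory

namespace BraidCob

/-- Vertices `i`, `j` of the chain with `n` vertices are neighbours. -/
def Adj {n : ℕ} (i j : Fin n) : Prop := i.val + 1 = j.val ∨ j.val + 1 = i.val

instance {n : ℕ} (i j : Fin n) : Decidable (Adj i j) := by unfold Adj; infer_instance

lemma Adj.symm {n : ℕ} {i j : Fin n} (h : Adj i j) : Adj j i := Or.symm h

/-! ### The ring `A_n` -/

/-- Generators of `A_n`: the length zero paths `(i)`, the length one paths `(i|j)` for neighbouring
vertices, and the elements `X_i` (which equal `(i|j|i)` as soon as `i` has a neighbour `j`). -/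
inductive Gen (n : ℕ) : Type
  | vert (i : Fin n)
  | edge (i j : Fin n) (h : Adj i j)
  | loop (i : Fin n)

/-- Path length of the generators. -/
def Gen.deg {n : ℕ} : Gen n → ℤ
  | .vert _ => 0
  | .edge _ _ _ => 1
  | .loop _ => 2

open FreeAlgebra in
/-- The defining relations of `A_n`. The first group presents the path ring of the quiver with
vertices `1, …, n` and one arrow `(i|j)` for every ordered pair of neighbours (paths are composed
from left to right); the second group consists of `(i|j|k) = 0` for three consecutive vertices,
`X_i = (i|j|i)` for every neighbour `j` of `i`, and `X_i (i|j) = 0`, `X_i X_i = 0`. The last two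
follow from the others for `n ≥ 3`; for `n = 2` they say `(1|2|1|2) = 0 = (2|1|2|1)`, for `n = 1`
they say `X_1 ^ 2 = 0`. -/
inductive Rel (n : ℕ) : FreeAlgebra ℤ (Gen n) → FreeAlgebra ℤ (Gen n) → Prop
  | vert_sq (i : Fin n) : Rel n (ι ℤ (.vert i) * ι ℤ (.vert i)) (ι ℤ (.vert i))
  | vert_mul {i j : Fin n} (h : i ≠ j) : Rel n (ι ℤ (.vert i) * ι ℤ (.vert j)) 0
  | sum_vert : Rel n (∑ i : Fin n, ι ℤ (.vert i)) 1
  | vert_edge (i j : Fin n) (h : Adj i j) :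
      Rel n (ι ℤ (.vert i) * ι ℤ (.edge i j h)) (ι ℤ (.edge i j h))
  | edge_vert (i j : Fin n) (h : Adj i j) :
      Rel n (ι ℤ (.edge i j h) * ι ℤ (.vert j)) (ι ℤ (.edge i j h))
  | vert_loop (i : Fin n) : Rel n (ι ℤ (.vert i) * ι ℤ (.loop i)) (ι ℤ (.loop i))
  | loop_vert (i : Fin n) : Rel n (ι ℤ (.loop i) * ι ℤ (.vert i)) (ι ℤ (.loop i))
  | straight (i j k : Fin n) (h : Adj i j) (h' : Adj j k) (hik : i ≠ k) :
      Rel n (ι ℤ (.edge i j h) * ι ℤ (.edge j k h')) 0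
  | loop_eq (i j : Fin n) (h : Adj i j) :
      Rel n (ι ℤ (.edge i j h) * ι ℤ (.edge j i h.symm)) (ι ℤ (.loop i))
  | loop_edge (i j : Fin n) (h : Adj i j) : Rel n (ι ℤ (.loop i) * ι ℤ (.edge i j h)) 0
  | loop_loop (i : Fin n) : Rel n (ι ℤ (.loop i) * ι ℤ (.loop i)) 0

/-- The ring `A_n`. -/
def A (n : ℕ) : Type := RingQuot (Rel n)

instance (n : ℕ) : Ring (A n) := inferInstanceAs (Ring (RingQuot (Rel n)))

variable {n : ℕ}

/-- The quotient map from the free ring on the generators to `A_n`. -/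
def toA (n : ℕ) : FreeAlgebra ℤ (Gen n) →+* A n := RingQuot.mkRingHom (Rel n)

/-- The class of a generator in `A_n`. -/
def gen (g : Gen n) : A n := toA n (FreeAlgebra.ι ℤ g)

/-- The idempotent `(i)`. -/
def e (i : Fin n) : A n := gen (.vert i)

/-- The path `(i|j)` of length one if `i`, `j` are neighbours, and `0` otherwise. -/
def arr (i j : Fin n) : A n := if h : Adj i j then gen (.edge i j h) else 0

/-- The element `X_i`. -/
def X (i : Fin n) : A n := gen (.loop i)

/-- `(A_n)_k`, spanned by the products of generators of total path length `k`. -/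
def grA (n : ℕ) (k : ℤ) : AddSubgroup (A n) :=
  AddSubgroup.closure {x | ∃ l : List (Gen n), (l.map Gen.deg).sum = k ∧ (l.map gen).prod = x}

lemma rel_eq {x y : FreeAlgebra ℤ (Gen n)} (h : Rel n x y) :
    toA n x = toA n y :=
  RingQuot.mkRingHom_rel h

lemma e_mul_e (i : Fin n) : e i * e i = e i := by
  simpa [e, gen] using rel_eq (Rel.vert_sq i)

lemma e_mul_e_ne {i j : Fin n} (h : i ≠ j) : e i * e j = 0 := by
  simpa [e, gen] using rel_eq (Rel.vert_mul h)

lemma sum_e : ∑ i : Fin n, e i = 1 := by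
  simpa [e, gen] using rel_eq (Rel.sum_vert (n := n))

lemma e_mul_arr (i j : Fin n) : e i * arr i j = arr i j := by
  unfold arr; split_ifs with h
  · simpa [e, gen] using rel_eq (Rel.vert_edge i j h)
  · simp

lemma arr_mul_e (i j : Fin n) : arr i j * e j = arr i j := by
  unfold arr; split_ifs with h
  · simpa [e, gen] using rel_eq (Rel.edge_vert i j h)
  · simp

lemma e_mul_X (i : Fin n) : e i * X i = X i := by
  simpa [e, X, gen] using rel_eq (Rel.vert_loop i)

lemma X_mul_e (i : Fin n) : X i * e i = X i := by
  simpa [e, X, gen] using rel_eq (Rel.loop_vert i)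

lemma X_mul_X (i : Fin n) : X i * X i = 0 := by
  simpa [X, gen] using rel_eq (Rel.loop_loop i)

lemma arr_mul_arr_ne {i j k : Fin n} (h : i ≠ k) : arr i j * arr j k = 0 := by
  unfold arr
  split_ifs with h₁ h₂
  · simpa [gen] using rel_eq (Rel.straight i j k h₁ h₂ h)
  all_goals simp

lemma arr_of_not {i j : Fin n} (h : ¬ Adj i j) : arr i j = 0 := by simp [arr, h]

lemma arr_mul_arr {i j : Fin n} (h : Adj i j) : arr i j * arr j i = X i := by
  have := rel_eq (Rel.loop_eq i j h)
  simpa [arr, h, h.symm, X, gen] using this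

lemma X_mul_arr (i j : Fin n) : X i * arr i j = 0 := by
  unfold arr; split_ifs with h
  · simpa [X, gen] using rel_eq (Rel.loop_edge i j h)
  · simp

lemma arr_mul_X (i j : Fin n) : arr i j * X j = 0 := by
  by_cases h : Adj i j
  · rw [← arr_mul_arr h.symm, ← mul_assoc, arr_mul_arr h, X_mul_arr]
  · simp [arr_of_not h]

lemma mul_zero_of_e {a b : A n} {i j : Fin n} (ha : a * e i = a) (hb : e j * b = b) (h : i ≠ j) :
    a * b = 0 := by
  rw [← ha, ← hb, mul_assoc, ← mul_assoc (e i), e_mul_e_ne h]; simp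

lemma gen_edge (i j : Fin n) (h : Adj i j) : gen (.edge i j h) = arr i j := by simp [arr, h]

/-- A property of elements of `A_n` that holds for all generators and is stable under the ring
operations holds for all elements. -/
lemma A_induction {p : A n → Prop} (he : ∀ i, p (e i)) (ha : ∀ i j, p (arr i j))
    (hX : ∀ i, p (X i)) (hz : ∀ m : ℤ, p (m : A n))
    (hadd : ∀ a b, p a → p b → p (a + b)) (hmul : ∀ a b, p a → p b → p (a * b)) (a : A n) : p a := by
  obtain ⟨a, rfl⟩ : ∃ b, toA n b = a := RingQuot.mkRingHom_surjective (Rel n) a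
  induction a using FreeAlgebra.induction with
  | grade0 m => simpa using hz m
  | grade1 g =>
    cases g with
    | vert i => exact he i
    | edge i j h => have := ha i j; rwa [← gen_edge i j h] at this
    | loop i => exact hX i
  | mul a b h₁ h₂ => rw [map_mul]; exact hmul _ _ h₁ h₂
  | add a b h₁ h₂ => rw [map_add]; exact hadd _ _ h₁ h₂

lemma X_central (i : Fin n) (a : A n) : X i * a = a * X i := by
  induction a using A_induction with
  | he j =>
    by_cases h : i = j
    · subst h; rw [X_mul_e, e_mul_X]
    · rw [mul_zero_of_e (X_mul_e i) (e_mul_e j) h, mul_zero_of_e (e_mul_e j) (e_mul_X i) (Ne.symm h)]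
  | ha j k =>
    have h₁ : X i * arr j k = 0 := by
      by_cases h : i = j
      · subst h; exact X_mul_arr _ _
      · exact mul_zero_of_e (X_mul_e i) (e_mul_arr j k) h
    have h₂ : arr j k * X i = 0 := by
      by_cases h : k = i
      · subst h; exact arr_mul_X _ _
      · exact mul_zero_of_e (arr_mul_e j k) (e_mul_X i) h
    rw [h₁, h₂]
  | hX j =>
    by_cases h : i = j
    · subst h; rfl
    · rw [mul_zero_of_e (X_mul_e i) (e_mul_X j) h,
        mul_zero_of_e (X_mul_e j) (e_mul_X i) (Ne.symm h)]
  | hz m => exact (Int.cast_commute m (X i)).symm.eq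
  | hadd a b h₁ h₂ => rw [mul_add, add_mul, h₁, h₂]
  | hmul a b h₁ h₂ => rw [← mul_assoc, h₁, mul_assoc, h₂, mul_assoc]

lemma gen_mem (g : Gen n) : gen g ∈ grA n g.deg :=
  AddSubgroup.subset_closure ⟨[g], by simp, by simp⟩

instance : SetLike.GradedMonoid (grA n) where
  one_mem := AddSubgroup.subset_closure ⟨[], by simp, by simp⟩
  mul_mem := by
    intro i j x y hx hy
    induction hx using AddSubgroup.closure_induction with
    | mem x h =>
      obtain ⟨l, rfl, rfl⟩ := h
      induction hy using AddSubgroup.closure_induction with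
      | mem y h' =>
        obtain ⟨l', rfl, rfl⟩ := h'
        exact AddSubgroup.subset_closure ⟨l ++ l', by simp, by simp⟩
      | zero => rw [mul_zero]; exact zero_mem _
      | add y z hy hz h₁ h₂ => rw [mul_add]; exact add_mem h₁ h₂
      | neg y hy h => rw [mul_neg]; exact neg_mem h
    | zero => rw [zero_mul]; exact zero_mem _
    | add x z hx hz h₁ h₂ => rw [add_mul]; exact add_mem h₁ h₂
    | neg x hx h => rw [neg_mul]; exact neg_mem h

open DirectSum in
/-- The generator `g` as an element of the direct sum of the graded pieces. -/
def genDS (g : Gen n) : ⨁ k, grA n k := DirectSum.of (fun k => grA n k) g.deg ⟨gen g, gen_mem g⟩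

lemma genDS_mul (g h : Gen n) : genDS g * genDS h =
    DirectSum.of (fun k => grA n k) (g.deg + h.deg)
      ⟨gen g * gen h, SetLike.mul_mem_graded (gen_mem g) (gen_mem h)⟩ := by
  simp only [genDS, DirectSum.of_mul_of]; rfl

lemma of_congr {i j : ℤ} (h : i = j) {x y : A n} (hx : x ∈ grA n i) (hy : y ∈ grA n j)
    (hxy : x = y) : DirectSum.of (fun k => grA n k) i ⟨x, hx⟩ =
      DirectSum.of (fun k => grA n k) j ⟨y, hy⟩ := by
  subst h; subst hxy; rfl

lemma of_eq_zero {i : ℤ} {x : A n} (hx : x ∈ grA n i) (h : x = 0) :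
    DirectSum.of (fun k => grA n k) i ⟨x, hx⟩ = 0 := by
  subst h; exact map_zero (DirectSum.of (fun k => grA n k) i)

/-- The map from `A_n` to the direct sum of its graded pieces. -/
noncomputable def decompA (n : ℕ) : A n →+* DirectSum ℤ fun k => grA n k :=
  RingQuot.lift ⟨(FreeAlgebra.lift ℤ genDS : FreeAlgebra ℤ (Gen n) →ₐ[ℤ] _), by
    intro x y h
    have key := rel_eq h
    induction h with
    | vert_mul h =>
      simp only [map_mul, map_zero, RingHom.coe_coe, FreeAlgebra.lift_ι_apply, genDS_mul] at key ⊢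
      exact of_eq_zero _ key
    | straight i j k h h' hik =>
      simp only [map_mul, map_zero, RingHom.coe_coe, FreeAlgebra.lift_ι_apply, genDS_mul] at key ⊢
      exact of_eq_zero _ key
    | loop_edge i j h =>
      simp only [map_mul, map_zero, RingHom.coe_coe, FreeAlgebra.lift_ι_apply, genDS_mul] at key ⊢
      exact of_eq_zero _ key
    | loop_loop i =>
      simp only [map_mul, map_zero, RingHom.coe_coe, FreeAlgebra.lift_ι_apply, genDS_mul] at key ⊢
      exact of_eq_zero _ key
    | sum_vert =>
      simp only [map_sum, map_one, RingHom.coe_coe, FreeAlgebra.lift_ι_apply] at key ⊢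
      have : (∑ i : Fin n, genDS (Gen.vert i)) =
          DirectSum.of (fun k => grA n k) 0 (∑ i : Fin n, ⟨gen (.vert i), gen_mem (.vert i)⟩) := by
        rw [map_sum]; rfl
      rw [this, DirectSum.one_def]
      congr 1
      ext
      rw [AddSubmonoidClass.coe_finsetSum]
      exact key
    | _ =>
      simp only [map_mul, RingHom.coe_coe, FreeAlgebra.lift_ι_apply, genDS_mul] at key ⊢
      exact of_congr (by simp [Gen.deg]) _ _ key⟩

lemma decompA_gen (g : Gen n) : decompA n (gen g) = genDS g := by
  have : decompA n (gen g) = (FreeAlgebra.lift ℤ genDS : FreeAlgebra ℤ (Gen n) →ₐ[ℤ] _)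
      (FreeAlgebra.ι ℤ g) := RingQuot.lift_mkRingHom_apply _ _ _
  rw [this, FreeAlgebra.lift_ι_apply]

lemma decompA_of_mem {i : ℤ} {x : A n} (hx : x ∈ grA n i) :
    decompA n x = DirectSum.of (fun k => grA n k) i ⟨x, hx⟩ := by
  induction hx using AddSubgroup.closure_induction with
  | mem x h =>
    obtain ⟨l, rfl, rfl⟩ := h
    induction l with
    | nil => simp only [List.map_nil, List.prod_nil, map_one]; rfl
    | cons g l ih =>
      simp only [List.map_cons, List.prod_cons, map_mul, ih, decompA_gen, genDS,
        DirectSum.of_mul_of]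
      exact of_congr (by simp) _ _ (by rfl)
  | zero => rw [map_zero]; exact (of_eq_zero _ rfl).symm
  | add x y hx hy h₁ h₂ => rw [map_add, h₁, h₂, ← map_add]; rfl
  | neg x hx h => rw [map_neg, h, ← map_neg]; rfl

/-- The grading of `A_n` by path length. -/
noncomputable instance : GradedRing (grA n) where
  decompose' := decompA n
  left_inv := by
    intro a
    induction a using A_induction with
    | he i => rw [e, decompA_gen, genDS, DirectSum.coeAddMonoidHom_of]
    | ha i j =>
      by_cases h : Adj i j
      · rw [← gen_edge i j h, decompA_gen, genDS, DirectSum.coeAddMonoidHom_of]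
      · rw [arr_of_not h, map_zero, map_zero]
    | hX i => rw [X, decompA_gen, genDS, DirectSum.coeAddMonoidHom_of]
    | hz m =>
      rw [map_intCast]
      exact map_intCast (DirectSum.coeRingHom (grA n)) m
    | hadd a b h₁ h₂ => rw [map_add, map_add, h₁, h₂]
    | hmul a b h₁ h₂ =>
      rw [map_mul]
      change DirectSum.coeRingHom (grA n) _ = _
      rw [map_mul]
      exact congrArg₂ (· * ·) h₁ h₂
  right_inv := by
    intro x
    induction x using DirectSum.induction_on with
    | zero => simp
    | of i x => rw [DirectSum.coeAddMonoidHom_of, decompA_of_mem x.2]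
    | add x y h₁ h₂ => rw [map_add, map_add, h₁, h₂]



/-! ### Internally graded abelian groups -/

section Graded

universe u v w

variable {M : Type u} {N : Type v} {T : Type w} [AddCommGroup M] [AddCommGroup N] [AddCommGroup T]

lemma isInternal_of_decomp (gr : ℤ → AddSubgroup M) (D : M →+ DirectSum ℤ fun k => gr k)
    (h₁ : ∀ x, DirectSum.coeAddMonoidHom gr (D x) = x)
    (h₂ : ∀ (k : ℤ) (x : M) (hx : x ∈ gr k), D x = DirectSum.of (fun k => gr k) k ⟨x, hx⟩) :
    DirectSum.IsInternal gr := by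
  refine Function.bijective_iff_has_inverse.2 ⟨D, fun x => ?_, h₁⟩
  induction x using DirectSum.induction_on with
  | zero => simp
  | of i x => rw [DirectSum.coeAddMonoidHom_of, h₂ i _ x.2]
  | add x y h₁ h₂ => rw [map_add, map_add, h₁, h₂]

lemma isInternal_induction {gr : ℤ → AddSubgroup M} (h : DirectSum.IsInternal gr) {p : M → Prop}
    (h0 : p 0) (hadd : ∀ x y, p x → p y → p (x + y)) (hom : ∀ k, ∀ x ∈ gr k, p x) (x : M) : p x := by
  obtain ⟨y, rfl⟩ := h.2 x
  induction y using DirectSum.induction_on with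
  | zero => simpa using h0
  | of i x => rw [DirectSum.coeAddMonoidHom_of]; exact hom _ _ x.2
  | add x y h₁ h₂ => rw [map_add]; exact hadd _ _ h₁ h₂

/-- The decomposition of an element of an internally graded group. -/
noncomputable def decompI {gr : ℤ → AddSubgroup M} (h : DirectSum.IsInternal gr) :
    M →+ DirectSum ℤ fun k => gr k :=
  (AddEquiv.ofBijective (DirectSum.coeAddMonoidHom gr) h).symm.toAddMonoidHom

lemma decompI_of_mem {gr : ℤ → AddSubgroup M} (h : DirectSum.IsInternal gr) {k : ℤ} {x : M}
    (hx : x ∈ gr k) : decompI h x = DirectSum.of (fun k => gr k) k ⟨x, hx⟩ := by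
  change (AddEquiv.ofBijective (DirectSum.coeAddMonoidHom gr) h).symm x = _
  rw [AddEquiv.symm_apply_eq]
  exact (DirectSum.coeAddMonoidHom_of gr k ⟨x, hx⟩).symm

/-- The graded map induced by an additive map that preserves degrees. -/
noncomputable def gradedLift {gr : ℤ → AddSubgroup M} {gr' : ℤ → AddSubgroup N} (f : M →+ N)
    (hf : ∀ k, ∀ x ∈ gr k, f x ∈ gr' k) :
    (DirectSum ℤ fun k => gr k) →+ DirectSum ℤ fun k => gr' k :=
  DirectSum.toAddMonoid fun k => (DirectSum.of (fun k => gr' k) k).comp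
    ((f.comp (gr k).subtype).codRestrict (gr' k) fun x => hf k x x.2)

lemma gradedLift_of {gr : ℤ → AddSubgroup M} {gr' : ℤ → AddSubgroup N} (f : M →+ N)
    (hf : ∀ k, ∀ x ∈ gr k, f x ∈ gr' k) {k : ℤ} (x : gr k) :
    gradedLift f hf (DirectSum.of (fun k => gr k) k x) =
      DirectSum.of (fun k => gr' k) k ⟨f x, hf k x x.2⟩ := by
  simp only [gradedLift, DirectSum.toAddMonoid_of]; rfl

/-- A graded retract of an internally graded group is internally graded. -/
lemma isInternal_retract {gr : ℤ → AddSubgroup M} (h : DirectSum.IsInternal gr)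
    (gr' : ℤ → AddSubgroup N) (i : N →+ M) (r : M →+ N) (hri : ∀ x, r (i x) = x)
    (hi : ∀ k, ∀ x ∈ gr' k, i x ∈ gr k) (hr : ∀ k, ∀ x ∈ gr k, r x ∈ gr' k) :
    DirectSum.IsInternal gr' := by
  refine isInternal_of_decomp gr' ((gradedLift r hr).comp ((decompI h).comp i)) ?_ ?_
  · intro x
    have : ∀ y, DirectSum.coeAddMonoidHom gr' (gradedLift r hr (decompI h y)) = r y := by
      intro y
      induction y using isInternal_induction h with
      | h0 => simp
      | hadd x y h₁ h₂ => simp only [map_add, h₁, h₂]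
      | hom k x hx => rw [decompI_of_mem h hx, gradedLift_of, DirectSum.coeAddMonoidHom_of]
    exact (this _).trans (hri x)
  · intro k x hx
    change gradedLift r hr (decompI h (i x)) = _
    rw [decompI_of_mem h (hi k x hx), gradedLift_of]
    congr 1
    exact Subtype.ext (hri x)

lemma isInternal_prod {gr : ℤ → AddSubgroup M} (h : DirectSum.IsInternal gr)
    {gr' : ℤ → AddSubgroup N} (h' : DirectSum.IsInternal gr') :
    DirectSum.IsInternal fun k => (gr k).prod (gr' k) := by
  have hl : ∀ k, ∀ x ∈ gr k, AddMonoidHom.inl M N x ∈ (gr k).prod (gr' k) :=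
    fun k x hx => AddSubgroup.mem_prod.2 ⟨hx, zero_mem _⟩
  have hr : ∀ k, ∀ x ∈ gr' k, AddMonoidHom.inr M N x ∈ (gr k).prod (gr' k) :=
    fun k x hx => AddSubgroup.mem_prod.2 ⟨zero_mem _, hx⟩
  have e₁ : ∀ y, DirectSum.coeAddMonoidHom (fun k => (gr k).prod (gr' k))
      (gradedLift (AddMonoidHom.inl M N) hl (decompI h y)) = (y, 0) := by
    intro y
    induction y using isInternal_induction h with
    | h0 => simp only [map_zero]; rfl
    | hadd x y h₁ h₂ => simp only [map_add, h₁, h₂]; simp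
    | hom k x hx => rw [decompI_of_mem h hx, gradedLift_of, DirectSum.coeAddMonoidHom_of]; rfl
  have e₂ : ∀ y, DirectSum.coeAddMonoidHom (fun k => (gr k).prod (gr' k))
      (gradedLift (AddMonoidHom.inr M N) hr (decompI h' y)) = (0, y) := by
    intro y
    induction y using isInternal_induction h' with
    | h0 => simp only [map_zero]; rfl
    | hadd x y h₁ h₂ => simp only [map_add, h₁, h₂]; simp
    | hom k x hx => rw [decompI_of_mem h' hx, gradedLift_of, DirectSum.coeAddMonoidHom_of]; rfl
  refine isInternal_of_decomp _
    (((gradedLift (AddMonoidHom.inl M N) hl).comp (decompI h)).comp (AddMonoidHom.fst M N) +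
      ((gradedLift (AddMonoidHom.inr M N) hr).comp (decompI h')).comp (AddMonoidHom.snd M N)) ?_ ?_
  · rintro ⟨x, y⟩
    rw [AddMonoidHom.add_apply, map_add]
    refine (congrArg₂ (· + ·) (e₁ x) (e₂ y)).trans ?_
    simp
  · rintro k ⟨x, y⟩ hxy
    obtain ⟨hx, hy⟩ := AddSubgroup.mem_prod.1 hxy
    change gradedLift (AddMonoidHom.inl M N) hl (decompI h x) +
      gradedLift (AddMonoidHom.inr M N) hr (decompI h' y) = _
    rw [decompI_of_mem h hx, decompI_of_mem h' hy, gradedLift_of, gradedLift_of, ← map_add]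
    congr 1
    ext <;> simp

/-- The subgroups generated by the values `b x y` with `x`, `y` homogeneous of total degree `k`. -/
def biGr (gr : ℤ → AddSubgroup M) (gr' : ℤ → AddSubgroup N) (b : M → N → T) (k : ℤ) :
    AddSubgroup T :=
  AddSubgroup.closure {t | ∃ i j : ℤ, i + j = k ∧ ∃ x ∈ gr i, ∃ y ∈ gr' j, b x y = t}

lemma mem_biGr {gr : ℤ → AddSubgroup M} {gr' : ℤ → AddSubgroup N} (b : M → N → T) {i j k : ℤ}
    (h : i + j = k) {x : M} {y : N} (hx : x ∈ gr i) (hy : y ∈ gr' j) :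
    b x y ∈ biGr gr gr' b k :=
  AddSubgroup.subset_closure ⟨i, j, h, x, hx, y, hy, rfl⟩

lemma map_mem_biGr {gr : ℤ → AddSubgroup M} {gr' : ℤ → AddSubgroup N} {b : M → N → T}
    {U : Type*} [AddCommGroup U] (f : T →+ U) (gr'' : AddSubgroup U) {k : ℤ}
    (hf : ∀ i j : ℤ, i + j = k → ∀ x ∈ gr i, ∀ y ∈ gr' j, f (b x y) ∈ gr'')
    {t : T} (ht : t ∈ biGr gr gr' b k) : f t ∈ gr'' := by
  have : biGr gr gr' b k ≤ gr''.comap f := by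
    refine (AddSubgroup.closure_le _).2 ?_
    rintro _ ⟨i, j, h, x, hx, y, hy, rfl⟩
    exact hf i j h x hx y hy
  exact this ht

/-- The biadditive map into the direct sum of the `biGr`, on direct sums. -/
noncomputable def biDS (gr : ℤ → AddSubgroup M) (gr' : ℤ → AddSubgroup N) (b : M →+ N →+ T) :
    (DirectSum ℤ fun k => gr k) →+ (DirectSum ℤ fun k => gr' k) →+
      DirectSum ℤ fun k => biGr gr gr' (fun x y => b x y) k :=
  DirectSum.toAddMonoid fun i => AddMonoidHom.flip (DirectSum.toAddMonoid fun j =>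
    AddMonoidHom.mk' (fun y : gr' j => AddMonoidHom.mk' (fun x : gr i =>
      DirectSum.of (fun k => biGr gr gr' (fun x y => b x y) k) (i + j)
        ⟨b x y, mem_biGr (fun x y => b x y) rfl x.2 y.2⟩)
      (fun x x' => by rw [← map_add]; congr 1; ext; simp))
      (fun y y' => by
        ext x : 1
        simp only [AddMonoidHom.mk'_apply, AddMonoidHom.add_apply]
        rw [← map_add]; congr 1; ext; simp))

/-- The biadditive map into the direct sum of the `biGr`. -/
noncomputable def biDecomp {gr : ℤ → AddSubgroup M} (h : DirectSum.IsInternal gr)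
    {gr' : ℤ → AddSubgroup N} (h' : DirectSum.IsInternal gr') (b : M →+ N →+ T) :
    M →+ N →+ DirectSum ℤ fun k => biGr gr gr' (fun x y => b x y) k :=
  ((AddMonoidHom.compHom.flip (decompI h')).comp (biDS gr gr' b)).comp (decompI h)

lemma biDecomp_of_mem {gr : ℤ → AddSubgroup M} (h : DirectSum.IsInternal gr)
    {gr' : ℤ → AddSubgroup N} (h' : DirectSum.IsInternal gr') (b : M →+ N →+ T) {i j k : ℤ}
    (hk : i + j = k) {x : M} {y : N} (hx : x ∈ gr i) (hy : y ∈ gr' j) :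
    biDecomp h h' b x y = DirectSum.of (fun k => biGr gr gr' (fun x y => b x y) k) k
      ⟨b x y, mem_biGr (fun x y => b x y) hk hx hy⟩ := by
  subst hk
  change biDS gr gr' b (decompI h x) (decompI h' y) = _
  rw [decompI_of_mem h hx, decompI_of_mem h' hy, biDS, DirectSum.toAddMonoid_of,
    AddMonoidHom.flip_apply, DirectSum.toAddMonoid_of]
  rfl

lemma coe_biDecomp {gr : ℤ → AddSubgroup M} (h : DirectSum.IsInternal gr)
    {gr' : ℤ → AddSubgroup N} (h' : DirectSum.IsInternal gr') (b : M →+ N →+ T) (x : M) (y : N) :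
    DirectSum.coeAddMonoidHom (biGr gr gr' fun x y => b x y) (biDecomp h h' b x y) = b x y := by
  induction x using isInternal_induction h with
  | h0 => simp
  | hadd x x' h₁ h₂ => simp only [map_add, AddMonoidHom.add_apply, h₁, h₂]
  | hom i x hx =>
    induction y using isInternal_induction h' with
    | h0 => simp
    | hadd y y' h₁ h₂ => simp only [map_add, h₁, h₂]
    | hom j y hy => rw [biDecomp_of_mem h h' b rfl hx hy, DirectSum.coeAddMonoidHom_of]

lemma of_congr' {gr : ℤ → AddSubgroup M} {i j : ℤ} (h : i = j) {x y : M} (hx : x ∈ gr i)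
    (hy : y ∈ gr j) (hxy : x = y) : DirectSum.of (fun k => gr k) i ⟨x, hx⟩ =
      DirectSum.of (fun k => gr k) j ⟨y, hy⟩ := by
  subst h; subst hxy; rfl

/-- If `biDecomp` factors through `T` then the `biGr` form a grading of `T`. -/
lemma isInternal_biGr {gr : ℤ → AddSubgroup M} (h : DirectSum.IsInternal gr)
    {gr' : ℤ → AddSubgroup N} (h' : DirectSum.IsInternal gr') (b : M →+ N →+ T)
    (hT : ∀ t : T, t ∈ AddSubgroup.closure {t | ∃ x y, b x y = t})
    (D : T →+ DirectSum ℤ fun k => biGr gr gr' (fun x y => b x y) k)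
    (hD : ∀ x y, D (b x y) = biDecomp h h' b x y) :
    DirectSum.IsInternal (biGr gr gr' fun x y => b x y) := by
  refine isInternal_of_decomp _ D ?_ ?_
  · intro t
    induction hT t using AddSubgroup.closure_induction with
    | mem t ht => obtain ⟨x, y, rfl⟩ := ht; rw [hD, coe_biDecomp]
    | zero => simp
    | add x y _ _ h₁ h₂ => rw [map_add, map_add, h₁, h₂]
    | neg x _ h₁ => rw [map_neg, map_neg, h₁]
  · intro k t ht
    induction ht using AddSubgroup.closure_induction with
    | mem t ht =>
      obtain ⟨i, j, hk, x, hx, y, hy, rfl⟩ := ht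
      rw [hD, biDecomp_of_mem h h' b hk hx hy]
    | zero => rw [map_zero]; exact (map_zero (DirectSum.of _ k)).symm
    | add x y _ _ h₁ h₂ => rw [map_add, h₁, h₂, ← map_add]; rfl
    | neg x _ h₁ => rw [map_neg, h₁, ← map_neg]; rfl

end Graded

end BraidCob

namespace BraidCob

variable {n : ℕ}

/-! ### Graded `A_n`-modules -/

universe u

open Limits

lemma isInternal_of_subsingleton {M : Type u} [AddCommGroup M] [Subsingleton M]
    (gr : ℤ → AddSubgroup M) : DirectSum.IsInternal gr := by
  refine isInternal_of_decomp gr 0 (fun _ => Subsingleton.elim _ _) fun k x hx => ?_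
  have : (⟨x, hx⟩ : gr k) = 0 := Subsingleton.elim _ _
  rw [this, map_zero]; rfl

/-- Graded left `A_n`-modules. -/
structure GrMod (n : ℕ) : Type (u + 1) where
  carrier : Type u
  [grp : AddCommGroup carrier]
  [mod : Module (A n) carrier]
  /-- The subgroup of homogeneous elements of a given degree. -/
  gr : ℤ → AddSubgroup carrier
  internal : DirectSum.IsInternal gr
  smul_mem : ∀ {i j : ℤ} {a : A n} {x : carrier}, a ∈ grA n i → x ∈ gr j → a • x ∈ gr (i + j)

namespace GrMod

attribute [instance] grp mod

/-- Homomorphisms of graded modules: the linear maps that preserve degrees. -/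
def homs (M N : GrMod.{u} n) : AddSubgroup (M.carrier →ₗ[A n] N.carrier) where
  carrier := {f | ∀ k, ∀ x ∈ M.gr k, f x ∈ N.gr k}
  zero_mem' := fun _ _ _ => zero_mem _
  add_mem' := fun hf hg k x hx => add_mem (hf k x hx) (hg k x hx)
  neg_mem' := fun hf k x hx => neg_mem (hf k x hx)

instance : Category (GrMod.{u} n) where
  Hom M N := homs M N
  id M := ⟨LinearMap.id, fun _ _ hx => hx⟩
  comp f g := ⟨g.1.comp f.1, fun k x hx => g.2 k _ (f.2 k x hx)⟩

/-- The linear map underlying a homomorphism of graded modules. -/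
def lin {M N : GrMod.{u} n} (f : M ⟶ N) : M.carrier →ₗ[A n] N.carrier := f.1

/-- Degree preserving linear maps as morphisms. -/
def mk' {M N : GrMod.{u} n} (f : M.carrier →ₗ[A n] N.carrier)
    (hf : ∀ k, ∀ x ∈ M.gr k, f x ∈ N.gr k) : M ⟶ N := ⟨f, hf⟩

instance : Preadditive (GrMod.{u} n) where
  homGroup M N := inferInstanceAs (AddCommGroup (homs M N))
  add_comp _ _ _ _ _ g := Subtype.ext (LinearMap.comp_add _ _ g.1)
  comp_add _ _ _ f _ _ := Subtype.ext (LinearMap.add_comp f.1 _ _)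

@[ext]
lemma hom_ext {M N : GrMod.{u} n} {f g : M ⟶ N} (h : ∀ x, lin f x = lin g x) : f = g :=
  Subtype.ext (LinearMap.ext h)

@[simp] lemma lin_mk' {M N : GrMod.{u} n} (f : M.carrier →ₗ[A n] N.carrier)
    (hf : ∀ k, ∀ x ∈ M.gr k, f x ∈ N.gr k) : lin (mk' f hf) = f := rfl

@[simp] lemma lin_id (M : GrMod.{u} n) (x : M.carrier) : lin (𝟙 M) x = x := rfl

@[simp] lemma lin_comp {M N K : GrMod.{u} n} (f : M ⟶ N) (g : N ⟶ K) (x : M.carrier) :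
    lin (f ≫ g) x = lin g (lin f x) := rfl

@[simp] lemma lin_add {M N : GrMod.{u} n} (f g : M ⟶ N) (x : M.carrier) :
    lin (f + g) x = lin f x + lin g x := rfl

@[simp] lemma lin_zero {M N : GrMod.{u} n} (x : M.carrier) : lin (0 : M ⟶ N) x = 0 := rfl

lemma lin_mem {M N : GrMod.{u} n} (f : M ⟶ N) {k : ℤ} {x : M.carrier} (hx : x ∈ M.gr k) :
    lin f x ∈ N.gr k := f.2 k x hx

instance : HasZeroObject (GrMod.{u} n) :=
  ⟨⟨{ carrier := PUnit
      gr := fun _ => ⊥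
      internal := isInternal_of_subsingleton _
      smul_mem := fun _ _ => Subsingleton.elim _ _ },
    fun M => ⟨⟨⟨0⟩, fun f => hom_ext fun x => by
      have : x = 0 := rfl
      rw [this, map_zero, map_zero]⟩⟩,
    fun M => ⟨⟨⟨0⟩, fun f => hom_ext fun x => rfl⟩⟩⟩⟩

/-- The direct sum of two graded modules. -/
def prod (M N : GrMod.{u} n) : GrMod.{u} n where
  carrier := M.carrier × N.carrier
  gr k := (M.gr k).prod (N.gr k)
  internal := isInternal_prod M.internal N.internal
  smul_mem ha hx := ⟨M.smul_mem ha hx.1, N.smul_mem ha hx.2⟩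

instance : HasBinaryBiproducts (GrMod.{u} n) where
  has_binary_biproduct M N := hasBinaryBiproduct_of_total
    { pt := prod M N
      fst := mk' (LinearMap.fst _ _ _) fun _ _ hx => hx.1
      snd := mk' (LinearMap.snd _ _ _) fun _ _ hx => hx.2
      inl := mk' (LinearMap.inl _ _ _) fun _ _ hx => ⟨hx, zero_mem _⟩
      inr := mk' (LinearMap.inr _ _ _) fun _ _ hx => ⟨zero_mem _, hx⟩
      inl_fst := rfl
      inl_snd := rfl
      inr_fst := hom_ext fun _ => rfl
      inr_snd := hom_ext fun _ => rfl }
    (hom_ext fun x => by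
      change ((x.1, 0) : M.carrier × N.carrier) + (0, x.2) = x
      exact Prod.ext (add_zero _) (zero_add _))

end GrMod

/-- The group of internal degrees. -/
def IntDeg : Type := ℤ

instance : AddCommGroup IntDeg := inferInstanceAs (AddCommGroup ℤ)

/-- An integer as an internal degree. -/
def intDeg (d : ℤ) : IntDeg := d

namespace GrMod

lemma isInternal_shift {M : Type u} [AddCommGroup M] {gr : ℤ → AddSubgroup M}
    (h : DirectSum.IsInternal gr) (d : ℤ) : DirectSum.IsInternal fun j => gr (j + d) := by
  have key : ∀ (k : ℤ) (x : M), x ∈ gr k → x ∈ gr (k - d + d) := fun k x hx => by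
    rwa [sub_add_cancel]
  let f : (DirectSum ℤ fun k => gr k) →+ DirectSum ℤ fun j => gr (j + d) :=
    DirectSum.toAddMonoid fun k => (DirectSum.of (fun j => gr (j + d)) (k - d)).comp
      (AddSubgroup.inclusion (key k))
  have hf : ∀ (k : ℤ) (x : M) (hx : x ∈ gr k), f (DirectSum.of (fun k => gr k) k ⟨x, hx⟩) =
      DirectSum.of (fun j => gr (j + d)) (k - d) ⟨x, key k x hx⟩ := fun k x hx => by
    simp only [f, DirectSum.toAddMonoid_of]; rfl
  refine isInternal_of_decomp _ (f.comp (decompI h)) ?_ ?_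
  · intro x
    induction x using isInternal_induction h with
    | h0 => simp
    | hadd x y h₁ h₂ => rw [map_add, map_add, h₁, h₂]
    | hom k x hx =>
      rw [AddMonoidHom.comp_apply, decompI_of_mem h hx, hf, DirectSum.coeAddMonoidHom_of]
  · intro k x hx
    rw [AddMonoidHom.comp_apply, decompI_of_mem h hx, hf]
    have : ∀ (i j : ℤ) (hij : i = j) (hi : x ∈ gr (i + d)) (hj : x ∈ gr (j + d)),
        DirectSum.of (fun j => gr (j + d)) i ⟨x, hi⟩ =
          DirectSum.of (fun j => gr (j + d)) j ⟨x, hj⟩ := by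
      rintro i _ rfl _ _; rfl
    exact this _ _ (by ring) _ _

/-- The shift `M⟨d⟩` of a graded module, with `M⟨d⟩_j = M_{j + d}`; that is, the grading is shifted
down by `d`. -/
def sh (d : ℤ) (M : GrMod.{u} n) : GrMod.{u} n where
  carrier := M.carrier
  grp := M.grp
  mod := M.mod
  gr j := M.gr (j + d)
  internal := isInternal_shift M.internal d
  smul_mem {i j a x} ha hx := by rw [add_assoc]; exact M.smul_mem ha hx

/-- The functor `M ↦ M⟨d⟩`. -/
def shF (d : ℤ) : GrMod.{u} n ⥤ GrMod.{u} n where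
  obj M := sh d M
  map {M N} f := mk' (M := sh d M) (N := sh d N) (lin f :) fun _ _ hx => lin_mem f hx

/-- The identity map of the underlying modules as an isomorphism between graded modules. -/
def idIso (M N : GrMod.{u} n) (f : M.carrier ≃ₗ[A n] N.carrier)
    (h : ∀ k, ∀ x ∈ M.gr k, f x ∈ N.gr k) (h' : ∀ k, ∀ x ∈ N.gr k, f.symm x ∈ M.gr k) : M ≅ N where
  hom := mk' f.toLinearMap h
  inv := mk' f.symm.toLinearMap h'
  hom_inv_id := hom_ext fun x => f.symm_apply_apply x
  inv_hom_id := hom_ext fun x => f.apply_symm_apply x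

lemma gr_congr (M : GrMod.{u} n) {i j : ℤ} (h : i = j) {x : M.carrier} (hx : x ∈ M.gr i) :
    x ∈ M.gr j := h ▸ hx

/-- `M⟨0⟩ ≅ M`, given by the identity map. -/
def shZero (M : GrMod.{u} n) : sh 0 M ≅ M :=
  idIso (sh 0 M) M (LinearEquiv.refl (A n) M.carrier)
    (fun k _ hx => gr_congr M (add_zero k) hx) (fun k _ hx => gr_congr M (add_zero k).symm hx)

/-- `M⟨a + b⟩ ≅ M⟨a⟩⟨b⟩`, given by the identity map. -/
def shAdd (a b : ℤ) (M : GrMod.{u} n) : sh (a + b) M ≅ sh b (sh a M) :=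
  idIso (sh (a + b) M) (sh b (sh a M)) (LinearEquiv.refl (A n) M.carrier)
    (fun k _ hx => gr_congr M (show k + (a + b) = k + b + a by ring) hx)
    (fun k _ hx => gr_congr M (show k + b + a = k + (a + b) by ring) hx)

lemma lin_eqToHom_sh (M : GrMod.{u} n) {a b : ℤ} (h : a = b) (h' : sh a M = sh b M)
    (x : M.carrier) : lin (eqToHom h') x = x := by
  subst h; rfl

instance : HasShift (GrMod.{u} n) IntDeg := hasShiftMk _ _
  { F := fun d => shF d
    zero := NatIso.ofComponents shZero fun _ => rfl
    add := fun a b => NatIso.ofComponents (shAdd a b) fun _ => rfl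
    assoc_hom_app := fun a b c M => hom_ext fun x =>
      (lin_eqToHom_sh M (add_assoc (a : ℤ) b c) _ x).symm
    zero_add_hom_app := fun a M => hom_ext fun x => (lin_eqToHom_sh M (zero_add (a : ℤ)) _ x).symm
    add_zero_hom_app := fun a M => hom_ext fun x => (lin_eqToHom_sh M (add_zero (a : ℤ)) _ x).symm }

instance (d : IntDeg) : (shiftFunctor (GrMod.{u} n) d).Additive where
  map_add {_ _ _ _} := hom_ext fun _ => rfl

end GrMod

end BraidCob

namespace BraidCob

variable {n : ℕ}
universe u
open Limits

/-! ### Graded bimodules and tensor products -/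

open MulOpposite in
/-- Graded `A_n`-bimodules; `ract (op a)` is the right multiplication by `a`. -/
structure GrBimod (n : ℕ) : Type 1 where
  carrier : Type
  [grp : AddCommGroup carrier]
  [mod : Module (A n) carrier]
  ract : (A n)ᵐᵒᵖ →+* Module.End (A n) carrier
  gr : ℤ → AddSubgroup carrier
  internal : DirectSum.IsInternal gr
  smul_mem : ∀ {i j : ℤ} {a : A n} {x : carrier}, a ∈ grA n i → x ∈ gr j → a • x ∈ gr (i + j)
  ract_mem : ∀ {i j : ℤ} {a : A n} {x : carrier}, x ∈ gr i → a ∈ grA n j →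
    ract (op a) x ∈ gr (i + j)

namespace GrBimod

open MulOpposite TensorProduct

attribute [instance] grp mod

variable (B : GrBimod n) (M N : GrMod.{u} n)

/-- The relations `(x a) ⊗ m = x ⊗ (a m)`. -/
def relSub : Submodule (A n) (B.carrier ⊗[ℤ] M.carrier) :=
  Submodule.span (A n) {t | ∃ x a m, B.ract (op a) x ⊗ₜ[ℤ] m - x ⊗ₜ[ℤ] (a • m) = t}

/-- The tensor product of a bimodule and a left module over `A_n`. -/
def Tens : Type u := (B.carrier ⊗[ℤ] M.carrier) ⧸ relSub B M

instance : AddCommGroup (Tens B M) :=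
  inferInstanceAs (AddCommGroup ((B.carrier ⊗[ℤ] M.carrier) ⧸ relSub B M))

instance : Module (A n) (Tens B M) :=
  inferInstanceAs (Module (A n) ((B.carrier ⊗[ℤ] M.carrier) ⧸ relSub B M))

/-- The projection from the tensor product over `ℤ`. -/
def tmk : (B.carrier ⊗[ℤ] M.carrier) →ₗ[A n] Tens B M := (relSub B M).mkQ

/-- The element `x ⊗ m`, as a biadditive map. -/
def tmul : B.carrier →+ M.carrier →+ Tens B M :=
  AddMonoidHom.mk' (fun x => AddMonoidHom.mk' (fun m => tmk B M (x ⊗ₜ m))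
    (fun m m' => by rw [TensorProduct.tmul_add, map_add]))
    (fun x x' => by ext m; simp [TensorProduct.add_tmul])

variable {B M}

lemma tmk_tmul (x : B.carrier) (m : M.carrier) : tmk B M (x ⊗ₜ m) = tmul B M x m := rfl

lemma tmul_ract (x : B.carrier) (a : A n) (m : M.carrier) :
    tmul B M (B.ract (op a) x) m = tmul B M x (a • m) := by
  rw [← sub_eq_zero, ← tmk_tmul, ← tmk_tmul, ← map_sub]
  exact (Submodule.Quotient.mk_eq_zero _).2 (Submodule.subset_span ⟨x, a, m, rfl⟩)

lemma smul_tmul (a : A n) (x : B.carrier) (m : M.carrier) :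
    a • tmul B M x m = tmul B M (a • x) m := by
  rw [← tmk_tmul, ← tmk_tmul, ← map_smul, TensorProduct.smul_tmul']

lemma tens_induction {p : Tens B M → Prop} (h0 : p 0) (hadd : ∀ s t, p s → p t → p (s + t))
    (h : ∀ x m, p (tmul B M x m)) (t : Tens B M) : p t := by
  obtain ⟨t, rfl⟩ := (relSub B M).mkQ_surjective t
  induction t using TensorProduct.induction_on with
  | zero => rw [map_zero]; exact h0
  | tmul x m => exact h x m
  | add s t h₁ h₂ => rw [map_add]; exact hadd _ _ h₁ h₂

variable {U : Type*} [AddCommGroup U]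

/-- Additive maps from the tensor product are balanced biadditive maps. -/
noncomputable def lift (f : B.carrier →+ M.carrier →+ U)
    (hf : ∀ x a m, f (B.ract (op a) x) m = f x (a • m)) : Tens B M →+ U :=
  QuotientAddGroup.lift (relSub B M).toAddSubgroup
    (TensorProduct.liftAddHom f fun r x m => by
      rw [map_zsmul, map_zsmul, AddMonoidHom.smul_apply]) (by
    intro t ht
    have key : ∀ t ∈ relSub B M, ∀ a : A n, (TensorProduct.liftAddHom f fun r x m => by
      rw [map_zsmul, map_zsmul, AddMonoidHom.smul_apply]) (a • t) = 0 := by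
      intro t ht
      induction ht using Submodule.span_induction with
      | mem t ht =>
        obtain ⟨x, b, m, rfl⟩ := ht
        intro a
        rw [smul_sub, TensorProduct.smul_tmul', TensorProduct.smul_tmul', map_sub,
          TensorProduct.liftAddHom_tmul, TensorProduct.liftAddHom_tmul, ← map_smul, hf, sub_self]
      | zero => simp
      | add s t _ _ h₁ h₂ => intro a; rw [smul_add, map_add, h₁, h₂, add_zero]
      | smul b t _ h => intro a; rw [← mul_smul, h]
    simpa using key t ht 1)

@[simp] lemma lift_tmul (f : B.carrier →+ M.carrier →+ U)
    (hf : ∀ x a m, f (B.ract (op a) x) m = f x (a • m)) (x : B.carrier) (m : M.carrier) :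
    lift f hf (tmul B M x m) = f x m := rfl

/-- Linear maps from the tensor product. -/
noncomputable def liftL [Module (A n) U] (f : B.carrier →+ M.carrier →+ U)
    (hf : ∀ x a m, f (B.ract (op a) x) m = f x (a • m))
    (hf' : ∀ (a : A n) x m, f (a • x) m = a • f x m) : Tens B M →ₗ[A n] U where
  toFun := lift f hf
  map_add' := map_add _
  map_smul' a t := by
    induction t using tens_induction with
    | h0 => simp
    | hadd s t h₁ h₂ => simp only [smul_add, map_add, h₁, h₂]
    | h x m => simp only [smul_tmul, lift_tmul, hf', RingHom.id_apply]

@[simp] lemma liftL_tmul [Module (A n) U] (f : B.carrier →+ M.carrier →+ U)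
    (hf : ∀ x a m, f (B.ract (op a) x) m = f x (a • m))
    (hf' : ∀ (a : A n) x m, f (a • x) m = a • f x m) (x : B.carrier) (m : M.carrier) :
    liftL f hf hf' (tmul B M x m) = f x m := rfl

variable (B M)

lemma biDecomp_balanced (x : B.carrier) (a : A n) (m : M.carrier) :
    biDecomp B.internal M.internal (tmul B M) (B.ract (op a) x) m =
      biDecomp B.internal M.internal (tmul B M) x (a • m) := by
  induction x using isInternal_induction B.internal with
  | h0 => simp
  | hadd x y h₁ h₂ => simp only [map_add, AddMonoidHom.add_apply, h₁, h₂]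
  | hom i x hx =>
    induction m using isInternal_induction M.internal with
    | h0 => simp
    | hadd x y h₁ h₂ => simp only [map_add, smul_add, h₁, h₂]
    | hom k m hm =>
      induction a using isInternal_induction (DirectSum.Decomposition.isInternal (grA n)) with
      | h0 => simp
      | hadd a b h₁ h₂ =>
        have h₃ : B.ract (op (a + b)) x = B.ract (op a) x + B.ract (op b) x := by
          rw [MulOpposite.op_add, map_add]; rfl
        rw [h₃, add_smul, map_add, map_add, AddMonoidHom.add_apply, h₁, h₂]
      | hom j a ha =>
        rw [biDecomp_of_mem B.internal M.internal (tmul B M) (k := i + (j + k)) (by ring)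
          (B.ract_mem hx ha) hm,
          biDecomp_of_mem B.internal M.internal (tmul B M) rfl hx (M.smul_mem ha hm)]
        exact of_congr' rfl _ _ (tmul_ract x a m)

/-- The graded module `B ⊗ M`, with `x ⊗ m` of degree `i + j` for `x` of degree `i` and `m` of
degree `j`. -/
noncomputable def tens : GrMod.{u} n where
  carrier := Tens B M
  gr := biGr B.gr M.gr fun x m => tmul B M x m
  internal := isInternal_biGr B.internal M.internal (tmul B M) (fun t => by
      induction t using tens_induction with
      | h0 => exact zero_mem _
      | hadd s t h₁ h₂ => exact add_mem h₁ h₂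
      | h x m => exact AddSubgroup.subset_closure ⟨x, m, rfl⟩)
    (lift (biDecomp B.internal M.internal (tmul B M)) (biDecomp_balanced B M)) (fun x m => rfl)
  smul_mem {i j a t} ha ht := by
    refine map_mem_biGr (DistribSMul.toAddMonoidHom (Tens B M) a) _ ?_ ht
    intro k l hkl x hx m hm
    change a • tmul B M x m ∈ _
    rw [smul_tmul]
    exact mem_biGr (fun x m => tmul B M x m) (by rw [add_assoc, hkl]) (B.smul_mem ha hx) hm

variable {M N}

/-- `id ⊗ f` as a linear map. -/
noncomputable def tensMapL (f : M ⟶ N) : Tens B M →ₗ[A n] Tens B N :=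
  liftL ((AddMonoidHom.compHom.flip (GrMod.lin f).toAddMonoidHom).comp (tmul B N))
    (fun x a m => by
      change tmul B N _ (GrMod.lin f m) = tmul B N x (GrMod.lin f (a • m))
      rw [tmul_ract, (GrMod.lin f).map_smul])
    (fun a x m => (smul_tmul a x (GrMod.lin f m)).symm)

/-- `id ⊗ f`. -/
noncomputable def tensMap (f : M ⟶ N) : tens B M ⟶ tens B N :=
  GrMod.mk' (M := tens B M) (N := tens B N) (tensMapL B f)
    (fun _ _ ht => map_mem_biGr (T := Tens B M) (U := Tens B N) (tensMapL B f).toAddMonoidHom _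
      (fun _ _ hij _ hx _ hm => mem_biGr (fun x m => tmul B N x m) hij hx (GrMod.lin_mem f hm)) ht)

lemma tensMap_tmul (f : M ⟶ N) (x : B.carrier) (m : M.carrier) :
    GrMod.lin (tensMap B f) (tmul B M x m) = tmul B N x (GrMod.lin f m) := rfl

/-- Two morphisms from `B ⊗ M` agree if they agree on the elements `x ⊗ m`. -/
lemma tens_hom_ext {f g : tens B M ⟶ N}
    (h : ∀ x m, GrMod.lin f (tmul B M x m) = GrMod.lin g (tmul B M x m)) : f = g :=
  GrMod.hom_ext fun t => by
    induction t using tens_induction (B := B) (M := M) with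
    | h0 => exact (map_zero _).trans (map_zero _).symm
    | hadd s t h₁ h₂ => exact (map_add _ s t).trans ((congrArg₂ _ h₁ h₂).trans (map_add _ s t).symm)
    | h x m => exact h x m

/-- The functor `M ↦ B ⊗ M`. -/
noncomputable def tensF : GrMod.{u} n ⥤ GrMod.{u} n where
  obj M := tens B M
  map f := tensMap B f
  map_id _ := tens_hom_ext B fun _ _ => rfl
  map_comp _ _ := tens_hom_ext B fun _ _ => rfl

instance : (tensF.{u} B).Additive where
  map_add {_ _ _ _} := tens_hom_ext B fun x _ => map_add (tmul B _ x) _ _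

end GrBimod

end BraidCob

namespace BraidCob

variable {n : ℕ}
universe u
open Limits

/-! ### The bimodules `P_i ⊗ _iP` -/

open MulOpposite TensorProduct

lemma e_mem (i : Fin n) : e i ∈ grA n 0 := gen_mem (.vert i)

lemma X_mem (i : Fin n) : X i ∈ grA n 2 := gen_mem (.loop i)

lemma arr_mem (i j : Fin n) : arr i j ∈ grA n 1 := by
  unfold arr
  split_ifs with h
  · exact gen_mem (.edge i j h)
  · exact zero_mem _

/-- The left ideal `P_i = A_n (i)`. -/
def Pl (i : Fin n) : Submodule (A n) (A n) where
  carrier := {a | a * e i = a}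
  add_mem' {a b} ha hb := by
    change (a + b) * e i = a + b
    rw [add_mul, ha, hb]
  zero_mem' := zero_mul _
  smul_mem' b a ha := by
    change b * a * e i = b * a
    rw [mul_assoc, ha]

/-- The right ideal `_iP = (i) A_n`. -/
def Pr (i : Fin n) : AddSubgroup (A n) where
  carrier := {a | e i * a = a}
  add_mem' {a b} ha hb := by
    change e i * (a + b) = a + b
    rw [mul_add, ha, hb]
  zero_mem' := mul_zero _
  neg_mem' {a} ha := by
    change e i * -a = -a
    rw [mul_neg, ha]

/-- The grading of `P_i`. -/
def grPl (i : Fin n) (k : ℤ) : AddSubgroup (Pl i) := (grA n k).comap (Pl i).subtype.toAddMonoidHom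

/-- The grading of `_iP`. -/
def grPr (i : Fin n) (k : ℤ) : AddSubgroup (Pr i) := (grA n k).comap (Pr i).subtype

/-- The projection `a ↦ a (i)`. -/
def toPl (i : Fin n) : A n →+ Pl i :=
  AddMonoidHom.mk' (fun a => ⟨a * e i, by change a * e i * e i = _; rw [mul_assoc, e_mul_e]⟩)
    fun a b => Subtype.ext (add_mul a b (e i))

/-- The projection `a ↦ (i) a`. -/
def toPr (i : Fin n) : A n →+ Pr i :=
  AddMonoidHom.mk' (fun a => ⟨e i * a, by change e i * (e i * a) = _; rw [← mul_assoc, e_mul_e]⟩)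
    fun a b => Subtype.ext (mul_add (e i) a b)

lemma internal_Pl (i : Fin n) : DirectSum.IsInternal (grPl i) :=
  isInternal_retract (DirectSum.Decomposition.isInternal (grA n)) _
    (Pl i).subtype.toAddMonoidHom (toPl i) (fun x => Subtype.ext x.2) (fun _ _ hx => hx)
    fun k x hx => by
      have := SetLike.mul_mem_graded hx (e_mem i)
      rwa [add_zero] at this

lemma internal_Pr (i : Fin n) : DirectSum.IsInternal (grPr i) :=
  isInternal_retract (DirectSum.Decomposition.isInternal (grA n)) _
    (Pr i).subtype (toPr i) (fun x => Subtype.ext x.2) (fun _ _ hx => hx)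
    fun k x hx => by
      have := SetLike.mul_mem_graded (e_mem i) hx
      rwa [zero_add] at this

/-- Right multiplication on `_iP`. -/
def rmulPr (i : Fin n) (a : A n) : Pr i →+ Pr i :=
  AddMonoidHom.mk' (fun x => ⟨x * a, by
    change e i * (x * a) = x * a
    rw [← mul_assoc]
    exact congrArg (· * a) x.2⟩) fun x y => Subtype.ext (add_mul x.1 y.1 a)

/-- The group `P_i ⊗ _iP`, with the left action on the first factor. -/
def PPt (i : Fin n) : Type := Pl i ⊗[ℤ] Pr i

instance (i : Fin n) : AddCommGroup (PPt i) := inferInstanceAs (AddCommGroup (Pl i ⊗[ℤ] Pr i))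

noncomputable instance (i : Fin n) : Module (A n) (PPt i) :=
  inferInstanceAs (Module (A n) (Pl i ⊗[ℤ] Pr i))

/-- The biadditive map `(x, y) ↦ x ⊗ y`. -/
def tm (i : Fin n) : Pl i →+ Pr i →+ PPt i :=
  AddMonoidHom.mk' (fun x => AddMonoidHom.mk' (fun y => (x ⊗ₜ[ℤ] y : Pl i ⊗[ℤ] Pr i))
    (TensorProduct.tmul_add x)) (fun x x' => by ext m; exact TensorProduct.add_tmul x x' m)

lemma PPt_induction {i : Fin n} {p : PPt i → Prop} (h0 : p 0)
    (hadd : ∀ s t, p s → p t → p (s + t)) (h : ∀ x y, p (tm i x y)) (t : PPt i) : p t :=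
  TensorProduct.induction_on t h0 h fun s t h₁ h₂ => hadd s t h₁ h₂

/-- Additive maps from `P_i ⊗ _iP` are biadditive maps. -/
def liftPP {U : Type*} [AddCommGroup U] (i : Fin n) (f : Pl i →+ Pr i →+ U) : PPt i →+ U :=
  TensorProduct.liftAddHom f fun r x m => by rw [map_zsmul, map_zsmul, AddMonoidHom.smul_apply]

lemma liftPP_tm {U : Type*} [AddCommGroup U] (i : Fin n) (f : Pl i →+ Pr i →+ U) (x : Pl i)
    (y : Pr i) : liftPP i f (tm i x y) = f x y := rfl

lemma smul_tm (i : Fin n) (a : A n) (x : Pl i) (y : Pr i) : a • tm i x y = tm i (a • x) y := rfl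

/-- Right multiplication on `P_i ⊗ _iP`. -/
noncomputable def rmulB (i : Fin n) (a : A n) : Module.End (A n) (PPt i) where
  toFun := liftPP i ((AddMonoidHom.compHom.flip (rmulPr i a)).comp (tm i))
  map_add' := map_add _
  map_smul' b t := by
    induction t using PPt_induction with
    | h0 => simp
    | h x y => rfl
    | hadd s t h₁ h₂ => rw [smul_add, map_add, h₁, h₂, map_add, smul_add]

lemma rmulB_tm (i : Fin n) (a : A n) (x : Pl i) (y : Pr i) :
    rmulB i a (tm i x y) = tm i x (rmulPr i a y) := rfl

lemma endB_ext {i : Fin n} {f g : Module.End (A n) (PPt i)}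
    (h : ∀ x y, f (tm i x y) = g (tm i x y)) : f = g := LinearMap.ext fun t => by
  induction t using PPt_induction with
  | h0 => rw [map_zero, map_zero]
  | h x y => exact h x y
  | hadd s t h₁ h₂ => rw [map_add, map_add, h₁, h₂]

/-- The right action on `P_i ⊗ _iP`. -/
noncomputable def ractPP (i : Fin n) : (A n)ᵐᵒᵖ →+* Module.End (A n) (PPt i) where
  toFun a := rmulB i (unop a)
  map_one' := endB_ext fun x y => congrArg (tm i x) (Subtype.ext (mul_one y.1))
  map_mul' _ _ := endB_ext fun x y => congrArg (tm i x) (Subtype.ext (mul_assoc y.1 _ _).symm)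
  map_zero' := endB_ext fun x y =>
    (congrArg (tm i x) (Subtype.ext (mul_zero y.1))).trans (map_zero (tm i x))
  map_add' a b := endB_ext fun x y =>
    (congrArg (tm i x) (Subtype.ext (mul_add y.1 _ _))).trans
      (map_add (tm i x) (rmulPr i (unop a) y) (rmulPr i (unop b) y))

lemma internal_PPt (i : Fin n) :
    DirectSum.IsInternal (biGr (grPl i) (grPr i) fun x y => tm i x y) :=
  isInternal_biGr (internal_Pl i) (internal_Pr i) (tm i)
    (fun t => by
      induction t using PPt_induction with
      | h0 => exact zero_mem _
      | h x y => exact AddSubgroup.subset_closure ⟨x, y, rfl⟩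
      | hadd s t h₁ h₂ => exact add_mem h₁ h₂)
    (liftPP i (biDecomp (internal_Pl i) (internal_Pr i) (tm i))) (fun _ _ => rfl)

/-- The graded bimodule `P_i ⊗ _iP`. -/
noncomputable def PP (i : Fin n) : GrBimod n where
  carrier := PPt i
  ract := ractPP i
  gr := biGr (grPl i) (grPr i) fun x y => tm i x y
  internal := internal_PPt i
  smul_mem {k l a t} ha ht := by
    refine map_mem_biGr (DistribSMul.toAddMonoidHom (PPt i) a) _ ?_ ht
    intro k' l' hkl x hx y hy
    exact mem_biGr (fun x y => tm i x y) (by rw [add_assoc, hkl])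
      (show a • x ∈ grPl i (k + k') from SetLike.mul_mem_graded ha hx) hy
  ract_mem {k l a t} ht ha := by
    refine map_mem_biGr (rmulB i a).toAddMonoidHom _ ?_ ht
    intro k' l' hkl x hx y hy
    exact mem_biGr (fun x y => tm i x y) (by rw [← add_assoc, hkl]) hx
      (show y.1 * a ∈ grA n (l' + l) from SetLike.mul_mem_graded (A := grA n) hy ha)

/-- The multiplication `P_i ⊗ _iP → A_n`. -/
def mulPP (i : Fin n) : (PP i).carrier →+ A n :=
  liftPP i ((AddMonoidHom.mul.compl₂ (Pr i).subtype).comp (Pl i).subtype.toAddMonoidHom)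

lemma PP_induction {i : Fin n} {p : (PP i).carrier → Prop} (h0 : p 0)
    (hadd : ∀ s t, p s → p t → p (s + t)) (h : ∀ x y, p (tm i x y)) (t : (PP i).carrier) : p t :=
  PPt_induction (p := p) h0 hadd h t

lemma mulPP_tm (i : Fin n) (x : Pl i) (y : Pr i) : mulPP i (tm i x y) = x.1 * y.1 := rfl

lemma mulPP_smul (i : Fin n) (a : A n) (t : (PP i).carrier) : mulPP i (a • t) = a * mulPP i t := by
  induction t using PP_induction with
  | h0 => simp
  | hadd s t h₁ h₂ => rw [smul_add, map_add, map_add, h₁, h₂, mul_add]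
  | h x y => exact mul_assoc a x.1 y.1

lemma mulPP_ract (i : Fin n) (a : A n) (t : (PP i).carrier) :
    mulPP i ((PP i).ract (op a) t) = mulPP i t * a := by
  induction t using PP_induction with
  | h0 => simp
  | hadd s t h₁ h₂ => rw [map_add, map_add, map_add, h₁, h₂, add_mul]
  | h x y => exact (mul_assoc x.1 y.1 a).symm

lemma mulPP_mem (i : Fin n) {k : ℤ} {t : (PP i).carrier} (ht : t ∈ (PP i).gr k) :
    mulPP i t ∈ grA n k :=
  map_mem_biGr (mulPP i) _ (fun k' l' hkl x hx y hy => by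
    change x.1 * y.1 ∈ _
    rw [← hkl]; exact SetLike.mul_mem_graded hx hy) ht

/-- The element `a (i) ⊗ (i) b` of `P_i ⊗ _iP`. -/
noncomputable def pt (i : Fin n) (a b : A n) : (PP i).carrier := tm i (toPl i a) (toPr i b)

/-- The sum `(i) ⊗ X_i + X_i ⊗ (i) + ∑ (j|i) ⊗ (i|j)`, the sum being over the neighbours `j`
of `i`. -/
noncomputable def casimir (i : Fin n) : (PP i).carrier :=
  pt i (e i) (X i) + pt i (X i) (e i) + ∑ j, pt i (arr j i) (arr i j)

lemma smul_pt (i : Fin n) (c a b : A n) : c • pt i a b = pt i (c * a) b := by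
  have : c • toPl i a = toPl i (c * a) := Subtype.ext (mul_assoc c a (e i)).symm
  unfold pt; rw [← this]; rfl

lemma pt_ract (i : Fin n) (a b c : A n) : (PP i).ract (op c) (pt i a b) = pt i a (b * c) := by
  have : rmulPr i c (toPr i b) = toPr i (b * c) := Subtype.ext (mul_assoc (e i) b c)
  unfold pt; rw [← this]; rfl

lemma pt_zero_left (i : Fin n) (b : A n) : pt i 0 b = 0 := by
  unfold pt; rw [map_zero, map_zero]; rfl

lemma pt_zero_right (i : Fin n) (a : A n) : pt i a 0 = 0 := by
  unfold pt; rw [map_zero, map_zero]; rfl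

lemma casimir_smul (i : Fin n) (a : A n) : a • casimir i = (PP i).ract (op a) (casimir i) := by
  induction a using A_induction with
  | he k =>
    simp only [casimir, smul_add, map_add, Finset.smul_sum, map_sum, smul_pt, pt_ract]
    congr 1
    · by_cases h : k = i
      · subst h; simp only [e_mul_e, e_mul_X, X_mul_e]
      · rw [e_mul_e_ne h, e_mul_e_ne (Ne.symm h),
          mul_zero_of_e (e_mul_e k) (e_mul_X i) h, mul_zero_of_e (X_mul_e i) (e_mul_e k) (Ne.symm h),
          pt_zero_left, pt_zero_left, pt_zero_right, pt_zero_right]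
    · refine Finset.sum_congr rfl fun j _ => ?_
      by_cases h : k = j
      · subst h; rw [e_mul_arr, arr_mul_e]
      · rw [mul_zero_of_e (e_mul_e k) (e_mul_arr j i) h,
          mul_zero_of_e (arr_mul_e i j) (e_mul_e k) (Ne.symm h), pt_zero_left, pt_zero_right]
  | ha k l =>
    simp only [casimir, smul_add, map_add, Finset.smul_sum, map_sum, smul_pt, pt_ract]
    have h₁ : pt i (arr k l * X i) (e i) = 0 := by
      by_cases h : l = i
      · subst h; rw [arr_mul_X, pt_zero_left]
      · rw [mul_zero_of_e (arr_mul_e k l) (e_mul_X i) h, pt_zero_left]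
    have h₂ : pt i (e i) (X i * arr k l) = 0 := by
      by_cases h : i = k
      · subst h; rw [X_mul_arr, pt_zero_right]
      · rw [mul_zero_of_e (X_mul_e i) (e_mul_arr k l) h, pt_zero_right]
    have h₃ : ∑ j, pt i (arr k l * arr j i) (arr i j) = pt i (X i) (e i * arr k l) := by
      rw [Finset.sum_eq_single l]
      · by_cases h : k = i
        · subst h
          by_cases h' : Adj k l
          · rw [arr_mul_arr h', e_mul_arr]
          · rw [arr_of_not h', mul_zero, pt_zero_right, pt_zero_right]
        · rw [arr_mul_arr_ne h, pt_zero_left, mul_zero_of_e (e_mul_e i) (e_mul_arr k l) (Ne.symm h),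
            pt_zero_right]
      · intro j _ hj
        rw [mul_zero_of_e (arr_mul_e k l) (e_mul_arr j i) (Ne.symm hj), pt_zero_left]
      · intro h; exact absurd (Finset.mem_univ l) h
    have h₄ : ∑ j, pt i (arr j i) (arr i j * arr k l) = pt i (arr k l * e i) (X i) := by
      rw [Finset.sum_eq_single k]
      · by_cases h : l = i
        · subst h
          by_cases h' : Adj k l
          · rw [arr_mul_arr h'.symm, arr_mul_e]
          · rw [arr_of_not h', zero_mul, pt_zero_left, pt_zero_left]
        · rw [arr_mul_arr_ne (Ne.symm h), pt_zero_right,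
            mul_zero_of_e (arr_mul_e k l) (e_mul_e i) h, pt_zero_left]
      · intro j _ hj
        rw [mul_zero_of_e (arr_mul_e i j) (e_mul_arr k l) hj, pt_zero_right]
      · intro h; exact absurd (Finset.mem_univ k) h
    rw [h₁, h₂, h₃, h₄]; abel
  | hX k =>
    simp only [casimir, smul_add, map_add, Finset.smul_sum, map_sum, smul_pt, pt_ract]
    have h₁ : ∑ j, pt i (X k * arr j i) (arr i j) = 0 := Finset.sum_eq_zero fun j _ => by
      by_cases h : k = j
      · subst h; rw [X_mul_arr, pt_zero_left]
      · rw [mul_zero_of_e (X_mul_e k) (e_mul_arr j i) h, pt_zero_left]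
    have h₂ : ∑ j, pt i (arr j i) (arr i j * X k) = 0 := Finset.sum_eq_zero fun j _ => by
      by_cases h : j = k
      · subst h; rw [arr_mul_X, pt_zero_right]
      · rw [mul_zero_of_e (arr_mul_e i j) (e_mul_X k) h, pt_zero_right]
    rw [h₁, h₂]
    by_cases h : k = i
    · subst h
      rw [X_mul_X, X_mul_e, e_mul_X, pt_zero_left, pt_zero_right]; abel
    · rw [mul_zero_of_e (X_mul_e k) (e_mul_e i) h, mul_zero_of_e (X_mul_e k) (e_mul_X i) h,
        mul_zero_of_e (X_mul_e i) (e_mul_X k) (Ne.symm h),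
        mul_zero_of_e (e_mul_e i) (e_mul_X k) (Ne.symm h)]
      simp only [pt_zero_left, pt_zero_right]
  | hz m =>
    have h₁ : (PP i).ract (op (m : A n)) = m := by
      rw [MulOpposite.op_intCast, map_intCast]
    rw [h₁, Int.cast_smul_eq_zsmul]
    exact (Module.End.intCast_apply m _).symm
  | hadd a b h₁ h₂ => rw [add_smul, MulOpposite.op_add, map_add, h₁, h₂]; rfl
  | hmul a b h₁ h₂ =>
    rw [mul_smul, h₂, ← LinearMap.map_smul, h₁, MulOpposite.op_mul, map_mul]; rfl

lemma pt_mem (i : Fin n) {k l r : ℤ} {a b : A n} (ha : a ∈ grA n k) (hb : b ∈ grA n l)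
    (h : k + l = r) : pt i a b ∈ (PP i).gr r :=
  mem_biGr (fun x y => tm i x y) h
    (show a * e i ∈ grA n k by
      have := SetLike.mul_mem_graded ha (e_mem i); rwa [add_zero] at this)
    (show e i * b ∈ grA n l by
      have := SetLike.mul_mem_graded (e_mem i) hb; rwa [zero_add] at this)

lemma casimir_mem (i : Fin n) : casimir i ∈ (PP i).gr 2 :=
  add_mem (add_mem (pt_mem i (e_mem i) (X_mem i) (by norm_num))
    (pt_mem i (X_mem i) (e_mem i) (by norm_num)))
    (sum_mem fun j _ => pt_mem i (arr_mem j i) (arr_mem i j) (by norm_num))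

/-- The central element `X_{i-1} - X_{i+1}`, with `X_j = 0` unless `j` is a vertex. -/
def zeta (i : Fin n) : A n :=
  (if h : 0 < i.val then X ⟨i.val - 1, by omega⟩ else 0) -
    (if h : i.val + 1 < n then X ⟨i.val + 1, h⟩ else 0)

lemma zeta_mem (i : Fin n) : zeta i ∈ grA n 2 := by
  unfold zeta
  refine sub_mem ?_ ?_
  · split_ifs
    · exact X_mem _
    · exact zero_mem _
  · split_ifs
    · exact X_mem _
    · exact zero_mem _

lemma zeta_central (i : Fin n) (a : A n) : zeta i * a = a * zeta i := by
  unfold zeta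
  split_ifs <;> simp only [sub_mul, mul_sub, X_central, zero_mul, mul_zero]

lemma e_mul_zeta (i : Fin n) : e i * zeta i = 0 := by
  have h₁ : ∀ j : Fin n, i ≠ j → e i * X j = 0 := fun j h =>
    mul_zero_of_e (e_mul_e i) (e_mul_X j) h
  unfold zeta
  rw [mul_sub]
  split_ifs with h h' h'
  · rw [h₁, h₁, sub_zero] <;> · intro h; have := congrArg Fin.val h; simp at this <;> omega
  · rw [h₁, mul_zero, sub_zero]; intro h; have := congrArg Fin.val h; simp at this; omega
  · rw [h₁, mul_zero, sub_zero]; intro h; have := congrArg Fin.val h; simp at this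
  · simp

end BraidCob

namespace BraidCob

variable {n : ℕ}
universe u
open Limits
open MulOpposite TensorProduct

/-! ### The transformations `β_i`, `γ_i`, `δ_i` -/

namespace GrBimod

/-- The bimodule `B` with the grading shifted down by `d`. -/
def sh (d : ℤ) (B : GrBimod n) : GrBimod n where
  carrier := B.carrier
  grp := B.grp
  mod := B.mod
  ract := B.ract
  gr j := B.gr (j + d)
  internal := GrMod.isInternal_shift B.internal d
  smul_mem {i j a x} ha hx := by rw [add_assoc]; exact B.smul_mem ha hx
  ract_mem {i j a x} hx ha := by rw [add_right_comm]; exact B.ract_mem hx ha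

variable (B : GrBimod n)

lemma tens_sh_le {d k : ℤ} (M : GrMod.{u} n) {t : Tens B M}
    (ht : t ∈ (tens B (GrMod.sh d M)).gr k) : t ∈ (GrMod.sh d (tens B M)).gr k :=
  map_mem_biGr (T := Tens B (GrMod.sh d M)) (AddMonoidHom.id (Tens B M)) _
    (fun i j hij _ hx _ hm => mem_biGr (fun x m => tmul B M x m)
      (show i + (j + d) = k + d by rw [← hij, add_assoc]) hx hm) ht

lemma tens_sh_ge {d k : ℤ} (M : GrMod.{u} n) {t : Tens B M}
    (ht : t ∈ (GrMod.sh d (tens B M)).gr k) : t ∈ (tens B (GrMod.sh d M)).gr k :=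
  map_mem_biGr (T := Tens B M) (U := Tens B (GrMod.sh d M)) (AddMonoidHom.id (Tens B M)) _
    (fun i j hij x hx m hm => mem_biGr (fun x m => tmul B (GrMod.sh d M) x m)
      (show i + (j - d) = k by omega) hx
      (show m ∈ M.gr (j - d + d) from GrMod.gr_congr M (sub_add_cancel j d).symm hm)) ht

/-- `B ⊗ M⟨d⟩ ≅ (B ⊗ M)⟨d⟩`, given by the identity map. -/
noncomputable def tensSh (d : ℤ) (M : GrMod.{u} n) :
    tens B (GrMod.sh d M) ≅ GrMod.sh d (tens B M) :=
  GrMod.idIso _ _ (LinearEquiv.refl (A n) (Tens B M)) (fun _ _ ht => tens_sh_le B M ht)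
    (fun _ _ ht => tens_sh_ge B M ht)

noncomputable instance : (tensF.{u} B).CommShift IntDeg where
  commShiftIso d := NatIso.ofComponents (fun M => tensSh B d M)
    (fun _ => tens_hom_ext B fun _ _ => rfl)
  commShiftIso_zero := by
    refine Iso.ext (NatTrans.ext (funext fun M => ?_))
    exact tens_hom_ext B fun _ _ => rfl
  commShiftIso_add a b := by
    refine Iso.ext (NatTrans.ext (funext fun M => ?_))
    rw [Functor.CommShift.isoAdd_hom_app]
    exact tens_hom_ext B fun _ _ => rfl

end GrBimod

open GrBimod

/-- `β_i ⊗ id : (P_i ⊗ _iP) ⊗ M → A_n ⊗ M = M`, where `β_i` is the multiplication. -/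
noncomputable def betaL (i : Fin n) (M : GrMod.{u} n) : Tens (PP i) M →ₗ[A n] M.carrier :=
  liftL ((AddMonoidHom.smul (R := A n) (M := M.carrier)).comp (mulPP i))
    (fun x a m => by
      change mulPP i ((PP i).ract (op a) x) • m = mulPP i x • a • m
      rw [mulPP_ract, mul_smul])
    (fun a x m => by
      change mulPP i (a • x) • m = a • mulPP i x • m
      rw [mulPP_smul, mul_smul])

lemma betaL_tmul (i : Fin n) (M : GrMod.{u} n) (x : (PP i).carrier) (m : M.carrier) :
    betaL i M (tmul (PP i) M x m) = mulPP i x • m := rfl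

/-- The transformation `β_i ⊗ id`. -/
noncomputable def beta (i : Fin n) : tensF.{u} (PP i) ⟶ 𝟭 (GrMod.{u} n) where
  app M := GrMod.mk' (M := tens (PP i) M) (betaL i M) fun _ _ ht =>
    map_mem_biGr (T := Tens (PP i) M) (betaL i M).toAddMonoidHom _
      (fun _ _ hij _ hx _ hm => hij ▸ M.smul_mem (mulPP_mem i hx) hm) ht
  naturality _ _ f := tens_hom_ext _ fun x m => ((GrMod.lin f).map_smul (mulPP i x) m).symm

/-- `γ_i ⊗ id : M = A_n ⊗ M → (P_i ⊗ _iP) ⊗ M`, where `γ_i` sends `1` to the element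
`casimir i`. -/
noncomputable def gammaL (i : Fin n) (M : GrMod.{u} n) :
    M.carrier →ₗ[A n] Tens ((PP i).sh 2) M where
  toFun m := tmul ((PP i).sh 2) M (casimir i) m
  map_add' := map_add _
  map_smul' a m :=
    (tmul_ract (B := (PP i).sh 2) (casimir i) a m).symm.trans
      ((congrArg (fun x => tmul ((PP i).sh 2) M x m) (casimir_smul i a).symm).trans
        (smul_tmul (B := (PP i).sh 2) a (casimir i) m).symm)

/-- The transformation `γ_i ⊗ id`. -/
noncomputable def gamma (i : Fin n) : 𝟭 (GrMod.{u} n) ⟶ tensF.{u} ((PP i).sh 2) where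
  app M := GrMod.mk' (M := M) (N := tens ((PP i).sh 2) M) (gammaL i M) fun k _ hm =>
    mem_biGr (fun x m => tmul ((PP i).sh 2) M x m) (zero_add k)
      (show casimir i ∈ (PP i).gr (0 + 2) from casimir_mem i) hm
  naturality _ _ _ := GrMod.hom_ext fun _ => rfl

/-- Multiplication by the central element `zeta i`, as a linear map. -/
def deltaL (i : Fin n) (M : GrMod.{u} n) : M.carrier →ₗ[A n] M.carrier where
  toFun m := zeta i • m
  map_add' := smul_add _
  map_smul' a m := by rw [← mul_smul, zeta_central, mul_smul, RingHom.id_apply]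

/-- The transformation `δ_i ⊗ id`: multiplication by the central element `X_{i-1} - X_{i+1}`, which
raises the internal degree by `2`. -/
noncomputable def delta (i : Fin n) :
    𝟭 (GrMod.{u} n) ⟶ shiftFunctor (GrMod.{u} n) (intDeg 2) where
  app M := GrMod.mk' (M := M) (N := GrMod.sh 2 M) (deltaL i M) fun k _ hm =>
    GrMod.gr_congr M (add_comm 2 k) (M.smul_mem (zeta_mem i) hm)
  naturality _ _ f := GrMod.hom_ext fun m => ((GrMod.lin f).map_smul (zeta i) m).symm

lemma zeta_mul_mulPP (i : Fin n) (x : (PP i).carrier) : zeta i * mulPP i x = 0 := by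
  induction x using PP_induction with
  | h0 => rw [map_zero, mul_zero]
  | hadd s t h₁ h₂ => rw [map_add, mul_add, h₁, h₂, add_zero]
  | h x y =>
    have hx : x.1 * e i = x.1 := x.2
    rw [mulPP_tm, ← hx, ← mul_assoc, zeta_central, mul_assoc x.1, e_mul_zeta, mul_zero, zero_mul]

lemma casimir_zeta (i : Fin n) : (PP i).ract (op (zeta i)) (casimir i) = 0 := by
  have h : ∀ a b, (PP i).ract (op (zeta i)) (pt i a b) = 0 := fun a b => by
    have : toPr i (b * zeta i) = 0 := Subtype.ext (by
      change e i * (b * zeta i) = 0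
      rw [← zeta_central, ← mul_assoc, e_mul_zeta, zero_mul])
    rw [pt_ract, pt, this, map_zero]; rfl
  unfold casimir
  rw [map_add, map_add, map_sum, h, h, Finset.sum_eq_zero fun j _ => h _ _, add_zero, add_zero]

lemma beta_delta (i : Fin n) (M : GrMod.{u} n) : (beta i).app M ≫ (delta i).app M = 0 :=
  tens_hom_ext _ fun x m => by
    change zeta i • mulPP i x • m = 0
    rw [← mul_smul, zeta_mul_mulPP, zero_smul]

lemma delta_gamma (i : Fin n) (M : GrMod.{u} n) :
    (delta i).app M ≫ (gamma i).app (M⟦intDeg 2⟧) = 0 :=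
  GrMod.hom_ext fun m =>
    (tmul_ract (B := (PP i).sh 2) (casimir i) (zeta i) m).symm.trans <| (congrArg (fun x => tmul ((PP i).sh 2) M x m) (casimir_zeta i)).trans
      (DFunLike.congr_fun (map_zero (tmul ((PP i).sh 2) M)) m)

instance (i : Fin n) : NatTrans.CommShift (beta.{u} i) IntDeg where
  shift_comm d := by
    refine NatTrans.ext (funext fun M => ?_)
    exact tens_hom_ext _ fun _ _ => rfl

instance (i : Fin n) : NatTrans.CommShift (gamma.{u} i) IntDeg where
  shift_comm d := by
    refine NatTrans.ext (funext fun M => ?_)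
    exact GrMod.hom_ext fun _ => rfl

end BraidCob

namespace BraidCob

universe u v
open Limits

/-! ### Complexes over a category with internal degrees -/

section Complexes

variable {C : Type u} [Category.{v} C] [Preadditive C] [HasShift C IntDeg]
  [∀ d : IntDeg, (shiftFunctor C d).Additive]

/-- The complexes `K⟨d⟩`, defined degreewise. -/
def shC (C : Type u) [Category.{v} C] [Preadditive C] [HasShift C IntDeg]
    [∀ d : IntDeg, (shiftFunctor C d).Additive] (d : IntDeg) :
    CochainComplex C ℤ ⥤ CochainComplex C ℤ :=
  (shiftFunctor C d).mapHomologicalComplex _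

/-- `K⟨0⟩ ≅ K`. -/
noncomputable def shCZero (K : CochainComplex C ℤ) : (shC C 0).obj K ≅ K :=
  HomologicalComplex.Hom.isoOfComponents (fun i => (shiftFunctorZero C IntDeg).app (K.X i))
    fun i j _ => ((shiftFunctorZero C IntDeg).hom.naturality (K.d i j)).symm

/-- `K⟨a + b⟩ ≅ K⟨a⟩⟨b⟩`. -/
noncomputable def shCAdd (a b : IntDeg) (K : CochainComplex C ℤ) :
    (shC C (a + b)).obj K ≅ (shC C b).obj ((shC C a).obj K) :=
  HomologicalComplex.Hom.isoOfComponents (fun i => (shiftFunctorAdd C a b).app (K.X i))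
    fun i j _ => ((shiftFunctorAdd C a b).hom.naturality (K.d i j)).symm

lemma eqToHom_shC_f {a b : IntDeg} (h : a = b) (K : CochainComplex C ℤ) (i : ℤ) :
    (eqToHom (congrArg (fun d => (shC C d).obj K) h)).f i =
      eqToHom (congrArg (fun d => (shiftFunctor C d).obj (K.X i)) h) := by
  subst h; rfl

noncomputable instance : HasShift (CochainComplex C ℤ) IntDeg := hasShiftMk _ _
  { F := shC C
    zero := NatIso.ofComponents shCZero fun f => by
      ext i; exact (shiftFunctorZero C IntDeg).hom.naturality (f.f i)
    add := fun a b => NatIso.ofComponents (shCAdd a b) fun f => by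
      ext i; exact (shiftFunctorAdd C a b).hom.naturality (f.f i)
    assoc_hom_app := fun a b c K => by
      ext i
      refine Eq.trans ?_ (congrArg (· ≫ _) (eqToHom_shC_f (add_assoc a b c) K i).symm)
      have := shiftFunctorAdd_assoc_hom_app a b c (K.X i)
      rw [shiftFunctorAdd'] at this
      simp only [Iso.trans_hom, eqToIso.hom, NatTrans.comp_app, eqToHom_app, Category.assoc] at this
      exact this
    zero_add_hom_app := fun a K => by
      ext i
      refine Eq.trans ?_ (congrArg (· ≫ _) (eqToHom_shC_f (zero_add a) K i).symm)
      exact shiftFunctorAdd_zero_add_hom_app a (K.X i)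
    add_zero_hom_app := fun a K => by
      ext i
      refine Eq.trans ?_ (congrArg (· ≫ _) (eqToHom_shC_f (add_zero a) K i).symm)
      exact shiftFunctorAdd_add_zero_hom_app a (K.X i) }

lemma shC_eq (d : IntDeg) : shiftFunctor (CochainComplex C ℤ) d = shC C d := rfl

lemma sh_map_f (d : IntDeg) {K L : CochainComplex C ℤ} (f : K ⟶ L) (i : ℤ) :
    ((shiftFunctor (CochainComplex C ℤ) d).map f).f i = (shiftFunctor C d).map (f.f i) := rfl

lemma shZero_hom_f (K : CochainComplex C ℤ) (i : ℤ) :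
    ((shiftFunctorZero (CochainComplex C ℤ) IntDeg).hom.app K).f i =
      (shiftFunctorZero C IntDeg).hom.app (K.X i) := rfl

lemma shZero_inv_f (K : CochainComplex C ℤ) (i : ℤ) :
    ((shiftFunctorZero (CochainComplex C ℤ) IntDeg).inv.app K).f i =
      (shiftFunctorZero C IntDeg).inv.app (K.X i) := rfl

lemma shAdd_hom_f (a b : IntDeg) (K : CochainComplex C ℤ) (i : ℤ) :
    ((shiftFunctorAdd (CochainComplex C ℤ) a b).hom.app K).f i =
      (shiftFunctorAdd C a b).hom.app (K.X i) := rfl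

lemma shAdd_inv_f (a b : IntDeg) (K : CochainComplex C ℤ) (i : ℤ) :
    ((shiftFunctorAdd (CochainComplex C ℤ) a b).inv.app K).f i =
      (shiftFunctorAdd C a b).inv.app (K.X i) := rfl

instance (d : IntDeg) : (shiftFunctor (CochainComplex C ℤ) d).Additive :=
  inferInstanceAs ((shiftFunctor C d).mapHomologicalComplex (ComplexShape.up ℤ)).Additive

/-- The termwise extension of a functor to complexes. -/
abbrev ext (F : C ⥤ C) [F.Additive] : CochainComplex C ℤ ⥤ CochainComplex C ℤ :=
  F.mapHomologicalComplex _

noncomputable instance (F : C ⥤ C) [F.Additive] [F.CommShift IntDeg] :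
    (ext F).CommShift IntDeg where
  commShiftIso d := NatIso.ofComponents (fun K => HomologicalComplex.Hom.isoOfComponents
      (fun i => (F.commShiftIso d).app (K.X i))
      fun i j _ => ((F.commShiftIso d).hom.naturality (K.d i j)).symm)
    fun f => by ext i; exact (F.commShiftIso d).hom.naturality (f.f i)
  commShiftIso_zero := by
    ext K i
    have := congrArg (fun e => e.hom.app (K.X i)) (F.commShiftIso_zero IntDeg)
    simp only [Functor.CommShift.isoZero_hom_app] at this ⊢
    exact this
  commShiftIso_add a b := by
    ext K i
    have := congrArg (fun e => e.hom.app (K.X i)) (F.commShiftIso_add a b)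
    simp only [Functor.CommShift.isoAdd_hom_app] at this ⊢
    exact this

lemma ext_commShift_hom_f (F : C ⥤ C) [F.Additive] [F.CommShift IntDeg] (d : IntDeg)
    (K : CochainComplex C ℤ) (i : ℤ) : (((ext F).commShiftIso d).hom.app K).f i =
      (F.commShiftIso d).hom.app (K.X i) := rfl

noncomputable instance (m : ℤ) : (shiftFunctor (CochainComplex C ℤ) m).CommShift IntDeg where
  commShiftIso d := NatIso.ofComponents (fun K => HomologicalComplex.Hom.isoOfComponents
      (fun i => Iso.refl ((shiftFunctor C d).obj (K.X (i + m))))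
      fun i j _ => by
        refine (Category.id_comp _).trans (Eq.trans ?_ (Category.comp_id _).symm)
        exact Functor.map_units_smul (R := ℤ) (shiftFunctor C d) m.negOnePow (K.d (i + m) (j + m)))
    fun f => by
      ext i
      exact (Category.comp_id _).trans (Category.id_comp _).symm
  commShiftIso_zero := by
    ext K i
    rw [Functor.CommShift.isoZero_hom_app]
    exact ((shiftFunctorZero C IntDeg).hom_inv_id_app (K.X (i + m))).symm
  commShiftIso_add a b := by
    ext K i
    rw [Functor.CommShift.isoAdd_hom_app]
    refine ((shiftFunctorAdd C a b).hom_inv_id_app (K.X (i + m))).symm.trans ?_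
    refine congrArg ((shiftFunctorAdd C a b).hom.app (K.X (i + m)) ≫ ·) ?_
    refine (Category.id_comp _).symm.trans (congrArg (𝟙 _ ≫ ·) ?_)
    exact (Category.id_comp _).symm.trans
      (congrArg (· ≫ _) ((shiftFunctor C b).map_id _).symm)

/-- A transformation to the identity functor, extended to complexes. -/
def extTo {F : C ⥤ C} [F.Additive] (φ : F ⟶ 𝟭 C) : ext F ⟶ 𝟭 (CochainComplex C ℤ) where
  app K := { f := fun i => φ.app (K.X i), comm' := fun i j _ => (φ.naturality (K.d i j)).symm }
  naturality _ _ f := by ext i; exact φ.naturality (f.f i)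

/-- A transformation from the identity functor, extended to complexes. -/
def extFrom {F : C ⥤ C} [F.Additive] (φ : 𝟭 C ⟶ F) : 𝟭 (CochainComplex C ℤ) ⟶ ext F where
  app K := { f := fun i => φ.app (K.X i), comm' := fun i j _ => (φ.naturality (K.d i j)).symm }
  naturality _ _ f := by ext i; exact φ.naturality (f.f i)

instance {F : C ⥤ C} [F.Additive] [F.CommShift IntDeg] (φ : F ⟶ 𝟭 C) [NatTrans.CommShift φ IntDeg] :
    NatTrans.CommShift (extTo φ) IntDeg where
  shift_comm d := by
    ext K i
    exact congrArg (fun τ => τ.app (K.X i)) (NatTrans.CommShift.shift_comm (τ := φ) d)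

instance {F : C ⥤ C} [F.Additive] [F.CommShift IntDeg] (φ : 𝟭 C ⟶ F) [NatTrans.CommShift φ IntDeg] :
    NatTrans.CommShift (extFrom φ) IntDeg where
  shift_comm d := by
    ext K i
    exact congrArg (fun τ => τ.app (K.X i)) (NatTrans.CommShift.shift_comm (τ := φ) d)

end Complexes

end BraidCob

namespace BraidCob

universe u v
open Limits

/-! ### Cones of natural transformations between functors on complexes -/

/-- Naturality squares in a category, in the form in which they occur below. -/
lemma square_comp {D : Type*} [Category* D] {T₀ T₁ T₂ T₃ T₄ : D} {a : T₀ ⟶ T₁} {b : T₁ ⟶ T₂}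
    {a' : T₀ ⟶ T₃} {b' : T₃ ⟶ T₂} (h : a ≫ b = a' ≫ b') (c : T₂ ⟶ T₄) :
    a ≫ b ≫ c = a' ≫ b' ≫ c := by
  rw [← Category.assoc, h, Category.assoc]

lemma map_square {D E : Type*} [Category* D] [Category* E] (H : D ⥤ E) {T₀ T₁ T₂ T₃ : D}
    {a : T₀ ⟶ T₁} {b : T₁ ⟶ T₂} {a' : T₀ ⟶ T₃} {b' : T₃ ⟶ T₂} (h : a ≫ b = a' ≫ b') :
    H.map a ≫ H.map b = H.map a' ≫ H.map b' := by
  rw [← H.map_comp, h, H.map_comp]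

section Cones

open CochainComplex hiding shiftFunctor shiftFunctorZero' shiftFunctorAdd'
open CochainComplex.HomComplex

variable {C : Type u} [Category.{v} C] [Preadditive C] [HasBinaryBiproducts C]

/-- The functor `K ↦ cone (φ_K : F K → G K)`. -/
noncomputable def coneF {F G : CochainComplex C ℤ ⥤ CochainComplex C ℤ} (φ : F ⟶ G) :
    CochainComplex C ℤ ⥤ CochainComplex C ℤ where
  obj K := mappingCone (φ.app K)
  map f := mappingCone.map _ _ (F.map f) (G.map f) (φ.naturality f).symm
  map_id K := by
    simp only [F.map_id, G.map_id]
    exact mappingCone.map_id _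
  map_comp f g := by
    simp only [F.map_comp, G.map_comp]
    exact mappingCone.map_comp _ _ _ _ _ (φ.naturality f).symm _ _ (φ.naturality g).symm

/-- Compatible homotopies induce a homotopy between maps of cones. -/
noncomputable def coneHomotopy {K₁ L₁ K₂ L₂ : CochainComplex C ℤ} (φ₁ : K₁ ⟶ L₁) (φ₂ : K₂ ⟶ L₂)
    (a a' : K₁ ⟶ K₂) (b b' : L₁ ⟶ L₂) (h : φ₁ ≫ b = a ≫ φ₂) (h' : φ₁ ≫ b' = a' ≫ φ₂)
    (z : Cochain K₁ K₂ (-1)) (w : Cochain L₁ L₂ (-1))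
    (hz : Cochain.ofHom a = δ (-1) 0 z + Cochain.ofHom a')
    (hw : Cochain.ofHom b = δ (-1) 0 w + Cochain.ofHom b')
    (hzw : (Cochain.ofHom φ₁).comp w (zero_add _) = z.comp (Cochain.ofHom φ₂) (add_zero _)) :
    Homotopy (mappingCone.map φ₁ φ₂ a b h) (mappingCone.map φ₁ φ₂ a' b' h') :=
  mappingCone.descHomotopy φ₁ _ _ (-(z.comp (mappingCone.inl φ₂) (by norm_num)))
    (w.comp (Cochain.ofHom (mappingCone.inr φ₂)) (add_zero _))
    (by
      simp only [mappingCone.map, mappingCone.inl_desc, δ_neg]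
      rw [δ_comp z (mappingCone.inl φ₂) (by norm_num) 0 0 (-1) (by norm_num) (by norm_num)
        (by norm_num), mappingCone.δ_inl, Cochain.ofHom_comp, hz,
        ← Cochain.comp_assoc_of_second_is_zero_cochain, ← hzw]
      simp [Cochain.add_comp])
    (by
      simp only [mappingCone.map, mappingCone.inr_desc, Cochain.ofHom_comp, hw]
      simp [Cochain.add_comp])

lemma inl_split {K L : CochainComplex C ℤ} (f : K ⟶ L) {p q : ℤ} (h : q + (-1) = p) {T : C}
    (a : K.X q ⟶ T) (b : L.X p ⟶ T) : (mappingCone.inl f).v q p h ≫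
      ((mappingCone.fst f).1.v p q (by omega) ≫ a +
        (mappingCone.snd f).v p p (add_zero p) ≫ b) = a := by
  simp

lemma inr_split {K L : CochainComplex C ℤ} (f : K ⟶ L) {p q : ℤ} (h : p + 1 = q) {T : C}
    (a : K.X q ⟶ T) (b : L.X p ⟶ T) : (mappingCone.inr f).f p ≫
      ((mappingCone.fst f).1.v p q h ≫ a + (mappingCone.snd f).v p p (add_zero p) ≫ b) = b := by
  simp

lemma inl_map {K₁ L₁ K₂ L₂ : CochainComplex C ℤ} {φ₁ : K₁ ⟶ L₁} {φ₂ : K₂ ⟶ L₂}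
    {a : K₁ ⟶ K₂} {b : L₁ ⟶ L₂} (comm : φ₁ ≫ b = a ≫ φ₂) (p q : ℤ) (h : q + (-1) = p) :
    (mappingCone.inl φ₁).v q p h ≫ (mappingCone.map φ₁ φ₂ a b comm).f p =
      a.f q ≫ (mappingCone.inl φ₂).v q p h := by
  simp [mappingCone.map]

lemma inr_map {K₁ L₁ K₂ L₂ : CochainComplex C ℤ} {φ₁ : K₁ ⟶ L₁} {φ₂ : K₂ ⟶ L₂}
    {a : K₁ ⟶ K₂} {b : L₁ ⟶ L₂} (comm : φ₁ ≫ b = a ≫ φ₂) (p : ℤ) :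
    (mappingCone.inr φ₁).f p ≫ (mappingCone.map φ₁ φ₂ a b comm).f p =
      b.f p ≫ (mappingCone.inr φ₂).f p := by
  simp [mappingCone.map]

lemma inl_map_comp {K₁ L₁ K₂ L₂ : CochainComplex C ℤ} {φ₁ : K₁ ⟶ L₁} {φ₂ : K₂ ⟶ L₂}
    {a : K₁ ⟶ K₂} {b : L₁ ⟶ L₂} (comm : φ₁ ≫ b = a ≫ φ₂) (p q : ℤ) (h : q + (-1) = p) {T : C}
    (t : (mappingCone φ₂).X p ⟶ T) :
    (mappingCone.inl φ₁).v q p h ≫ (mappingCone.map φ₁ φ₂ a b comm).f p ≫ t =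
      a.f q ≫ (mappingCone.inl φ₂).v q p h ≫ t := by
  rw [← Category.assoc, inl_map, Category.assoc]

lemma inr_map_comp {K₁ L₁ K₂ L₂ : CochainComplex C ℤ} {φ₁ : K₁ ⟶ L₁} {φ₂ : K₂ ⟶ L₂}
    {a : K₁ ⟶ K₂} {b : L₁ ⟶ L₂} (comm : φ₁ ≫ b = a ≫ φ₂) (p : ℤ) {T : C}
    (t : (mappingCone φ₂).X p ⟶ T) :
    (mappingCone.inr φ₁).f p ≫ (mappingCone.map φ₁ φ₂ a b comm).f p ≫ t =
      b.f p ≫ (mappingCone.inr φ₂).f p ≫ t := by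
  rw [← Category.assoc, inr_map, Category.assoc]

/-- Morphisms from a cone are determined by their restrictions to the two summands. -/
lemma cone_hom_ext {K L T : CochainComplex C ℤ} (f : K ⟶ L) {g g' : mappingCone f ⟶ T}
    (h₁ : ∀ p q (h : q + (-1) = p), (mappingCone.inl f).v q p h ≫ g.f p =
      (mappingCone.inl f).v q p h ≫ g'.f p)
    (h₂ : ∀ p, (mappingCone.inr f).f p ≫ g.f p = (mappingCone.inr f).f p ≫ g'.f p) : g = g' := by
  ext p
  exact mappingCone.ext_from f (p + 1) p rfl (h₁ p (p + 1) (by omega)) (h₂ p)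

variable [HasShift C IntDeg] [∀ d : IntDeg, (shiftFunctor C d).Additive]
  {F G : CochainComplex C ℤ ⥤ CochainComplex C ℤ} [F.CommShift IntDeg] [G.CommShift IntDeg]
  (φ : F ⟶ G) [NatTrans.CommShift φ IntDeg]

/-- `cone (f⟨d⟩) ≅ cone (f)⟨d⟩`. -/
noncomputable def coneSh (d : IntDeg) {K L : CochainComplex C ℤ} (f : K ⟶ L) :
    mappingCone ((shiftFunctor (CochainComplex C ℤ) d).map f) ≅ (mappingCone f)⟦d⟧ :=
  (mappingCone.mapHomologicalComplexIso f (shiftFunctor C d)).symm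

lemma coneSh_hom_f (d : IntDeg) {K L : CochainComplex C ℤ} (f : K ⟶ L) (p q : ℤ) (h : p + 1 = q) :
    (coneSh d f).hom.f p =
      (mappingCone.fst ((shiftFunctor (CochainComplex C ℤ) d).map f)).1.v p q h ≫
        (shiftFunctor C d).map ((mappingCone.inl f).v q p (by omega)) +
      (mappingCone.snd ((shiftFunctor (CochainComplex C ℤ) d).map f)).v p p (add_zero p) ≫
        (shiftFunctor C d).map ((mappingCone.inr f).f p) := by
  change (mappingCone.mapHomologicalComplexXIso f (shiftFunctor C d) p).inv = _
  rw [mappingCone.mapHomologicalComplexXIso_eq _ _ p q h]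
  rfl

lemma inl_coneSh (d : IntDeg) {K L : CochainComplex C ℤ} (f : K ⟶ L) (p q : ℤ)
    (h : q + (-1) = p) :
    (mappingCone.inl ((shiftFunctor (CochainComplex C ℤ) d).map f)).v q p h ≫ (coneSh d f).hom.f p =
      (shiftFunctor C d).map ((mappingCone.inl f).v q p h) := by
  rw [coneSh_hom_f d f p q (by omega)]
  exact inl_split _ _ _ _

lemma inr_coneSh (d : IntDeg) {K L : CochainComplex C ℤ} (f : K ⟶ L) (p : ℤ) :
    (mappingCone.inr ((shiftFunctor (CochainComplex C ℤ) d).map f)).f p ≫ (coneSh d f).hom.f p =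
      (shiftFunctor C d).map ((mappingCone.inr f).f p) := by
  rw [coneSh_hom_f d f p _ rfl]
  exact inr_split _ _ _ _

/-- An isomorphism of arrows induces an isomorphism of cones. -/
noncomputable def coneIso {K L K' L' : CochainComplex C ℤ} (f : K ⟶ L) (f' : K' ⟶ L')
    (a : K ≅ K') (b : L ≅ L') (h : f ≫ b.hom = a.hom ≫ f') : mappingCone f ≅ mappingCone f' where
  hom := mappingCone.map _ _ a.hom b.hom h
  inv := mappingCone.map _ _ a.inv b.inv (by
    rw [← cancel_epi a.hom, ← Category.assoc, ← h, Category.assoc, b.hom_inv_id, Category.comp_id,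
      a.hom_inv_id_assoc])
  hom_inv_id := by
    rw [← mappingCone.map_comp]
    simp only [a.hom_inv_id, b.hom_inv_id, mappingCone.map_id]
  inv_hom_id := by
    rw [← mappingCone.map_comp]
    simp only [a.inv_hom_id, b.inv_hom_id, mappingCone.map_id]

/-- `cone (φ_{K⟨d⟩}) ≅ cone (φ_K)⟨d⟩`. -/
noncomputable def coneComm (d : IntDeg) (K : CochainComplex C ℤ) :
    (coneF φ).obj (K⟦d⟧) ≅ ((coneF φ).obj K)⟦d⟧ :=
  coneIso (φ.app (K⟦d⟧)) ((shiftFunctor (CochainComplex C ℤ) d).map (φ.app K))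
    ((F.commShiftIso d).app K) ((G.commShiftIso d).app K)
    (NatTrans.shift_app_comm φ d K).symm ≪≫ coneSh d (φ.app K)

lemma inl_coneComm (d : IntDeg) (K : CochainComplex C ℤ) (p q : ℤ) (h : q + (-1) = p) :
    (mappingCone.inl (φ.app (K⟦d⟧))).v q p h ≫ (coneComm φ d K).hom.f p =
      ((F.commShiftIso d).hom.app K).f q ≫
        (shiftFunctor C d).map ((mappingCone.inl (φ.app K)).v q p h) := by
  refine (inl_map_comp (NatTrans.shift_app_comm φ d K).symm p q h _).trans ?_
  exact congrArg (((F.commShiftIso d).hom.app K).f q ≫ ·) (inl_coneSh d (φ.app K) p q h)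

lemma inr_coneComm (d : IntDeg) (K : CochainComplex C ℤ) (p : ℤ) :
    (mappingCone.inr (φ.app (K⟦d⟧))).f p ≫ (coneComm φ d K).hom.f p =
      ((G.commShiftIso d).hom.app K).f p ≫
        (shiftFunctor C d).map ((mappingCone.inr (φ.app K)).f p) := by
  refine (inr_map_comp (NatTrans.shift_app_comm φ d K).symm p _).trans ?_
  exact congrArg (((G.commShiftIso d).hom.app K).f p ≫ ·) (inr_coneSh d (φ.app K) p)

lemma inl_coneComm_comp (d : IntDeg) (K : CochainComplex C ℤ) (p q : ℤ) (h : q + (-1) = p) {T : C}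
    (t : (((coneF φ).obj K)⟦d⟧).X p ⟶ T) :
    (mappingCone.inl (φ.app (K⟦d⟧))).v q p h ≫ (coneComm φ d K).hom.f p ≫ t =
      ((F.commShiftIso d).hom.app K).f q ≫
        (shiftFunctor C d).map ((mappingCone.inl (φ.app K)).v q p h) ≫ t :=
  (Category.assoc _ _ _).symm.trans
    ((congrArg (· ≫ t) (inl_coneComm φ d K p q h)).trans (Category.assoc _ _ _))

lemma inr_coneComm_comp (d : IntDeg) (K : CochainComplex C ℤ) (p : ℤ) {T : C}
    (t : (((coneF φ).obj K)⟦d⟧).X p ⟶ T) :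
    (mappingCone.inr (φ.app (K⟦d⟧))).f p ≫ (coneComm φ d K).hom.f p ≫ t =
      ((G.commShiftIso d).hom.app K).f p ≫
        (shiftFunctor C d).map ((mappingCone.inr (φ.app K)).f p) ≫ t :=
  (Category.assoc _ _ _).symm.trans
    ((congrArg (· ≫ t) (inr_coneComm φ d K p)).trans (Category.assoc _ _ _))

noncomputable instance : (coneF φ).CommShift IntDeg where
  commShiftIso d := NatIso.ofComponents (coneComm φ d) fun {K L} f => by
    refine cone_hom_ext _ (fun p q h => ?_) (fun p => ?_)
    · refine (inl_map_comp (φ.naturality _).symm p q h _).trans ?_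
      refine (congrArg (_ ≫ ·) (inl_coneComm φ d L p q h)).trans ?_
      refine Eq.trans ?_ (inl_coneComm_comp φ d K p q h _).symm
      refine Eq.trans ?_ (congrArg (_ ≫ ·)
        (map_square (shiftFunctor C d) (inl_map (φ.naturality f).symm p q h)).symm)
      exact square_comp (congrArg (fun t => HomologicalComplex.Hom.f t q)
        ((F.commShiftIso d).hom.naturality f)) _
    · refine (inr_map_comp (φ.naturality _).symm p _).trans ?_
      refine (congrArg (_ ≫ ·) (inr_coneComm φ d L p)).trans ?_
      refine Eq.trans ?_ (inr_coneComm_comp φ d K p _).symm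
      refine Eq.trans ?_ (congrArg (_ ≫ ·)
        (map_square (shiftFunctor C d) (inr_map (φ.naturality f).symm p)).symm)
      exact square_comp (congrArg (fun t => HomologicalComplex.Hom.f t p)
        ((G.commShiftIso d).hom.naturality f)) _
  commShiftIso_zero := by
    refine Iso.ext (NatTrans.ext (funext fun K => ?_))
    rw [Functor.CommShift.isoZero_hom_app]
    have hF := congrArg (fun e => e.hom.app K) (F.commShiftIso_zero IntDeg)
    have hG := congrArg (fun e => e.hom.app K) (G.commShiftIso_zero IntDeg)
    simp only [Functor.CommShift.isoZero_hom_app] at hF hG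
    refine cone_hom_ext _ (fun p q h => ?_) (fun p => ?_)
    · refine (inl_coneComm φ 0 K p q h).trans ?_
      refine Eq.trans ?_ (inl_map_comp (φ.naturality _).symm p q h _).symm
      refine Eq.trans ?_ (congrArg (_ ≫ ·)
        ((shiftFunctorZero C IntDeg).inv.naturality ((mappingCone.inl (φ.app K)).v q p h)).symm)
      exact (congrArg (fun t => HomologicalComplex.Hom.f t q ≫ _) hF).trans (Category.assoc _ _ _)
    · refine (inr_coneComm φ 0 K p).trans ?_
      refine Eq.trans ?_ (inr_map_comp (φ.naturality _).symm p _).symm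
      refine Eq.trans ?_ (congrArg (_ ≫ ·)
        ((shiftFunctorZero C IntDeg).inv.naturality ((mappingCone.inr (φ.app K)).f p)).symm)
      exact (congrArg (fun t => HomologicalComplex.Hom.f t p ≫ _) hG).trans (Category.assoc _ _ _)
  commShiftIso_add a b := by
    refine Iso.ext (NatTrans.ext (funext fun K => ?_))
    rw [Functor.CommShift.isoAdd_hom_app]
    have hF := congrArg (fun e => e.hom.app K) (F.commShiftIso_add a b)
    have hG := congrArg (fun e => e.hom.app K) (G.commShiftIso_add a b)
    simp only [Functor.CommShift.isoAdd_hom_app] at hF hG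
    refine cone_hom_ext _ (fun p q h => ?_) (fun p => ?_)
    · refine (inl_coneComm φ (a + b) K p q h).trans ?_
      refine Eq.trans ?_ (inl_map_comp (φ.naturality _).symm p q h _).symm
      refine Eq.trans ?_ (congrArg (_ ≫ ·) (inl_coneComm_comp φ b (K⟦a⟧) p q h _).symm)
      refine Eq.trans ?_ (congrArg (_ ≫ ·) (congrArg (_ ≫ ·) (square_comp
        (map_square (shiftFunctor C b) (inl_coneComm φ a K p q h)) _).symm))
      refine Eq.trans ?_ (congrArg (_ ≫ ·) (congrArg (_ ≫ ·) (congrArg (_ ≫ ·)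
        ((shiftFunctorAdd C a b).inv.naturality ((mappingCone.inl (φ.app K)).v q p h)).symm)))
      refine (congrArg (fun t => HomologicalComplex.Hom.f t q ≫ _) hF).trans ?_
      refine (Category.assoc _ _ _).trans (congrArg (_ ≫ ·) ?_)
      refine (Category.assoc _ _ _).trans (congrArg (_ ≫ ·) ?_)
      exact Category.assoc _ _ _
    · refine (inr_coneComm φ (a + b) K p).trans ?_
      refine Eq.trans ?_ (inr_map_comp (φ.naturality _).symm p _).symm
      refine Eq.trans ?_ (congrArg (_ ≫ ·) (inr_coneComm_comp φ b (K⟦a⟧) p _).symm)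
      refine Eq.trans ?_ (congrArg (_ ≫ ·) (congrArg (_ ≫ ·) (square_comp
        (map_square (shiftFunctor C b) (inr_coneComm φ a K p)) _).symm))
      refine Eq.trans ?_ (congrArg (_ ≫ ·) (congrArg (_ ≫ ·) (congrArg (_ ≫ ·)
        ((shiftFunctorAdd C a b).inv.naturality ((mappingCone.inr (φ.app K)).f p)).symm)))
      refine (congrArg (fun t => HomologicalComplex.Hom.f t p ≫ _) hG).trans ?_
      refine (Category.assoc _ _ _).trans (congrArg (_ ≫ ·) ?_)
      refine (Category.assoc _ _ _).trans (congrArg (_ ≫ ·) ?_)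
      exact Category.assoc _ _ _

end Cones

end BraidCob

namespace BraidCob

universe u v
open Limits

/-! ### The bounded homotopy category -/

section Bounded

open HomologicalComplex Pretriangulated

variable (C : Type u) [Category.{v} C] [Preadditive C]

/-- Complexes with only finitely many nonzero terms. -/
def bddCx : ObjectProperty (CochainComplex C ℤ) := fun K =>
  ∃ a b : ℤ, ∀ i, i < a ∨ b < i → IsZero (K.X i)

/-- Bounded complexes, as objects of the homotopy category. -/
def bdd : ObjectProperty (HomotopyCategory C (ComplexShape.up ℤ)) := fun K => bddCx C K.as

variable {C}

lemma bddCx_shift (m : ℤ) {K : CochainComplex C ℤ} (hK : bddCx C K) : bddCx C (K⟦m⟧) := by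
  obtain ⟨a, b, h⟩ := hK
  refine ⟨a - m, b - m, fun i hi => ?_⟩
  exact h (i + m) (hi.imp (by lia) (by lia))

lemma bddCx_cone [HasBinaryBiproducts C] {K L : CochainComplex C ℤ} (f : K ⟶ L)
    (hK : bddCx C K) (hL : bddCx C L) : bddCx C (CochainComplex.mappingCone f) := by
  obtain ⟨a, b, h⟩ := hK
  obtain ⟨a', b', h'⟩ := hL
  refine ⟨min (a - 1) a', max (b - 1) b', fun i hi => ?_⟩
  rw [CochainComplex.mappingCone.isZero_X_iff]
  exact ⟨h _ (hi.imp (by lia) (by lia)), h' _ (hi.imp (by lia) (by lia))⟩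

instance [HasZeroObject C] : (bdd C).ContainsZero where
  exists_zero := ⟨(HomotopyCategory.quotient _ _).obj HomologicalComplex.zero,
    Functor.map_isZero _ HomologicalComplex.isZero_zero, 0, 0, fun _ _ => isZero_zero C⟩

instance : (bdd C).IsStableUnderShift ℤ where
  isStableUnderShiftBy m :=
    { le_shift K hK := by
        obtain ⟨K : CochainComplex _ _, rfl⟩ := K.quotient_obj_surjective
        rw [ObjectProperty.prop_shift_iff, HomotopyCategory.shift_quotient_obj]
        exact bddCx_shift m (K := K) hK }

instance [HasZeroObject C] [HasBinaryBiproducts C] : (bdd C).IsTriangulatedClosed₃ where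
  ext₃' T hT h₁ h₂ := by
    obtain ⟨f : T.obj₁.as ⟶ T.obj₂.as, hf⟩ := (HomotopyCategory.quotient _ _).map_surjective T.mor₁
    refine ⟨_, bddCx_cone f h₁ h₂, ⟨Triangle.π₃.mapIso (isoTriangleOfIso₁₂ T _ hT
      (HomotopyCategory.mappingCone_triangleh_distinguished f) (Iso.refl _) (Iso.refl _) ?_)⟩⟩
    exact (Category.comp_id _).trans (hf.symm.trans (Category.id_comp _).symm)

instance [HasZeroObject C] [HasBinaryBiproducts C] : (bdd C).IsTriangulated where
  toIsTriangulatedClosed₂ := .of_isTriangulatedClosed₃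

variable (C) in
/-- The homotopy category of bounded complexes. -/
abbrev Kb := (bdd C).FullSubcategory

/-- An endofunctor of complexes which preserves homotopy and bounded complexes. -/
class Descends (Φ : CochainComplex C ℤ ⥤ CochainComplex C ℤ) : Prop where
  homotopic : ∀ {K L : CochainComplex C ℤ} (f g : K ⟶ L), Homotopy f g →
    Nonempty (Homotopy (Φ.map f) (Φ.map g))
  bounded : ∀ K, bddCx C K → bddCx C (Φ.obj K)

instance : Descends (𝟭 (CochainComplex C ℤ)) where
  homotopic _ _ h := ⟨h⟩
  bounded _ h := h

instance (Φ Ψ : CochainComplex C ℤ ⥤ CochainComplex C ℤ) [Descends Φ] [Descends Ψ] :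
    Descends (Φ ⋙ Ψ) where
  homotopic f g h := Descends.homotopic (Φ := Ψ) _ _ (Descends.homotopic (Φ := Φ) f g h).some
  bounded K h := Descends.bounded (Φ := Ψ) _ (Descends.bounded (Φ := Φ) K h)

instance (m : ℤ) : Descends (shiftFunctor (CochainComplex C ℤ) m) where
  homotopic _ _ h := ⟨h.shift m⟩
  bounded _ h := bddCx_shift m h

instance (F : C ⥤ C) [F.Additive] : Descends (ext F) where
  homotopic _ _ h := ⟨F.mapHomotopy h⟩
  bounded _ := fun ⟨a, b, h⟩ => ⟨a, b, fun i hi => F.map_isZero (h i hi)⟩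

/-- The functor on the homotopy category of complexes. -/
def onK (Φ : CochainComplex C ℤ ⥤ CochainComplex C ℤ) [Descends Φ] :
    HomotopyCategory C (ComplexShape.up ℤ) ⥤ HomotopyCategory C (ComplexShape.up ℤ) :=
  CategoryTheory.Quotient.lift _ (Φ ⋙ HomotopyCategory.quotient C _) fun _ _ _ _ ⟨h⟩ =>
    HomotopyCategory.eq_of_homotopy _ _ (Descends.homotopic _ _ h).some

/-- The functor on the bounded homotopy category. -/
def onKb (Φ : CochainComplex C ℤ ⥤ CochainComplex C ℤ) [Descends Φ] : Kb C ⥤ Kb C :=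
  (bdd C).lift ((bdd C).ι ⋙ onK Φ) fun K => Descends.bounded (Φ := Φ) K.obj.as K.property

/-- A transformation between functors on complexes, on the bounded homotopy category. -/
def natKb {Φ Ψ : CochainComplex C ℤ ⥤ CochainComplex C ℤ} [Descends Φ] [Descends Ψ]
    (τ : Φ ⟶ Ψ) : onKb Φ ⟶ onKb Ψ where
  app K := ObjectProperty.homMk ((HomotopyCategory.quotient C _).map (τ.app K.obj.as))
  naturality K L f := by
    obtain ⟨f⟩ := f
    obtain ⟨f, rfl⟩ := (HomotopyCategory.quotient C _).map_surjective f
    refine ObjectProperty.hom_ext _ ?_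
    exact map_square (HomotopyCategory.quotient C _) (τ.naturality f)

variable (C) in
/-- The identity of complexes induces the identity. -/
def idKb : onKb (𝟭 (CochainComplex C ℤ)) ≅ 𝟭 (Kb C) :=
  NatIso.ofComponents (fun K => Iso.refl K) fun {K L} f => by
    obtain ⟨f⟩ := f
    obtain ⟨f, rfl⟩ := (HomotopyCategory.quotient C _).map_surjective f
    exact (Category.comp_id _).trans (Category.id_comp _).symm

section Shift

variable [HasShift C IntDeg] [∀ d : IntDeg, (shiftFunctor C d).Additive]

instance (d : IntDeg) : Descends (shiftFunctor (CochainComplex C ℤ) d) :=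
  inferInstanceAs (Descends (ext (shiftFunctor C d)))

instance : (homotopic C (ComplexShape.up ℤ)).IsCompatibleWithShift IntDeg :=
  ⟨fun d _ _ _ _ ⟨h⟩ => ⟨(shiftFunctor C d).mapHomotopy h⟩⟩

noncomputable instance : HasShift (HomotopyCategory C (ComplexShape.up ℤ)) IntDeg :=
  inferInstanceAs (HasShift (CategoryTheory.Quotient (homotopic C (ComplexShape.up ℤ))) IntDeg)

noncomputable instance : (HomotopyCategory.quotient C (ComplexShape.up ℤ)).CommShift IntDeg :=
  CategoryTheory.Quotient.functor_commShift (homotopic C (ComplexShape.up ℤ)) IntDeg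

lemma sh_quotient_obj (K : CochainComplex C ℤ) (d : IntDeg) :
    ((HomotopyCategory.quotient C (ComplexShape.up ℤ)).obj K)⟦d⟧ =
      (HomotopyCategory.quotient C (ComplexShape.up ℤ)).obj (K⟦d⟧) :=
  CategoryTheory.Quotient.functor_obj_shift _ IntDeg _ d

instance : (bdd C).IsStableUnderShift IntDeg where
  isStableUnderShiftBy d :=
    { le_shift K hK := by
        obtain ⟨K : CochainComplex _ _, rfl⟩ := K.quotient_obj_surjective
        rw [ObjectProperty.prop_shift_iff, sh_quotient_obj]
        exact Descends.bounded (Φ := shiftFunctor (CochainComplex C ℤ) d) K hK }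

noncomputable instance (Φ : CochainComplex C ℤ ⥤ CochainComplex C ℤ) [Descends Φ]
    [Φ.CommShift IntDeg] : (onK Φ).CommShift IntDeg :=
  CategoryTheory.Quotient.liftCommShift _ _ _ _

noncomputable instance (Φ : CochainComplex C ℤ ⥤ CochainComplex C ℤ) [Descends Φ]
    [Φ.CommShift IntDeg] : (onKb Φ).CommShift IntDeg :=
  Functor.CommShift.ofComp ((bdd C).liftCompιIso ((bdd C).ι ⋙ onK Φ) fun K =>
    Descends.bounded (Φ := Φ) K.obj.as K.property) IntDeg

/-- A transformation of degree `d` between functors on complexes, on the bounded homotopy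
category. -/
noncomputable def natKbSh {Φ Ψ : CochainComplex C ℤ ⥤ CochainComplex C ℤ} [Descends Φ]
    [Descends Ψ] (d : IntDeg) (τ : Φ ⟶ Ψ ⋙ shiftFunctor (CochainComplex C ℤ) d) :
    onKb Φ ⟶ onKb Ψ ⋙ shiftFunctor (Kb C) d where
  app K := ObjectProperty.homMk ((HomotopyCategory.quotient C _).map (τ.app K.obj.as) ≫
    ((HomotopyCategory.quotient C _).commShiftIso d).hom.app (Ψ.obj K.obj.as) ≫
    ((bdd C).ι.commShiftIso d).inv.app ((onKb Ψ).obj K))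
  naturality K L f := by
    obtain ⟨g, hg⟩ := (HomotopyCategory.quotient C _).map_surjective f.hom
    refine ObjectProperty.hom_ext _ ?_
    have h₁ := map_square (HomotopyCategory.quotient C _) (τ.naturality g)
    have h₂ := ((HomotopyCategory.quotient C _).commShiftIso d).hom.naturality (Ψ.map g)
    have h₃ := ((bdd C).ι.commShiftIso d).inv.naturality ((onKb Ψ).map f)
    have e₁ : ((onKb Φ).map f).hom = (HomotopyCategory.quotient C _).map (Φ.map g) := by
      change (onK Φ).map f.hom = _
      rw [← hg]; rfl
    have e₂ : ((onKb Ψ).map f).hom = (HomotopyCategory.quotient C _).map (Ψ.map g) := by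
      change (onK Ψ).map f.hom = _
      rw [← hg]; rfl
    refine (congrArg (· ≫ _) e₁).trans ((square_comp h₁ _).trans ?_)
    refine Eq.trans ?_ (Category.assoc _ _ _).symm
    refine congrArg (_ ≫ ·) ?_
    refine (square_comp h₂ _).trans ?_
    refine Eq.trans ?_ (Category.assoc _ _ _).symm
    refine congrArg (_ ≫ ·) ?_
    refine Eq.trans ?_ h₃
    exact congrArg (fun t => (shiftFunctor (HomotopyCategory C _) d).map t ≫ _) e₂.symm

end Shift

section Cone

open CochainComplex.HomComplex

variable [HasBinaryBiproducts C]

instance {F : C ⥤ C} [F.Additive] (φ : F ⟶ 𝟭 C) : Descends (coneF (extTo φ)) where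
  homotopic {K L} f g h := ⟨coneHomotopy _ _ _ _ _ _
    ((extTo φ).naturality f).symm ((extTo φ).naturality g).symm
    (Cochain.ofHomotopy (F.mapHomotopy h)) (Cochain.ofHomotopy h)
    (by rw [δ_ofHomotopy]; exact (sub_add_cancel _ _).symm)
    (by rw [δ_ofHomotopy]; exact (sub_add_cancel _ _).symm)
    (by
      ext p q hpq
      rw [Cochain.zero_cochain_comp_v, Cochain.comp_zero_cochain_v, Cochain.ofHom_v,
        Cochain.ofHom_v, Cochain.ofHomotopy, Cochain.mk_v, Cochain.ofHomotopy, Cochain.mk_v]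
      exact (φ.naturality (h.hom p q)).symm)⟩
  bounded K hK := bddCx_cone _ (Descends.bounded (Φ := ext F) K hK) hK

instance {F : C ⥤ C} [F.Additive] (φ : 𝟭 C ⟶ F) : Descends (coneF (extFrom φ)) where
  homotopic {K L} f g h := ⟨coneHomotopy _ _ _ _ _ _
    ((extFrom φ).naturality f).symm ((extFrom φ).naturality g).symm
    (Cochain.ofHomotopy h) (Cochain.ofHomotopy (F.mapHomotopy h))
    (by rw [δ_ofHomotopy]; exact (sub_add_cancel _ _).symm)
    (by rw [δ_ofHomotopy]; exact (sub_add_cancel _ _).symm)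
    (by
      ext p q hpq
      rw [Cochain.zero_cochain_comp_v, Cochain.comp_zero_cochain_v, Cochain.ofHom_v,
        Cochain.ofHom_v, Cochain.ofHomotopy, Cochain.mk_v, Cochain.ofHomotopy, Cochain.mk_v]
      exact (φ.naturality (h.hom p q)).symm)⟩
  bounded K hK := bddCx_cone _ hK (Descends.bounded (Φ := ext F) K hK)

end Cone

end Bounded

end BraidCob

namespace BraidCob

variable {n : ℕ}
universe u v
open Limits

/-! ### Homogeneous natural transformations -/

section Endofunctors

variable {D : Type u} [Category.{v} D] [HasShift D IntDeg]

/-- A natural transformation `F → G` of degree `a`, followed by one `G → H` of degree `b`. -/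
noncomputable def natComp {F G H : D ⥤ D} {a b c : IntDeg} (α : F ⟶ G ⋙ shiftFunctor D a)
    (β : G ⟶ H ⋙ shiftFunctor D b) (h : b + a = c) : F ⟶ H ⋙ shiftFunctor D c where
  app K := ShiftedHom.comp (α.app K) (β.app K) h
  naturality K L f := by
    unfold ShiftedHom.comp
    refine (square_comp (α.naturality f) _).trans ?_
    refine Eq.trans (congrArg (_ ≫ ·) ?_) (Category.assoc _ _ _).symm
    refine (square_comp (map_square (shiftFunctor D a) (β.naturality f)) _).trans ?_
    refine Eq.trans (congrArg (_ ≫ ·) ?_) (Category.assoc _ _ _).symm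
    exact (shiftFunctorAdd' D b a c h).inv.naturality (H.map f)

/-- Homogeneous natural transformations between endofunctors of a category with internal degrees: a
transformation of degree `d` consists of natural morphisms `F K → (G K)⟨d⟩`. -/
structure HNat (F G : D ⥤ D) where
  deg : IntDeg
  nat : F ⟶ G ⋙ shiftFunctor D deg

namespace HNat

variable {F G H E : D ⥤ D}

/-- A natural transformation, in degree `0`. -/
noncomputable def ofNat (τ : F ⟶ G) : HNat F G where
  deg := 0
  nat := { app := fun K => ShiftedHom.mk₀ 0 rfl (τ.app K)
           naturality := fun K L f => by
             unfold ShiftedHom.mk₀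
             refine (square_comp (τ.naturality f) _).trans ?_
             refine Eq.trans (congrArg (_ ≫ ·) ?_) (Category.assoc _ _ _).symm
             exact (shiftFunctorZero' D 0 rfl).inv.naturality (G.map f) }

/-- Composition, which adds the degrees. -/
noncomputable def comp (α : HNat F G) (β : HNat G H) : HNat F H :=
  ⟨β.deg + α.deg, natComp α.nat β.nat rfl⟩

lemma mk_natComp {a b c c' : IntDeg} (α : F ⟶ G ⋙ shiftFunctor D a) (β : G ⟶ H ⋙ shiftFunctor D b)
    (h : b + a = c) (h' : b + a = c') :
    (⟨c, natComp α β h⟩ : HNat F H) = ⟨c', natComp α β h'⟩ := by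
  subst h; subst h'; rfl

lemma id_comp (α : HNat F G) : (ofNat (𝟙 F)).comp α = α :=
  (mk_natComp _ _ rfl (add_zero _)).trans <| congrArg (mk α.deg) <|
    NatTrans.ext <| funext fun _ => ShiftedHom.mk₀_id_comp 0 rfl _

lemma comp_id (α : HNat F G) : α.comp (ofNat (𝟙 G)) = α :=
  (mk_natComp _ _ rfl (zero_add _)).trans <| congrArg (mk α.deg) <|
    NatTrans.ext <| funext fun _ => ShiftedHom.comp_mk₀_id _ 0 rfl

lemma assoc (α : HNat F G) (β : HNat G H) (γ : HNat H E) :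
    (α.comp β).comp γ = α.comp (β.comp γ) :=
  (congrArg (mk (γ.deg + (β.deg + α.deg))) <| NatTrans.ext <| funext fun K =>
    ShiftedHom.comp_assoc (α.nat.app K) (β.nat.app K) (γ.nat.app K) rfl rfl
      (add_assoc _ _ _)).trans (mk_natComp α.nat (β.comp γ).nat (add_assoc _ _ _) rfl)

lemma ofNat_comp (σ : F ⟶ G) (τ : G ⟶ H) : (ofNat σ).comp (ofNat τ) = ofNat (σ ≫ τ) :=
  (mk_natComp _ _ rfl (add_zero _)).trans <| congrArg (mk 0) <|
    NatTrans.ext <| funext fun _ => ShiftedHom.mk₀_comp_mk₀ _ _ (add_zero 0) rfl rfl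

/-- `G` applied to `α : F → F'`, where `G` commutes with the internal shift. -/
noncomputable def whiskerRight {F' : D ⥤ D} (α : HNat F F') (G : D ⥤ D) [G.CommShift IntDeg] :
    HNat (F ⋙ G) (F' ⋙ G) :=
  ⟨α.deg, Functor.whiskerRight α.nat G ≫
    Functor.whiskerLeft F' (G.commShiftIso α.deg).hom⟩

/-- `β : G → G'` at the values of `F`. -/
def whiskerLeft (F : D ⥤ D) {G' : D ⥤ D} (β : HNat G G') : HNat (F ⋙ G) (F ⋙ G') :=
  ⟨β.deg, Functor.whiskerLeft F β.nat⟩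

/-- Horizontal composition. -/
noncomputable def hcomp {F' G' : D ⥤ D} (α : HNat F F') (β : HNat G G') [G.CommShift IntDeg] :
    HNat (F ⋙ G) (F' ⋙ G') :=
  (α.whiskerRight G).comp (whiskerLeft F' β)

/-- Equality up to an overall sign. -/
def EqUpToSign [Preadditive D] (α β : HNat F G) : Prop :=
  α = β ∨ α = ⟨β.deg, -β.nat⟩

end HNat

variable (D) in
/-- The endofunctors of a category with internal degrees which commute with the internal shift. -/
structure GrEnd where
  /-- The underlying functor. -/
  functor : D ⥤ D
  /-- Its compatibility with the internal shift. -/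
  comm : functor.CommShift IntDeg

noncomputable instance (F : GrEnd D) : F.functor.CommShift IntDeg := F.comm

/-- Endofunctors which commute with the internal shift and homogeneous natural transformations
form a category. -/
noncomputable instance : Category (GrEnd D) where
  Hom F G := HNat F.functor G.functor
  id F := HNat.ofNat (𝟙 F.functor)
  comp := HNat.comp
  id_comp := HNat.id_comp
  comp_id := HNat.comp_id
  assoc := HNat.assoc

/-- The identity endofunctor. -/
noncomputable def GrEnd.one : GrEnd D := ⟨𝟭 D, inferInstance⟩

/-- The composite endofunctor, applying `F` first. -/
noncomputable def GrEnd.comp (F G : GrEnd D) : GrEnd D := ⟨F.functor ⋙ G.functor, inferInstance⟩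

/-- Horizontal composition of homogeneous natural transformations. -/
noncomputable def GrEnd.hcomp {F F' G G' : GrEnd D} (α : F ⟶ F') (β : G ⟶ G') :
    F.comp G ⟶ F'.comp G' :=
  HNat.hcomp (F := F.functor) (G := G.functor) (F' := F'.functor) (G' := G'.functor) α β

/-- Isomorphic endofunctors are isomorphic by an isomorphism of degree `0`. -/
noncomputable def GrEnd.isoOf {F G : GrEnd D} (φ : F.functor ≅ G.functor) : F ≅ G where
  hom := HNat.ofNat φ.hom
  inv := HNat.ofNat φ.inv
  hom_inv_id := (HNat.ofNat_comp _ _).trans (congrArg HNat.ofNat φ.hom_inv_id)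
  inv_hom_id := (HNat.ofNat_comp _ _).trans (congrArg HNat.ofNat φ.inv_hom_id)

end Endofunctors

/-! ### The functors `R_i`, `R_i'` and the four basic transformations -/

section Functors

open CochainComplex hiding shiftFunctor shiftFunctorZero' shiftFunctorAdd'
open CochainComplex.HomComplex

section Cocone

variable {C : Type u} [Category.{v} C] [Preadditive C] [HasBinaryBiproducts C]

lemma cocone_fst_f {K L : CochainComplex C ℤ} (f : K ⟶ L) (p : ℤ) :
    (mappingCocone.fst f).f p = (mappingCone.fst f).1.v (p + -1) p (by lia) := by
  rw [mappingCocone.fst, HomologicalComplex.neg_f_apply, Cocycle.homOf_f]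
  refine (congrArg Neg.neg ((mappingCone.fst f).1.leftShift_v (-1) 0 (add_neg_cancel 1) p p
    (add_zero p) (p + -1) (by lia))).trans ?_
  rw [show (-1 * 0 + -1 * (-1 - 1) / 2 : ℤ).negOnePow = -1 from by decide, Units.neg_smul, one_smul,
    neg_neg]
  exact Category.id_comp _

lemma cocone_lift_f {M K L : CochainComplex C ℤ} (f : K ⟶ L) (a : M ⟶ K)
    (h : δ (-1) 0 (0 : Cochain M L (-1)) + Cochain.ofHom (a ≫ f) = 0) (p : ℤ) :
    (mappingCocone.lift f a 0 h).f p = a.f p ≫ (mappingCone.inl f).v p (p + -1) rfl := by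
  have h₁ := congrArg (fun z => z.v p p (add_zero p)) (mappingCocone.ofHom_lift f a 0 h)
  have h₂ := (mappingCone.liftCochain f (Cochain.ofHom a) (0 : Cochain M L (-1))
    (neg_add_cancel 1)).rightShift_v (-1) 0 (zero_add (-1)) p p (add_zero p) (p + -1) rfl
  refine (Cochain.ofHom_v _ p).symm.trans (h₁.trans (h₂.trans ((Category.comp_id _).trans ?_)))
  rw [mappingCone.liftCochain, Cochain.zero_comp, add_zero, Cochain.zero_cochain_comp_v,
    Cochain.ofHom_v]

lemma fst_map {K₁ L₁ K₂ L₂ : CochainComplex C ℤ} {φ₁ : K₁ ⟶ L₁} {φ₂ : K₂ ⟶ L₂}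
    {a : K₁ ⟶ K₂} {b : L₁ ⟶ L₂} (h : φ₁ ≫ b = a ≫ φ₂) (p q : ℤ) (hpq : p + 1 = q) :
    (mappingCone.map φ₁ φ₂ a b h).f p ≫ (mappingCone.fst φ₂).1.v p q hpq =
      (mappingCone.fst φ₁).1.v p q hpq ≫ a.f q := by
  rw [mappingCone.ext_from_iff _ _ _ hpq]
  simp [mappingCone.map]

end Cocone

/-- The category `C(A_n)`: bounded complexes of graded left `A_n`-modules up to homotopy. -/
abbrev 𝒞 (n : ℕ) : Type (u + 1) := Kb (GrMod.{u} n)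

/-- Tensor product with the complex `R_i = (P_i ⊗ _iP → A_n)`, with `A_n` in degree `0`: the tensor
product with the two term complex is the cone of `β_i ⊗ K : (P_i ⊗ _iP) ⊗ K → K`. -/
noncomputable def tensR (i : Fin n) :
    CochainComplex (GrMod.{u} n) ℤ ⥤ CochainComplex (GrMod.{u} n) ℤ :=
  coneF (extTo (beta i))

/-- Tensor product with the complex `R_i' = (A_n → P_i ⊗ _iP {-2})`, with `A_n` in degree `0`, as the
desuspended cone of `γ_i ⊗ K : K → (P_i ⊗ _iP {-2}) ⊗ K`. -/
noncomputable def tensR' (i : Fin n) :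
    CochainComplex (GrMod.{u} n) ℤ ⥤ CochainComplex (GrMod.{u} n) ℤ :=
  coneF (extFrom (gamma i)) ⋙ shiftFunctor _ (-1 : ℤ)

instance (i : Fin n) : Descends (tensR.{u} i) :=
  inferInstanceAs (Descends (coneF (extTo (beta i))))

instance (i : Fin n) : Descends (tensR'.{u} i) :=
  inferInstanceAs (Descends (coneF (extFrom (gamma i)) ⋙ shiftFunctor _ (-1 : ℤ)))

noncomputable instance (i : Fin n) : (tensR.{u} i).CommShift IntDeg :=
  inferInstanceAs ((coneF (extTo (beta i))).CommShift IntDeg)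

noncomputable instance (i : Fin n) : (tensR'.{u} i).CommShift IntDeg :=
  inferInstanceAs ((coneF (extFrom (gamma i)) ⋙ shiftFunctor _ (-1 : ℤ)).CommShift IntDeg)

/-- Multiplication by `X_{i-1} - X_{i+1}` on complexes. -/
noncomputable def cdelta (i : Fin n) :
    𝟭 _ ⟶ shiftFunctor (CochainComplex (GrMod.{u} n) ℤ) (intDeg 2) where
  app K :=
    { f := fun p => (delta i).app (K.X p)
      comm' := fun p q _ => ((delta i).naturality (K.d p q)).symm }
  naturality _ _ f := HomologicalComplex.hom_ext _ _ fun p => (delta i).naturality (f.f p)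

lemma cbeta_cdelta (i : Fin n) (K : CochainComplex (GrMod.{u} n) ℤ) :
    (extTo (beta i)).app K ≫ (cdelta i).app K = 0 :=
  HomologicalComplex.hom_ext _ _ fun p => beta_delta i (K.X p)

lemma cdelta_cgamma (i : Fin n) (K : CochainComplex (GrMod.{u} n) ℤ) :
    (cdelta i).app K ≫ (extFrom (gamma i)).app (K⟦intDeg 2⟧) = 0 :=
  HomologicalComplex.hom_ext _ _ fun p => delta_gamma i (K.X p)

/-- `w_1 : A_n → R_i` on complexes, the identity on `A_n`. -/
noncomputable def cw₁ (i : Fin n) : 𝟭 _ ⟶ tensR.{u} i where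
  app K := mappingCone.inr ((extTo (beta i)).app K)
  naturality K L f := by
    refine HomologicalComplex.hom_ext _ _ fun p => ?_
    exact (inr_map ((extTo (beta i)).naturality f).symm p).symm

/-- `w_2 : R_i' → A_n` on complexes, the identity on `A_n`. -/
noncomputable def cw₂ (i : Fin n) : tensR'.{u} i ⟶ 𝟭 _ where
  app K := mappingCocone.fst ((extFrom (gamma i)).app K)
  naturality K L f := by
    refine HomologicalComplex.hom_ext _ _ fun p => ?_
    refine (congrArg (_ ≫ ·) (cocone_fst_f _ p)).trans ?_
    refine Eq.trans ?_ (congrArg (· ≫ _) (cocone_fst_f _ p).symm)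
    exact fst_map ((extFrom (gamma i)).naturality f).symm (p + -1) p (by lia)

/-- `w_3 : R_i → A_n` on complexes, of degree `2`, given by `δ_i` on `A_n`. -/
noncomputable def cw₃ (i : Fin n) :
    tensR.{u} i ⟶ 𝟭 _ ⋙ shiftFunctor (CochainComplex (GrMod.{u} n) ℤ) (intDeg 2) where
  app K := mappingCone.desc ((extTo (beta i)).app K) 0 ((cdelta i).app K)
    (by rw [δ_zero, cbeta_cdelta, Cochain.ofHom_zero])
  naturality K L f := by
    refine cone_hom_ext _ (fun p q h => ?_) (fun p => ?_)
    · refine (inl_map_comp ((extTo (beta i)).naturality f).symm p q h _).trans ?_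
      refine (congrArg (_ ≫ ·) (mappingCone.inl_v_desc_f _ _ _ _ q p h)).trans ?_
      refine Eq.trans ?_ (Category.assoc _ _ _)
      refine Eq.trans ?_ (congrArg (· ≫ _) (mappingCone.inl_v_desc_f _ _ _ _ q p h).symm)
      rw [Cochain.zero_v, Cochain.zero_v, comp_zero, zero_comp]
    · refine (inr_map_comp ((extTo (beta i)).naturality f).symm p _).trans ?_
      refine (congrArg (_ ≫ ·) (mappingCone.inr_f_desc_f _ _ _ _ p)).trans ?_
      refine Eq.trans ?_ (Category.assoc _ _ _)
      refine Eq.trans ?_ (congrArg (· ≫ _) (mappingCone.inr_f_desc_f _ _ _ _ p).symm)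
      exact (delta i).naturality (f.f p)

/-- `w_4 : A_n → R_i'` on complexes, of degree `2`, given by `δ_i` on `A_n`. -/
noncomputable def cw₄ (i : Fin n) :
    𝟭 _ ⟶ tensR'.{u} i ⋙ shiftFunctor (CochainComplex (GrMod.{u} n) ℤ) (intDeg 2) where
  app K := mappingCocone.lift ((extFrom (gamma i)).app (K⟦intDeg 2⟧)) ((cdelta i).app K) 0
    (by rw [δ_zero, zero_add, cdelta_cgamma, Cochain.ofHom_zero]) ≫
      ((tensR'.{u} i).commShiftIso (intDeg 2)).hom.app K
  naturality K L f := by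
    refine Eq.trans ?_ ((congrArg (_ ≫ ·)
      (((tensR'.{u} i).commShiftIso (intDeg 2)).hom.naturality f)).trans
        (Category.assoc _ _ _).symm)
    refine Eq.trans ?_ (Category.assoc _ _ _)
    refine (Category.assoc _ _ _).symm.trans (congrArg (· ≫ _) ?_)
    refine HomologicalComplex.hom_ext _ _ fun p => ?_
    refine (congrArg (f.f p ≫ ·) (cocone_lift_f _ _ _ p)).trans ?_
    refine (square_comp ((delta i).naturality (f.f p)) _).trans ?_
    refine Eq.trans ?_ (congrArg (· ≫ _) (cocone_lift_f _ _ _ p).symm)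
    refine Eq.trans (congrArg (_ ≫ ·) ?_) (Category.assoc _ _ _).symm
    exact (inl_map ((extFrom (gamma i)).naturality (f⟦intDeg 2⟧')).symm (p + -1) p rfl).symm

/-- The endofunctors `R_i` and `R_i'` of `C(A_n)`. -/
noncomputable def R (i : Fin n) : GrEnd (𝒞.{u} n) := ⟨onKb (tensR i), inferInstance⟩

/-- The endofunctor `R_i'` of `C(A_n)`. -/
noncomputable def R' (i : Fin n) : GrEnd (𝒞.{u} n) := ⟨onKb (tensR' i), inferInstance⟩

/-- The transformation `w_1 : Id → R_i`, of degree `0`. -/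
noncomputable def w₁ (i : Fin n) : GrEnd.one ⟶ R.{u} i :=
  HNat.ofNat ((idKb (GrMod.{u} n)).inv ≫ natKb (cw₁ i))

/-- The transformation `w_2 : R_i' → Id`, of degree `0`. -/
noncomputable def w₂ (i : Fin n) : R'.{u} i ⟶ GrEnd.one :=
  HNat.ofNat (natKb (cw₂ i) ≫ (idKb (GrMod.{u} n)).hom)

/-- The transformation `w_3 : R_i → Id`, of degree `2`. -/
noncomputable def w₃ (i : Fin n) : R.{u} i ⟶ GrEnd.one :=
  ⟨intDeg 2, natKbSh (intDeg 2) (cw₃ i) ≫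
    Functor.whiskerRight (idKb (GrMod.{u} n)).hom (shiftFunctor (𝒞.{u} n) (intDeg 2))⟩

/-- The transformation `w_4 : Id → R_i'`, of degree `2`. -/
noncomputable def w₄ (i : Fin n) : GrEnd.one ⟶ R'.{u} i :=
  ⟨intDeg 2, (idKb (GrMod.{u} n)).inv ≫ natKbSh (intDeg 2) (cw₄ i)⟩

end Functors

end BraidCob

namespace BraidCob

variable {n : ℕ}
universe u v
open Limits

/-! ### Braid words and braid movies -/

/-- The letters `σ_i` (for `(i, true)`) and `σ_i⁻¹` (for `(i, false)`); the braids have `n + 1`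
strands. -/
abbrev Letter (n : ℕ) : Type := Fin n × Bool

/-- Braid words: arbitrary finite sequences of letters, not reduced in any way. -/
abbrev Word (n : ℕ) : Type := List (Letter n)

/-- The generators `σ_i` and `σ_j` commute: `|i - j| > 1`. -/
def Far (i j : Fin n) : Prop := i.val + 1 < j.val ∨ j.val + 1 < i.val

lemma Far.symm {i j : Fin n} (h : Far i j) : Far j i := Or.symm h

/-- The signs `a, b, c` for which `σ_i^a σ_j^b σ_i^c = σ_j^c σ_i^b σ_j^a` is a braid relation. -/
def Mixed (a b c : Bool) : Prop := b = a ∨ b = c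

lemma Mixed.symm {a b c : Bool} (h : Mixed a b c) : Mixed c b a := Or.symm h

/-- The elementary moves between subwords. The first four are the Reidemeister moves of braid words,
in all their versions; the last two insert or remove a single letter. -/
inductive Move : Word n → Word n → Type
  | create (i : Fin n) {a b : Bool} (h : a ≠ b) : Move [] [(i, a), (i, b)]
  | cancel (i : Fin n) {a b : Bool} (h : a ≠ b) : Move [(i, a), (i, b)] []
  | far {i j : Fin n} (h : Far i j) (a b : Bool) : Move [(i, a), (j, b)] [(j, b), (i, a)]
  | braid {i j : Fin n} (h : Adj i j) {a b c : Bool} (hs : Mixed a b c) :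
      Move [(i, a), (j, b), (i, c)] [(j, c), (i, b), (j, a)]
  | birth (i : Fin n) (a : Bool) : Move [] [(i, a)]
  | death (i : Fin n) (a : Bool) : Move [(i, a)] []

/-- The move read backwards. -/
def Move.inv : ∀ {x y : Word n}, Move x y → Move y x
  | _, _, .create i h => .cancel i h
  | _, _, .cancel i h => .create i h
  | _, _, .far h a b => .far h.symm b a
  | _, _, .braid h hs => .braid h.symm hs.symm
  | _, _, .birth i a => .death i a
  | _, _, .death i a => .birth i a

/-- The number of negative branch points of a move: the moves `∅ → σ_i⁻¹` and `σ_i → ∅` have one. -/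
def Move.neg : ∀ {x y : Word n}, Move x y → ℕ
  | _, _, .birth _ a => if a then 0 else 1
  | _, _, .death _ a => if a then 1 else 0
  | _, _, _ => 0

/-- A step `τ₁ x τ₂ → τ₁ y τ₂` of a movie. -/
structure Step (u v : Word n) where
  /-- the part of the word before the move -/
  pre : Word n
  /-- the part of the word after the move -/
  post : Word n
  /-- the subword which is replaced -/
  old : Word n
  /-- the subword by which it is replaced -/
  new : Word n
  move : Move old new
  src : u = pre ++ old ++ post
  tgt : v = pre ++ new ++ post

namespace Step

variable {u v : Word n}

/-- The step read backwards. -/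
def inv (s : Step u v) : Step v u := ⟨s.pre, s.post, s.new, s.old, s.move.inv, s.tgt, s.src⟩

/-- The same step with `g` to the left of all words. -/
def left (g : Word n) (s : Step u v) : Step (g ++ u) (g ++ v) :=
  ⟨g ++ s.pre, s.post, s.old, s.new, s.move, (congrArg (g ++ ·) s.src).trans (by simp only [List.append_assoc]),
    (congrArg (g ++ ·) s.tgt).trans (by simp only [List.append_assoc])⟩

/-- The same step with `g` to the right of all words. -/
def right (s : Step u v) (g : Word n) : Step (u ++ g) (v ++ g) :=
  ⟨s.pre, s.post ++ g, s.old, s.new, s.move, (congrArg (· ++ g) s.src).trans (by simp only [List.append_assoc]),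
    (congrArg (· ++ g) s.tgt).trans (by simp only [List.append_assoc])⟩

end Step

/-- Braid movies: finite sequences of steps. -/
inductive Movie : Word n → Word n → Type
  | nil {u : Word n} : Movie u u
  | cons {u v w : Word n} (s : Step u v) (S : Movie v w) : Movie u w

namespace Movie

/-- The movie `S` followed by the movie `T`. -/
def comp : ∀ {u v w : Word n}, Movie u v → Movie v w → Movie u w
  | _, _, _, nil, T => T
  | _, _, _, cons s S, T => cons s (comp S T)

/-- The movie with the single step `pre x post → pre y post`. -/
def one (pre : Word n) {x y : Word n} (m : Move x y) (post : Word n) :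
    Movie (pre ++ x ++ post) (pre ++ y ++ post) :=
  cons ⟨pre, post, x, y, m, rfl, rfl⟩ nil

/-- The movie with the single step `s`. -/
def single {u v : Word n} (s : Step u v) : Movie u v := cons s nil

/-- The movie run backwards. -/
def inv : ∀ {u v : Word n}, Movie u v → Movie v u
  | _, _, nil => nil
  | _, _, cons s S => comp (inv S) (single s.inv)

/-- The same movie with `g` to the left of all words. -/
def left (g : Word n) : ∀ {u v : Word n}, Movie u v → Movie (g ++ u) (g ++ v)
  | _, _, nil => nil
  | _, _, cons s S => cons (s.left g) (left g S)

/-- The same movie with `g` to the right of all words. -/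
def right : ∀ {u v : Word n}, Movie u v → (g : Word n) → Movie (u ++ g) (v ++ g)
  | _, _, nil, _ => nil
  | _, _, cons s S, g => cons (s.right g) (right S g)

/-- The number `p_-(S)` of negative branch points. -/
def neg : ∀ {u v : Word n}, Movie u v → ℕ
  | _, _, nil => 0
  | _, _, cons s S => s.move.neg + neg S

lemma comp_nil : ∀ {u v : Word n} (S : Movie u v), S.comp nil = S
  | _, _, nil => rfl
  | _, _, cons s S => congrArg (cons s) (comp_nil S)

lemma comp_assoc : ∀ {u v w z : Word n} (S : Movie u v) (T : Movie v w) (U : Movie w z),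
    (S.comp T).comp U = S.comp (T.comp U)
  | _, _, _, _, nil, _, _ => rfl
  | _, _, _, _, cons s S, T, U => congrArg (cons s) (comp_assoc S T U)

end Movie

/-- `S` followed by `T`. -/
local infixr:60 " ⬝ " => Movie.comp

open Move Movie in
/-- The braid movie moves, in the versions from which all other versions follow by reading movies
backwards. Here `a, b, c, …` are the signs of the letters. -/
inductive MovieMove : ∀ {u v : Word n}, Movie u v → Movie u v → Prop
  /-- Creating a pair `σ σ⁻¹` and cancelling it again. -/
  | create_cancel (i : Fin n) {a a' : Bool} (h : a ≠ a') :
      MovieMove (one [] (create i h) [] ⬝ one [] (cancel i h) []) nil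
  /-- Cancelling a pair `σ σ⁻¹` and creating it again. -/
  | cancel_create (i : Fin n) {a a' : Bool} (h : a ≠ a') :
      MovieMove (one [] (cancel i h) [] ⬝ one [] (create i h) []) nil
  /-- Exchanging two distant letters twice. -/
  | far_far {i j : Fin n} (h : Far i j) (a b : Bool) :
      MovieMove (one [] (far h a b) [] ⬝ one [] (far h.symm b a) []) nil
  /-- A braid relation followed by its inverse. -/
  | braid_braid {i j : Fin n} (h : Adj i j) {a b c : Bool} (hs : Mixed a b c) :
      MovieMove (one [] (braid h hs) [] ⬝ one [] (braid h.symm hs.symm) []) nil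
  /-- `σ → σ σ⁻¹ σ → σ`, creating a pair on the right and cancelling the pair on the left. -/
  | zigzag (i : Fin n) {a a' : Bool} (h : a ≠ a') :
      MovieMove (u := [(i, a)])
        (one [(i, a)] (create i h.symm) [] ⬝ one [] (cancel i h) [(i, a)]) nil
  /-- The two ways to reverse the order of three distant letters. -/
  | far_far_far {i j k : Fin n} (hij : Far i j) (hik : Far i k) (hjk : Far j k) (a b c : Bool) :
      MovieMove (u := [(i, a), (j, b), (k, c)])
        (one [] (far hij a b) [(k, c)] ⬝ one [(j, b)] (far hik a c) [] ⬝
          one [] (far hjk b c) [(i, a)])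
        (one [(i, a)] (far hjk b c) [] ⬝ one [] (far hik a c) [(j, b)] ⬝
          one [(k, c)] (far hij a b) [])
  /-- A letter moved past a newly created distant pair. -/
  | far_pair {i j : Fin n} (hji : Far j i) {a a' : Bool} (h : a ≠ a') (b : Bool) :
      MovieMove (u := [(j, b)])
        (one [(j, b)] (create i h) [] ⬝ one [] (far hji b a) [(i, a')] ⬝
          one [(i, a)] (far hji b a') [])
        (one [] (create i h) [(j, b)])
  /-- A distant letter moved past a braid relation. -/
  | far_braid {i j k : Fin n} (hij : Adj i j) (hki : Far k i) (hkj : Far k j) {a b c : Bool}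
      (hs : Mixed a b c) (d : Bool) :
      MovieMove (u := [(k, d), (i, a), (j, b), (i, c)])
        (one [] (far hki d a) [(j, b), (i, c)] ⬝ one [(i, a)] (far hkj d b) [(i, c)] ⬝
          one [(i, a), (j, b)] (far hki d c) [] ⬝ one [] (braid hij hs) [(k, d)])
        (one [(k, d)] (braid hij hs) [] ⬝ one [] (far hkj d c) [(i, b), (j, a)] ⬝
          one [(j, c)] (far hki d b) [(j, a)] ⬝ one [(j, c), (i, b)] (far hkj d a) [])
  /-- A newly created pair moved past two letters from the right to the left. -/
  | braid_pair_right {i j : Fin n} (hij : Adj i j) {a b c c' : Bool} (h : c ≠ c')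
      (hs : Mixed a b c) (hs' : Mixed c' a b) :
      MovieMove (u := [(i, a), (j, b)])
        (one [(i, a), (j, b)] (create i h) [] ⬝ one [] (braid hij hs) [(i, c')])
        (one [] (create j h) [(i, a), (j, b)] ⬝ one [(j, c)] (braid hij.symm hs') [])
  /-- A newly created pair moved past two letters from the left to the right. -/
  | braid_pair_left {i j : Fin n} (hij : Adj i j) {a a' b c : Bool} (h : a' ≠ a)
      (hs : Mixed a b c) (hs' : Mixed b c a') :
      MovieMove (u := [(j, b), (i, c)])
        (one [] (create i h) [(j, b), (i, c)] ⬝ one [(i, a')] (braid hij hs) [])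
        (one [(j, b), (i, c)] (create j h) [] ⬝ one [] (braid hij.symm hs') [(j, a)])
  /-- The two ways to apply braid relations in the half twist of four strands. -/
  | tetra {p q r : Fin n} (hpq : Adj p q) (hqr : Adj q r) (hpr : Far p r) {a b c d e f : Bool}
      (h₁ : Mixed a b d) (h₂ : Mixed a c e) (h₃ : Mixed b c f) (h₄ : Mixed d e f) :
      MovieMove (u := [(p, a), (q, b), (p, d), (r, c), (q, e), (p, f)])
        (v := [(r, f), (q, e), (r, d), (p, c), (q, b), (r, a)])
        (one [] (braid hpq h₁) [(r, c), (q, e), (p, f)] ⬝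
          one [(q, d), (p, b)] (braid hqr h₂) [(p, f)] ⬝
          one [(q, d)] (far hpr b e) [(q, c), (r, a), (p, f)] ⬝
          one [(q, d), (r, e), (p, b), (q, c)] (far hpr.symm a f) [] ⬝
          one [(q, d), (r, e)] (braid hpq h₃) [(r, a)] ⬝
          one [] (braid hqr h₄) [(p, c), (q, b), (r, a)])
        (one [(p, a), (q, b)] (far hpr d c) [(q, e), (p, f)] ⬝
          one [(p, a), (q, b), (r, c)] (braid hpq h₄) [] ⬝
          one [(p, a)] (braid hqr h₃) [(p, e), (q, d)] ⬝
          one [] (far hpr a f) [(q, c), (r, b), (p, e), (q, d)] ⬝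
          one [(r, f), (p, a), (q, c)] (far hpr.symm b e) [(q, d)] ⬝
          one [(r, f)] (braid hpq h₂) [(r, b), (q, d)] ⬝
          one [(r, f), (q, e), (p, c)] (braid hqr h₁) [] ⬝
          one [(r, f), (q, e)] (far hpr c d) [(q, b), (r, a)])
  /-- A newly inserted letter moved past a distant letter. -/
  | birth_far {i j : Fin n} (hij : Far i j) (a b : Bool) :
      MovieMove (u := [(j, b)])
        (one [] (birth i a) [(j, b)] ⬝ one [] (far hij a b) [])
        (one [(j, b)] (birth i a) [])
  /-- Creating `σ σ⁻¹` and removing the second letter, or inserting `σ`. -/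
  | create_death_right (i : Fin n) {a a' : Bool} (h : a ≠ a') :
      MovieMove (one [] (create i h) [] ⬝ one [(i, a)] (death i a') []) (one [] (birth i a) [])
  /-- Creating `σ⁻¹ σ` and removing the first letter, or inserting `σ`. -/
  | create_death_left (i : Fin n) {a a' : Bool} (h : a ≠ a') :
      MovieMove (one [] (create i h) [] ⬝ one [] (death i a) [(i, a')]) (one [] (birth i a') [])
  /-- A newly inserted letter moved past two letters. -/
  | birth_braid {i j : Fin n} (hij : Adj i j) (a c : Bool) :
      MovieMove (u := [(i, a), (j, a)])
        (one [(i, a), (j, a)] (birth i c) [] ⬝ one [] (braid hij (Or.inl rfl : Mixed a a c)) [])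
        (one [] (birth j c) [(i, a), (j, a)])
  /-- A letter inserted in the middle of a pair `σ σ⁻¹`, followed by a braid relation. -/
  | create_birth_braid {i j : Fin n} (hij : Adj i j) {a a' b : Bool} (h : a ≠ a')
      (hs : Mixed a b a') :
      MovieMove (one [] (create i h) [] ⬝ one [(i, a)] (birth j b) [(i, a')] ⬝
          one [] (braid hij hs) [])
        (one [] (create j h.symm) [] ⬝ one [(j, a')] (birth i b) [(j, a)])
  /-- Locality: steps in disjoint parts of the words commute. -/
  | locality {u u' v v' : Word n} (s : Step u u') (t : Step v v') :
      MovieMove (single (s.right v) ⬝ single (t.left u')) (single (t.left u) ⬝ single (s.right v'))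

/-- Equality of braid movies up to braid movie moves, applied anywhere in a movie and in any part of
the words. -/
inductive MovieEq : ∀ {u v : Word n}, Movie u v → Movie u v → Prop
  | of_move {u v : Word n} {S T : Movie u v} : MovieMove S T → MovieEq S T
  | of_inv {u v : Word n} {S T : Movie u v} : MovieMove S T → MovieEq S.inv T.inv
  | refl {u v : Word n} (S : Movie u v) : MovieEq S S
  | symm {u v : Word n} {S T : Movie u v} : MovieEq S T → MovieEq T S
  | trans {u v : Word n} {S T U : Movie u v} : MovieEq S T → MovieEq T U → MovieEq S U
  | comp {u v w : Word n} {S S' : Movie u v} {T T' : Movie v w} :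
      MovieEq S S' → MovieEq T T' → MovieEq (S ⬝ T) (S' ⬝ T')
  | left (g : Word n) {u v : Word n} {S T : Movie u v} :
      MovieEq S T → MovieEq (S.left g) (T.left g)
  | right {u v : Word n} {S T : Movie u v} (g : Word n) :
      MovieEq S T → MovieEq (S.right g) (T.right g)

/-- The category of combinatorial braid cobordisms with `n + 1` strands. Its objects are braid
words. -/
structure BC (n : ℕ) where
  /-- The braid word. -/
  word : Word n

/-- Braid movies from `u` to `v` modulo braid movie moves. -/
def Cobordism (u v : Word n) : Type := Quot (@MovieEq n u v)

/-- The cobordism of a movie. -/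
def Movie.cob {u v : Word n} (S : Movie u v) : Cobordism u v := Quot.mk _ S

namespace Cobordism

/-- Composition of cobordisms. -/
def comp {u v w : Word n} (S : Cobordism u v) (T : Cobordism v w) : Cobordism u w :=
  Quot.map₂ Movie.comp (fun S _ _ h => MovieEq.comp (MovieEq.refl S) h)
    (fun _ _ T h => MovieEq.comp h (MovieEq.refl T)) S T

/-- The cobordism `S₂ ∘ S₁ : g₂ g₁ → h₂ h₁` obtained by placing `S₂ : g₂ → h₂` to the left of
`S₁ : g₁ → h₁`. -/
def tensor {g₂ h₂ g₁ h₁ : Word n} (S₂ : Cobordism g₂ h₂) (S₁ : Cobordism g₁ h₁) :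
    Cobordism (g₂ ++ g₁) (h₂ ++ h₁) :=
  Quot.map₂ (fun S₂ S₁ => (Movie.right S₂ g₁).comp (Movie.left h₂ S₁))
    (fun S _ _ h => MovieEq.comp (MovieEq.refl (S.right g₁)) (MovieEq.left h₂ h))
    (fun _ _ T h => MovieEq.comp (MovieEq.right g₁ h) (MovieEq.refl (T.left h₂))) S₂ S₁

end Cobordism

/-- Morphisms of the category of combinatorial braid cobordisms. -/
instance : Category (BC n) where
  Hom g h := Cobordism g.word h.word
  id g := (Movie.nil : Movie g.word g.word).cob
  comp S T := Cobordism.comp S T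
  id_comp := by
    rintro _ _ ⟨S⟩
    rfl
  comp_id := by
    rintro _ _ ⟨S⟩
    exact congrArg Movie.cob S.comp_nil
  assoc := by
    rintro _ _ _ _ ⟨S⟩ ⟨T⟩ ⟨U⟩
    exact congrArg Movie.cob (S.comp_assoc T U)

namespace BC

/-- The product of braid words. -/
def mul (g h : BC n) : BC n := ⟨g.word ++ h.word⟩

/-- The product of cobordisms. -/
def tensor {g₂ h₂ g₁ h₁ : BC n} (S₂ : g₂ ⟶ h₂) (S₁ : g₁ ⟶ h₁) : mul g₂ g₁ ⟶ mul h₂ h₁ :=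
  Cobordism.tensor S₂ S₁

/-- The morphism given by a movie. -/
def ofMovie {g h : BC n} (S : Movie g.word h.word) : g ⟶ h := S.cob

/-- The empty word. -/
def empty (n : ℕ) : BC n := ⟨[]⟩

/-- The word `σ_i`. -/
def σ (i : Fin n) : BC n := ⟨[(i, true)]⟩

/-- The word `σ_i⁻¹`. -/
def σ' (i : Fin n) : BC n := ⟨[(i, false)]⟩

/-- The four movies with a single branch point between the empty word and a word of one letter. -/
def birth (i : Fin n) : empty n ⟶ σ i := ofMovie (Movie.one [] (Move.birth i true) [])

/-- The movie `∅ → σ_i⁻¹`. -/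
def birth' (i : Fin n) : empty n ⟶ σ' i := ofMovie (Movie.one [] (Move.birth i false) [])

/-- The movie `σ_i → ∅`. -/
def death (i : Fin n) : σ i ⟶ empty n := ofMovie (Movie.one [] (Move.death i true) [])

/-- The movie `σ_i⁻¹ → ∅`. -/
def death' (i : Fin n) : σ' i ⟶ empty n := ofMovie (Movie.one [] (Move.death i false) [])

end BC

/-! ### The functors of braid words -/

/-- The functor of a letter. -/
noncomputable def letterFun : Letter n → GrEnd (𝒞.{u} n)
  | (i, true) => R i
  | (i, false) => R' i

/-- The functor `F_g` of a braid word `g`: the tensor product, in the order of the word, with the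
complexes `R_i` for the letters `σ_i` and `R_i'` for the letters `σ_i⁻¹`. -/
noncomputable def wordFun : Word n → GrEnd (𝒞.{u} n)
  | [] => GrEnd.one
  | s :: g => (wordFun g).comp (letterFun s)

/-- `F_{gh} ≅ F_g ∘ F_h`, by associativity of composition. -/
noncomputable def wordFunMul (h : Word n) : ∀ g : Word n,
    (wordFun.{u} (g ++ h)).functor ≅ (wordFun h).functor ⋙ (wordFun g).functor
  | [] => (Functor.rightUnitor _).symm
  | s :: g => Functor.isoWhiskerRight (wordFunMul h g) (letterFun s).functor ≪≫
      Functor.associator _ _ _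

/-- `F_{gh} ≅ F_g ∘ F_h`. -/
noncomputable def mulIso (g h : BC n) :
    wordFun.{u} (g.mul h).word ≅ (wordFun h.word).comp (wordFun g.word) :=
  GrEnd.isoOf (wordFunMul h.word g.word)

/-- `F_∅` is the identity. -/
noncomputable def emptyIso (n : ℕ) : wordFun.{u} (BC.empty n).word ≅ GrEnd.one := Iso.refl _

/-- `F_{σ_i} ≅ R_i`. -/
noncomputable def σIso (i : Fin n) : wordFun.{u} (BC.σ i).word ≅ R i :=
  GrEnd.isoOf (Functor.leftUnitor (R i).functor)

/-- `F_{σ_i⁻¹} ≅ R_i'`. -/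
noncomputable def σIso' (i : Fin n) : wordFun.{u} (BC.σ' i).word ≅ R' i :=
  GrEnd.isoOf (Functor.leftUnitor (R' i).functor)

/-- A projective monoidal functor from the category of braid cobordisms to the category of
endofunctors of `C(A_n)` which sends every braid word `g` to `F_g`: homogeneous natural
transformations `F_S : F_g → F_h` for all `S : g → h`, which respect identities, composition and
products up to sign. -/
structure ProjMonoidalFunctor (n : ℕ) where
  /-- The transformations `F_S`. -/
  map : ∀ {g h : BC n}, (g ⟶ h) → (wordFun.{u} g.word ⟶ wordFun.{u} h.word)
  map_id : ∀ g : BC n, HNat.EqUpToSign (map (𝟙 g)) (𝟙 (wordFun g.word))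
  map_comp : ∀ {g h k : BC n} (S : g ⟶ h) (T : h ⟶ k),
    HNat.EqUpToSign (map (S ≫ T)) (map S ≫ map T)
  map_tensor : ∀ {g₂ h₂ g₁ h₁ : BC n} (S₂ : g₂ ⟶ h₂) (S₁ : g₁ ⟶ h₁),
    HNat.EqUpToSign (map (BC.tensor S₂ S₁) ≫ (mulIso h₂ h₁).hom)
      ((mulIso g₂ g₁).hom ≫ GrEnd.hcomp (map S₁) (map S₂))

end BraidCob

universe u

/-!
# Braid cobordisms act on complexes of modules over the zigzag ring, up to sign

Nothing is checked by computing with the complexes of long words: every movie move holds up to sign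
because both sides satisfy a condition which determines a transformation up to sign.

*Rigidity.* A natural transformation of the identity functor of complexes is the multiplication by a
central element of `A_n`: it suffices to evaluate it at the contractible complexes `A_n = A_n`, which
map to every complex (`exists_central`). The same evaluation shows that the transformations
`Id → R_i` of degree `0` are the multiples of `w₁` (`eq_zsmul_wOneT`). No multiple by a nonzero
integer is null-homotopic, by evaluation at a simple module (`eq_or_eq_neg_of_tame`). So the
transformations of degree `0` of `Id` and from `Id` to `R_i` are the multiples of one
*generator* (`Sg.Gen`), and a generator is unique up to sign.

*Invertibility.* The functors `R_i` and `R_i'` are mutually inverse up to homotopy (`PairData`,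
`PairData'`), so placing letters to the left or to the right of a word is fully faithful on
transformations (`Sg.lft_injective`, `Sg.lft_surjective` and the same for `rgt`). It follows that
placing letters preserves generators, and that an invertible transformation of degree `0` between the
functors of two words is a generator (`Sg.IsIso₀.gen`). The functors of `σ_i σ_j` and `σ_j σ_i`, for
`i`, `j` distant, and of `σ_i σ_j σ_i` and `σ_j σ_i σ_j`, for `i`, `j` adjacent, are isomorphic. For
the second pair, an explicit map `braidT` takes the product of three copies of `w₁` to the
corresponding product (`Sg.wOneT₃_braidT`), so that by rigidity its composition with the map in the
other direction is the identity up to sign. The other signs of the exponents follow by conjugation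
(`Sg.Equiv₀.rotate`). Hence there are invertible transformations for all moves of type I, and any
choice satisfies all movie moves without branch points.

*Branch points.* `w₁` and `w₂` are generators, which settles the movie moves with a positive branch
point. For the negative ones, multiplication by the central element `∑ c_k X_k` acts on every word
functor; moving it past a letter `σ_i` changes `c` by a reflection, up to sign
(`Sg.lft_mulH`). The transformations `w₃` and `w₄` are divisors of the multiplication by
`X_{i-1} - X_{i+1}`: composed with the generator in the other direction they give this
multiplication, and they are determined by this (`Sg.Divisor`). In a movie with one negative branch
point and moves of type I the root `c` is transported by reflections, and each movie move reduces to
an identity between roots (`MovieMove.mT_eq`).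

All this takes place in the category `Sg n` of word functors and homogeneous transformations between
complexes, up to homotopy and an overall sign; `exists_realizes` passes to natural transformations
on the homotopy category. Exactness is independent of the rest: the terms of `R_i K` and `R_i' K` are
sums of additive functors of the terms of `K`, with a triangular differential (`TermDecomp`), so that
`R_i` and `R_i'` preserve degreewise split short exact sequences and their connecting morphisms.
-/

set_option linter.unusedSectionVars false

namespace BraidCob

universe v
open Limits

variable {n : ℕ}

/-! ### A basis of `A_n` -/

/-- The elements `(i)`, `X_i`, `(i|j)` span `A_n`. -/
lemma A_span_induction {p : A n → Prop} (h0 : p 0) (hadd : ∀ a b, p a → p b → p (a + b))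
    (hneg : ∀ a, p a → p (-a)) (he : ∀ i, p (e i)) (hX : ∀ i, p (X i))
    (ha : ∀ i j, Adj i j → p (arr i j)) (a : A n) : p a := by
  have ha' : ∀ i j, p (arr i j) := fun i j => by
    by_cases h : Adj i j
    · exact ha i j h
    · rwa [arr_of_not h]
  let S : AddSubgroup (A n) := AddSubgroup.closure {x | (∃ i, e i = x) ∨ (∃ i, X i = x) ∨
    ∃ i j, arr i j = x}
  have hS : ∀ x ∈ S, p x := fun x hx => by
    induction hx using AddSubgroup.closure_induction with
    | mem x hx =>
      obtain ⟨i, rfl⟩ | ⟨i, rfl⟩ | ⟨i, j, rfl⟩ := hx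
      exacts [he i, hX i, ha' i j]
    | zero => exact h0
    | add x y _ _ h₁ h₂ => exact hadd _ _ h₁ h₂
    | neg x _ h => exact hneg _ h
  have eS : ∀ i, e i ∈ S := fun i => AddSubgroup.subset_closure (Or.inl ⟨i, rfl⟩)
  have XS : ∀ i, X i ∈ S := fun i => AddSubgroup.subset_closure (Or.inr (Or.inl ⟨i, rfl⟩))
  have aS : ∀ i j, arr i j ∈ S := fun i j => AddSubgroup.subset_closure (Or.inr (Or.inr ⟨i, j,
      rfl⟩))
  have key : ∀ a : A n, (∀ i, a * e i ∈ S) → (∀ i, a * X i ∈ S) → (∀ i j, a * arr i j ∈ S) →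
      ∀ b ∈ S, a * b ∈ S := fun a h₁ h₂ h₃ b hb => by
    induction hb using AddSubgroup.closure_induction with
    | mem x hx =>
      obtain ⟨i, rfl⟩ | ⟨i, rfl⟩ | ⟨i, j, rfl⟩ := hx
      exacts [h₁ i, h₂ i, h₃ i j]
    | zero => rw [mul_zero]; exact zero_mem _
    | add x y _ _ h₁ h₂ => rw [mul_add]; exact add_mem h₁ h₂
    | neg x _ h => rw [mul_neg]; exact neg_mem h
  have main : ∀ a : A n, ∀ b ∈ S, a * b ∈ S := fun a => by
    induction a using A_induction with
    | he i =>
      refine key _ (fun j => ?_) (fun j => ?_) (fun j k => ?_) <;> by_cases h : i = j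
      · subst h; rw [e_mul_e]; exact eS i
      · rw [e_mul_e_ne h]; exact zero_mem _
      · subst h; rw [e_mul_X]; exact XS i
      · rw [mul_zero_of_e (e_mul_e i) (e_mul_X j) h]; exact zero_mem _
      · subst h; rw [e_mul_arr]; exact aS i k
      · rw [mul_zero_of_e (e_mul_e i) (e_mul_arr j k) h]; exact zero_mem _
    | ha k i =>
      refine key _ (fun j => ?_) (fun j => ?_) (fun j l => ?_) <;> by_cases h : i = j
      · subst h; rw [arr_mul_e]; exact aS k i
      · rw [mul_zero_of_e (arr_mul_e k i) (e_mul_e j) h]; exact zero_mem _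
      · subst h; rw [arr_mul_X]; exact zero_mem _
      · rw [mul_zero_of_e (arr_mul_e k i) (e_mul_X j) h]; exact zero_mem _
      · subst h
        by_cases h' : k = l
        · subst h'
          by_cases h : Adj k i
          · rw [arr_mul_arr h]; exact XS k
          · rw [arr_of_not h, zero_mul]; exact zero_mem _
        · rw [arr_mul_arr_ne h']; exact zero_mem _
      · rw [mul_zero_of_e (arr_mul_e k i) (e_mul_arr j l) h]; exact zero_mem _
    | hX i =>
      refine key _ (fun j => ?_) (fun j => ?_) (fun j k => ?_) <;> by_cases h : i = j
      · subst h; rw [X_mul_e]; exact XS i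
      · rw [mul_zero_of_e (X_mul_e i) (e_mul_e j) h]; exact zero_mem _
      · subst h; rw [X_mul_X]; exact zero_mem _
      · rw [mul_zero_of_e (X_mul_e i) (e_mul_X j) h]; exact zero_mem _
      · subst h; rw [X_mul_arr]; exact zero_mem _
      · rw [mul_zero_of_e (X_mul_e i) (e_mul_arr j k) h]; exact zero_mem _
    | hz m => intro b hb; rw [← zsmul_eq_mul]; exact zsmul_mem hb m
    | hadd a b h₁ h₂ => intro c hc; rw [add_mul]; exact add_mem (h₁ c hc) (h₂ c hc)
    | hmul a b h₁ h₂ => intro c hc; rw [mul_assoc]; exact h₁ _ (h₂ c hc)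
  have h1 : (1 : A n) ∈ S := by rw [← sum_e]; exact sum_mem fun i _ => eS i
  simpa using hS _ (main a 1 h1)

/-- The action of a generator on the column module `P_i`, in the basis formed by `(i)`, the
`(j|i)` and `X_i` (with a coordinate for every `j`, for simplicity). -/
def repGen (i : Fin n) : Gen n → Module.End ℤ (ℤ × (Fin n → ℤ) × ℤ)
  | .vert v =>
    { toFun := fun x => (if v = i then x.1 else 0, Pi.single v (x.2.1 v),
        if v = i then x.2.2 else 0)
      map_add' := fun x y => by
        split_ifs <;> simp [Pi.single_add]
      map_smul' := fun c x => by
        refine Prod.ext ?_ (Prod.ext (Pi.single_smul _ _ _) ?_)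
        · change (if v = i then c * x.1 else 0) = c * (if v = i then x.1 else 0)
          rw [mul_ite, mul_zero]
        · change (if v = i then c * x.2.2 else 0) = c * (if v = i then x.2.2 else 0)
          rw [mul_ite, mul_zero] }
  | .edge a b _ =>
    { toFun := fun x => (0, if b = i then Pi.single a x.1 else 0, if a = i then x.2.1 b else 0)
      map_add' := fun x y => by split_ifs <;> simp [Pi.single_add]
      map_smul' := fun c x => by
        refine Prod.ext (mul_zero c).symm (Prod.ext ?_ ?_)
        · change (if b = i then Pi.single a (c • x.1) else 0) =
            c • (if b = i then Pi.single a x.1 else 0 : Fin n → ℤ)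
          rw [smul_ite, smul_zero, Pi.single_smul]
        · change (if a = i then c * x.2.1 b else 0) = c * (if a = i then x.2.1 b else 0)
          rw [mul_ite, mul_zero] }
  | .loop a =>
    { toFun := fun x => (0, 0, if a = i then x.1 else 0)
      map_add' := fun x y => by split_ifs <;> simp
      map_smul' := fun c x => by split_ifs <;> simp }

lemma repGen_vert (i v : Fin n) (x : ℤ × (Fin n → ℤ) × ℤ) : repGen i (.vert v) x =
    (if v = i then x.1 else 0, Pi.single v (x.2.1 v), if v = i then x.2.2 else 0) := rfl

lemma repGen_edge (i a b : Fin n) (h : Adj a b) (x : ℤ × (Fin n → ℤ) × ℤ) :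
    repGen i (.edge a b h) x =
      (0, if b = i then Pi.single a x.1 else 0, if a = i then x.2.1 b else 0) := rfl

lemma repGen_loop (i a : Fin n) (x : ℤ × (Fin n → ℤ) × ℤ) : repGen i (.loop a) x =
    (0, 0, if a = i then x.1 else 0) := rfl

/-- The column module `P_i` as a representation. -/
noncomputable def rep (i : Fin n) : A n →+* Module.End ℤ (ℤ × (Fin n → ℤ) × ℤ) :=
  RingQuot.lift ⟨(FreeAlgebra.lift ℤ (repGen i) : FreeAlgebra ℤ (Gen n) →ₐ[ℤ] _), by
    intro x y h
    refine LinearMap.ext fun v => ?_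
    induction h with
    | vert_sq a =>
      simp only [map_mul, RingHom.coe_coe, FreeAlgebra.lift_ι_apply, Module.End.mul_apply,
        repGen_vert]
      split_ifs <;> simp
    | vert_mul h =>
      simp only [map_mul, map_zero, RingHom.coe_coe, FreeAlgebra.lift_ι_apply,
        Module.End.mul_apply, repGen_vert]
      split_ifs with h₁ h₂ <;> simp [h]
      exact (h (h₁.trans h₂.symm)).elim
    | sum_vert =>
      simp only [map_sum, map_one, RingHom.coe_coe, FreeAlgebra.lift_ι_apply,
        LinearMap.sum_apply, repGen_vert]
      refine Prod.ext ?_ (Prod.ext ?_ ?_)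
      · simp [Prod.fst_sum]
      · simpa [Prod.fst_sum, Prod.snd_sum] using Finset.univ_sum_single v.2.1
      · simp [Prod.snd_sum]
    | vert_edge a b h =>
      simp only [map_mul, RingHom.coe_coe, FreeAlgebra.lift_ι_apply, Module.End.mul_apply,
        repGen_vert, repGen_edge]
      split_ifs <;> simp
    | edge_vert a b h =>
      simp only [map_mul, RingHom.coe_coe, FreeAlgebra.lift_ι_apply, Module.End.mul_apply,
        repGen_vert, repGen_edge]
      split_ifs <;> simp
    | vert_loop a =>
      simp only [map_mul, RingHom.coe_coe, FreeAlgebra.lift_ι_apply, Module.End.mul_apply,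
        repGen_vert, repGen_loop]
      split_ifs <;> simp
    | loop_vert a =>
      simp only [map_mul, RingHom.coe_coe, FreeAlgebra.lift_ι_apply, Module.End.mul_apply,
        repGen_vert, repGen_loop]
      split_ifs <;> simp
    | straight a b c h h' hac =>
      simp only [map_mul, map_zero, RingHom.coe_coe, FreeAlgebra.lift_ι_apply,
        Module.End.mul_apply, repGen_edge]
      split_ifs <;> first | exact absurd (‹a = i›.trans ‹c = i›.symm) hac | simp
    | loop_eq a b h =>
      simp only [map_mul, RingHom.coe_coe, FreeAlgebra.lift_ι_apply,
        Module.End.mul_apply, repGen_edge, repGen_loop]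
      split_ifs <;> simp
    | loop_edge a b h =>
      simp only [map_mul, map_zero, RingHom.coe_coe, FreeAlgebra.lift_ι_apply,
        Module.End.mul_apply, repGen_edge, repGen_loop]
      split_ifs <;> simp
    | loop_loop a =>
      simp only [map_mul, map_zero, RingHom.coe_coe, FreeAlgebra.lift_ι_apply,
        Module.End.mul_apply, repGen_loop]
      split_ifs <;> simp⟩

lemma rep_gen (i : Fin n) (g : Gen n) : rep i (gen g) = repGen i g := by
  have : rep i (gen g) = (FreeAlgebra.lift ℤ (repGen i) : FreeAlgebra ℤ (Gen n) →ₐ[ℤ] _)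
      (FreeAlgebra.ι ℤ g) := RingQuot.lift_mkRingHom_apply _ _ _
  rw [this, FreeAlgebra.lift_ι_apply]

/-- The coefficient of `X_i` in an element of `A_n`. -/
noncomputable def coefX (i : Fin n) : A n →+ ℤ where
  toFun a := (rep i a (1, 0, 0)).2.2
  map_zero' := by simp
  map_add' a b := by simp

lemma coefX_X (i j : Fin n) : coefX i (X j) = if j = i then 1 else 0 := by
  change (rep i (gen _) (1, 0, 0)).2.2 = _
  rw [rep_gen, repGen_loop]

lemma coefX_e (i j : Fin n) : coefX i (e j) = 0 := by
  change (rep i (gen _) (1, 0, 0)).2.2 = _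
  rw [rep_gen, repGen_vert]; simp

lemma coefX_arr (i j k : Fin n) : coefX i (arr j k) = 0 := by
  by_cases h : Adj j k
  · rw [← gen_edge j k h]
    change (rep i (gen _) (1, 0, 0)).2.2 = _
    rw [rep_gen, repGen_edge]; simp
  · rw [arr_of_not h, map_zero]

lemma coefX_self (i : Fin n) : coefX i (X i) = 1 := by rw [coefX_X, if_pos rfl]

/-- `coefX i` vanishes on homogeneous elements of degree other than `2`. -/
lemma coefX_of_mem (i : Fin n) {k : ℤ} (hk : k ≠ 2) {a : A n} (ha : a ∈ grA n k) :
    coefX i a = 0 := by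
  let V (k : ℤ) (x : ℤ × (Fin n → ℤ) × ℤ) : Prop :=
    (k ≠ 0 → x.1 = 0) ∧ (k ≠ 1 → x.2.1 = 0) ∧ (k ≠ 2 → x.2.2 = 0)
  have hV : ∀ (g : Gen n) (k : ℤ) x, V k x → V (g.deg + k) (repGen i g x) := by
    rintro g k ⟨t, m, s⟩ ⟨h₀, h₁, h₂⟩
    cases g with
    | vert v =>
      simp only [Gen.deg, zero_add, repGen_vert, V] at h₀ h₁ h₂ ⊢
      refine ⟨fun h => by simp [h₀ h], fun h => by simp [h₁ h], fun h => by simp [h₂ h]⟩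
    | edge a b h =>
      simp only [Gen.deg, repGen_edge, V] at h₀ h₁ h₂ ⊢
      refine ⟨fun h => trivial, fun h => ?_, fun h => ?_⟩
      · rw [h₀ (by omega)]; simp
      · rw [h₁ (by omega)]; simp
    | loop a =>
      simp only [Gen.deg, repGen_loop, V] at h₀ h₁ h₂ ⊢
      refine ⟨fun h => trivial, fun h => trivial, fun h => ?_⟩
      rw [h₀ (by omega)]; simp
  have hl : ∀ l : List (Gen n), V (l.map Gen.deg).sum (rep i (l.map gen).prod (1, 0, 0)) := by
    intro l
    induction l with
    | nil => simp [V]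
    | cons g l ih =>
      simp only [List.map_cons, List.sum_cons, List.prod_cons, map_mul, Module.End.mul_apply,
        rep_gen]
      exact hV g _ _ ih
  induction ha using AddSubgroup.closure_induction with
  | mem x hx =>
    obtain ⟨l, rfl, rfl⟩ := hx
    exact (hl l).2.2 hk
  | zero => exact map_zero _
  | add x y _ _ h₁ h₂ => rw [map_add, h₁, h₂, add_zero]
  | neg x _ h => rw [map_neg, h, neg_zero]

/-- The expansion of `a (i)` in the basis of `P_i`; the coefficients are those of `X_i` in the
products of `a` with the dual basis. -/
lemma mul_e_expand (i : Fin n) (a : A n) : a * e i = coefX i (X i * a) • e i + coefX i a • X i +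
    ∑ j, coefX i (arr i j * a) • arr j i := by
  induction a using A_span_induction with
  | h0 => simp
  | hadd a b h₁ h₂ =>
    simp only [add_mul, mul_add, map_add, add_smul, Finset.sum_add_distrib, h₁, h₂]; abel
  | hneg a h =>
    simp only [neg_mul, mul_neg, map_neg, neg_smul, Finset.sum_neg_distrib, h]; abel
  | he k =>
    have h₁ : ∀ j, arr i j * e k = 0 ∨ arr i j * e k = arr i j := fun j => by
      by_cases h : j = k
      · subst h; right; exact arr_mul_e _ _
      · left; exact mul_zero_of_e (arr_mul_e i j) (e_mul_e k) h
    have h₂ : ∑ j, coefX i (arr i j * e k) • arr j i = 0 := Finset.sum_eq_zero fun j _ => by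
      obtain h | h := h₁ j <;> simp [h, coefX_arr]
    rw [h₂, coefX_e]
    by_cases h : k = i
    · subst h; simp [e_mul_e, X_mul_e, coefX_self]
    · rw [e_mul_e_ne h, mul_zero_of_e (X_mul_e i) (e_mul_e k) (Ne.symm h)]; simp
  | hX k =>
    have h₂ : ∑ j, coefX i (arr i j * X k) • arr j i = 0 := Finset.sum_eq_zero fun j _ => by
      by_cases h : j = k
      · subst h; simp [arr_mul_X]
      · rw [mul_zero_of_e (arr_mul_e i j) (e_mul_X k) h]; simp
    rw [h₂, coefX_X]
    by_cases h : k = i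
    · subst h; simp [X_mul_e, X_mul_X]
    · rw [mul_zero_of_e (X_mul_e k) (e_mul_e i) h,
        mul_zero_of_e (X_mul_e i) (e_mul_X k) (Ne.symm h)]
      simp [h]
  | ha k l hkl =>
    have h₃ : X i * arr k l = 0 := by
      by_cases h : i = k
      · subst h; exact X_mul_arr _ _
      · exact mul_zero_of_e (X_mul_e i) (e_mul_arr k l) h
    rw [h₃, map_zero, coefX_arr, Finset.sum_eq_single k]
    · by_cases h : l = i
      · subst h; simp [arr_mul_arr hkl.symm, coefX_self, arr_mul_e]
      · rw [arr_mul_arr_ne (Ne.symm h), mul_zero_of_e (arr_mul_e k l) (e_mul_e i) h]; simp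
    · intro j _ hj
      rw [mul_zero_of_e (arr_mul_e i j) (e_mul_arr k l) hj]; simp
    · intro h; exact absurd (Finset.mem_univ k) h

/-- The ring `(i) A_n (i)` is spanned by `(i)` and `X_i`. -/
lemma e_mul_e_self (i : Fin n) (a : A n) :
    e i * a * e i = coefX i (X i * a) • e i + coefX i a • X i := by
  rw [mul_assoc, mul_e_expand, mul_add, mul_add, Finset.mul_sum,
    Finset.sum_eq_zero fun j _ => ?_, mul_smul_comm, mul_smul_comm, e_mul_e, e_mul_X, add_zero]
  rw [mul_smul_comm]
  by_cases h : i = j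
  · subst h; rw [arr_of_not (by unfold Adj; omega), mul_zero, smul_zero]
  · rw [mul_zero_of_e (e_mul_e i) (e_mul_arr j i) h, smul_zero]

/-- `(i) A_n (j)` is spanned by `(i|j)` for `i ≠ j`. -/
lemma e_mul_e_of_ne {i j : Fin n} (hij : i ≠ j) (a : A n) :
    e i * a * e j = coefX j (arr j i * a) • arr i j := by
  rw [mul_assoc, mul_e_expand, mul_add, mul_add, Finset.mul_sum, Finset.sum_eq_single i,
    mul_smul_comm, mul_smul_comm, mul_smul_comm, e_mul_e_ne hij,
    mul_zero_of_e (e_mul_e i) (e_mul_X j) hij, e_mul_arr, smul_zero, smul_zero, zero_add, zero_add]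
  · intro k _ hk
    rw [mul_smul_comm, mul_zero_of_e (e_mul_e i) (e_mul_arr k j) (Ne.symm hk), smul_zero]
  · intro h; exact absurd (Finset.mem_univ i) h

/-- The degree `0` part of `A_n` is spanned by the `(i)`. -/
lemma exists_of_mem_zero {a : A n} (ha : a ∈ grA n 0) : ∃ c : Fin n → ℤ, a = ∑ i, c i • e i := by
  have key : ∀ a : A n, ∃ c : Fin n → ℤ, GradedRing.proj (grA n) 0 a = ∑ i, c i • e i := by
    intro a
    have hp : ∀ {k : ℤ} {x : A n}, x ∈ grA n k → k ≠ 0 → GradedRing.proj (grA n) 0 x = 0 :=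
      fun hx hk => by
        rw [GradedRing.proj_apply, DirectSum.decompose_of_mem_ne _ hx hk]
    induction a using A_span_induction with
    | h0 => exact ⟨0, by simp⟩
    | hadd a b h₁ h₂ =>
      obtain ⟨c, hc⟩ := h₁; obtain ⟨d, hd⟩ := h₂
      exact ⟨c + d, by simp only [map_add, hc, hd, Pi.add_apply, add_smul, Finset.sum_add_distrib]⟩
    | hneg a h =>
      obtain ⟨c, hc⟩ := h
      exact ⟨-c, by simp only [map_neg, hc, Pi.neg_apply, neg_smul, Finset.sum_neg_distrib]⟩
    | he i =>
      refine ⟨Pi.single i 1, ?_⟩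
      rw [GradedRing.proj_apply, DirectSum.decompose_of_mem_same _ (e_mem i),
        Finset.sum_eq_single i (fun j _ hj => by simp [hj]) (by simp)]
      simp
    | hX i => exact ⟨0, by rw [hp (X_mem i) (by norm_num)]; simp⟩
    | ha i j _ => exact ⟨0, by rw [hp (arr_mem i j) (by norm_num)]; simp⟩
  obtain ⟨c, hc⟩ := key a
  rw [GradedRing.proj_apply, DirectSum.decompose_of_mem_same _ ha] at hc
  exact ⟨c, hc⟩

/-- Central elements of degree `0` are integers. -/
lemma exists_int_of_central {a : A n} (ha : a ∈ grA n 0) (hc : ∀ b, a * b = b * a) :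
    ∃ k : ℤ, a = k := by
  obtain ⟨c, rfl⟩ := exists_of_mem_zero ha
  have hl : ∀ i j, (∑ k, c k • e k) * arr i j = c i • arr i j := fun i j => by
    rw [Finset.sum_mul, Finset.sum_eq_single i (fun k _ hk => by
      rw [smul_mul_assoc, mul_zero_of_e (e_mul_e k) (e_mul_arr i j) hk, smul_zero]) (by simp),
      smul_mul_assoc, e_mul_arr]
  have hr : ∀ i j, arr i j * (∑ k, c k • e k) = c j • arr i j := fun i j => by
    rw [Finset.mul_sum, Finset.sum_eq_single j (fun k _ hk => by
      rw [mul_smul_comm, mul_zero_of_e (arr_mul_e i j) (e_mul_e k) (Ne.symm hk), smul_zero])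
      (by simp), mul_smul_comm, arr_mul_e]
  have h : ∀ i j : Fin n, i.val + 1 = j.val → c i = c j := fun i j hij => by
    have h₁ := hc (arr i j)
    rw [hl, hr] at h₁
    have h₂ := congrArg (fun x => coefX i (x * arr j i)) h₁
    simpa only [smul_mul_assoc, arr_mul_arr (Or.inl hij : Adj i j), map_zsmul, coefX_self,
      smul_eq_mul, mul_one] using h₂
  obtain _ | n := n
  · exact ⟨0, by simp⟩
  refine ⟨c 0, ?_⟩
  have h' : ∀ k (hk : k < n + 1), c ⟨k, hk⟩ = c 0 := fun k => by
    induction k with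
    | zero => intro _; rfl
    | succ k ih => intro hk; rw [← h ⟨k, by omega⟩ ⟨k + 1, hk⟩ rfl, ih]
  rw [Finset.sum_congr rfl fun i _ => by rw [h' i.1 i.2], ← Finset.smul_sum, sum_e,
    zsmul_eq_mul, mul_one]

/-- The ring homomorphism `A_n → ℤ` that sends `(i)` to `1` and all other paths to `0`. -/
noncomputable def aug (i : Fin n) : A n →+* ℤ :=
  RingQuot.lift ⟨(FreeAlgebra.lift ℤ (fun g => match g with
      | .vert j => if j = i then 1 else 0
      | _ => 0 : Gen n → ℤ) : FreeAlgebra ℤ (Gen n) →ₐ[ℤ] ℤ), by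
    intro x y h
    induction h with
    | vert_mul h =>
      simp only [map_mul, map_zero, RingHom.coe_coe, FreeAlgebra.lift_ι_apply]
      split_ifs with h₁ h₂ <;> simp
      exact h (h₁.trans h₂.symm)
    | _ => simp [FreeAlgebra.lift_ι_apply]⟩

lemma aug_X (i j : Fin n) : aug i (X j) = 0 :=
  (RingQuot.lift_mkRingHom_apply _ _ _).trans (FreeAlgebra.lift_ι_apply _ _)

lemma aug_of_mem (i : Fin n) {k : ℤ} (hk : k ≠ 0) {a : A n} (ha : a ∈ grA n k) : aug i a = 0 := by
  have hg : ∀ g : Gen n, g.deg ≠ 0 → aug i (gen g) = 0 := fun g hg => by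
    refine (RingQuot.lift_mkRingHom_apply _ _ _).trans ((FreeAlgebra.lift_ι_apply _ _).trans ?_)
    cases g with
    | vert j => exact absurd rfl hg
    | _ => rfl
  induction ha using AddSubgroup.closure_induction with
  | mem x hx =>
    obtain ⟨l, hl, rfl⟩ := hx
    obtain ⟨g, hg₁, hg₂⟩ : ∃ g ∈ l, g.deg ≠ 0 := by
      by_contra! h
      refine hk (hl ▸ List.sum_eq_zero fun x hx => ?_)
      obtain ⟨g, hg, rfl⟩ := List.mem_map.1 hx
      exact h g hg
    rw [map_list_prod, List.prod_eq_zero]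
    exact List.mem_map.2 ⟨gen g, List.mem_map.2 ⟨g, hg₁, rfl⟩, hg g hg₂⟩
  | zero => exact map_zero _
  | add x y _ _ h₁ h₂ => rw [map_add, h₁, h₂, add_zero]
  | neg x _ h => rw [map_neg, h, neg_zero]

/-! ### Maps out of `P_i ⊗ _iP ⊗ M` -/

section

open MulOpposite TensorProduct GrBimod

lemma toPl_mul_e (i : Fin n) (a : A n) : toPl i (a * e i) = toPl i a :=
  Subtype.ext (by change a * e i * e i = a * e i; rw [mul_assoc, e_mul_e])

lemma toPr_e_mul (i : Fin n) (a : A n) : toPr i (e i * a) = toPr i a :=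
  Subtype.ext (by change e i * (e i * a) = e i * a; rw [← mul_assoc, e_mul_e])

lemma tm_eq_pt (i : Fin n) (x : Pl i) (y : Pr i) : tm i x y = pt i x.1 y.1 := by
  have hx : toPl i x.1 = x := Subtype.ext x.2
  have hy : toPr i y.1 = y := Subtype.ext y.2
  rw [pt, hx, hy]

/-- The graded module `P_i ⊗ _iP ⊗ M`. -/
noncomputable abbrev U (i : Fin n) (M : GrMod.{u} n) : GrMod.{u} n := tens (PP i) M

/-- The graded module `P_i ⊗ _iP{-2} ⊗ M`. -/
noncomputable abbrev U' (i : Fin n) (M : GrMod.{u} n) : GrMod.{u} n := tens ((PP i).sh 2) M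

/-- The element `(i) ⊗ (i) ⊗ m` of `P_i ⊗ _iP ⊗ M`. -/
noncomputable def br (i : Fin n) (M : GrMod.{u} n) : M.carrier →+ (U i M).carrier :=
  tmul (PP i) M (pt i (e i) (e i))

/-- The identity map from `P_i ⊗ _iP ⊗ M` to `P_i ⊗ _iP{-2} ⊗ M`, which lowers degrees by `2`. -/
noncomputable def toU' (i : Fin n) (M : GrMod.{u} n) : (U i M).carrier →ₗ[A n] (U' i M).carrier :=
  liftL (B := PP i) (tmul ((PP i).sh 2) M) (fun x a m => tmul_ract (B := (PP i).sh 2) x a m)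
    (fun a x m => (GrBimod.smul_tmul (B := (PP i).sh 2) a x m).symm)

/-- The inverse of `toU'`. -/
noncomputable def ofU' (i : Fin n) (M : GrMod.{u} n) : (U' i M).carrier →ₗ[A n] (U i M).carrier :=
  liftL (B := (PP i).sh 2) (tmul (PP i) M) (fun x a m => tmul_ract (B := PP i) x a m)
    (fun a x m => (GrBimod.smul_tmul (B := PP i) a x m).symm)

lemma toU'_tmul (i : Fin n) (M : GrMod.{u} n) (x : (PP i).carrier) (m : M.carrier) :
    toU' i M (tmul (PP i) M x m) = tmul ((PP i).sh 2) M x m := rfl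

lemma ofU'_tmul (i : Fin n) (M : GrMod.{u} n) (x : (PP i).carrier) (m : M.carrier) :
    ofU' i M (tmul ((PP i).sh 2) M x m) = tmul (PP i) M x m := rfl

lemma toU'_ofU' (i : Fin n) (M : GrMod.{u} n) (t : (U' i M).carrier) :
    toU' i M (ofU' i M t) = t := by
  refine tens_induction (B := (PP i).sh 2) (M := M) (p := fun t => toU' i M (ofU' i M t) = t)
    ?_ (fun s t h₁ h₂ => ?_) (fun x m => ?_) t
  · exact (congrArg _ (map_zero (ofU' i M))).trans (map_zero (toU' i M))
  · exact (congrArg _ (map_add (ofU' i M) s t)).trans ((map_add (toU' i M) _ _).trans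
      (congrArg₂ _ h₁ h₂))
  · exact (congrArg _ (ofU'_tmul i M x m)).trans (toU'_tmul i M x m)

lemma ofU'_toU' (i : Fin n) (M : GrMod.{u} n) (t : (U i M).carrier) :
    ofU' i M (toU' i M t) = t := by
  refine tens_induction (B := PP i) (M := M) (p := fun t => ofU' i M (toU' i M t) = t)
    ?_ (fun s t h₁ h₂ => ?_) (fun x m => ?_) t
  · exact (congrArg _ (map_zero (toU' i M))).trans (map_zero (ofU' i M))
  · exact (congrArg _ (map_add (toU' i M) s t)).trans ((map_add (ofU' i M) _ _).trans
      (congrArg₂ _ h₁ h₂))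
  · exact (congrArg _ (toU'_tmul i M x m)).trans (ofU'_tmul i M x m)

/-- The element `(i) ⊗ (i) ⊗ m` of `P_i ⊗ _iP{-2} ⊗ M`. -/
noncomputable def br' (i : Fin n) (M : GrMod.{u} n) : M.carrier →+ (U' i M).carrier :=
  (toU' i M).toAddMonoidHom.comp (br i M)

lemma br'_apply (i : Fin n) (M : GrMod.{u} n) (m : M.carrier) : br' i M m = toU' i M (br i M m) :=
  rfl

section

variable {i : Fin n} {M N : GrMod.{u} n}

lemma tmul_pt (a b : A n) (m : M.carrier) :
    (tmul (PP i) M (pt i a b) m : (U i M).carrier) = a • br i M (b • m) := by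
  have h : pt i a b = (PP i).ract (op b) (a • pt i (e i) (e i)) := by
    rw [smul_pt, pt_ract]
    unfold pt
    rw [toPl_mul_e, toPr_e_mul]
  rw [h, tmul_ract]
  exact (GrBimod.smul_tmul a _ _).symm

lemma br_e_smul (m : M.carrier) : br i M (e i • m) = br i M m := by
  have h := tmul_pt (i := i) (1 : A n) (e i) m
  rw [one_smul] at h
  rw [← h]
  have : pt i (1 : A n) (e i) = pt i (e i) (e i) := by
    unfold pt; rw [← one_mul (e i), toPl_mul_e]
  rw [this]; rfl

lemma e_smul_br (m : M.carrier) : e i • br i M m = br i M m := by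
  refine (GrBimod.smul_tmul (e i) _ _).trans ?_
  rw [smul_pt, e_mul_e]; rfl

lemma br_mem {k : ℤ} {m : M.carrier} (hm : m ∈ M.gr k) : br i M m ∈ (U i M).gr k :=
  mem_biGr (fun x m => tmul (PP i) M x m) (zero_add k) (pt_mem i (e_mem i) (e_mem i) (add_zero 0))
      hm

/-- Elements of `P_i ⊗ _iP ⊗ M` are sums of elements `a (i) ⊗ (i) ⊗ m`. -/
lemma Tens_induction {p : (U i M).carrier → Prop} (h0 : p 0)
    (hadd : ∀ s t, p s → p t → p (s + t))
    (h : ∀ (a : A n) m, p (a • br i M m)) (t : (U i M).carrier) : p t := by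
  refine tens_induction (B := PP i) (M := M) (p := p) h0 hadd (fun x m => ?_) t
  have h0' : ∀ m, tmul (PP i) M 0 m = 0 := fun m => by rw [map_zero]; rfl
  induction x using PP_induction with
  | h0 => rw [h0']; exact h0
  | hadd s t h₁ h₂ => rw [map_add, AddMonoidHom.add_apply]; exact hadd _ _ h₁ h₂
  | h x y => rw [tm_eq_pt, tmul_pt]; exact h _ _

/-- Two maps from `P_i ⊗ _iP ⊗ M` agree if they agree on the elements `(i) ⊗ (i) ⊗ m`. -/
lemma U_hom_ext {f g : U i M ⟶ N}
    (h : ∀ m, GrMod.lin f (br i M m) = GrMod.lin g (br i M m)) : f = g :=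
  GrMod.hom_ext fun t => by
    induction t using Tens_induction (i := i) (M := M) with
    | h0 => rw [map_zero, map_zero]
    | hadd s t h₁ h₂ => rw [map_add, map_add, h₁, h₂]
    | h a m => rw [map_smul, map_smul, h]

lemma U'_hom_ext {f g : U' i M ⟶ N}
    (h : ∀ m, GrMod.lin f (br' i M m) = GrMod.lin g (br' i M m)) : f = g :=
  GrMod.hom_ext fun t => by
    rw [← toU'_ofU' i M t]
    induction ofU' i M t using Tens_induction (i := i) (M := M) with
    | h0 => rw [map_zero, map_zero, map_zero]
    | hadd s t h₁ h₂ => rw [map_add, map_add, map_add, h₁, h₂]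
    | h a m => rw [map_smul, map_smul, map_smul, ← br'_apply, h]

lemma toU'_mem {k l : ℤ} (h : k = l + 2) {t : (U i M).carrier} (ht : t ∈ (U i M).gr k) :
    toU' i M t ∈ (U' i M).gr l :=
  map_mem_biGr (T := Tens (PP i) M) (toU' i M).toAddMonoidHom ((U' i M).gr l)
    (fun a b hab x hx m hm => mem_biGr (fun x m => tmul ((PP i).sh 2) M x m)
      (show (a - 2) + b = l by omega)
      (show x ∈ (PP i).gr (a - 2 + 2) by rwa [sub_add_cancel]) hm) ht

lemma ofU'_mem {k l : ℤ} (h : k = l + 2) {t : (U' i M).carrier}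
    (ht : t ∈ (U' i M).gr l) : ofU' i M t ∈ (U i M).gr k :=
  map_mem_biGr (T := Tens ((PP i).sh 2) M) (ofU' i M).toAddMonoidHom ((U i M).gr k)
    (fun a b hab x hx m hm => mem_biGr (fun x m => tmul (PP i) M x m)
      (show (a + 2) + b = k by omega) hx hm) ht

lemma br'_mem {k : ℤ} {m : M.carrier} (hm : m ∈ M.gr k) : br' i M m ∈ (U' i M).gr (k - 2) :=
  toU'_mem (sub_add_cancel k 2).symm (br_mem hm)

/-- Multiplication by an element, as an additive map. -/
def smulHom (M : GrMod.{u} n) : A n →+ M.carrier →+ M.carrier := AddMonoidHom.smul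

/-- Additive maps from `P_i ⊗ _iP`. -/
def liftPPc {V : Type*} [AddCommGroup V] (i : Fin n) (f : Pl i →+ Pr i →+ V) :
    (PP i).carrier →+ V := liftPP i f

/-- The triadditive map `(x, y, m) ↦ x φ(y m)`. -/
def descTri (i : Fin n) (φ : M.carrier →+ N.carrier) : Pl i →+ Pr i →+ M.carrier →+ N.carrier :=
  AddMonoidHom.mk' (fun x => AddMonoidHom.mk'
      (fun y => (smulHom N x.1).comp (φ.comp (smulHom M y.1)))
      (fun y y' => AddMonoidHom.ext fun m => by
        change x.1 • φ ((y.1 + y'.1) • m) = x.1 • φ (y.1 • m) + x.1 • φ (y'.1 • m)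
        rw [add_smul, map_add, smul_add]))
      (fun x x' => AddMonoidHom.ext fun y => AddMonoidHom.ext fun m =>
        add_smul x.1 x'.1 (φ (y.1 • m)))

/-- The linear map `P_i ⊗ _iP ⊗ M → N`, `x ⊗ y ⊗ m ↦ x φ(y m)` for an additive map `φ`. -/
noncomputable def desc (i : Fin n) (φ : M.carrier →+ N.carrier) :
    (U i M).carrier →ₗ[A n] N.carrier :=
  liftL (liftPPc i (descTri i φ))
    (fun p a m => by
      induction p using PP_induction with
      | h0 => simp only [map_zero, AddMonoidHom.zero_apply]
      | hadd s t h₁ h₂ => simp only [map_add, AddMonoidHom.add_apply, h₁, h₂]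
      | h x y =>
        change x.1 • φ ((y.1 * a) • m) = x.1 • φ (y.1 • a • m)
        rw [mul_smul])
    (fun a p m => by
      induction p using PP_induction with
      | h0 => simp only [smul_zero, map_zero, AddMonoidHom.zero_apply]
      | hadd s t h₁ h₂ => simp only [smul_add, map_add, AddMonoidHom.add_apply, h₁, h₂]
      | h x y => exact mul_smul a x.1 _)

lemma desc_br (φ : M.carrier →+ N.carrier) (m : M.carrier) :
    desc i φ (br i M m) = e i • φ (e i • m) := by
  change (e i * e i) • φ ((e i * e i) • m) = _
  rw [e_mul_e]

lemma desc_mem (φ : M.carrier →+ N.carrier) {c : ℤ}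
    (hφ : ∀ k, ∀ m ∈ M.gr k, φ m ∈ N.gr (k + c)) {k : ℤ} {t : (U i M).carrier}
    (ht : t ∈ (U i M).gr k) : desc i φ t ∈ N.gr (k + c) := by
  refine map_mem_biGr (T := Tens (PP i) M) (desc i φ).toAddMonoidHom (N.gr (k + c)) ?_ ht
  intro a b hab p hp m hm
  let ev : (PP i).carrier →+ N.carrier :=
    (AddMonoidHom.eval m).comp (liftPPc i (descTri i φ))
  refine map_mem_biGr (T := PPt i) (k := a) ev (N.gr (k + c)) ?_ hp
  intro a' b' hab' x hx y hy
  change x.1 • φ (y.1 • m) ∈ N.gr (k + c)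
  refine GrMod.gr_congr N ?_ (N.smul_mem hx (hφ _ _ (M.smul_mem hy hm)))
  omega

/-- The map `P_i ⊗ _iP → A_n` that sends `x ⊗ y` to `y` times the coefficient of `X_i` in `x`. -/
noncomputable def midX (i : Fin n) : (PP i).carrier →+ A n :=
  liftPPc i (AddMonoidHom.mk' (fun x => AddMonoidHom.mk' (fun y => coefX i x.1 • y.1)
    (fun y y' => smul_add _ _ _)) (fun x x' => AddMonoidHom.ext fun y => by
      change coefX i (x.1 + x'.1) • y.1 = coefX i x.1 • y.1 + coefX i x'.1 • y.1
      rw [map_add, add_smul]))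

/-- The map `P_i ⊗ _iP ⊗ M → M` that sends `x ⊗ y ⊗ m` to `y m` times the coefficient of `X_i`
in `x`. -/
noncomputable def cX (i : Fin n) (M : GrMod.{u} n) : (U i M).carrier →+ M.carrier :=
  lift ((smulHom M).comp (midX i)) (fun p a m => by
    change midX i ((PP i).ract (op a) p) • m = midX i p • a • m
    rw [← mul_smul]
    congr 1
    induction p using PP_induction with
    | h0 => simp
    | hadd s t h₁ h₂ => rw [map_add, map_add, map_add, h₁, h₂, add_mul]
    | h x y => exact (smul_mul_assoc (coefX i x.1) y.1 a).symm)

lemma coefX_mul_e (a : A n) : coefX i (a * e i) = coefX i a := by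
  rw [mul_e_expand]
  simp only [map_add, map_sum, map_zsmul, coefX_e, coefX_arr, coefX_self,
    Finset.sum_const_zero, add_zero, zero_add, smul_eq_mul, mul_one, mul_zero]

lemma cX_smul_br (a : A n) (m : M.carrier) :
    cX i M (a • br i M m) = coefX i a • e i • m := by
  change midX i (a • pt i (e i) (e i)) • m = _
  rw [smul_pt]
  change (coefX i (a * e i * e i) • (e i * e i)) • m = _
  rw [coefX_mul_e, coefX_mul_e, e_mul_e, smul_assoc]

lemma cX_br (m : M.carrier) : cX i M (br i M m) = 0 := by
  rw [← e_smul_br, cX_smul_br, coefX_e, zero_smul]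

lemma cX_X_br (m : M.carrier) : cX i M (X i • br i M m) = e i • m := by
  rw [cX_smul_br, coefX_self, one_smul]

lemma cX_e_smul (t : (U i M).carrier) : cX i M (e i • t) = cX i M t := by
  induction t using Tens_induction with
  | h0 => rw [smul_zero]
  | hadd s t h₁ h₂ => rw [smul_add, map_add, map_add, h₁, h₂]
  | h a m =>
    rw [← mul_smul, cX_smul_br, cX_smul_br, ← coefX_mul_e, e_mul_e_self]
    simp only [map_add, map_zsmul, coefX_e, coefX_self, mul_zero, zero_add, smul_eq_mul, mul_one]

lemma cX_mem {k : ℤ} {t : (U i M).carrier} (ht : t ∈ (U i M).gr k) :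
    cX i M t ∈ M.gr (k - 2) := by
  refine map_mem_biGr (T := Tens (PP i) M) (cX i M) (M.gr (k - 2)) ?_ ht
  intro a b hab p hp m hm
  change midX i p • m ∈ M.gr (k - 2)
  have : midX i p ∈ grA n (a - 2) := by
    refine map_mem_biGr (T := PPt i) (midX i) (grA n (a - 2)) ?_ hp
    intro a' b' hab' x hx y hy
    change coefX i x.1 • y.1 ∈ grA n (a - 2)
    by_cases h : a' = 2
    · have : b' = a - 2 := by omega
      exact zsmul_mem (this ▸ hy) _
    · have h' : coefX i x.1 = 0 := coefX_of_mem i h hx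
      rw [h', zero_smul]; exact zero_mem _
  exact GrMod.gr_congr M (by omega) (M.smul_mem this hm)

/-- Every element of `P_i ⊗ _iP ⊗ M` is determined by its coefficients with respect to the basis
of `P_i`. -/
lemma Tens_expand (t : (U i M).carrier) :
    t = br i M (cX i M (X i • t)) + X i • br i M (cX i M t) +
      ∑ j, arr j i • br i M (cX i M (arr i j • t)) := by
  induction t using Tens_induction with
  | h0 => simp
  | hadd s t h₁ h₂ =>
    simp only [smul_add, map_add, Finset.sum_add_distrib]
    nth_rewrite 1 [h₁, h₂]; abel
  | h a m =>
    have h : a • br i M m = (a * e i) • br i M m := by rw [mul_smul, e_smul_br]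
    simp only [← mul_smul, cX_smul_br, map_zsmul, br_e_smul]
    rw [h, mul_e_expand, add_smul, add_smul, Finset.sum_smul]
    simp only [smul_assoc, e_smul_br, smul_comm (_ : A n) (_ : ℤ)]

/-- Two additive maps from `P_i ⊗ _iP ⊗ M` agree on `(i) (P_i ⊗ _iP ⊗ M)` if they agree on the
elements `(i) ⊗ (i) ⊗ m` and `X_i ⊗ (i) ⊗ m`. -/
lemma corner_ext {L : Type*} [AddCommGroup L] {f g : (U i M).carrier →+ L}
    (h₁ : ∀ m, f (br i M m) = g (br i M m)) (h₂ : ∀ m, f (X i • br i M m) = g (X i • br i M m))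
    (t : (U i M).carrier) : f (e i • t) = g (e i • t) := by
  induction t using Tens_induction with
  | h0 => simp
  | hadd s t h₁ h₂ => rw [smul_add, map_add, map_add, h₁, h₂]
  | h a m =>
    have : e i • a • br i M m = coefX i (X i * a) • br i M m + coefX i a • X i • br i M m := by
      nth_rewrite 1 [← e_smul_br]
      rw [← mul_smul, ← mul_smul, e_mul_e_self, add_smul, smul_assoc, smul_assoc, e_smul_br]
    rw [this, map_add, map_add, map_zsmul, map_zsmul, map_zsmul, map_zsmul, h₁, h₂]

lemma corner_ext_of_ne {j : Fin n} (hij : i ≠ j) {L : Type*} [AddCommGroup L]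
    {f g : (U j M).carrier →+ L} (h : ∀ m, f (arr i j • br j M m) = g (arr i j • br j M m))
    (t : (U j M).carrier) : f (e i • t) = g (e i • t) := by
  induction t using Tens_induction with
  | h0 => simp
  | hadd s t h₁ h₂ => rw [smul_add, map_add, map_add, h₁, h₂]
  | h a m =>
    have : e i • a • br j M m = coefX j (arr j i * a) • arr i j • br j M m := by
      nth_rewrite 1 [← e_smul_br]
      rw [← mul_smul, ← mul_smul, e_mul_e_of_ne hij, smul_assoc]
    rw [this, map_zsmul, map_zsmul, h]

/-! The same facts for `P_i ⊗ _iP{-2} ⊗ M`. -/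

lemma br'_e_smul (m : M.carrier) : br' i M (e i • m) = br' i M m := by
  rw [br'_apply, br_e_smul, ← br'_apply]

lemma e_smul_br' (m : M.carrier) : e i • br' i M m = br' i M m := by
  rw [br'_apply, ← map_smul, e_smul_br]

/-- `desc` on `P_i ⊗ _iP{-2} ⊗ M`. -/
noncomputable def desc' (i : Fin n) (φ : M.carrier →+ N.carrier) :
    (U' i M).carrier →ₗ[A n] N.carrier := (desc i φ).comp (ofU' i M)

lemma desc'_br' (φ : M.carrier →+ N.carrier) (m : M.carrier) :
    desc' i φ (br' i M m) = e i • φ (e i • m) := by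
  rw [desc', LinearMap.comp_apply, br'_apply, ofU'_toU', desc_br]

/-- `cX` on `P_i ⊗ _iP{-2} ⊗ M`. -/
noncomputable def cX' (i : Fin n) (M : GrMod.{u} n) : (U' i M).carrier →+ M.carrier :=
  (cX i M).comp (ofU' i M).toAddMonoidHom

lemma cX'_apply (t : (U' i M).carrier) : cX' i M t = cX i M (ofU' i M t) := rfl

lemma cX'_br' (m : M.carrier) : cX' i M (br' i M m) = 0 := by
  rw [cX'_apply, br'_apply, ofU'_toU', cX_br]

lemma cX'_X_br' (m : M.carrier) : cX' i M (X i • br' i M m) = e i • m := by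
  rw [cX'_apply, br'_apply, map_smul, ofU'_toU', cX_X_br]

lemma cX'_e_smul (t : (U' i M).carrier) : cX' i M (e i • t) = cX' i M t := by
  rw [cX'_apply, map_smul, cX_e_smul, cX'_apply]

lemma cX'_mem {k : ℤ} {t : (U' i M).carrier} (ht : t ∈ (U' i M).gr k) : cX' i M t ∈ M.gr k :=
  M.gr_congr (add_sub_cancel_right k 2) (cX_mem (ofU'_mem rfl ht))

lemma corner_ext' {L : Type*} [AddCommGroup L] {f g : (U' i M).carrier →+ L}
    (h₁ : ∀ m, f (br' i M m) = g (br' i M m))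
    (h₂ : ∀ m, f (X i • br' i M m) = g (X i • br' i M m))
    (t : (U' i M).carrier) : f (e i • t) = g (e i • t) := by
  have := corner_ext (i := i) (M := M) (f := f.comp (toU' i M).toAddMonoidHom)
    (g := g.comp (toU' i M).toAddMonoidHom) h₁ (fun m => by
      change f (toU' i M (X i • br i M m)) = g (toU' i M (X i • br i M m))
      rw [map_smul]; exact h₂ m) (ofU' i M t)
  change f (toU' i M _) = g (toU' i M _) at this
  rwa [map_smul, toU'_ofU'] at this

/-- The morphism `P_i ⊗ _iP ⊗ M ⟶ N` given by a degree preserving additive map `M → N`. -/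
noncomputable def descHom (i : Fin n) (φ : M.carrier →+ N.carrier)
    (hφ : ∀ k, ∀ m ∈ M.gr k, φ m ∈ N.gr k) : U i M ⟶ N :=
  GrMod.mk' (desc i φ) fun k _ ht => N.gr_congr (add_zero k)
    (desc_mem φ (fun k m hm => N.gr_congr (add_zero k).symm (hφ k m hm)) ht)

/-- The morphism `P_i ⊗ _iP{-2} ⊗ M ⟶ N` given by an additive map `M → N` that lowers degrees
by `2`. -/
noncomputable def descHom' (i : Fin n) (φ : M.carrier →+ N.carrier)
    (hφ : ∀ k, ∀ m ∈ M.gr k, φ m ∈ N.gr (k - 2)) : U' i M ⟶ N :=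
  GrMod.mk' (desc' i φ) fun k _ ht => N.gr_congr (by ring)
    (desc_mem (c := -2) φ (fun k m hm => N.gr_congr (by ring) (hφ k m hm)) (ofU'_mem rfl ht))

lemma lin_descHom (φ : M.carrier →+ N.carrier) (hφ : ∀ k, ∀ m ∈ M.gr k, φ m ∈ N.gr k)
    (m : M.carrier) : GrMod.lin (descHom i φ hφ) (br i M m) = e i • φ (e i • m) := desc_br φ m

lemma lin_descHom' (φ : M.carrier →+ N.carrier) (hφ : ∀ k, ∀ m ∈ M.gr k, φ m ∈ N.gr (k - 2))
    (m : M.carrier) : GrMod.lin (descHom' i φ hφ) (br' i M m) = e i • φ (e i • m) := desc'_br' φ m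

end

end

/-! ### The bimodule maps that enter the elementary cobordisms -/

section

open MulOpposite TensorProduct GrBimod

section

variable {i j : Fin n} {M N M' N' : GrMod.{u} n}

/-- The morphism `id ⊗ f` between the modules `P_i ⊗ _iP ⊗ M`. -/
noncomputable def mapU (i : Fin n) (f : M ⟶ N) : U i M ⟶ U i N := (tensF (PP i)).map f

/-- The morphism `id ⊗ f` between the modules `P_i ⊗ _iP{-2} ⊗ M`. -/
noncomputable def mapU' (i : Fin n) (f : M ⟶ N) : U' i M ⟶ U' i N := (tensF ((PP i).sh 2)).map f

/-- The morphism `β_i ⊗ M`. -/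
noncomputable def betaM (i : Fin n) (M : GrMod.{u} n) : U i M ⟶ M := (beta i).app M

/-- The morphism `γ_i ⊗ M`. -/
noncomputable def gammaM (i : Fin n) (M : GrMod.{u} n) : M ⟶ U' i M := (gamma i).app M

lemma lin_mapU_br (f : M ⟶ N) (m : M.carrier) :
    GrMod.lin (mapU i f) (br i M m) = br i N (GrMod.lin f m) := rfl

lemma lin_mapU'_br' (f : M ⟶ N) (m : M.carrier) :
    GrMod.lin (mapU' i f) (br' i M m) = br' i N (GrMod.lin f m) := rfl

lemma lin_betaM_br (m : M.carrier) : GrMod.lin (betaM i M) (br i M m) = e i • m := by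
  change mulPP i (pt i (e i) (e i)) • m = _
  congr 1
  change e i * e i * (e i * e i) = e i
  rw [e_mul_e, e_mul_e]

lemma tmul_casimir (m : M.carrier) : (tmul (PP i) M (casimir i) m : (U i M).carrier) =
    br i M (X i • m) + X i • br i M m + ∑ j, arr j i • br i M (arr i j • m) := by
  have h : (tmul (PP i) M (casimir i) m : (U i M).carrier) =
      tmul (PP i) M (pt i (e i) (X i)) m + tmul (PP i) M (pt i (X i) (e i)) m +
        ∑ j, tmul (PP i) M (pt i (arr j i) (arr i j)) m := by
    rw [casimir, map_add, map_add, map_sum, AddMonoidHom.add_apply, AddMonoidHom.add_apply,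
      AddMonoidHom.finsetSum_apply]
  rw [h, Finset.sum_congr rfl fun j _ => tmul_pt (arr j i) (arr i j) m]
  refine congrArg₂ _ (congrArg₂ _ ?_ ?_) rfl
  · exact (tmul_pt _ _ _).trans (e_smul_br _)
  · exact (tmul_pt _ _ _).trans (by rw [br_e_smul])

lemma lin_gammaM (m : M.carrier) :
    GrMod.lin (gammaM i M) m = br' i M (X i • m) + X i • br' i M m +
      ∑ j, arr j i • br' i M (arr i j • m) := by
  have h : GrMod.lin (gammaM i M) m = toU' i M (tmul (PP i) M (casimir i) m) := rfl
  rw [h, tmul_casimir, map_add, map_add, map_sum]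
  simp only [(toU' i M).map_smul, br'_apply]

lemma e_mul_arr_self (i j : Fin n) : e i * arr j i = 0 := by
  by_cases h : i = j
  · subst h; rw [arr_of_not (by unfold Adj; omega), mul_zero]
  · exact mul_zero_of_e (e_mul_e i) (e_mul_arr j i) h

lemma arr_mul_e_self (i j : Fin n) : arr i j * e i = 0 := by
  by_cases h : j = i
  · subst h; rw [arr_of_not (by unfold Adj; omega), zero_mul]
  · exact mul_zero_of_e (arr_mul_e i j) (e_mul_e i) h

lemma e_smul_gammaM (m : M.carrier) : e i • GrMod.lin (gammaM i M) m =
    br' i M (X i • m) + X i • br' i M m := by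
  rw [lin_gammaM, smul_add, smul_add, e_smul_br', ← mul_smul, e_mul_X, Finset.smul_sum,
    Finset.sum_eq_zero, add_zero]
  intro j _
  rw [← mul_smul, e_mul_arr_self, zero_smul]

lemma gammaM_e_smul (m : M.carrier) : GrMod.lin (gammaM i M) (e i • m) =
    br' i M (X i • m) + X i • br' i M m := by
  rw [lin_gammaM, ← mul_smul, X_mul_e, br'_e_smul, Finset.sum_eq_zero, add_zero]
  intro j _
  rw [← mul_smul, arr_mul_e_self, zero_smul, map_zero, smul_zero]

lemma map_descHom {f : M ⟶ M'} {g : N ⟶ N'} {φ : M.carrier →+ N.carrier}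
    {φ' : M'.carrier →+ N'.carrier} (hφ : ∀ k, ∀ m ∈ M.gr k, φ m ∈ N.gr k)
    (hφ' : ∀ k, ∀ m ∈ M'.gr k, φ' m ∈ N'.gr k)
    (h : ∀ m, φ' (GrMod.lin f m) = GrMod.lin g (φ m)) :
    mapU i f ≫ descHom i φ' hφ' = descHom i φ hφ ≫ g := U_hom_ext fun m => by
  rw [GrMod.lin_comp, GrMod.lin_comp, lin_mapU_br, lin_descHom, lin_descHom,
    (GrMod.lin g).map_smul, ← h, (GrMod.lin f).map_smul]

lemma map_descHom' {f : M ⟶ M'} {g : N ⟶ N'} {φ : M.carrier →+ N.carrier}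
    {φ' : M'.carrier →+ N'.carrier} (hφ : ∀ k, ∀ m ∈ M.gr k, φ m ∈ N.gr (k - 2))
    (hφ' : ∀ k, ∀ m ∈ M'.gr k, φ' m ∈ N'.gr (k - 2))
    (h : ∀ m, φ' (GrMod.lin f m) = GrMod.lin g (φ m)) :
    mapU' i f ≫ descHom' i φ' hφ' = descHom' i φ hφ ≫ g := U'_hom_ext fun m => by
  rw [GrMod.lin_comp, GrMod.lin_comp, lin_mapU'_br', lin_descHom', lin_descHom',
    (GrMod.lin g).map_smul, ← h, (GrMod.lin f).map_smul]

lemma cX_map (f : M ⟶ N) (t : (U i M).carrier) :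
    cX i N (GrMod.lin (mapU i f) t) = GrMod.lin f (cX i M t) := by
  induction t using Tens_induction with
  | h0 => simp only [map_zero]
  | hadd s t h₁ h₂ => rw [map_add, map_add, map_add, map_add, h₁, h₂]
  | h a m => rw [map_smul, lin_mapU_br, cX_smul_br, cX_smul_br, map_zsmul, map_smul]

lemma mapU'_toU' (f : M ⟶ N) (t : (U i M).carrier) :
    GrMod.lin (mapU' i f) (toU' i M t) = toU' i N (GrMod.lin (mapU i f) t) := by
  induction t using Tens_induction with
  | h0 => simp only [map_zero]
  | hadd s t h₁ h₂ => rw [map_add, map_add, map_add, map_add, h₁, h₂]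
  | h a m =>
    rw [map_smul, map_smul, map_smul, map_smul, ← br'_apply, lin_mapU'_br', lin_mapU_br, br'_apply]

lemma cX'_map (f : M ⟶ N) (t : (U' i M).carrier) :
    cX' i N (GrMod.lin (mapU' i f) t) = GrMod.lin f (cX' i M t) := by
  rw [cX'_apply, cX'_apply, ← cX_map, ← toU'_ofU' i M t, mapU'_toU', ofU'_toU', ofU'_toU']

variable (i j)

/-- The insertion `x ⊗ y ⊗ m ↦ x ⊗ (i) ⊗ (i) ⊗ y ⊗ m`. -/
noncomputable def iotaM (M : GrMod.{u} n) : U i M ⟶ U i (U i M) :=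
  descHom i ((br i (U i M)).comp (br i M)) fun _ _ hm => br_mem (br_mem hm)

/-- The insertion, with values in `U_i U'_i`. -/
noncomputable def iotaUU'M (M : GrMod.{u} n) : U' i M ⟶ U i (U' i M) :=
  descHom' i ((br i (U' i M)).comp (br' i M)) fun _ _ hm => br_mem (br'_mem hm)

/-- The insertion, with values in `U'_i U_i`. -/
noncomputable def iotaU'UM (M : GrMod.{u} n) : U' i M ⟶ U' i (U i M) :=
  descHom' i ((br' i (U i M)).comp (br i M)) fun _ _ hm => br'_mem (br_mem hm)

/-- The contraction of the inner factor `(i) A_n (i)` of `U_i U'_i` by the coefficient of `X_i`. -/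
noncomputable def contrUU'M (M : GrMod.{u} n) : U i (U' i M) ⟶ U i M :=
  descHom i ((br i M).comp (cX' i M)) fun _ _ hm => br_mem (cX'_mem hm)

/-- The contraction of the inner factor `(i) A_n (i)` of `U'_i U_i` by the coefficient of `X_i`. -/
noncomputable def contrU'UM (M : GrMod.{u} n) : U' i (U i M) ⟶ U i M :=
  descHom' i ((br i M).comp (cX i M)) fun _ _ hm => br_mem (cX_mem hm)

/-- The map `t ↦ (i) ⊗ (i|j) ⊗ (j|i) ⊗ m` from `U_i M` to `U_i U_j U_i M`, where `m` is the
coefficient of `X_i` in `t`. -/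
noncomputable def rhoFun (M : GrMod.{u} n) : (U i M).carrier →+ (U i (U j (U i M))).carrier :=
  (br i (U j (U i M))).comp <| (smulHom (U j (U i M)) (arr i j)).comp <|
    (br j (U i M)).comp <| (smulHom (U i M) (arr j i)).comp <| (br i M).comp (cX i M)

lemma rhoFun_apply (M : GrMod.{u} n) (t : (U i M).carrier) : rhoFun i j M t =
    br i _ (arr i j • br j _ (arr j i • br i _ (cX i _ t))) := rfl

lemma rhoFun_mem (M : GrMod.{u} n) (k : ℤ) (t : (U i M).carrier) (ht : t ∈ (U i M).gr k) :
    rhoFun i j M t ∈ (U i (U j (U i M))).gr k :=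
  br_mem <| GrMod.gr_congr _ (by ring) <| (U j (U i M)).smul_mem (arr_mem i j) <|
    br_mem <| (U i M).smul_mem (arr_mem j i) (br_mem (cX_mem ht))

/-- The map that replaces the factor `X_i` in `(i) A_n (i)` by `(i|j) ⊗ (j|i)`. -/
noncomputable def rhoM (M : GrMod.{u} n) : U i (U i M) ⟶ U i (U j (U i M)) :=
  descHom i (rhoFun i j M) (rhoFun_mem i j M)

/-- `iotaM` as a natural transformation. -/
noncomputable def iota : tensF.{u} (PP i) ⟶ tensF (PP i) ⋙ tensF (PP i) where
  app M := iotaM i M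
  naturality _ _ _ := map_descHom (N := U i (U i _)) (N' := U i (U i _)) _ _ fun _ => rfl

/-- `iotaUU'M` as a natural transformation. -/
noncomputable def iotaUU' : tensF.{u} ((PP i).sh 2) ⟶ tensF ((PP i).sh 2) ⋙ tensF (PP i) where
  app M := iotaUU'M i M
  naturality _ _ _ := map_descHom' (N := U i (U' i _)) (N' := U i (U' i _)) _ _ fun _ => rfl

/-- `iotaU'UM` as a natural transformation. -/
noncomputable def iotaU'U : tensF.{u} ((PP i).sh 2) ⟶ tensF (PP i) ⋙ tensF ((PP i).sh 2) where
  app M := iotaU'UM i M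
  naturality _ _ _ := map_descHom' (N := U' i (U i _)) (N' := U' i (U i _)) _ _ fun _ => rfl

/-- `contrUU'M` as a natural transformation. -/
noncomputable def contrUU' : tensF.{u} ((PP i).sh 2) ⋙ tensF (PP i) ⟶ tensF (PP i) where
  app M := contrUU'M i M
  naturality _ _ f := map_descHom (M := U' i _) (M' := U' i _) (N := U i _) (N' := U i _) _ _
    fun m => congrArg (br i _) (cX'_map f m)

/-- `contrU'UM` as a natural transformation. -/
noncomputable def contrU'U : tensF.{u} (PP i) ⋙ tensF ((PP i).sh 2) ⟶ tensF (PP i) where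
  app M := contrU'UM i M
  naturality _ _ f := map_descHom' (M := U i _) (M' := U i _) (N := U i _) (N' := U i _) _ _
    fun m => congrArg (br i _) (cX_map f m)

/-- `rhoM` as a natural transformation. -/
noncomputable def rho : tensF.{u} (PP i) ⋙ tensF (PP i) ⟶
    tensF (PP i) ⋙ tensF (PP j) ⋙ tensF (PP i) where
  app M := rhoM i j M
  naturality M N f := map_descHom (M := U i _) (M' := U i _) (N := U i (U j (U i _)))
    (N' := U i (U j (U i _))) (f := mapU i f) (g := mapU i (mapU j (mapU i f))) _ _ fun m => by
      rw [rhoFun_apply, rhoFun_apply, lin_mapU_br, map_smul (GrMod.lin (mapU j (mapU i f))),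
        lin_mapU_br, map_smul (GrMod.lin (mapU i f)), lin_mapU_br, cX_map]

end

/-! Compatibility with the shift of the internal grading. -/

section

open GrMod

variable {i j : Fin n} {M N : GrMod.{u} n} (d : ℤ)

/-- The identity map from `M` to `M⟨d⟩`. -/
def toSh (M : GrMod.{u} n) : M.carrier ≃ₗ[A n] (sh d M).carrier := LinearEquiv.refl (A n) M.carrier

/-- The shift of a morphism. -/
def shMap (f : M ⟶ N) : sh d M ⟶ sh d N := (shF d).map f

/-- The isomorphism `U_i M⟨d⟩ ≅ (U_i M)⟨d⟩`. -/
noncomputable def csU (i : Fin n) (d : ℤ) (M : GrMod.{u} n) : U i (sh d M) ⟶ sh d (U i M) :=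
    (tensSh (PP i) d M).hom

/-- The isomorphism `U'_i M⟨d⟩ ≅ (U'_i M)⟨d⟩`. -/
noncomputable def csU' (i : Fin n) (d : ℤ) (M : GrMod.{u} n) : U' i (sh d M) ⟶ sh d (U' i M) :=
    (tensSh ((PP i).sh 2) d M).hom

lemma toSh_symm_toSh (x : (sh d M).carrier) : toSh d M ((toSh d M).symm x) = x := rfl

lemma lin_shMap (f : M ⟶ N) (m : M.carrier) :
    lin (shMap d f) (toSh d M m) = toSh d N (lin f m) := rfl

lemma lin_csU_br (m : M.carrier) :
    lin (csU i d M) (br i (sh d M) (toSh d M m)) = toSh d (U i M) (br i M m) := rfl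

lemma lin_csU'_br' (m : M.carrier) :
    lin (csU' i d M) (br' i (sh d M) (toSh d M m)) = toSh d (U' i M) (br' i M m) := rfl

lemma cX_csU (t : (U i (sh d M)).carrier) :
    cX i (sh d M) t = toSh d M (cX i M ((toSh d (U i M)).symm (lin (csU i d M) t))) := by
  induction t using Tens_induction with
  | h0 => simp only [map_zero]
  | hadd s t h₁ h₂ => simp only [map_add, h₁, h₂]
  | h a m =>
    rw [← toSh_symm_toSh d m]
    generalize (toSh d M).symm m = m
    rw [map_smul (lin (csU i d M)), lin_csU_br, map_smul (toSh d (U i M)).symm,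
        LinearEquiv.symm_apply_apply, cX_smul_br,
      cX_smul_br, map_zsmul, map_smul]

lemma csU'_toU' (t : (U i (sh d M)).carrier) : lin (csU' i d M) (toU' i _ t) =
    toSh d (U' i M) (toU' i M ((toSh d (U i M)).symm (lin (csU i d M) t))) := by
  induction t using Tens_induction with
  | h0 => simp only [map_zero]
  | hadd s t h₁ h₂ => simp only [map_add, h₁, h₂]
  | h a m =>
    rw [← toSh_symm_toSh d m]
    generalize (toSh d M).symm m = m
    rw [map_smul (lin (csU i d M)), lin_csU_br, map_smul (toU' i _), ← br'_apply,
      map_smul (lin (csU' i d M)), lin_csU'_br', map_smul (toSh d (U i M)).symm,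
      LinearEquiv.symm_apply_apply, map_smul (toU' i M), map_smul (toSh d _), br'_apply]

lemma cX'_csU' (t : (U' i (sh d M)).carrier) :
    cX' i (sh d M) t = toSh d M (cX' i M ((toSh d (U' i M)).symm (lin (csU' i d M) t))) := by
  obtain ⟨t, rfl⟩ : ∃ s, toU' i _ s = t := ⟨_, toU'_ofU' i _ t⟩
  rw [csU'_toU', cX'_apply, ofU'_toU', cX_csU, LinearEquiv.symm_apply_apply, cX'_apply, ofU'_toU']

lemma shift_descHom {φ : M.carrier →+ N.carrier}
    (hφ : ∀ k, ∀ m ∈ M.gr k, φ m ∈ N.gr k) {M' N' : GrMod.{u} n} (f : M' ⟶ sh d M)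
    (g : N' ⟶ sh d N) {φ' : M'.carrier →+ N'.carrier}
    (hφ' : ∀ k, ∀ m ∈ M'.gr k, φ' m ∈ N'.gr k)
    (h : ∀ m m', lin f m = toSh d M m' → lin g (φ' m) = toSh d N (φ m')) :
    mapU i f ≫ csU i d M ≫ shMap d (descHom i φ hφ) = descHom i φ' hφ' ≫ g := by
  refine U_hom_ext fun m => ?_
  obtain ⟨m', hm'⟩ : ∃ m', lin f m = toSh d M m' := ⟨_, (toSh_symm_toSh d (lin f m)).symm⟩
  rw [lin_comp, lin_mapU_br, hm', lin_comp, lin_csU_br, lin_shMap, lin_descHom, lin_comp,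
    lin_descHom, map_smul (lin g), h (e i • m) (e i • m') (by rw [map_smul, map_smul, hm']),
    map_smul (toSh d N)]

lemma shift_descHom' {φ : M.carrier →+ N.carrier}
    (hφ : ∀ k, ∀ m ∈ M.gr k, φ m ∈ N.gr (k - 2)) {M' N' : GrMod.{u} n} (f : M' ⟶ sh d M)
    (g : N' ⟶ sh d N) {φ' : M'.carrier →+ N'.carrier}
    (hφ' : ∀ k, ∀ m ∈ M'.gr k, φ' m ∈ N'.gr (k - 2))
    (h : ∀ m m', lin f m = toSh d M m' → lin g (φ' m) = toSh d N (φ m')) :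
    mapU' i f ≫ csU' i d M ≫ shMap d (descHom' i φ hφ) = descHom' i φ' hφ' ≫ g := by
  refine U'_hom_ext fun m => ?_
  obtain ⟨m', hm'⟩ : ∃ m', lin f m = toSh d M m' := ⟨_, (toSh_symm_toSh d (lin f m)).symm⟩
  rw [lin_comp, lin_mapU'_br', hm', lin_comp, lin_csU'_br', lin_shMap, lin_descHom', lin_comp,
    lin_descHom', map_smul (lin g), h (e i • m) (e i • m') (by rw [map_smul, map_smul, hm']),
    map_smul (toSh d N)]

lemma mapU_id (M : GrMod.{u} n) : mapU i (𝟙 M) = 𝟙 _ := (tensF (PP i)).map_id M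

lemma mapU'_id (M : GrMod.{u} n) : mapU' i (𝟙 M) = 𝟙 _ := (tensF ((PP i).sh 2)).map_id M

end

section

variable (i j : Fin n)

lemma iota_shift (d : ℤ) (M : GrMod.{u} n) :
    csU i d M ≫ shMap d ((iota i).app M) =
      (iota i).app (GrMod.sh d M) ≫ mapU i (csU i d M) ≫ csU i d (U i M) := by
  have := shift_descHom (i := i) (M := M) (N := U i (U i M)) d
    (φ := (br i (U i M)).comp (br i M)) (fun _ _ hm => br_mem (br_mem hm)) (𝟙 _)
    (mapU i (csU i d M) ≫ csU i d (U i M))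
    (φ' := (br i (U i (GrMod.sh d M))).comp (br i (GrMod.sh d M)))
    (fun _ _ hm => br_mem (br_mem hm)) (fun m m' h => by
      have h' : m = toSh d M m' := h
      rw [h', GrMod.lin_comp, AddMonoidHom.comp_apply, lin_mapU_br, lin_csU_br, lin_csU_br]; rfl)
  rw [mapU_id, Category.id_comp] at this
  exact this

lemma iotaUU'_shift (d : ℤ) (M : GrMod.{u} n) :
    csU' i d M ≫ shMap d ((iotaUU' i).app M) =
      (iotaUU' i).app (GrMod.sh d M) ≫ mapU i (csU' i d M) ≫ csU i d (U' i M) := by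
  have := shift_descHom' (i := i) (M := M) (N := U i (U' i M)) d
    (φ := (br i (U' i M)).comp (br' i M)) (fun _ _ hm => br_mem (br'_mem hm)) (𝟙 _)
    (mapU i (csU' i d M) ≫ csU i d (U' i M))
    (φ' := (br i (U' i (GrMod.sh d M))).comp (br' i (GrMod.sh d M)))
    (fun _ _ hm => br_mem (br'_mem hm)) (fun m m' h => by
      have h' : m = toSh d M m' := h
      rw [h', GrMod.lin_comp, AddMonoidHom.comp_apply, lin_mapU_br, lin_csU'_br', lin_csU_br]; rfl)
  rw [mapU'_id, Category.id_comp] at this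
  exact this

lemma iotaU'U_shift (d : ℤ) (M : GrMod.{u} n) :
    csU' i d M ≫ shMap d ((iotaU'U i).app M) =
      (iotaU'U i).app (GrMod.sh d M) ≫ mapU' i (csU i d M) ≫ csU' i d (U i M) := by
  have := shift_descHom' (i := i) (M := M) (N := U' i (U i M)) d
    (φ := (br' i (U i M)).comp (br i M)) (fun _ _ hm => br'_mem (br_mem hm)) (𝟙 _)
    (mapU' i (csU i d M) ≫ csU' i d (U i M))
    (φ' := (br' i (U i (GrMod.sh d M))).comp (br i (GrMod.sh d M)))
    (fun _ _ hm => br'_mem (br_mem hm)) (fun m m' h => by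
      have h' : m = toSh d M m' := h
      rw [h', GrMod.lin_comp, AddMonoidHom.comp_apply, lin_mapU'_br', lin_csU_br,
          lin_csU'_br']; rfl)
  rw [mapU'_id, Category.id_comp] at this
  exact this

lemma contrUU'_shift (d : ℤ) (M : GrMod.{u} n) :
    mapU i (csU' i d M) ≫ csU i d (U' i M) ≫ shMap d ((contrUU' i).app M) =
      (contrUU' i).app (GrMod.sh d M) ≫ csU i d M :=
  shift_descHom (i := i) (M := U' i M) (N := U i M) d
    (φ := (br i M).comp (cX' i M)) (fun _ _ hm => br_mem (cX'_mem hm)) (csU' i d M) (csU i d M)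
    (φ' := (br i (GrMod.sh d M)).comp (cX' i (GrMod.sh d M)))
    (fun _ _ hm => br_mem (cX'_mem hm)) (fun m m' h => by
      rw [AddMonoidHom.comp_apply, cX'_csU', h, LinearEquiv.symm_apply_apply, lin_csU_br]; rfl)

lemma contrU'U_shift (d : ℤ) (M : GrMod.{u} n) :
    mapU' i (csU i d M) ≫ csU' i d (U i M) ≫ shMap d ((contrU'U i).app M) =
      (contrU'U i).app (GrMod.sh d M) ≫ csU i d M :=
  shift_descHom' (i := i) (M := U i M) (N := U i M) d
    (φ := (br i M).comp (cX i M)) (fun _ _ hm => br_mem (cX_mem hm)) (csU i d M) (csU i d M)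
    (φ' := (br i (GrMod.sh d M)).comp (cX i (GrMod.sh d M)))
    (fun _ _ hm => br_mem (cX_mem hm)) (fun m m' h => by
      rw [AddMonoidHom.comp_apply, cX_csU, h, LinearEquiv.symm_apply_apply, lin_csU_br]; rfl)

lemma rho_shift (d : ℤ) (M : GrMod.{u} n) :
    mapU i (csU i d M) ≫ csU i d (U i M) ≫ shMap d ((rho i j).app M) =
      (rho i j).app (GrMod.sh d M) ≫ mapU i (mapU j (csU i d M)) ≫ mapU i (csU j d (U i M)) ≫
        csU i d (U j (U i M)) :=
  shift_descHom (i := i) (M := U i M) (N := U i (U j (U i M))) d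
    (φ := rhoFun i j M) (rhoFun_mem i j M) (csU i d M)
    (mapU i (mapU j (csU i d M)) ≫ mapU i (csU j d (U i M)) ≫ csU i d (U j (U i M)))
    (φ' := rhoFun i j (GrMod.sh d M)) (rhoFun_mem i j (GrMod.sh d M)) (fun m m' h => by
      rw [rhoFun_apply, GrMod.lin_comp, GrMod.lin_comp, lin_mapU_br,
        map_smul (GrMod.lin (mapU j (csU i d M))), lin_mapU_br,
        map_smul (GrMod.lin (csU j d (U i M))), lin_mapU_br, map_smul (GrMod.lin (csU i d M)),
        cX_csU, h, LinearEquiv.symm_apply_apply, lin_csU_br, ← map_smul (toSh d (U i M)),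
            lin_csU_br,
        ← map_smul (toSh d (U j (U i M))), lin_csU_br, rhoFun_apply])

instance : NatTrans.CommShift (iota.{u} i) IntDeg where
  shift_comm d := NatTrans.ext (funext fun M => by
    rw [NatTrans.comp_app, NatTrans.comp_app, Functor.commShiftIso_comp_hom_app]
    exact iota_shift i d M)

instance : NatTrans.CommShift (iotaUU'.{u} i) IntDeg where
  shift_comm d := NatTrans.ext (funext fun M => by
    rw [NatTrans.comp_app, NatTrans.comp_app, Functor.commShiftIso_comp_hom_app]
    exact iotaUU'_shift i d M)

instance : NatTrans.CommShift (iotaU'U.{u} i) IntDeg where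
  shift_comm d := NatTrans.ext (funext fun M => by
    rw [NatTrans.comp_app, NatTrans.comp_app, Functor.commShiftIso_comp_hom_app]
    exact iotaU'U_shift i d M)

instance : NatTrans.CommShift (contrUU'.{u} i) IntDeg where
  shift_comm d := NatTrans.ext (funext fun M => by
    rw [NatTrans.comp_app, NatTrans.comp_app, Functor.commShiftIso_comp_hom_app, Category.assoc]
    exact contrUU'_shift i d M)

instance : NatTrans.CommShift (contrU'U.{u} i) IntDeg where
  shift_comm d := NatTrans.ext (funext fun M => by
    rw [NatTrans.comp_app, NatTrans.comp_app, Functor.commShiftIso_comp_hom_app, Category.assoc]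
    exact contrU'U_shift i d M)

instance : NatTrans.CommShift (rho.{u} i j) IntDeg where
  shift_comm d := NatTrans.ext (funext fun M => by
    rw [NatTrans.comp_app, NatTrans.comp_app, Functor.commShiftIso_comp_hom_app,
      Functor.commShiftIso_comp_hom_app, Functor.commShiftIso_comp_hom_app, Category.assoc]
    exact rho_shift i j d M)

/-! Relations between these maps. -/

variable (M : GrMod.{u} n)

lemma lin_iotaM (m : M.carrier) : GrMod.lin (iotaM i M) (br i M m) = br i _ (br i _ m) := by
  have h : GrMod.lin (iotaM i M) (br i M m) = e i • br i _ (br i _ (e i • m)) :=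
    lin_descHom ((br i (U i M)).comp (br i M)) (fun _ _ hm => br_mem (br_mem hm)) m
  rw [h, e_smul_br, br_e_smul]

lemma lin_iotaUU'M (m : M.carrier) :
    GrMod.lin (iotaUU'M i M) (br' i M m) = br i _ (br' i _ m) := by
  have h : GrMod.lin (iotaUU'M i M) (br' i M m) = e i • br i _ (br' i _ (e i • m)) :=
    lin_descHom' ((br i (U' i M)).comp (br' i M)) (fun _ _ hm => br_mem (br'_mem hm)) m
  rw [h, e_smul_br, br'_e_smul]

lemma lin_iotaU'UM (m : M.carrier) :
    GrMod.lin (iotaU'UM i M) (br' i M m) = br' i _ (br i _ m) := by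
  have h : GrMod.lin (iotaU'UM i M) (br' i M m) = e i • br' i _ (br i _ (e i • m)) :=
    lin_descHom' ((br' i (U i M)).comp (br i M)) (fun _ _ hm => br'_mem (br_mem hm)) m
  rw [h, e_smul_br', br_e_smul]

lemma lin_contrUU'M (t : (U' i M).carrier) :
    GrMod.lin (contrUU'M i M) (br i (U' i M) t) = br i M (cX' i M t) := by
  have h : GrMod.lin (contrUU'M i M) (br i (U' i M) t) = e i • br i M (cX' i M (e i • t)) :=
    lin_descHom ((br i M).comp (cX' i M)) (fun _ _ hm => br_mem (cX'_mem hm)) t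
  rw [h, cX'_e_smul, e_smul_br]

lemma lin_contrU'UM (t : (U i M).carrier) :
    GrMod.lin (contrU'UM i M) (br' i (U i M) t) = br i M (cX i M t) := by
  have h : GrMod.lin (contrU'UM i M) (br' i (U i M) t) = e i • br i M (cX i M (e i • t)) :=
    lin_descHom' ((br i M).comp (cX i M)) (fun _ _ hm => br_mem (cX_mem hm)) t
  rw [h, cX_e_smul, e_smul_br]

lemma lin_rhoM (t : (U i M).carrier) : GrMod.lin (rhoM i j M) (br i (U i M) t) =
    rhoFun i j M t := by
  have h : GrMod.lin (rhoM i j M) (br i (U i M) t) = e i • rhoFun i j M (e i • t) :=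
    lin_descHom (rhoFun i j M) (rhoFun_mem i j M) t
  rw [h, rhoFun_apply, cX_e_smul, e_smul_br, rhoFun_apply]

variable {i j M} in
lemma UU_hom_ext {N : GrMod.{u} n} {f g : U i (U i M) ⟶ N}
    (h₁ : ∀ m, GrMod.lin f (br i _ (br i M m)) = GrMod.lin g (br i _ (br i M m)))
    (h₂ : ∀ m, GrMod.lin f (br i _ (X i • br i M m)) = GrMod.lin g (br i _ (X i • br i M m))) :
    f = g := U_hom_ext fun t => by
  rw [← br_e_smul]
  exact corner_ext (f := (GrMod.lin f).toAddMonoidHom.comp (br i _))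
    (g := (GrMod.lin g).toAddMonoidHom.comp (br i _)) h₁ h₂ t

variable {i j M} in
lemma UU'_hom_ext {N : GrMod.{u} n} {f g : U i (U' i M) ⟶ N}
    (h₁ : ∀ m, GrMod.lin f (br i _ (br' i M m)) = GrMod.lin g (br i _ (br' i M m)))
    (h₂ : ∀ m, GrMod.lin f (br i _ (X i • br' i M m)) = GrMod.lin g (br i _ (X i • br' i M m))) :
    f = g := U_hom_ext fun t => by
  rw [← br_e_smul]
  exact corner_ext' (f := (GrMod.lin f).toAddMonoidHom.comp (br i _))
    (g := (GrMod.lin g).toAddMonoidHom.comp (br i _)) h₁ h₂ t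

variable {i j M} in
lemma U'U_hom_ext {N : GrMod.{u} n} {f g : U' i (U i M) ⟶ N}
    (h₁ : ∀ m, GrMod.lin f (br' i _ (br i M m)) = GrMod.lin g (br' i _ (br i M m)))
    (h₂ : ∀ m, GrMod.lin f (br' i _ (X i • br i M m)) = GrMod.lin g (br' i _ (X i • br i M m))) :
    f = g := U'_hom_ext fun t => by
  rw [← br'_e_smul]
  exact corner_ext (f := (GrMod.lin f).toAddMonoidHom.comp (br' i _))
    (g := (GrMod.lin g).toAddMonoidHom.comp (br' i _)) h₁ h₂ t

variable {i j M} in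
lemma UUU_hom_ext (hij : i ≠ j) {N : GrMod.{u} n} {f g : U i (U j (U i M)) ⟶ N}
    (h : ∀ m, GrMod.lin f (br i _ (arr i j • br j _ (arr j i • br i M m))) =
      GrMod.lin g (br i _ (arr i j • br j _ (arr j i • br i M m)))) :
    f = g := U_hom_ext fun t => by
  rw [← br_e_smul]
  refine corner_ext_of_ne (f := (GrMod.lin f).toAddMonoidHom.comp (br i _))
    (g := (GrMod.lin g).toAddMonoidHom.comp (br i _)) hij (fun s => ?_) t
  rw [← br_e_smul]
  exact corner_ext_of_ne (f := ((GrMod.lin f).toAddMonoidHom.comp (br i _)).comp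
      ((smulHom (U j (U i M)) (arr i j)).comp (br j _)))
    (g := ((GrMod.lin g).toAddMonoidHom.comp (br i _)).comp
      ((smulHom (U j (U i M)) (arr i j)).comp (br j _))) hij.symm h s

lemma iota_beta : iotaM i M ≫ betaM i (U i M) = 𝟙 _ := U_hom_ext fun m => by
  rw [GrMod.lin_comp, lin_iotaM, lin_betaM_br, e_smul_br, GrMod.lin_id]

lemma iota_map_beta : iotaM i M ≫ mapU i (betaM i M) = 𝟙 _ := U_hom_ext fun m => by
  rw [GrMod.lin_comp, lin_iotaM, lin_mapU_br, lin_betaM_br, br_e_smul, GrMod.lin_id]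

lemma iotaUU'_beta : iotaUU'M i M ≫ betaM i (U' i M) = 𝟙 _ := U'_hom_ext fun m => by
  rw [GrMod.lin_comp, lin_iotaUU'M, lin_betaM_br, e_smul_br', GrMod.lin_id]

lemma iotaUU'_contr : iotaUU'M i M ≫ contrUU'M i M = 0 := U'_hom_ext fun m => by
  rw [GrMod.lin_comp, lin_iotaUU'M, lin_contrUU'M, cX'_br', map_zero, GrMod.lin_zero]

lemma map_gamma_contr : mapU i (gammaM i M) ≫ contrUU'M i M = 𝟙 _ := U_hom_ext fun m => by
  rw [GrMod.lin_comp, lin_mapU_br, lin_contrUU'M, ← cX'_e_smul, e_smul_gammaM, map_add, cX'_br',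
    cX'_X_br', zero_add, br_e_smul, GrMod.lin_id]

lemma iotaU'U_map_beta : iotaU'UM i M ≫ mapU' i (betaM i M) = 𝟙 _ := U'_hom_ext fun m => by
  rw [GrMod.lin_comp, lin_iotaU'UM, lin_mapU'_br', lin_betaM_br, br'_e_smul, GrMod.lin_id]

lemma iotaU'U_contr : iotaU'UM i M ≫ contrU'UM i M = 0 := U'_hom_ext fun m => by
  rw [GrMod.lin_comp, lin_iotaU'UM, lin_contrU'UM, cX_br, map_zero, GrMod.lin_zero]

/-- `γ_i` on `e_i U_i M`. -/
lemma gammaM_br (m : M.carrier) : GrMod.lin (gammaM i (U i M)) (br i M m) =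
    br' i _ (X i • br i M m) + X i • br' i _ (br i M m) := by
  rw [← gammaM_e_smul, e_smul_br]

lemma gamma_contr : gammaM i (U i M) ≫ contrU'UM i M = 𝟙 _ := U_hom_ext fun m => by
  rw [GrMod.lin_comp, gammaM_br, map_add, map_smul (GrMod.lin (contrU'UM i M)), lin_contrU'UM,
    lin_contrU'UM, cX_X_br, cX_br, map_zero, smul_zero, add_zero, br_e_smul, GrMod.lin_id]

lemma lin_sub {M N : GrMod.{u} n} (f g : M ⟶ N) (m : M.carrier) :
    GrMod.lin (f - g) m = GrMod.lin f m - GrMod.lin g m := by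
  rw [eq_sub_iff_add_eq, ← GrMod.lin_add, sub_add_cancel]

/-- The splitting of `U_i U'_i`. -/
lemma split_UU' : contrUU'M i M ≫ mapU i (gammaM i M) + betaM i (U' i M) ≫ iotaUU'M i M =
    𝟙 _ + contrUU'M i M ≫ betaM i M ≫ gammaM i M ≫ iotaUU'M i M := by
  refine UU'_hom_ext (fun m => ?_) fun m => ?_
  all_goals simp only [GrMod.lin_add, GrMod.lin_comp, GrMod.lin_id, lin_contrUU'M, lin_betaM_br,
    lin_mapU_br]
  · simp only [cX'_br', map_zero, smul_zero]
    rw [e_smul_br', lin_iotaUU'M, zero_add, add_zero]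
  · rw [cX'_X_br', ← mul_smul (e i) (e i), e_mul_e, gammaM_e_smul,
      ← mul_smul, e_mul_X, map_add, map_add,
      map_smul (GrMod.lin (iotaUU'M i M)), lin_iotaUU'M, lin_iotaUU'M]
    abel

/-- The splitting of `U'_i U_i`. -/
lemma split_U'U : contrU'UM i M ≫ gammaM i (U i M) + mapU' i (betaM i M) ≫ iotaU'UM i M =
    𝟙 _ + contrU'UM i M ≫ betaM i M ≫ gammaM i M ≫ iotaU'UM i M := by
  refine U'U_hom_ext (fun m => ?_) fun m => ?_
  all_goals simp only [GrMod.lin_add, GrMod.lin_comp, GrMod.lin_id, lin_contrU'UM,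
    lin_mapU'_br']
  · rw [cX_br, map_zero, map_zero, map_zero, map_zero, map_zero, lin_betaM_br, br'_e_smul,
      lin_iotaU'UM, zero_add, add_zero]
  · rw [cX_X_br, br_e_smul, gammaM_br, lin_betaM_br, gammaM_e_smul,
      map_smul (GrMod.lin (betaM i M)), lin_betaM_br, ← mul_smul, X_mul_e, lin_iotaU'UM, map_add,
      map_smul (GrMod.lin (iotaU'UM i M)), lin_iotaU'UM, lin_iotaU'UM]
    abel

lemma map_beta_rho (h : Adj i j) :
    mapU i (betaM j (U i M)) ≫ rhoM i j M = 𝟙 (U i (U j (U i M))) := by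
  refine UUU_hom_ext (fun h' => by subst h'; unfold Adj at h; omega) fun m => ?_
  rw [GrMod.lin_comp, lin_mapU_br, map_smul (GrMod.lin (betaM j (U i M))), lin_betaM_br,
    ← mul_smul, ← mul_smul, arr_mul_e, arr_mul_arr h, lin_rhoM, rhoFun_apply, cX_X_br,
    br_e_smul, GrMod.lin_id]

lemma rho_beta (h : Adj i j) :
    rhoM i j M ≫ mapU i (betaM j (U i M)) ≫ (betaM i (U i M) - mapU i (betaM i M)) =
      betaM i (U i M) - mapU i (betaM i M) := by
  refine UU_hom_ext (fun m => ?_) fun m => ?_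
  · rw [GrMod.lin_comp, lin_rhoM, rhoFun_apply, cX_br]
    simp only [map_zero, smul_zero]
    rw [lin_sub, lin_betaM_br, lin_mapU_br, lin_betaM_br,
      e_smul_br, br_e_smul, sub_self]
  · rw [GrMod.lin_comp, lin_rhoM, rhoFun_apply, cX_X_br, br_e_smul, GrMod.lin_comp, lin_mapU_br,
      map_smul (GrMod.lin (betaM j (U i M))), lin_betaM_br, ← mul_smul, ← mul_smul, arr_mul_e,
      arr_mul_arr h]

lemma U_far (h₁ : i ≠ j) (h₂ : ¬ Adj i j) : 𝟙 (U i (U j M)) = 0 := U_hom_ext fun t => by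
  rw [GrMod.lin_id, GrMod.lin_zero, ← br_e_smul]
  refine corner_ext_of_ne (f := br i (U j M)) (g := 0) h₁ (fun m => ?_) t
  rw [arr_of_not h₂, zero_smul, map_zero, map_zero]

end

end

/-! ### Coordinates on the cones of natural transformations -/

section Coordinates

open CochainComplex hiding shiftFunctor shiftFunctorZero' shiftFunctorAdd'
open CochainComplex.HomComplex

variable {C : Type u} [Category.{v} C] [Preadditive C]

/-- The component `U M ⟶ M` of a transformation `U ⟶ 𝟭`. -/
abbrev toOne {U : C ⥤ C} (β : U ⟶ 𝟭 C) (M : C) : U.obj M ⟶ M := β.app M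

/-- The component `M ⟶ U M` of a transformation `𝟭 ⟶ U`. -/
abbrev fromOne {U : C ⥤ C} (γ : 𝟭 C ⟶ U) (M : C) : M ⟶ U.obj M := γ.app M

section Positive

variable [HasBinaryBiproducts C] {U : C ⥤ C} [U.Additive] (β : U ⟶ 𝟭 C)

/-- The functor `K ↦ cone (β_K : U K → K)`. -/
noncomputable abbrev posF : CochainComplex C ℤ ⥤ CochainComplex C ℤ := coneF (extTo β)

variable (K L : CochainComplex C ℤ) {p q r : ℤ}

/-- The inclusion of the summand `U K^{p+1}` of the cone of `β_K` in degree `p`. -/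
noncomputable def inU (h : p + 1 = q) : U.obj (K.X q) ⟶ ((posF β).obj K).X p :=
  (mappingCone.inl ((extTo β).app K)).v q p (by omega)

/-- The inclusion of the summand `K^p` of the cone of `β_K` in degree `p`. -/
noncomputable def inK (p : ℤ) : K.X p ⟶ ((posF β).obj K).X p :=
  (mappingCone.inr ((extTo β).app K)).f p

/-- The projection to the summand `U K^{p+1}` of the cone of `β_K` in degree `p`. -/
noncomputable def prU (h : p + 1 = q) : ((posF β).obj K).X p ⟶ U.obj (K.X q) :=
  (mappingCone.fst ((extTo β).app K)).1.v p q h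

/-- The projection to the summand `K^p` of the cone of `β_K` in degree `p`. -/
noncomputable def prK (p : ℤ) : ((posF β).obj K).X p ⟶ K.X p :=
  (mappingCone.snd ((extTo β).app K)).v p p (add_zero p)

lemma inU_prU (h : p + 1 = q) : inU β K h ≫ prU β K h = 𝟙 _ :=
  mappingCone.inl_v_fst_v _ _ _ _

lemma inU_prK (h : p + 1 = q) : inU β K h ≫ prK β K p = 0 :=
  mappingCone.inl_v_snd_v _ _ _ _

lemma inK_prU (h : p + 1 = q) : inK β K p ≫ prU β K h = 0 :=
  mappingCone.inr_f_fst_v _ _ _ _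

lemma inK_prK (p : ℤ) : inK β K p ≫ prK β K p = 𝟙 _ :=
  mappingCone.inr_f_snd_v _ _

lemma pos_split (h : p + 1 = q) : prU β K h ≫ inU β K h + prK β K p ≫ inK β K p = 𝟙 _ :=
  mappingCone.id_X _ _ _ _

lemma inU_d (h : p + 1 = q) (h' : q + 1 = r) : inU β K h ≫ ((posF β).obj K).d p q =
    toOne β (K.X q) ≫ inK β K q - U.map (K.d q r) ≫ inU β K h' :=
  mappingCone.inl_v_d _ _ _ _ _ _

lemma inK_d (p q : ℤ) : inK β K p ≫ ((posF β).obj K).d p q = K.d p q ≫ inK β K q :=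
  mappingCone.inr_f_d _ _ _

section

variable (G : C ⥤ C) [G.Additive] {Y : C}

lemma inU_d_assoc (h : p + 1 = q) (h' : q + 1 = r) (t : ((posF β).obj K).X q ⟶ Y) :
    inU β K h ≫ ((posF β).obj K).d p q ≫ t =
      toOne β (K.X q) ≫ inK β K q ≫ t - U.map (K.d q r) ≫ inU β K h' ≫ t := by
  rw [← Category.assoc, inU_d β K h h', Preadditive.sub_comp, Category.assoc, Category.assoc]

lemma inK_d_assoc (p q : ℤ) (t : ((posF β).obj K).X q ⟶ Y) :
    inK β K p ≫ ((posF β).obj K).d p q ≫ t = K.d p q ≫ inK β K q ≫ t := by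
  rw [← Category.assoc, inK_d, Category.assoc]

lemma map_inU_d (h : p + 1 = q) (h' : q + 1 = r) :
    G.map (inU β K h) ≫ G.map (((posF β).obj K).d p q) = G.map (toOne β (K.X q)) ≫
      G.map (inK β K q) - G.map (U.map (K.d q r)) ≫ G.map (inU β K h') := by
  rw [← G.map_comp, inU_d β K h h', G.map_sub, G.map_comp, G.map_comp]

lemma map_inU_d_assoc (h : p + 1 = q) (h' : q + 1 = r) (t : G.obj (((posF β).obj K).X q) ⟶ Y) :
    G.map (inU β K h) ≫ G.map (((posF β).obj K).d p q) ≫ t = G.map (toOne β (K.X q)) ≫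
      G.map (inK β K q) ≫ t - G.map (U.map (K.d q r)) ≫ G.map (inU β K h') ≫ t := by
  rw [← Category.assoc, map_inU_d β K G h h', Preadditive.sub_comp, Category.assoc, Category.assoc]

omit [G.Additive] in
lemma map_inK_d (p q : ℤ) : G.map (inK β K p) ≫ G.map (((posF β).obj K).d p q) =
    G.map (K.d p q) ≫ G.map (inK β K q) := by
  rw [← G.map_comp, inK_d, G.map_comp]

omit [G.Additive] in
lemma map_inK_d_assoc (p q : ℤ) (t : G.obj (((posF β).obj K).X q) ⟶ Y) :
    G.map (inK β K p) ≫ G.map (((posF β).obj K).d p q) ≫ t =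
      G.map (K.d p q) ≫ G.map (inK β K q) ≫ t := by
  rw [← Category.assoc, map_inK_d, Category.assoc]

lemma inU_prU_assoc (h : p + 1 = q) (t : U.obj (K.X q) ⟶ Y) :
    inU β K h ≫ prU β K h ≫ t = t := by
  rw [← Category.assoc, inU_prU, Category.id_comp]

lemma map_inU_prU (h : p + 1 = q) : G.map (inU β K h) ≫ G.map (prU β K h) = 𝟙 _ := by
  rw [← G.map_comp, inU_prU, CategoryTheory.Functor.map_id]

lemma map_inU_prU_assoc (h : p + 1 = q) (t : G.obj (U.obj (K.X q)) ⟶ Y) :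
    G.map (inU β K h) ≫ G.map (prU β K h) ≫ t = t := by
  rw [← Category.assoc, map_inU_prU, Category.id_comp]

lemma inU_prK_assoc (h : p + 1 = q) (t : K.X p ⟶ Y) :
    inU β K h ≫ prK β K p ≫ t = 0 := by
  rw [← Category.assoc, inU_prK, zero_comp]

lemma map_inU_prK (h : p + 1 = q) : G.map (inU β K h) ≫ G.map (prK β K p) = 0 := by
  rw [← G.map_comp, inU_prK, G.map_zero]

lemma map_inU_prK_assoc (h : p + 1 = q) (t : G.obj (K.X p) ⟶ Y) :
    G.map (inU β K h) ≫ G.map (prK β K p) ≫ t = 0 := by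
  rw [← Category.assoc, map_inU_prK, zero_comp]

lemma inK_prU_assoc (h : p + 1 = q) (t : U.obj (K.X q) ⟶ Y) :
    inK β K p ≫ prU β K h ≫ t = 0 := by
  rw [← Category.assoc, inK_prU, zero_comp]

lemma map_inK_prU (h : p + 1 = q) : G.map (inK β K p) ≫ G.map (prU β K h) = 0 := by
  rw [← G.map_comp, inK_prU, G.map_zero]

lemma map_inK_prU_assoc (h : p + 1 = q) (t : G.obj (U.obj (K.X q)) ⟶ Y) :
    G.map (inK β K p) ≫ G.map (prU β K h) ≫ t = 0 := by
  rw [← Category.assoc, map_inK_prU, zero_comp]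

lemma inK_prK_assoc (p : ℤ) (t : K.X p ⟶ Y) :
    inK β K p ≫ prK β K p ≫ t = t := by
  rw [← Category.assoc, inK_prK, Category.id_comp]

lemma map_inK_prK (p : ℤ) : G.map (inK β K p) ≫ G.map (prK β K p) = 𝟙 _ := by
  rw [← G.map_comp, inK_prK, CategoryTheory.Functor.map_id]

lemma map_inK_prK_assoc (p : ℤ) (t : G.obj (K.X p) ⟶ Y) :
    G.map (inK β K p) ≫ G.map (prK β K p) ≫ t = t := by
  rw [← Category.assoc, map_inK_prK, Category.id_comp]

end

variable {K L}

lemma pos_ext (h : p + 1 = q) {Y : C} {f g : ((posF β).obj K).X p ⟶ Y}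
    (h₁ : inU β K h ≫ f = inU β K h ≫ g) (h₂ : inK β K p ≫ f = inK β K p ≫ g) : f = g := by
  rw [← Category.id_comp f, ← Category.id_comp g, ← pos_split β K h]
  simp only [Preadditive.add_comp, Category.assoc, h₁, h₂]

lemma pos_ext_map (G : C ⥤ C) [G.Additive] (h : p + 1 = q) {Y : C}
    {f g : G.obj (((posF β).obj K).X p) ⟶ Y}
    (h₁ : G.map (inU β K h) ≫ f = G.map (inU β K h) ≫ g)
    (h₂ : G.map (inK β K p) ≫ f = G.map (inK β K p) ≫ g) : f = g := by
  rw [← Category.id_comp f, ← Category.id_comp g, ← G.map_id, ← pos_split β K h]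
  simp only [Functor.map_add, Functor.map_comp, Preadditive.add_comp, Category.assoc, h₁, h₂]

lemma inU_map (f : K ⟶ L) (h : p + 1 = q) :
    inU β K h ≫ ((posF β).map f).f p = U.map (f.f q) ≫ inU β L h :=
  inl_map ((extTo β).naturality f).symm p q (by omega)

lemma inK_map (f : K ⟶ L) (p : ℤ) : inK β K p ≫ ((posF β).map f).f p = f.f p ≫ inK β L p :=
  inr_map ((extTo β).naturality f).symm p

instance : (posF β).Additive where
  map_add {K L f g} := by
    ext p
    refine pos_ext β rfl ?_ ?_
    · rw [HomologicalComplex.add_f_apply, Preadditive.comp_add, inU_map, inU_map, inU_map,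
        HomologicalComplex.add_f_apply, U.map_add, Preadditive.add_comp]
    · rw [HomologicalComplex.add_f_apply, Preadditive.comp_add, inK_map, inK_map, inK_map,
        HomologicalComplex.add_f_apply, Preadditive.add_comp]

end Positive

section Negative

variable [HasBinaryBiproducts C] {U : C ⥤ C} [U.Additive] (γ : 𝟭 C ⟶ U)

/-- The functor `K ↦ cone (γ_K : K → U K)[-1]`. -/
noncomputable abbrev negF : CochainComplex C ℤ ⥤ CochainComplex C ℤ :=
  coneF (extFrom γ) ⋙ shiftFunctor _ (-1 : ℤ)

variable (K L : CochainComplex C ℤ) {p q r : ℤ}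

/-- The inclusion of the summand `K^p` of the desuspended cone of `γ_K` in degree `p`. -/
noncomputable def inK' (p : ℤ) : K.X p ⟶ ((negF γ).obj K).X p :=
  (mappingCone.inl ((extFrom γ).app K)).v p (p + -1) rfl

/-- The inclusion of the summand `U K^{q-1}` of the desuspended cone of `γ_K` in degree `q`. -/
noncomputable def inU' (h : p + 1 = q) : U.obj (K.X p) ⟶ ((negF γ).obj K).X q :=
  U.map (K.XIsoOfEq (show p = q + -1 by omega)).hom ≫
    (mappingCone.inr ((extFrom γ).app K)).f (q + -1)

/-- The projection to the summand `K^p` of the desuspended cone of `γ_K` in degree `p`. -/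
noncomputable def prK' (p : ℤ) : ((negF γ).obj K).X p ⟶ K.X p :=
  (mappingCone.fst ((extFrom γ).app K)).1.v (p + -1) p (by omega)

/-- The projection to the summand `U K^{q-1}` of the desuspended cone of `γ_K` in degree `q`. -/
noncomputable def prU' (h : p + 1 = q) : ((negF γ).obj K).X q ⟶ U.obj (K.X p) :=
  (mappingCone.snd ((extFrom γ).app K)).v (q + -1) (q + -1) (add_zero _) ≫
    U.map (K.XIsoOfEq (show q + -1 = p by omega)).hom

lemma inU'_eq (q : ℤ) : inU' γ K (show q + -1 + 1 = q by omega) =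
    (mappingCone.inr ((extFrom γ).app K)).f (q + -1) := by
  rw [inU', HomologicalComplex.XIsoOfEq_rfl, Iso.refl_hom]
  exact (congrArg (· ≫ _) (U.map_id _)).trans (Category.id_comp _)

lemma prU'_eq (q : ℤ) : prU' γ K (show q + -1 + 1 = q by omega) =
    (mappingCone.snd ((extFrom γ).app K)).v (q + -1) (q + -1) (add_zero _) := by
  rw [prU', HomologicalComplex.XIsoOfEq_rfl, Iso.refl_hom]
  exact (congrArg (_ ≫ ·) (U.map_id _)).trans (Category.comp_id _)

lemma inU'_prU' (h : p + 1 = q) : inU' γ K h ≫ prU' γ K h = 𝟙 _ := by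
  obtain rfl : p = q + -1 := by omega
  rw [inU'_eq, prU'_eq]
  exact mappingCone.inr_f_snd_v _ _

lemma inU'_prK' (h : p + 1 = q) : inU' γ K h ≫ prK' γ K q = 0 := by
  obtain rfl : p = q + -1 := by omega
  rw [inU'_eq]
  exact mappingCone.inr_f_fst_v _ _ _ _

lemma inK'_prU' (h : p + 1 = q) : inK' γ K q ≫ prU' γ K h = 0 := by
  obtain rfl : p = q + -1 := by omega
  rw [prU'_eq]
  exact mappingCone.inl_v_snd_v _ _ _ _

lemma inK'_prK' (p : ℤ) : inK' γ K p ≫ prK' γ K p = 𝟙 _ :=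
  mappingCone.inl_v_fst_v _ _ _ _

lemma neg_split (h : p + 1 = q) : prK' γ K q ≫ inK' γ K q + prU' γ K h ≫ inU' γ K h = 𝟙 _ := by
  obtain rfl : p = q + -1 := by omega
  rw [inU'_eq, prU'_eq]
  exact mappingCone.id_X _ _ _ _

lemma inK'_d (h : p + 1 = q) : inK' γ K p ≫ ((negF γ).obj K).d p q =
    K.d p q ≫ inK' γ K q - fromOne γ (K.X p) ≫ inU' γ K h := by
  obtain rfl : p = q + -1 := by omega
  rw [inU'_eq]
  have h₁ : ((negF γ).obj K).d (q + -1) q =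
      (-1 : ℤ).negOnePow • (mappingCone ((extFrom γ).app K)).d (q + -1 + -1) (q + -1) := rfl
  rw [h₁, Int.negOnePow_neg, Int.negOnePow_one, Units.neg_smul, one_smul]
  refine (Preadditive.comp_neg _ _).trans ?_
  refine (congrArg Neg.neg (mappingCone.inl_v_d ((extFrom γ).app K) (q + -1) (q + -1 + -1) q
    (by omega) (by omega))).trans ?_
  exact neg_sub _ _

lemma inU'_d (h : p + 1 = q) (h' : q + 1 = r) : inU' γ K h ≫ ((negF γ).obj K).d q r =
    - (U.map (K.d p q) ≫ inU' γ K h') := by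
  obtain rfl : p = q + -1 := by omega
  obtain rfl : q = r + -1 := by omega
  rw [inU'_eq, inU'_eq]
  have h₁ : ((negF γ).obj K).d (r + -1) r =
      (-1 : ℤ).negOnePow • (mappingCone ((extFrom γ).app K)).d (r + -1 + -1) (r + -1) := rfl
  rw [h₁, Int.negOnePow_neg, Int.negOnePow_one, Units.neg_smul, one_smul]
  exact (Preadditive.comp_neg _ _).trans
    (congrArg Neg.neg (mappingCone.inr_f_d ((extFrom γ).app K) (r + -1 + -1) (r + -1)))

section

variable (G : C ⥤ C) [G.Additive] {Y : C}

lemma inK'_d_assoc (h : p + 1 = q) (t : ((negF γ).obj K).X q ⟶ Y) :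
    inK' γ K p ≫ ((negF γ).obj K).d p q ≫ t =
      K.d p q ≫ inK' γ K q ≫ t - fromOne γ (K.X p) ≫ inU' γ K h ≫ t := by
  rw [← Category.assoc, inK'_d γ K h, Preadditive.sub_comp, Category.assoc, Category.assoc]

lemma inU'_d_assoc (h : p + 1 = q) (h' : q + 1 = r) (t : ((negF γ).obj K).X r ⟶ Y) :
    inU' γ K h ≫ ((negF γ).obj K).d q r ≫ t = - (U.map (K.d p q) ≫ inU' γ K h' ≫ t) := by
  rw [← Category.assoc, inU'_d γ K h h', Preadditive.neg_comp, Category.assoc]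

lemma map_inK'_d (h : p + 1 = q) : G.map (inK' γ K p) ≫ G.map (((negF γ).obj K).d p q) =
    G.map (K.d p q) ≫ G.map (inK' γ K q) - G.map (fromOne γ (K.X p)) ≫ G.map (inU' γ K h) := by
  rw [← G.map_comp, inK'_d γ K h, G.map_sub, G.map_comp, G.map_comp]

lemma map_inK'_d_assoc (h : p + 1 = q) (t : G.obj (((negF γ).obj K).X q) ⟶ Y) :
    G.map (inK' γ K p) ≫ G.map (((negF γ).obj K).d p q) ≫ t =
      G.map (K.d p q) ≫ G.map (inK' γ K q) ≫ t -
        G.map (fromOne γ (K.X p)) ≫ G.map (inU' γ K h) ≫ t := by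
  rw [← Category.assoc, map_inK'_d γ K G h, Preadditive.sub_comp, Category.assoc, Category.assoc]

lemma map_inU'_d (h : p + 1 = q) (h' : q + 1 = r) :
    G.map (inU' γ K h) ≫ G.map (((negF γ).obj K).d q r) =
      - (G.map (U.map (K.d p q)) ≫ G.map (inU' γ K h')) := by
  rw [← G.map_comp, inU'_d γ K h h', G.map_neg, G.map_comp]

lemma map_inU'_d_assoc (h : p + 1 = q) (h' : q + 1 = r)
    (t : G.obj (((negF γ).obj K).X r) ⟶ Y) :
    G.map (inU' γ K h) ≫ G.map (((negF γ).obj K).d q r) ≫ t =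
      - (G.map (U.map (K.d p q)) ≫ G.map (inU' γ K h') ≫ t) := by
  rw [← Category.assoc, map_inU'_d γ K G h h', Preadditive.neg_comp, Category.assoc]

lemma inU'_prU'_assoc (h : p + 1 = q) (t : U.obj (K.X p) ⟶ Y) :
    inU' γ K h ≫ prU' γ K h ≫ t = t := by
  rw [← Category.assoc, inU'_prU', Category.id_comp]

lemma map_inU'_prU' (h : p + 1 = q) : G.map (inU' γ K h) ≫ G.map (prU' γ K h) = 𝟙 _ := by
  rw [← G.map_comp, inU'_prU', CategoryTheory.Functor.map_id]

lemma map_inU'_prU'_assoc (h : p + 1 = q) (t : G.obj (U.obj (K.X p)) ⟶ Y) :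
    G.map (inU' γ K h) ≫ G.map (prU' γ K h) ≫ t = t := by
  rw [← Category.assoc, map_inU'_prU', Category.id_comp]

lemma inU'_prK'_assoc (h : p + 1 = q) (t : K.X q ⟶ Y) :
    inU' γ K h ≫ prK' γ K q ≫ t = 0 := by
  rw [← Category.assoc, inU'_prK', zero_comp]

lemma inK'_prU'_assoc (h : p + 1 = q) (t : U.obj (K.X p) ⟶ Y) :
    inK' γ K q ≫ prU' γ K h ≫ t = 0 := by
  rw [← Category.assoc, inK'_prU', zero_comp]

lemma map_inK'_prU' (h : p + 1 = q) : G.map (inK' γ K q) ≫ G.map (prU' γ K h) = 0 := by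
  rw [← G.map_comp, inK'_prU', G.map_zero]

lemma map_inK'_prU'_assoc (h : p + 1 = q) (t : G.obj (U.obj (K.X p)) ⟶ Y) :
    G.map (inK' γ K q) ≫ G.map (prU' γ K h) ≫ t = 0 := by
  rw [← Category.assoc, map_inK'_prU', zero_comp]

lemma inK'_prK'_assoc (p : ℤ) (t : K.X p ⟶ Y) :
    inK' γ K p ≫ prK' γ K p ≫ t = t := by
  rw [← Category.assoc, inK'_prK', Category.id_comp]

lemma map_inK'_prK' (p : ℤ) : G.map (inK' γ K p) ≫ G.map (prK' γ K p) = 𝟙 _ := by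
  rw [← G.map_comp, inK'_prK', CategoryTheory.Functor.map_id]

end

variable {K L}

lemma neg_ext (h : p + 1 = q) {Y : C} {f g : ((negF γ).obj K).X q ⟶ Y}
    (h₁ : inK' γ K q ≫ f = inK' γ K q ≫ g) (h₂ : inU' γ K h ≫ f = inU' γ K h ≫ g) : f = g := by
  rw [← Category.id_comp f, ← Category.id_comp g, ← neg_split γ K h]
  simp only [Preadditive.add_comp, Category.assoc, h₁, h₂]

lemma neg_ext_map (G : C ⥤ C) [G.Additive] (h : p + 1 = q) {Y : C}
    {f g : G.obj (((negF γ).obj K).X q) ⟶ Y}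
    (h₁ : G.map (inK' γ K q) ≫ f = G.map (inK' γ K q) ≫ g)
    (h₂ : G.map (inU' γ K h) ≫ f = G.map (inU' γ K h) ≫ g) : f = g := by
  rw [← Category.id_comp f, ← Category.id_comp g, ← G.map_id, ← neg_split γ K h]
  simp only [Functor.map_add, Functor.map_comp, Preadditive.add_comp, Category.assoc, h₁, h₂]

lemma inK'_map (f : K ⟶ L) (p : ℤ) : inK' γ K p ≫ ((negF γ).map f).f p = f.f p ≫ inK' γ L p :=
  inl_map ((extFrom γ).naturality f).symm (p + -1) p rfl

lemma inU'_map (f : K ⟶ L) (h : p + 1 = q) :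
    inU' γ K h ≫ ((negF γ).map f).f q = U.map (f.f p) ≫ inU' γ L h := by
  obtain rfl : p = q + -1 := by omega
  rw [inU'_eq, inU'_eq]
  exact inr_map ((extFrom γ).naturality f).symm (q + -1)

instance : (negF γ).Additive where
  map_add {K L f g} := by
    ext q
    refine neg_ext γ (show q + -1 + 1 = q by omega) ?_ ?_
    · rw [HomologicalComplex.add_f_apply, Preadditive.comp_add, inK'_map, inK'_map, inK'_map,
        HomologicalComplex.add_f_apply, Preadditive.add_comp]
    · rw [HomologicalComplex.add_f_apply, Preadditive.comp_add, inU'_map, inU'_map, inU'_map,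
        HomologicalComplex.add_f_apply, U.map_add, Preadditive.add_comp]

end Negative

/-! Homogeneous morphisms. -/

section Homogeneous

variable [HasShift C IntDeg] [∀ d : IntDeg, (shiftFunctor C d).Additive]
  {K L : CochainComplex C ℤ} {d : IntDeg} {p q : ℤ}

/-- The components of a homogeneous morphism of complexes. -/
def cmp (f : ShiftedHom K L d) (p : ℤ) : ShiftedHom (K.X p) (L.X p) d := f.f p

lemma cmp_comm (f : ShiftedHom K L d) (p q : ℤ) :
    cmp f p ≫ (shiftFunctor C d).map (L.d p q) = K.d p q ≫ cmp f q := f.comm p q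

lemma cmp_ext {f g : ShiftedHom K L d} (h : ∀ p, cmp f p = cmp g p) : f = g :=
  HomologicalComplex.hom_ext _ _ h

lemma commShift_id_f (L : CochainComplex C ℤ) (d : IntDeg) (p : ℤ) :
    (((𝟭 (CochainComplex C ℤ)).commShiftIso d).hom.app L).f p =
      𝟙 ((shiftFunctor C d).obj (L.X p)) := by
  rw [Functor.commShiftIso_id_hom_app]; rfl

variable [HasBinaryBiproducts C] {U : C ⥤ C} [U.Additive] [U.CommShift IntDeg]

lemma commShift_negF_f (γ : 𝟭 C ⟶ U) [NatTrans.CommShift γ IntDeg] (L : CochainComplex C ℤ)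
    (d : IntDeg) (p : ℤ) : (((negF γ).commShiftIso d).hom.app L).f p =
      (coneComm (extFrom γ) d L).hom.f (p + -1) := by
  rw [Functor.commShiftIso_comp_hom_app]
  exact Category.comp_id ((coneComm (extFrom γ) d L).hom.f (p + -1))

lemma inU_cmp (β : U ⟶ 𝟭 C) [NatTrans.CommShift β IntDeg] (f : ShiftedHom K L d) (h : p + 1 = q) :
    inU β K h ≫ cmp (f.map (posF β)) p =
      (cmp f q).map U ≫ (shiftFunctor C d).map (inU β L h) := by
  refine (square_comp (inU_map β f h) _).trans ?_
  refine (congrArg (U.map (f.f q) ≫ ·)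
    (inl_coneComm (extTo β) d L p q (by omega))).trans ?_
  exact (Category.assoc _ _ _).symm

lemma inK_cmp (β : U ⟶ 𝟭 C) [NatTrans.CommShift β IntDeg] (f : ShiftedHom K L d) (p : ℤ) :
    inK β K p ≫ cmp (f.map (posF β)) p = cmp f p ≫ (shiftFunctor C d).map (inK β L p) := by
  refine (square_comp (inK_map β f p) _).trans ?_
  refine (congrArg (f.f p ≫ ·) (inr_coneComm (extTo β) d L p)).trans ?_
  exact congrArg (f.f p ≫ ·) ((congrArg (· ≫ _) (commShift_id_f L d p)).trans (Category.id_comp _))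

lemma inK'_cmp (γ : 𝟭 C ⟶ U) [NatTrans.CommShift γ IntDeg] (f : ShiftedHom K L d) (p : ℤ) :
    inK' γ K p ≫ cmp (f.map (negF γ)) p = cmp f p ≫ (shiftFunctor C d).map (inK' γ L p) := by
  have h : cmp (f.map (negF γ)) p =
      ((negF γ).map f).f p ≫ (coneComm (extFrom γ) d L).hom.f (p + -1) := by
    exact congrArg (((negF γ).map f).f p ≫ ·) (commShift_negF_f γ L d p)
  rw [h]
  refine (square_comp (inK'_map γ f p) _).trans ?_
  refine (congrArg (f.f p ≫ ·) (inl_coneComm (extFrom γ) d L (p + -1) p rfl)).trans ?_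
  exact congrArg (f.f p ≫ ·) ((congrArg (· ≫ _) (commShift_id_f L d p)).trans (Category.id_comp _))

lemma inU'_cmp (γ : 𝟭 C ⟶ U) [NatTrans.CommShift γ IntDeg] (f : ShiftedHom K L d)
    (h : p + 1 = q) : inU' γ K h ≫ cmp (f.map (negF γ)) q =
      (cmp f p).map U ≫ (shiftFunctor C d).map (inU' γ L h) := by
  have h₁ : cmp (f.map (negF γ)) q =
      ((negF γ).map f).f q ≫ (coneComm (extFrom γ) d L).hom.f (q + -1) := by
    exact congrArg (((negF γ).map f).f q ≫ ·) (commShift_negF_f γ L d q)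
  rw [h₁]
  refine (square_comp (inU'_map γ f h) _).trans ?_
  obtain rfl : p = q + -1 := by omega
  rw [inU'_eq, inU'_eq]
  refine (congrArg (U.map (f.f (q + -1)) ≫ ·)
    (inr_coneComm (extFrom γ) d L (q + -1))).trans ?_
  exact (Category.assoc _ _ _).symm

variable {M N M' N' M'' N'' : C}

/-- A commutative square with two homogeneous sides of the same degree. -/
def HSq (a : M ⟶ M') (f : ShiftedHom M N d) (f' : ShiftedHom M' N' d) (b : N ⟶ N') : Prop :=
  a ≫ f' = f ≫ (shiftFunctor C d).map b

section HSq

omit [HasBinaryBiproducts C]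

namespace HSq

variable {a b : M ⟶ M'} {f : ShiftedHom M N d} {f' : ShiftedHom M' N' d}
  {f'' : ShiftedHom M'' N'' d} {a₁ b₁ : N ⟶ N'} {a' : M' ⟶ M''} {a₁' : N' ⟶ N''}

omit [Preadditive C] [∀ d : IntDeg, (shiftFunctor C d).Additive] in
lemma comp (h : HSq a f f' a₁) (h' : HSq a' f' f'' a₁') : HSq (a ≫ a') f f'' (a₁ ≫ a₁') := by
  unfold HSq at *
  rw [Category.assoc, h', ← Category.assoc, h, Category.assoc, Functor.map_comp]

lemma add (h : HSq a f f' a₁) (h' : HSq b f f' b₁) : HSq (a + b) f f' (a₁ + b₁) := by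
  unfold HSq at *
  rw [Preadditive.add_comp, h, h', Functor.map_add, Preadditive.comp_add]

lemma sub (h : HSq a f f' a₁) (h' : HSq b f f' b₁) : HSq (a - b) f f' (a₁ - b₁) := by
  unfold HSq at *
  rw [Preadditive.sub_comp, h, h', Functor.map_sub, Preadditive.comp_sub]

omit [Preadditive C] [∀ d : IntDeg, (shiftFunctor C d).Additive] in
lemma map (h : HSq a f f' a₁) (G : C ⥤ C) [G.CommShift IntDeg] :
    HSq (G.map a) (f.map G) (f'.map G) (G.map a₁) := by
  unfold HSq ShiftedHom.map at *
  rw [← Category.assoc, ← G.map_comp, h, G.map_comp, Category.assoc, Category.assoc]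
  exact congrArg (_ ≫ ·) ((G.commShiftIso d).hom.naturality a₁)

end HSq

omit [Preadditive C] [∀ d : IntDeg, (shiftFunctor C d).Additive] in
lemma hsq_app {F G : C ⥤ C} [F.CommShift IntDeg] [G.CommShift IntDeg] (α : F ⟶ G)
    [NatTrans.CommShift α IntDeg] (f : ShiftedHom M N d) :
    HSq (α.app M) (f.map F) (f.map G) (α.app N) := by
  have := f.map_naturality α
  rw [ShiftedHom.comp_mk₀, ShiftedHom.mk₀_comp] at this
  exact this.symm

omit [Preadditive C] [∀ d : IntDeg, (shiftFunctor C d).Additive] in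
lemma hsq_toOne (β : U ⟶ 𝟭 C) [NatTrans.CommShift β IntDeg] (f : ShiftedHom M N d) :
    HSq (toOne β M) (f.map U) f (toOne β N) := by
  have := hsq_app β f
  rwa [ShiftedHom.id_map] at this

omit [Preadditive C] [∀ d : IntDeg, (shiftFunctor C d).Additive] in
lemma hsq_fromOne (γ : 𝟭 C ⟶ U) [NatTrans.CommShift γ IntDeg] (f : ShiftedHom M N d) :
    HSq (fromOne γ M) f (f.map U) (fromOne γ N) := by
  have := hsq_app γ f
  rwa [ShiftedHom.id_map] at this

end HSq

variable (f : ShiftedHom K L d)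

lemma hsq_inU (β : U ⟶ 𝟭 C) [NatTrans.CommShift β IntDeg] (h : p + 1 = q) :
    HSq (inU β K h) ((cmp f q).map U) (cmp (f.map (posF β)) p) (inU β L h) := inU_cmp β f h

lemma hsq_inK (β : U ⟶ 𝟭 C) [NatTrans.CommShift β IntDeg] (p : ℤ) :
    HSq (inK β K p) (cmp f p) (cmp (f.map (posF β)) p) (inK β L p) := inK_cmp β f p

lemma hsq_inU' (γ : 𝟭 C ⟶ U) [NatTrans.CommShift γ IntDeg] (h : p + 1 = q) :
    HSq (inU' γ K h) ((cmp f p).map U) (cmp (f.map (negF γ)) q) (inU' γ L h) := inU'_cmp γ f h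

lemma hsq_inK' (γ : 𝟭 C ⟶ U) [NatTrans.CommShift γ IntDeg] (p : ℤ) :
    HSq (inK' γ K p) (cmp f p) (cmp (f.map (negF γ)) p) (inK' γ L p) := inK'_cmp γ f p

lemma hsq_prU (β : U ⟶ 𝟭 C) [NatTrans.CommShift β IntDeg] (h : p + 1 = q) :
    HSq (prU β K h) (cmp (f.map (posF β)) p) ((cmp f q).map U) (prU β L h) := by
  refine pos_ext β h ?_ ?_
  · rw [← Category.assoc, inU_prU, Category.id_comp, ← Category.assoc, inU_cmp β f h,
      Category.assoc, ← Functor.map_comp, inU_prU, CategoryTheory.Functor.map_id, Category.comp_id]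
  · rw [← Category.assoc, inK_prU, zero_comp, ← Category.assoc, inK_cmp,
      Category.assoc, ← Functor.map_comp, inK_prU, Functor.map_zero, comp_zero]

lemma hsq_prK (β : U ⟶ 𝟭 C) [NatTrans.CommShift β IntDeg] (p : ℤ) :
    HSq (prK β K p) (cmp (f.map (posF β)) p) (cmp f p) (prK β L p) := by
  refine pos_ext β rfl ?_ ?_
  · rw [← Category.assoc, inU_prK, zero_comp, ← Category.assoc, inU_cmp β f rfl,
      Category.assoc, ← Functor.map_comp, inU_prK, Functor.map_zero, comp_zero]
  · rw [← Category.assoc, inK_prK, Category.id_comp, ← Category.assoc, inK_cmp,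
      Category.assoc, ← Functor.map_comp, inK_prK, CategoryTheory.Functor.map_id, Category.comp_id]

lemma hsq_prU' (γ : 𝟭 C ⟶ U) [NatTrans.CommShift γ IntDeg] (h : p + 1 = q) :
    HSq (prU' γ K h) (cmp (f.map (negF γ)) q) ((cmp f p).map U) (prU' γ L h) := by
  refine neg_ext γ h ?_ ?_
  · rw [← Category.assoc, inK'_prU', zero_comp, ← Category.assoc, inK'_cmp,
      Category.assoc, ← Functor.map_comp, inK'_prU', Functor.map_zero, comp_zero]
  · rw [← Category.assoc, inU'_prU', Category.id_comp, ← Category.assoc, inU'_cmp γ f h,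
      Category.assoc, ← Functor.map_comp, inU'_prU', CategoryTheory.Functor.map_id,
          Category.comp_id]

lemma hsq_prK' (γ : 𝟭 C ⟶ U) [NatTrans.CommShift γ IntDeg] (p : ℤ) :
    HSq (prK' γ K p) (cmp (f.map (negF γ)) p) (cmp f p) (prK' γ L p) := by
  refine neg_ext γ (show p + -1 + 1 = p by omega) ?_ ?_
  · rw [← Category.assoc, inK'_prK', Category.id_comp, ← Category.assoc, inK'_cmp,
      Category.assoc, ← Functor.map_comp, inK'_prK', CategoryTheory.Functor.map_id,
          Category.comp_id]
  · rw [← Category.assoc, inU'_prK', zero_comp, ← Category.assoc,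
      inU'_cmp γ f (show p + -1 + 1 = p by omega),
      Category.assoc, ← Functor.map_comp, inU'_prK', Functor.map_zero, comp_zero]

end Homogeneous

end Coordinates

/-! ### The invertibility of the elementary complexes -/

section Invertibility

variable {C : Type u} [Category.{v} C] [Preadditive C] [HasBinaryBiproducts C]
  [HasShift C IntDeg] [∀ d : IntDeg, (shiftFunctor C d).Additive]

/-- A homotopy, in terms of maps that lower the degree by one. -/
def homotopyMk {K L : CochainComplex C ℤ} {f g : K ⟶ L} (s : ∀ p q : ℤ, q + 1 = p → (K.X p ⟶ L.X q))
    (h : ∀ p q r (h₁ : p + 1 = q) (h₂ : q + 1 = r), f.f q =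
      K.d q r ≫ s r q h₂ + s q p h₁ ≫ L.d p q + g.f q) : Homotopy f g where
  hom i j := if hji : j + 1 = i then s i j hji else 0
  zero i j hij := dif_neg hij
  comm i := by
    have h₁ : i - 1 + 1 = i := by omega
    rw [dNext_eq _ (show (ComplexShape.up ℤ).Rel i (i + 1) from rfl),
      prevD_eq _ (show (ComplexShape.up ℤ).Rel (i - 1) i from h₁), dif_pos rfl, dif_pos h₁]
    exact h (i - 1) i (i + 1) h₁ rfl

variable {U V : C ⥤ C} [U.Additive] [V.Additive] [U.CommShift IntDeg] [V.CommShift IntDeg]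

lemma toOne_nat (β : U ⟶ 𝟭 C) {M N : C} (f : M ⟶ N) : U.map f ≫ toOne β N = toOne β M ≫ f :=
  β.naturality f

lemma toOne_nat_assoc (β : U ⟶ 𝟭 C) {M N Y : C} (f : M ⟶ N) (t : N ⟶ Y) :
    U.map f ≫ toOne β N ≫ t = toOne β M ≫ f ≫ t := by
  rw [← Category.assoc, toOne_nat, Category.assoc]

lemma fromOne_nat (γ : 𝟭 C ⟶ V) {M N : C} (f : M ⟶ N) :
    f ≫ fromOne γ N = fromOne γ M ≫ V.map f := γ.naturality f

lemma fromOne_nat_assoc (γ : 𝟭 C ⟶ V) {M N Y : C} (f : M ⟶ N) (t : V.obj N ⟶ Y) :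
    f ≫ fromOne γ N ≫ t = fromOne γ M ≫ V.map f ≫ t := by
  rw [← Category.assoc, fromOne_nat, Category.assoc]

/-- Splitting data for `U V`; it makes `cone (𝟭 → V)[-1]` a right inverse of `cone (U → 𝟭)`. -/
structure PairData (β : U ⟶ 𝟭 C) (γ : 𝟭 C ⟶ V) where
  ι : ∀ M, V.obj M ⟶ U.obj (V.obj M)
  κ : ∀ M, U.obj (V.obj M) ⟶ U.obj M
  ι_nat : ∀ {M N : C} (f : M ⟶ N), V.map f ≫ ι N = ι M ≫ U.map (V.map f)
  κ_nat : ∀ {M N : C} (f : M ⟶ N), U.map (V.map f) ≫ κ N = κ M ≫ U.map f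
  ι_hsq : ∀ {M N : C} {d : IntDeg} (f : ShiftedHom M N d),
    HSq (ι M) (f.map V) ((f.map V).map U) (ι N)
  κ_hsq : ∀ {M N : C} {d : IntDeg} (f : ShiftedHom M N d),
    HSq (κ M) ((f.map V).map U) (f.map U) (κ N)
  ι_β : ∀ M, ι M ≫ toOne β (V.obj M) = 𝟙 _
  ι_κ : ∀ M, ι M ≫ κ M = 0
  γ_κ : ∀ M, U.map (fromOne γ M) ≫ κ M = 𝟙 _
  split : ∀ M, κ M ≫ U.map (fromOne γ M) + toOne β (V.obj M) ≫ ι M =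
    𝟙 _ + κ M ≫ toOne β M ≫ fromOne γ M ≫ ι M

/-- Splitting data for `V U`; it makes `cone (𝟭 → V)[-1]` a left inverse of `cone (U → 𝟭)`. -/
structure PairData' (β : U ⟶ 𝟭 C) (γ : 𝟭 C ⟶ V) where
  ι : ∀ M, V.obj M ⟶ V.obj (U.obj M)
  κ : ∀ M, V.obj (U.obj M) ⟶ U.obj M
  ι_nat : ∀ {M N : C} (f : M ⟶ N), V.map f ≫ ι N = ι M ≫ V.map (U.map f)
  κ_nat : ∀ {M N : C} (f : M ⟶ N), V.map (U.map f) ≫ κ N = κ M ≫ U.map f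
  ι_hsq : ∀ {M N : C} {d : IntDeg} (f : ShiftedHom M N d),
    HSq (ι M) (f.map V) ((f.map U).map V) (ι N)
  κ_hsq : ∀ {M N : C} {d : IntDeg} (f : ShiftedHom M N d),
    HSq (κ M) ((f.map U).map V) (f.map U) (κ N)
  ι_β : ∀ M, ι M ≫ V.map (toOne β M) = 𝟙 _
  ι_κ : ∀ M, ι M ≫ κ M = 0
  γ_κ : ∀ M, fromOne γ (U.obj M) ≫ κ M = 𝟙 _
  split : ∀ M, κ M ≫ fromOne γ (U.obj M) + V.map (toOne β M) ≫ ι M =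
    𝟙 _ + κ M ≫ toOne β M ≫ fromOne γ M ≫ ι M

variable {β : U ⟶ 𝟭 C} {γ : 𝟭 C ⟶ V}

namespace PairData

variable (D : PairData β γ) (K L : CochainComplex C ℤ)

lemma ι_nat_assoc {M N Y : C} (f : M ⟶ N) (t : U.obj (V.obj N) ⟶ Y) :
    V.map f ≫ D.ι N ≫ t = D.ι M ≫ U.map (V.map f) ≫ t := by
  rw [← Category.assoc, D.ι_nat, Category.assoc]

lemma κ_nat_assoc {M N Y : C} (f : M ⟶ N) (t : U.obj N ⟶ Y) :
    U.map (V.map f) ≫ D.κ N ≫ t = D.κ M ≫ U.map f ≫ t := by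
  rw [← Category.assoc, D.κ_nat, Category.assoc]

lemma ι_β_assoc {M Y : C} (t : V.obj M ⟶ Y) : D.ι M ≫ toOne β (V.obj M) ≫ t = t := by
  rw [← Category.assoc, D.ι_β, Category.id_comp]

lemma γ_κ_assoc {M Y : C} (t : U.obj M ⟶ Y) : U.map (fromOne γ M) ≫ D.κ M ≫ t = t := by
  rw [← Category.assoc, D.γ_κ, Category.id_comp]

lemma ι_κ_assoc {M Y : C} (t : U.obj M ⟶ Y) : D.ι M ≫ D.κ M ≫ t = 0 := by
  rw [← Category.assoc, D.ι_κ, zero_comp]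

lemma split_assoc {M Y : C} (t : U.obj (V.obj M) ⟶ Y) :
    D.κ M ≫ toOne β M ≫ fromOne γ M ≫ D.ι M ≫ t = D.κ M ≫ U.map (fromOne γ M) ≫ t +
      toOne β (V.obj M) ≫ D.ι M ≫ t - t := by
  have := congrArg (· ≫ t) (D.split M)
  simp only [Preadditive.add_comp, Category.assoc, Category.id_comp] at this
  rw [this, add_sub_cancel_left]

/-- The map `K ⟶ T T' K`, for `T = cone (U → 𝟭)` and `T' = cone (𝟭 → V)[-1]`. -/
noncomputable def create : K ⟶ (posF β).obj ((negF γ).obj K) where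
  f p := inK' γ K p ≫ inK β _ p +
    fromOne γ (K.X p) ≫ D.ι (K.X p) ≫ U.map (inU' γ K (rfl : p + 1 = p + 1)) ≫ inU β _ rfl
  comm' p q h := by
    obtain rfl : p + 1 = q := h
    simp only [Preadditive.add_comp, Preadditive.comp_add, Category.assoc, inK_d,
      inU_d β _ rfl rfl, inK'_d_assoc γ _ rfl, Preadditive.comp_sub,
      map_inU'_d_assoc γ _ U rfl rfl, toOne_nat_assoc, ι_β_assoc, Preadditive.comp_neg]
    rw [← ι_nat_assoc, fromOne_nat_assoc]
    abel

/-- The map `T T' K ⟶ K`. -/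
noncomputable def cancel : (posF β).obj ((negF γ).obj K) ⟶ K where
  f p := prK β _ p ≫ prK' γ K p -
    prU β _ rfl ≫ U.map (prU' γ K (rfl : p + 1 = p + 1)) ≫ D.κ (K.X p) ≫ toOne β (K.X p)
  comm' p q h := by
    obtain rfl : p + 1 = q := h
    obtain ⟨m, rfl⟩ : ∃ m, p = m + 1 := ⟨p - 1, by omega⟩
    refine pos_ext β rfl (neg_ext_map γ U rfl ?_ ?_) (neg_ext γ rfl ?_ ?_)
    all_goals simp only [Category.assoc,
      Preadditive.sub_comp, Preadditive.comp_sub, inK_d_assoc, inU_d_assoc β _ rfl rfl,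
      inU_prK_assoc, inU_prU_assoc, inK_prK_assoc, inK_prU_assoc, inK'_prK'_assoc,
      inU'_prK'_assoc, map_inK'_prU'_assoc, map_inU'_prU'_assoc,
      map_inK'_d_assoc γ _ U rfl, map_inU'_d_assoc γ _ U rfl rfl, inK'_d_assoc γ _ rfl,
      inU'_d_assoc γ _ rfl rfl, comp_zero, sub_zero, zero_sub,
      Preadditive.comp_neg, neg_neg, toOne_nat_assoc, inK'_prK', inU'_prK',
      Category.comp_id, γ_κ_assoc, κ_nat_assoc, toOne_nat, neg_zero, sub_self]

/-- Creating and cancelling is the identity. -/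
lemma create_cancel : D.create K ≫ D.cancel K = 𝟙 K := by
  ext p
  simp only [create, cancel, HomologicalComplex.comp_f, Preadditive.add_comp, Preadditive.comp_sub,
    Category.assoc, inK_prK_assoc, inK_prU_assoc, inU_prK_assoc, inU_prU_assoc, inK'_prK',
    map_inU'_prU'_assoc, ι_κ_assoc, comp_zero, sub_zero, add_zero,
    HomologicalComplex.id_f]

/-- Cancelling and creating is homotopic to the identity. -/
noncomputable def cancelCreate : Homotopy (D.cancel K ≫ D.create K) (𝟙 _) :=
  homotopyMk (fun p q h => - (prU β _ rfl ≫ U.map (prU' γ K (rfl : p + 1 = p + 1)) ≫ D.κ (K.X p) ≫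
      U.map (inK' γ K p) ≫ inU β _ h) -
      prK β _ p ≫ prU' γ K h ≫ D.ι (K.X q) ≫ U.map (inU' γ K h) ≫ inU β _ h) (by
    rintro p _ _ rfl rfl
    refine pos_ext β rfl (neg_ext_map γ U rfl ?_ ?_) (neg_ext γ rfl ?_ ?_)
    all_goals simp only [create, cancel, HomologicalComplex.comp_f, HomologicalComplex.id_f,
      Preadditive.comp_add, Category.assoc,
      Preadditive.sub_comp, Preadditive.comp_sub, inK_d_assoc, inU_d_assoc β _ rfl rfl,
      inU_prK_assoc, inU_prU_assoc, inK_prK_assoc, inK_prU_assoc, inK'_prK'_assoc,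
      inU'_prK'_assoc, inK'_prU'_assoc, inU'_prU'_assoc, map_inK'_prU'_assoc, map_inU'_prU'_assoc,
      map_inK'_d_assoc γ _ U rfl, map_inU'_d_assoc γ _ U rfl rfl, inK'_d_assoc γ _ rfl,
      inU'_d_assoc γ _ rfl rfl, comp_zero, sub_zero, zero_sub, add_zero,
      Preadditive.comp_neg, Preadditive.neg_comp, neg_neg, toOne_nat_assoc,
      Category.comp_id, γ_κ_assoc, κ_nat_assoc, neg_zero, sub_self,
      inU_d β _ rfl rfl, ι_β_assoc, ι_nat_assoc,
          split_assoc]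
    all_goals abel)

variable {K L} {d : IntDeg} [NatTrans.CommShift β IntDeg] [NatTrans.CommShift γ IntDeg]

lemma create_natural (f : ShiftedHom K L d) :
    D.create K ≫ (f.map (negF γ)).map (posF β) = f ≫ (shiftFunctor _ d).map (D.create L) :=
  cmp_ext fun p => ((hsq_inK' f γ p).comp (hsq_inK _ β p)).add ((hsq_fromOne γ (cmp f p)).comp
    ((D.ι_hsq (cmp f p)).comp (((hsq_inU' f γ rfl).map U).comp (hsq_inU _ β rfl))))

lemma cancel_natural (f : ShiftedHom K L d) :
    D.cancel K ≫ f = (f.map (negF γ)).map (posF β) ≫ (shiftFunctor _ d).map (D.cancel L) :=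
  cmp_ext fun p => ((hsq_prK _ β p).comp (hsq_prK' f γ p)).sub ((hsq_prU _ β rfl).comp
    (((hsq_prU' f γ rfl).map U).comp ((D.κ_hsq (cmp f p)).comp (hsq_toOne β (cmp f p)))))

end PairData

namespace PairData'

variable (D : PairData' β γ) (K L : CochainComplex C ℤ)

lemma ι_nat_assoc {M N Y : C} (f : M ⟶ N) (t : V.obj (U.obj N) ⟶ Y) :
    V.map f ≫ D.ι N ≫ t = D.ι M ≫ V.map (U.map f) ≫ t := by
  rw [← Category.assoc, D.ι_nat, Category.assoc]

lemma κ_nat_assoc {M N Y : C} (f : M ⟶ N) (t : U.obj N ⟶ Y) :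
    V.map (U.map f) ≫ D.κ N ≫ t = D.κ M ≫ U.map f ≫ t := by
  rw [← Category.assoc, D.κ_nat, Category.assoc]

lemma ι_β_assoc {M Y : C} (t : V.obj M ⟶ Y) : D.ι M ≫ V.map (toOne β M) ≫ t = t := by
  rw [← Category.assoc, D.ι_β, Category.id_comp]

lemma γ_κ_assoc {M Y : C} (t : U.obj M ⟶ Y) : fromOne γ (U.obj M) ≫ D.κ M ≫ t = t := by
  rw [← Category.assoc, D.γ_κ, Category.id_comp]

lemma ι_κ_assoc {M Y : C} (t : U.obj M ⟶ Y) : D.ι M ≫ D.κ M ≫ t = 0 := by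
  rw [← Category.assoc, D.ι_κ, zero_comp]

lemma split_assoc {M Y : C} (t : V.obj (U.obj M) ⟶ Y) :
    D.κ M ≫ toOne β M ≫ fromOne γ M ≫ D.ι M ≫ t = D.κ M ≫ fromOne γ (U.obj M) ≫ t +
      V.map (toOne β M) ≫ D.ι M ≫ t - t := by
  have := congrArg (· ≫ t) (D.split M)
  simp only [Preadditive.add_comp, Category.assoc, Category.id_comp] at this
  rw [this, add_sub_cancel_left]

/-- The components of `create`, where `q = p - 1`. -/
noncomputable def createF {q p : ℤ} (h : q + 1 = p) :
    K.X p ⟶ ((negF γ).obj ((posF β).obj K)).X p :=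
  inK β K p ≫ inK' γ _ p -
    fromOne γ (K.X p) ≫ D.ι (K.X p) ≫ V.map (inU β K h) ≫ inU' γ _ h

/-- The components of `cancel`, where `q = p - 1`. -/
noncomputable def cancelF {q p : ℤ} (h : q + 1 = p) :
    ((negF γ).obj ((posF β).obj K)).X p ⟶ K.X p :=
  prK' γ _ p ≫ prK β K p + prU' γ _ h ≫ V.map (prU β K h) ≫ D.κ (K.X p) ≫ toOne β (K.X p)

lemma createF_d {o p q : ℤ} (h : o + 1 = p) (h' : p + 1 = q) :
    D.createF K h ≫ ((negF γ).obj ((posF β).obj K)).d p q = K.d p q ≫ D.createF K h' := by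
  subst h h'
  simp only [createF, Preadditive.sub_comp, Preadditive.comp_sub, Category.assoc, inK_d_assoc,
    inK'_d γ _ rfl, inU'_d γ _ rfl rfl, Preadditive.comp_neg, ι_β_assoc,
    map_inU_d_assoc β _ V rfl rfl]
  rw [← ι_nat_assoc, fromOne_nat_assoc γ (K.d (o + 1) (o + 1 + 1)),
    fromOne_nat_assoc γ (inK β K (o + 1))]
  abel

lemma cancelF_d {o p q : ℤ} (h : o + 1 = p) (h' : p + 1 = q) :
    D.cancelF K h ≫ K.d p q = ((negF γ).obj ((posF β).obj K)).d p q ≫ D.cancelF K h' := by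
  subst h h'
  refine neg_ext γ rfl (pos_ext β rfl ?_ ?_) (pos_ext_map β V rfl ?_ ?_)
  all_goals simp only [cancelF, Preadditive.add_comp, Preadditive.comp_add, Category.assoc,
    inK_d_assoc, inU_d_assoc β _ rfl rfl,
    inU_prK_assoc, inK_prK_assoc, inK'_prK'_assoc,
    inU'_prK'_assoc, inK'_prU'_assoc, inU'_prU'_assoc, map_inK_prU_assoc, map_inU_prU_assoc,
    map_inK_d_assoc, map_inU_d_assoc β _ V rfl rfl, inK'_d_assoc γ _ rfl,
    inU'_d_assoc γ _ rfl rfl, comp_zero, sub_zero, zero_sub, add_zero, zero_add,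
    Preadditive.comp_neg, neg_neg, inK_prK, inU_prK,
    Category.comp_id, γ_κ_assoc, κ_nat_assoc, toOne_nat, neg_zero,
    fromOne_nat_assoc γ (inU β K _), fromOne_nat_assoc γ (inK β K _), add_neg_cancel]

/-- The map `K ⟶ T' T K`, for `T = cone (U → 𝟭)` and `T' = cone (𝟭 → V)[-1]`. -/
noncomputable def create : K ⟶ (negF γ).obj ((posF β).obj K) where
  f p := D.createF K (show p - 1 + 1 = p by omega)
  comm' p q h := by
    obtain rfl : p + 1 = q := h
    have : D.createF K (show p + 1 - 1 + 1 = p + 1 by omega) = D.createF K rfl := by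
      congr 1; omega
    rw [this]
    exact D.createF_d K _ rfl

/-- The map `T' T K ⟶ K`. -/
noncomputable def cancel : (negF γ).obj ((posF β).obj K) ⟶ K where
  f p := D.cancelF K (show p - 1 + 1 = p by omega)
  comm' p q h := by
    obtain rfl : p + 1 = q := h
    have : D.cancelF K (show p + 1 - 1 + 1 = p + 1 by omega) = D.cancelF K rfl := by
      congr 1; omega
    rw [this]
    exact D.cancelF_d K _ rfl

lemma create_f {q p : ℤ} (h : q + 1 = p) : (D.create K).f p = D.createF K h := by
  obtain rfl : q = p - 1 := by omega
  rfl

lemma cancel_f {q p : ℤ} (h : q + 1 = p) : (D.cancel K).f p = D.cancelF K h := by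
  obtain rfl : q = p - 1 := by omega
  rfl

/-- Creating and cancelling is the identity. -/
lemma create_cancel : D.create K ≫ D.cancel K = 𝟙 K := by
  ext p
  obtain ⟨m, rfl⟩ : ∃ m, p = m + 1 := ⟨p - 1, by omega⟩
  rw [HomologicalComplex.comp_f, create_f _ _ rfl, cancel_f _ _ rfl]
  simp only [createF, cancelF, Preadditive.sub_comp, Preadditive.comp_add,
    Category.assoc, inK'_prK'_assoc, inK'_prU'_assoc, inU'_prK'_assoc, inU'_prU'_assoc, inK_prK,
    map_inU_prU_assoc, ι_κ_assoc, comp_zero, sub_zero, add_zero,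
    HomologicalComplex.id_f]

/-- The homotopy between `cancel ≫ create` and the identity. -/
noncomputable def homotopyF {o q p : ℤ} (h : o + 1 = q) (h' : q + 1 = p) :
    ((negF γ).obj ((posF β).obj K)).X p ⟶ ((negF γ).obj ((posF β).obj K)).X q :=
  prU' γ _ h' ≫ V.map (prU β K h') ≫ D.κ (K.X p) ≫ inU β K h' ≫ inK' γ _ q +
    prU' γ _ h' ≫ V.map (prK β K q) ≫ D.ι (K.X q) ≫ V.map (inU β K h) ≫ inU' γ _ h

lemma homotopyF_comm {o p q r : ℤ} (h₀ : o + 1 = p) (h₁ : p + 1 = q) (h₂ : q + 1 = r) :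
    (D.cancel K ≫ D.create K).f q = ((negF γ).obj ((posF β).obj K)).d q r ≫ D.homotopyF K h₁ h₂ +
      D.homotopyF K h₀ h₁ ≫ ((negF γ).obj ((posF β).obj K)).d p q +
        HomologicalComplex.Hom.f (𝟙 ((negF γ).obj ((posF β).obj K))) q := by
  rw [HomologicalComplex.comp_f, D.create_f K h₁, D.cancel_f K h₁, HomologicalComplex.id_f]
  subst h₀ h₁ h₂
  refine neg_ext γ rfl (pos_ext β rfl ?_ ?_) (pos_ext_map β V rfl ?_ ?_)
  all_goals simp only [createF, cancelF, homotopyF,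
    Preadditive.add_comp, Preadditive.comp_add, Category.assoc,
    Preadditive.comp_sub, inU_d_assoc β _ rfl rfl,
    inU_prK_assoc, inK_prK_assoc, inK'_prK'_assoc,
    inU'_prK'_assoc, inK'_prU'_assoc, inU'_prU'_assoc, map_inK_prU_assoc, map_inU_prU_assoc,
    map_inK_prK_assoc, map_inU_prK_assoc,
    map_inK_d_assoc, map_inU_d_assoc β _ V rfl rfl, inK'_d_assoc γ _ rfl,
    inU'_d_assoc γ _ rfl rfl, comp_zero, sub_zero, zero_sub, add_zero, zero_add,
    Preadditive.comp_neg, neg_neg,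
    Category.comp_id, γ_κ_assoc, κ_nat_assoc, neg_zero,
    sub_self, fromOne_nat_assoc γ (inU β K _), fromOne_nat_assoc γ (inK β K _),
        inK'_d γ _ rfl, inU'_d γ _ rfl rfl,
    ι_nat_assoc D (K.d _ _), ι_β_assoc, split_assoc]
  all_goals abel

/-- Cancelling and creating is homotopic to the identity. -/
noncomputable def cancelCreate : Homotopy (D.cancel K ≫ D.create K) (𝟙 _) :=
  homotopyMk (fun p q h => D.homotopyF K (show q - 1 + 1 = q by omega) h) (by
    rintro p q r rfl h₂
    have : D.homotopyF K (show p + 1 - 1 + 1 = p + 1 by omega) h₂ = D.homotopyF K rfl h₂ := by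
      congr 1; omega
    rw [this]
    exact D.homotopyF_comm K _ rfl h₂)

variable {K L} {d : IntDeg} [NatTrans.CommShift β IntDeg] [NatTrans.CommShift γ IntDeg]

lemma create_natural (f : ShiftedHom K L d) :
    D.create K ≫ (f.map (posF β)).map (negF γ) = f ≫ (shiftFunctor _ d).map (D.create L) :=
  cmp_ext fun p => ((hsq_inK f β p).comp (hsq_inK' _ γ p)).sub ((hsq_fromOne γ (cmp f p)).comp
    ((D.ι_hsq (cmp f p)).comp (((hsq_inU f β _).map V).comp (hsq_inU' _ γ _))))

lemma cancel_natural (f : ShiftedHom K L d) :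
    D.cancel K ≫ f = (f.map (posF β)).map (negF γ) ≫ (shiftFunctor _ d).map (D.cancel L) :=
  cmp_ext fun p => ((hsq_prK' _ γ p).comp (hsq_prK f β p)).add ((hsq_prU' _ γ _).comp
    (((hsq_prU f β _).map V).comp ((D.κ_hsq (cmp f p)).comp (hsq_toOne β (cmp f p)))))

end PairData'

end Invertibility

/-! ### The braid relations between the elementary complexes -/

section Braid

variable {C : Type u} [Category.{v} C] [Preadditive C] [HasBinaryBiproducts C]
  [HasShift C IntDeg] [∀ d : IntDeg, (shiftFunctor C d).Additive]
  {U V : C ⥤ C} [U.Additive] [V.Additive] [U.CommShift IntDeg] [V.CommShift IntDeg]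
  (α : U ⟶ 𝟭 C) (β : V ⟶ 𝟭 C) (K L : CochainComplex C ℤ)

lemma map_toOne_nat (G : C ⥤ C) {M N : C} (f : M ⟶ N) :
    G.map (U.map f) ≫ G.map (toOne α N) = G.map (toOne α M) ≫ G.map f :=
  map_square G (toOne_nat α f)

lemma map_toOne_nat_assoc (G : C ⥤ C) {M N Y : C} (f : M ⟶ N) (t : G.obj N ⟶ Y) :
    G.map (U.map f) ≫ G.map (toOne α N) ≫ t = G.map (toOne α M) ≫ G.map f ≫ t :=
  square_comp (map_toOne_nat α G f) t

/-- The inclusion of `K` in the cone of `β_K`. -/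
noncomputable def incK : K ⟶ (posF β).obj K where
  f p := inK β K p
  comm' p q _ := inK_d β K p q

section Far

lemma map_inU_far (h₁ : ∀ M, 𝟙 (U.obj (V.obj M)) = 0) {p q : ℤ} (h : p + 1 =
    q) : U.map (inU β K h) = 0 := by
  rw [← Category.id_comp (U.map _), h₁, zero_comp]

/-- The components of `far`: they exchange the summands `U K^{p+1}` and `V K^{p+1}`. -/
noncomputable def farF (p : ℤ) : ((posF α).obj ((posF β).obj K)).X p ⟶
    ((posF β).obj ((posF α).obj K)).X p :=
  prK α _ p ≫ prK β K p ≫ inK α K p ≫ inK β _ p +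
    prK α _ p ≫ prU β K rfl ≫ V.map (inK α K (p + 1)) ≫ inU β _ rfl +
      prU α _ rfl ≫ U.map (prK β K (p + 1)) ≫ inU α K rfl ≫ inK β _ p

/-- The isomorphism which exchanges the complexes of two distant letters, for which `U V = 0 = V U`.
-/
noncomputable def far (h₁ : ∀ M, 𝟙 (U.obj (V.obj M)) = 0) : (posF α).obj ((posF β).obj K) ⟶
    (posF β).obj ((posF α).obj K) where
  f p := farF α β K p
  comm' p q h := by
    obtain rfl : p + 1 = q := h
    refine pos_ext α rfl (pos_ext_map β U rfl ?_ ?_) (pos_ext β rfl ?_ ?_)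
    · rw [map_inU_far β K h₁, zero_comp, zero_comp]
    all_goals simp only [farF, Preadditive.add_comp, Preadditive.comp_add, Category.assoc,
      Preadditive.comp_sub, inK_d_assoc, inU_d_assoc _ _ rfl rfl,
      inU_prK_assoc, inU_prU_assoc, inK_prK_assoc, inK_prU_assoc, map_inK_prK_assoc,
      map_inK_d_assoc, comp_zero, sub_zero, zero_sub, add_zero, zero_add,
      toOne_nat_assoc, inK_d, inU_d _ _ rfl rfl, sub_self, Preadditive.comp_neg]
    all_goals abel

lemma far_far (h₁ : ∀ M, 𝟙 (U.obj (V.obj M)) = 0) (h₂ : ∀ M, 𝟙 (V.obj (U.obj M)) = 0) :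
    far α β K h₁ ≫ far β α K h₂ = 𝟙 _ := by
  ext p
  refine pos_ext α rfl (pos_ext_map β U rfl ?_ ?_) (pos_ext β rfl ?_ ?_)
  · rw [map_inU_far β K h₁, zero_comp, zero_comp]
  all_goals simp only [far, farF, HomologicalComplex.comp_f, HomologicalComplex.id_f,
    Preadditive.add_comp, Preadditive.comp_add, Category.assoc,
    inU_prK_assoc, inU_prU_assoc, inK_prK_assoc, inK_prU_assoc, map_inK_prK_assoc,
    comp_zero, add_zero, zero_add, Category.comp_id]

end Far

/-- Data for the braid relation between `cone (U → 𝟭)` and `cone (V → 𝟭)`. -/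
structure BraidData where
  ι : ∀ M, V.obj M ⟶ V.obj (V.obj M)
  ρ : ∀ M, U.obj (U.obj M) ⟶ U.obj (V.obj (U.obj M))
  ι_nat : ∀ {M N : C} (f : M ⟶ N), V.map f ≫ ι N = ι M ≫ V.map (V.map f)
  ρ_nat : ∀ {M N : C} (f : M ⟶ N), U.map (U.map f) ≫ ρ N = ρ M ≫ U.map (V.map (U.map f))
  ι_hsq : ∀ {M N : C} {d : IntDeg} (f : ShiftedHom M N d),
    HSq (ι M) (f.map V) ((f.map V).map V) (ι N)
  ρ_hsq : ∀ {M N : C} {d : IntDeg} (f : ShiftedHom M N d),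
    HSq (ρ M) ((f.map U).map U) (((f.map U).map V).map U) (ρ N)
  ι_β : ∀ M, ι M ≫ toOne β (V.obj M) = 𝟙 _
  ι_map_β : ∀ M, ι M ≫ V.map (toOne β M) = 𝟙 _
  β_ρ : ∀ M, U.map (toOne β (U.obj M)) ≫ ρ M = 𝟙 _
  ρ_β : ∀ M, ρ M ≫ U.map (toOne β (U.obj M)) ≫ (toOne α (U.obj M) - U.map (toOne α M)) =
    toOne α (U.obj M) - U.map (toOne α M)

namespace BraidData

variable {α β} (D : BraidData α β)

lemma ι_nat_assoc {M N Y : C} (f : M ⟶ N) (t : V.obj (V.obj N) ⟶ Y) :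
    V.map f ≫ D.ι N ≫ t = D.ι M ≫ V.map (V.map f) ≫ t := square_comp (D.ι_nat f) t

lemma ρ_nat_assoc {M N Y : C} (f : M ⟶ N) (t : U.obj (V.obj (U.obj N)) ⟶ Y) :
    U.map (U.map f) ≫ D.ρ N ≫ t = D.ρ M ≫ U.map (V.map (U.map f)) ≫ t :=
  square_comp (D.ρ_nat f) t

lemma ι_β_assoc {M Y : C} (t : V.obj M ⟶ Y) : D.ι M ≫ toOne β (V.obj M) ≫ t = t := by
  rw [← Category.assoc, D.ι_β, Category.id_comp]

lemma ι_map_β_assoc {M Y : C} (t : V.obj M ⟶ Y) : D.ι M ≫ V.map (toOne β M) ≫ t = t := by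
  rw [← Category.assoc, D.ι_map_β, Category.id_comp]

lemma β_ρ_assoc {M Y : C} (t : U.obj (V.obj (U.obj M)) ⟶ Y) :
    U.map (toOne β (U.obj M)) ≫ D.ρ M ≫ t = t := by
  rw [← Category.assoc, D.β_ρ, Category.id_comp]

lemma ρ_β_assoc {M Y : C} (t : U.obj M ⟶ Y) :
    D.ρ M ≫ U.map (toOne β (U.obj M)) ≫ toOne α (U.obj M) ≫ t =
      D.ρ M ≫ U.map (toOne β (U.obj M)) ≫ U.map (toOne α M) ≫ t + toOne α (U.obj M) ≫ t -
        U.map (toOne α M) ≫ t := by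
  have := congrArg (· ≫ t) (D.ρ_β M)
  simp only [Preadditive.sub_comp, Preadditive.comp_sub, Category.assoc] at this
  rw [eq_sub_iff_add_eq, ← sub_eq_iff_eq_add', add_sub_right_comm, this, sub_add_cancel]

/-- The component of the braid transformation on `U K`. -/
noncomputable def zOne {p q : ℤ} (h : p + 1 = q) :
    U.obj (K.X q) ⟶ ((posF β).obj ((posF α).obj ((posF β).obj K))).X p :=
  U.map (inK β K q) ≫ inU α _ h ≫ inK β _ p

/-- The component of the braid transformation on `U V K`. -/
noncomputable def zTwo {p q r : ℤ} (h : p + 1 = q) (h' : q + 1 = r) :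
    U.obj (V.obj (K.X r)) ⟶ ((posF β).obj ((posF α).obj ((posF β).obj K))).X p :=
  U.map (inU β K h') ≫ inU α _ h ≫ inK β _ p -
    toOne α (V.obj (K.X r)) ≫ D.ι (K.X r) ≫ V.map (inU β K h') ≫ V.map (inK α _ q) ≫ inU β _ h

/-- The component of the braid transformation on `U U K`. -/
noncomputable def zThree {p q r : ℤ} (h : p + 1 = q) (h' : q + 1 = r) :
    U.obj (U.obj (K.X r)) ⟶ ((posF β).obj ((posF α).obj ((posF β).obj K))).X p :=
  D.ρ (K.X r) ≫ (toOne α _ ≫ V.map (U.map (inK β K r)) ≫ V.map (inU α _ h') ≫ inU β _ h +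
    U.map (V.map (toOne α (K.X r))) ≫ D.zTwo K h h')

/-- The component of the braid transformation on `U T_V T_U K`. -/
noncomputable def zF {p q : ℤ} (h : p + 1 = q) : U.obj (((posF β).obj ((posF α).obj K)).X q) ⟶
    ((posF β).obj ((posF α).obj ((posF β).obj K))).X p :=
  U.map (prK β _ q) ≫ U.map (prK α K q) ≫ zOne K h +
    U.map (prU β _ rfl) ≫ U.map (V.map (prK α K (q + 1))) ≫ D.zTwo K h rfl +
      U.map (prK β _ q) ≫ U.map (prU α K rfl) ≫ D.zThree K h rfl

lemma inKinK_zF {p q : ℤ} (h : p + 1 = q) :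
    U.map (inK α K q) ≫ U.map (inK β _ q) ≫ D.zF K h = zOne K h := by
  simp only [zF, Preadditive.comp_add, map_inK_prK_assoc, map_inK_prU_assoc,
    add_zero]

lemma inKinU_zF {p q r : ℤ} (h : p + 1 = q) (h' : q + 1 = r) :
    U.map (V.map (inK α K r)) ≫ U.map (inU β _ h') ≫ D.zF K h = D.zTwo K h h' := by
  subst h'
  simp only [zF, Preadditive.comp_add, map_inU_prK_assoc, map_inU_prU_assoc,
    add_zero, zero_add]
  exact map_inK_prK_assoc α K (V ⋙ U) _ _

lemma inUinK_zF {p q r : ℤ} (h : p + 1 = q) (h' : q + 1 = r) :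
    U.map (inU α K h') ≫ U.map (inK β _ q) ≫ D.zF K h = D.zThree K h h' := by
  subst h'
  simp only [zF, Preadditive.comp_add, map_inK_prK_assoc, map_inK_prU_assoc, map_inU_prK_assoc,
    map_inU_prU_assoc, add_zero, zero_add]

lemma inUinU_zF {p q r : ℤ} (h : p + 1 = q) (h' : q + 1 = r) :
    U.map (V.map (inU α K (rfl : r + 1 = r + 1))) ≫ U.map (inU β _ h') ≫ D.zF K h = 0 := by
  subst h'
  simp only [zF, Preadditive.comp_add, map_inU_prK_assoc, map_inU_prU_assoc,
    add_zero, zero_add]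
  exact map_inU_prK_assoc α K (V ⋙ U) _ _

/-- The inclusion of `T_V T_U K` in `T_V T_U T_V K`. -/
noncomputable def incl : (posF β).obj ((posF α).obj K) ⟶
    (posF β).obj ((posF α).obj ((posF β).obj K)) :=
  (posF β).map ((posF α).map (incK β K))

lemma incl_inKinK (p : ℤ) : inK α K p ≫ inK β _ p ≫ (incl K).f p =
    inK β K p ≫ inK α _ p ≫ inK β _ p := by
  rw [incl, inK_map]
  exact square_comp (inK_map α (incK β K) p) _

lemma incl_inUinK {p q : ℤ} (h : p + 1 = q) : inU α K h ≫ inK β _ p ≫ (incl K).f p =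
    U.map (inK β K q) ≫ inU α _ h ≫ inK β _ p := by
  rw [incl, inK_map]
  exact square_comp (inU_map α (incK β K) h) _

lemma incl_inKinU {p q : ℤ} (h : p + 1 = q) : V.map (inK α K q) ≫ inU β _ h ≫ (incl K).f p =
    V.map (inK β K q) ≫ V.map (inK α _ q) ≫ inU β _ h := by
  rw [incl, inU_map]
  exact square_comp (map_square V (inK_map α (incK β K) q)) _

lemma incl_inUinU {p q r : ℤ} (h : p + 1 = q) (h' : q + 1 = r) :
    V.map (inU α K h') ≫ inU β _ h ≫ (incl K).f p =
      V.map (U.map (inK β K r)) ≫ V.map (inU α _ h') ≫ inU β _ h := by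
  rw [incl, inU_map]
  exact square_comp (map_square V (inU_map α (incK β K) h')) _

lemma map_map_inK_d_assoc (p q : ℤ) {Y : C} (t : U.obj (V.obj (((posF α).obj K).X q)) ⟶ Y) :
    U.map (V.map (inK α K p)) ≫ U.map (V.map (((posF α).obj K).d p q)) ≫ t =
      U.map (V.map (K.d p q)) ≫ U.map (V.map (inK α K q)) ≫ t :=
  map_inK_d_assoc α K (V ⋙ U) p q t

lemma map_map_inU_d_assoc {p q r : ℤ} (h : p + 1 = q) (h' : q + 1 = r) {Y : C}
    (t : U.obj (V.obj (((posF α).obj K).X q)) ⟶ Y) :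
    U.map (V.map (inU α K h)) ≫ U.map (V.map (((posF α).obj K).d p q)) ≫ t =
      U.map (V.map (toOne α (K.X q))) ≫ U.map (V.map (inK α K q)) ≫ t -
        U.map (V.map (U.map (K.d q r))) ≫ U.map (V.map (inU α K h')) ≫ t :=
  map_inU_d_assoc α K (V ⋙ U) h h' t

lemma map_map_inK_d_assoc' (p q : ℤ) {Y : C} (t : V.obj (U.obj (((posF β).obj K).X q)) ⟶ Y) :
    V.map (U.map (inK β K p)) ≫ V.map (U.map (((posF β).obj K).d p q)) ≫ t =
      V.map (U.map (K.d p q)) ≫ V.map (U.map (inK β K q)) ≫ t :=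
  map_inK_d_assoc β K (U ⋙ V) p q t

lemma map_map_toOne_nat_assoc {M N Y : C} (f : M ⟶ N) (t : U.obj (V.obj N) ⟶ Y) :
    U.map (V.map (U.map f)) ≫ U.map (V.map (toOne α N)) ≫ t =
      U.map (V.map (toOne α M)) ≫ U.map (V.map f) ≫ t :=
  map_toOne_nat_assoc α (V ⋙ U) f t

/-- The map `zF` is a null-homotopy of the composite of `U T_V T_U K ⟶ T_V T_U K` with the
inclusion in `T_V T_U T_V K`. -/
lemma zF_d {p q r : ℤ} (h : p + 1 = q) (h' : q + 1 = r) :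
    D.zF K h ≫ ((posF β).obj ((posF α).obj ((posF β).obj K))).d p q +
      U.map (((posF β).obj ((posF α).obj K)).d q r) ≫ D.zF K h' =
    toOne α _ ≫ (incl K).f q := by
  subst h h'
  refine pos_ext_map β U rfl (pos_ext_map α (V ⋙ U) rfl ?_ ?_) (pos_ext_map α U rfl ?_ ?_)
  · change U.map (V.map _) ≫ _ = U.map (V.map _) ≫ _
    simp only [Preadditive.comp_add, reassoc_of% (D.inUinU_zF K (rfl : p + 1 = _) rfl), zero_comp,
      zero_add, map_inU_d_assoc β _ U rfl rfl, Preadditive.comp_sub, map_toOne_nat_assoc,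
      D.inUinK_zF K, map_map_inU_d_assoc K rfl rfl, D.inKinU_zF K, toOne_nat_assoc, incl_inUinU,
      zThree, β_ρ_assoc, D.inUinU_zF K (rfl : p + 1 + 1 = _) rfl, comp_zero, sub_zero]
    abel
  · change U.map (V.map _) ≫ _ = U.map (V.map _) ≫ _
    simp only [reassoc_of% (D.inKinU_zF K (rfl : p + 1 = _) rfl), map_map_inK_d_assoc K,
      incl_inKinU, zTwo, zOne, Preadditive.comp_add, Preadditive.comp_sub,
      Preadditive.sub_comp, Category.assoc, map_inU_d_assoc β _ U rfl rfl, map_toOne_nat_assoc,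
      D.inKinK_zF K, D.inKinU_zF K, toOne_nat_assoc,
      inK_d, inU_d _ _ rfl rfl, inU_d_assoc _ _ rfl rfl, map_inU_d_assoc _ _ V rfl rfl,
          map_inK_d_assoc _ _ V,
      ι_β_assoc, ι_map_β_assoc, ι_nat_assoc D (K.d _ _)]
    abel
  · have e : ∀ {M Y : C} (t : M ⟶ Y), toOne α (V.obj M) ≫ toOne β M ≫ t =
        U.map (toOne β M) ≫ toOne α M ≫ t := fun t => (toOne_nat_assoc α (toOne β _) t).symm
    simp only [reassoc_of% (D.inUinK_zF K (rfl : p + 1 = _) rfl),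
      map_inK_d_assoc, map_inU_d_assoc α _ U rfl rfl,
      incl_inUinK, zTwo, zOne, zThree, Preadditive.comp_add, Preadditive.comp_sub,
          Preadditive.add_comp,
      Preadditive.sub_comp, Category.assoc, map_inU_d_assoc β _ U rfl rfl, map_toOne_nat_assoc,
      D.inKinK_zF K, D.inUinK_zF K, toOne_nat_assoc,
      inK_d, inU_d _ _ rfl rfl, inU_d_assoc _ _ rfl rfl, map_inU_d_assoc _ _ V rfl rfl,
          map_inK_d_assoc _ _ V,
      ι_β_assoc, ι_map_β_assoc, ι_nat_assoc D (K.d _ _), map_map_inK_d_assoc' K, ρ_nat_assoc,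
      map_map_toOne_nat_assoc]
    simp only [e, ρ_β_assoc]
    abel
  · simp only [reassoc_of% (D.inKinK_zF K (rfl : p + 1 = _)),
      map_inK_d_assoc, incl_inKinK, zOne, Preadditive.comp_add, Preadditive.comp_sub,
      Category.assoc,
      D.inKinK_zF K, toOne_nat_assoc,
      inK_d, inU_d_assoc _ _ rfl rfl]
    abel

/-- The braid transformation `T_U T_V T_U K ⟶ T_V T_U T_V K`. -/
noncomputable def braid : (posF α).obj ((posF β).obj ((posF α).obj K)) ⟶
    (posF β).obj ((posF α).obj ((posF β).obj K)) where
  f p := prU α _ rfl ≫ D.zF K rfl + prK α _ p ≫ (incl K).f p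
  comm' p q h := by
    obtain rfl : p + 1 = q := h
    refine pos_ext α rfl ?_ ?_
    · simp only [Preadditive.add_comp, Preadditive.comp_add, Category.assoc, inU_prU_assoc,
        inU_prK_assoc, add_zero, inU_d_assoc α _ rfl rfl,
        inK_prU_assoc, inK_prK_assoc, comp_zero, zero_sub]
      rw [sub_zero, neg_add_eq_sub]
      exact eq_sub_of_add_eq (D.zF_d K rfl rfl)
    · simp only [Preadditive.add_comp, Preadditive.comp_add, Category.assoc, inK_prU_assoc,
        inK_prK_assoc, zero_add, inK_d_assoc, HomologicalComplex.Hom.comm, comp_zero]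

/-- The braid transformation respects the inclusions of `K`. -/
lemma incK_braid : incK α _ ≫ D.braid K = incl K := by
  ext p
  simp only [HomologicalComplex.comp_f, incK, braid, Preadditive.comp_add, inK_prU_assoc,
    inK_prK_assoc, zero_add]

end BraidData

/-! Naturality with respect to homogeneous morphisms. -/

variable {K L} {d : IntDeg} [NatTrans.CommShift α IntDeg] [NatTrans.CommShift β IntDeg]

lemma incK_natural (f : ShiftedHom K L d) :
    incK β K ≫ f.map (posF β) = f ≫ (shiftFunctor _ d).map (incK β L) :=
  cmp_ext fun p => hsq_inK f β p

lemma far_natural (h₁ : ∀ M, 𝟙 (U.obj (V.obj M)) = 0) (f : ShiftedHom K L d) :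
    far α β K h₁ ≫ (f.map (posF α)).map (posF β) =
      (f.map (posF β)).map (posF α) ≫ (shiftFunctor _ d).map (far α β L h₁) :=
  cmp_ext fun p => (((hsq_prK _ α p).comp ((hsq_prK f β p).comp ((hsq_inK f α p).comp
    (hsq_inK _ β p)))).add ((hsq_prK _ α p).comp ((hsq_prU f β rfl).comp
      (((hsq_inK f α (p + 1)).map V).comp (hsq_inU _ β rfl))))).add
        ((hsq_prU _ α rfl).comp (((hsq_prK f β (p + 1)).map U).comp ((hsq_inU f α rfl).comp
          (hsq_inK _ β p))))

namespace BraidData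

variable {α β} (D : BraidData α β)

lemma hsq_zOne (f : ShiftedHom K L d) {p q : ℤ} (h : p + 1 = q) :
    HSq (zOne K h) ((cmp f q).map U) (cmp (((f.map (posF β)).map (posF α)).map (posF β)) p)
      (zOne (α := α) (β := β) L h) :=
  ((hsq_inK f β q).map U).comp ((hsq_inU _ α h).comp (hsq_inK _ β p))

lemma hsq_zTwo (f : ShiftedHom K L d) {p q r : ℤ} (h : p + 1 = q) (h' : q + 1 = r) :
    HSq (D.zTwo K h h') (((cmp f r).map V).map U)
      (cmp (((f.map (posF β)).map (posF α)).map (posF β)) p) (D.zTwo L h h') :=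
  (((hsq_inU f β h').map U).comp ((hsq_inU _ α h).comp (hsq_inK _ β p))).sub
    ((hsq_toOne α _).comp ((D.ι_hsq _).comp (((hsq_inU f β h').map V).comp
      (((hsq_inK _ α q).map V).comp (hsq_inU _ β h)))))

lemma hsq_zThree (f : ShiftedHom K L d) {p q r : ℤ} (h : p + 1 = q) (h' : q + 1 = r) :
    HSq (D.zThree K h h') (((cmp f r).map U).map U)
      (cmp (((f.map (posF β)).map (posF α)).map (posF β)) p) (D.zThree L h h') :=
  (D.ρ_hsq _).comp (((hsq_toOne α _).comp ((((hsq_inK f β r).map U).map V).comp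
    (((hsq_inU _ α h').map V).comp (hsq_inU _ β h)))).add
      ((((hsq_toOne α (cmp f r)).map V).map U).comp (D.hsq_zTwo f h h')))

lemma braid_natural (f : ShiftedHom K L d) :
    D.braid K ≫ ((f.map (posF β)).map (posF α)).map (posF β) =
      ((f.map (posF α)).map (posF β)).map (posF α) ≫ (shiftFunctor _ d).map (D.braid L) := by
  have h₁ : ∀ p q (h : p + 1 = q), HSq (D.zF K h) ((cmp ((f.map (posF α)).map (posF β)) q).map U)
      (cmp (((f.map (posF β)).map (posF α)).map (posF β)) p) (D.zF L h) := fun p q h =>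
    ((((hsq_prK _ β q).map U).comp (((hsq_prK f α q).map U).comp (hsq_zOne f h))).add
      (((hsq_prU _ β rfl).map U).comp ((((hsq_prK f α (q + 1)).map V).map U).comp
        (D.hsq_zTwo f h rfl)))).add (((hsq_prK _ β q).map U).comp (((hsq_prU f α rfl).map U).comp
          (D.hsq_zThree f h rfl)))
  have h₂ : ∀ p, HSq ((incl K).f p) (cmp ((f.map (posF α)).map (posF β)) p)
      (cmp (((f.map (posF β)).map (posF α)).map (posF β)) p) ((incl L).f p) := fun p => by
    have h : HSq (incK β K) f (f.map (posF β)) (incK β L) := incK_natural β f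
    have e := (h.map (posF α)).map (posF β)
    unfold HSq at e
    exact congrArg (fun t => cmp t p) e
  exact cmp_ext fun p => ((hsq_prU _ α rfl).comp (h₁ p _ rfl)).add ((hsq_prK _ α p).comp (h₂ p))

end BraidData

end Braid

/-! ### Multiplication by central elements of degree two -/

section Multiplication

variable {C : Type u} [Category.{v} C] [Preadditive C] [HasBinaryBiproducts C]
  [HasShift C IntDeg] [∀ d : IntDeg, (shiftFunctor C d).Additive]
  {U : C ⥤ C} [U.Additive] [U.CommShift IntDeg] {d : IntDeg}

/-- The component `M ⟶ M⟨d⟩` of a transformation of degree `d` of the identity. -/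
def toShift (μ : 𝟭 C ⟶ shiftFunctor C d) (M : C) : ShiftedHom M M d := μ.app M

lemma toShift_nat (μ : 𝟭 C ⟶ shiftFunctor C d) {M N : C} (f : M ⟶ N) :
    f ≫ toShift μ N = toShift μ M ≫ (shiftFunctor C d).map f := μ.naturality f

/-- A natural transformation of degree `d` of the identity, on complexes. -/
def onCx (μ : 𝟭 C ⟶ shiftFunctor C d) (K : CochainComplex C ℤ) : ShiftedHom K K d where
  f p := toShift μ (K.X p)
  comm' p q _ := (μ.naturality (K.d p q)).symm

lemma cmp_onCx (μ : 𝟭 C ⟶ shiftFunctor C d) (K : CochainComplex C ℤ) (p : ℤ) :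
    cmp (onCx μ K) p = toShift μ (K.X p) := rfl

/-- The component of a transformation `𝟭 ⟶ U` of degree `d`. -/
def toShiftU (g : 𝟭 C ⟶ U ⋙ shiftFunctor C d) (M : C) : ShiftedHom M (U.obj M) d := g.app M

lemma toShiftU_nat_assoc (g : 𝟭 C ⟶ U ⋙ shiftFunctor C d) {M N Y : C} (f : M ⟶ N)
    (t : (shiftFunctor C d).obj (U.obj N) ⟶ Y) :
    f ≫ toShiftU g N ≫ t = toShiftU g M ≫ (shiftFunctor C d).map (U.map f) ≫ t :=
  square_comp (g.naturality f) t

section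

variable (β : U ⟶ 𝟭 C) [NatTrans.CommShift β IntDeg]
    (μ μ' : 𝟭 C ⟶ shiftFunctor C d) (g : 𝟭 C ⟶ U ⋙ shiftFunctor C d)
    (h₁ : ∀ M, toShiftU g M ≫ (shiftFunctor C d).map (toOne β M) = toShift μ M - toShift μ' M)
    (h₂ : ∀ M, toOne β M ≫ toShiftU g M = (toShift μ M).map U - toShift μ' (U.obj M))
    (K : CochainComplex C ℤ)

include h₁ h₂ in
lemma act_comm {p q r : ℤ} (h : p + 1 = q) (h' : q + 1 = r) : cmp ((onCx μ K).map (posF β)) q =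
    (((posF β).obj K).d q r ≫ prK β K r ≫ toShiftU g (K.X r) ≫
        (shiftFunctor C d).map (inU β K h') +
      (prK β K q ≫ toShiftU g (K.X q) ≫ (shiftFunctor C d).map (inU β K h)) ≫
        (shiftFunctor C d).map (((posF β).obj K).d p q) + toShift μ' (((posF β).obj K).X q) :
      ShiftedHom (((posF β).obj K).X q) (((posF β).obj K).X q) d) := by
  refine pos_ext β h' ?_ ?_
  · rw [inU_cmp β _ h', cmp_onCx]
    subst h h'
    simp only [Preadditive.comp_add, Category.assoc, inU_d_assoc _ _ rfl rfl, inU_prK_assoc,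
      inK_prK_assoc, comp_zero, sub_zero, add_zero, toShift_nat]
    rw [← Category.assoc (toOne β _), h₂, Preadditive.sub_comp, sub_add_cancel]
  · rw [inK_cmp, cmp_onCx]
    subst h h'
    simp only [Preadditive.comp_add, Category.assoc, inK_d_assoc, inK_prK_assoc, toShift_nat,
      map_inU_d β K (shiftFunctor C d) rfl rfl, Preadditive.comp_sub,
          toShiftU_nat_assoc g (K.d _ _)]
    rw [← Category.assoc (toShiftU g _) ((shiftFunctor C d).map (toOne β _)), h₁,
      Preadditive.sub_comp]
    abel

/-- If `g : 𝟭 ⟶ U` of degree `d` satisfies `g ≫ β = μ - μ'` and `β ≫ g = U μ - μ'`, then `μ` on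
`cone (U → 𝟭)` induced from the argument is homotopic to `μ'` on the value. -/
noncomputable def actHomotopy : Homotopy ((onCx μ K).map (posF β)) (onCx μ' ((posF β).obj K)) :=
  homotopyMk (fun p _ h => prK β K p ≫ toShiftU g (K.X p) ≫ (shiftFunctor C d).map (inU β K h))
    fun _ _ _ h h' => act_comm β μ μ' g h₁ h₂ K h h'

end

section

variable {F G H : C ⥤ C} [F.CommShift IntDeg] [G.CommShift IntDeg] [H.CommShift IntDeg]
  {M N : C} (f : ShiftedHom M N d)

lemma hsq_app_comp (α : F ⟶ G ⋙ H) [NatTrans.CommShift α IntDeg] :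
    HSq (M' := H.obj (G.obj M)) (N' := H.obj (G.obj N)) (α.app M) (f.map F) ((f.map G).map H)
      (α.app N) := by
  have h := hsq_app α f
  unfold HSq at h ⊢
  rw [ShiftedHom.comp_map] at h
  exact h

lemma hsq_comp_app (α : F ⋙ G ⟶ H) [NatTrans.CommShift α IntDeg] :
    HSq (M := G.obj (F.obj M)) (N := G.obj (F.obj N)) (α.app M) ((f.map F).map G) (f.map H)
      (α.app N) := by
  have h := hsq_app α f
  unfold HSq at h ⊢
  rw [ShiftedHom.comp_map] at h
  exact h

end

end Multiplication

/-! ### The concrete splitting data -/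

section Data

variable {n : ℕ} (i j : Fin n)

/-- The splitting data which make `R_i'` a right inverse of `R_i`. -/
noncomputable def pairData : PairData (beta.{u} i) (gamma i) where
  ι M := iotaUU'M i M
  κ M := contrUU'M i M
  ι_nat f := (iotaUU' i).naturality f
  κ_nat f := (contrUU' i).naturality f
  ι_hsq f := hsq_app_comp f (iotaUU' i)
  κ_hsq f := hsq_comp_app f (contrUU' i)
  ι_β M := iotaUU'_beta i M
  ι_κ M := iotaUU'_contr i M
  γ_κ M := map_gamma_contr i M
  split M := split_UU' i M

/-- The splitting data which make `R_i'` a left inverse of `R_i`. -/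
noncomputable def pairData' : PairData' (beta.{u} i) (gamma i) where
  ι M := iotaU'UM i M
  κ M := contrU'UM i M
  ι_nat f := (iotaU'U i).naturality f
  κ_nat f := (contrU'U i).naturality f
  ι_hsq f := hsq_app_comp f (iotaU'U i)
  κ_hsq f := hsq_comp_app f (contrU'U i)
  ι_β M := iotaU'U_map_beta i M
  ι_κ M := iotaU'U_contr i M
  γ_κ M := gamma_contr i M
  split M := split_U'U i M

variable {i j}

/-- The data of the braid relation of two adjacent letters. -/
noncomputable def braidData (h : Adj i j) : BraidData (beta.{u} i) (beta j) where
  ι M := iotaM j M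
  ρ M := rhoM i j M
  ι_nat f := (iota j).naturality f
  ρ_nat f := (rho i j).naturality f
  ι_hsq f := hsq_app_comp f (iota j)
  ρ_hsq f := by
    have h := hsq_app (rho i j) f
    unfold HSq at h ⊢
    rw [ShiftedHom.comp_map, ShiftedHom.comp_map, ShiftedHom.comp_map] at h
    exact h
  ι_β M := iota_beta j M
  ι_map_β M := iota_map_beta j M
  β_ρ M := map_beta_rho i j M h
  ρ_β M := rho_beta i j M h

lemma far_zero (h : Far i j) (M : GrMod.{u} n) :
    𝟙 ((GrBimod.tensF (PP i)).obj ((GrBimod.tensF (PP j)).obj M)) = 0 :=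
  U_far i j M (fun h' => by subst h'; rcases h with h | h <;> omega)
    (fun h' => by unfold Adj at h'; rcases h with h | h <;> omega)

end Data

/-! ### Homogeneous maps of graded modules -/

section Evaluation

variable {M N L : GrMod.{u} n} {a b c : IntDeg}

/-- The linear map underlying a homogeneous map of graded modules. -/
def ev (f : ShiftedHom M N a) : M.carrier →ₗ[A n] N.carrier :=
  GrMod.lin (M := M) (N := GrMod.sh a N) f

lemma ev_ext {f g : ShiftedHom M N a} (h : ∀ m, ev f m = ev g m) : f = g := GrMod.hom_ext h

lemma lin_shiftFunctorAdd' (h : a + b = c) (M : GrMod.{u} n) (m : M.carrier) :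
    GrMod.lin ((shiftFunctorAdd' (GrMod.{u} n) a b c h).inv.app M) m = m := by
  subst h
  rw [shiftFunctorAdd'_eq_shiftFunctorAdd]
  rfl

lemma ev_comp (f : ShiftedHom M N a) (g : ShiftedHom N L b) (h : b + a = c) (m : M.carrier) :
    ev (f.comp g h) m = ev g (ev f m) := lin_shiftFunctorAdd' h L (ev g (ev f m))

lemma ev_mk₀ (f : M ⟶ N) (h : a = 0) (m : M.carrier) :
    ev (ShiftedHom.mk₀ a h f) m = GrMod.lin f m := by
  subst h
  unfold ShiftedHom.mk₀
  have : shiftFunctorZero' (GrMod.{u} n) (0 : IntDeg) rfl = shiftFunctorZero (GrMod.{u} n) IntDeg :=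
    Iso.ext (NatTrans.ext (funext fun _ => by simp [shiftFunctorZero']))
  rw [this]
  rfl

lemma ev_mem (f : ShiftedHom M N a) {k : ℤ} {m : M.carrier} (hm : m ∈ M.gr k) :
    ev f m ∈ N.gr (k + (show ℤ from a)) := GrMod.lin_mem (M := M) (N := GrMod.sh a N) f hm

lemma ev_sub (f g : ShiftedHom M N a) (m : M.carrier) : ev (f - g) m = ev f m - ev g m :=
  lin_sub (M := M) (N := GrMod.sh a N) f g m

lemma ev_map_br (i : Fin n) (f : ShiftedHom M N a) (m : M.carrier) :
    ev (f.map (GrBimod.tensF (PP i))) (br i M m) = br i N (ev f m) := rfl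

variable {C : Type u} [Category.{v} C] [Preadditive C] [HasShift C IntDeg]
  [∀ d : IntDeg, (shiftFunctor C d).Additive] {K₁ K₂ K₃ : CochainComplex C ℤ}

lemma cmp_comp (f : ShiftedHom K₁ K₂ a) (g : ShiftedHom K₂ K₃ b) (h : b + a = c) (p : ℤ) :
    cmp (f.comp g h) p = (cmp f p).comp (cmp g p) h := by
  subst h
  unfold ShiftedHom.comp
  rw [shiftFunctorAdd'_eq_shiftFunctorAdd, shiftFunctorAdd'_eq_shiftFunctorAdd]
  rfl

lemma cmp_mk₀ (f : K₁ ⟶ K₂) (h : a = 0) (p : ℤ) :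
    cmp (ShiftedHom.mk₀ a h f) p = ShiftedHom.mk₀ a h (f.f p) := by
  subst h
  unfold ShiftedHom.mk₀
  have h₁ : shiftFunctorZero' (CochainComplex C ℤ) (0 : IntDeg) rfl = shiftFunctorZero _ IntDeg :=
    Iso.ext (NatTrans.ext (funext fun _ => by simp [shiftFunctorZero']))
  have h₂ : shiftFunctorZero' C (0 : IntDeg) rfl = shiftFunctorZero C IntDeg :=
    Iso.ext (NatTrans.ext (funext fun _ => by simp [shiftFunctorZero']))
  rw [h₁, h₂]
  rfl

end Evaluation

/-! ### Multiplication by central elements of degree two -/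

section Central

/-- The central element `∑ c_k X_k`. -/
noncomputable def lc (c : Fin n → ℤ) : A n := ∑ k, c k • X k

lemma lc_mem (c : Fin n → ℤ) : lc c ∈ grA n 2 :=
  sum_mem fun k _ => zsmul_mem (X_mem k) _

lemma lc_central (c : Fin n → ℤ) (a : A n) : lc c * a = a * lc c := by
  simp only [lc, Finset.sum_mul, Finset.mul_sum, smul_mul_assoc, mul_smul_comm, X_central]

lemma e_mul_lc (c : Fin n → ℤ) (i : Fin n) : e i * lc c = c i • X i := by
  rw [lc, Finset.mul_sum, Finset.sum_eq_single i]
  · rw [mul_smul_comm, e_mul_X]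
  · intro k _ hk
    rw [mul_smul_comm, mul_zero_of_e (e_mul_e i) (e_mul_X k) (Ne.symm hk), smul_zero]
  · intro h; exact absurd (Finset.mem_univ i) h

/-- The reflection which describes the action of `σ_j` on the elements `∑ c_k X_k`. -/
def reflect (j : Fin n) (c : Fin n → ℤ) : Fin n → ℤ := fun k =>
  if k = j then - c j else if Adj j k then c k - c j else c k

/-- The coefficients of `X_{i-1} - X_{i+1}`. -/
def zc (i : Fin n) : Fin n → ℤ := fun k =>
  (if k.val + 1 = i.val then 1 else 0) - (if i.val + 1 = k.val then 1 else 0)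

lemma lc_zc (i : Fin n) : lc (zc i) = zeta i := by
  simp only [lc, zc, zeta, sub_smul, ite_smul, one_smul, zero_smul, Finset.sum_sub_distrib]
  congr 1
  · split_ifs with h
    · rw [Finset.sum_eq_single ⟨i.val - 1, by omega⟩, if_pos (by simp; omega)]
      · intro k _ hk
        rw [if_neg fun h' => hk (Fin.ext (by simp; omega))]
      · intro h'; exact absurd (Finset.mem_univ _) h'
    · exact Finset.sum_eq_zero fun k _ => if_neg (by omega)
  · split_ifs with h
    · rw [Finset.sum_eq_single ⟨i.val + 1, h⟩, if_pos rfl]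
      · intro k _ hk
        rw [if_neg fun h' => hk (Fin.ext h'.symm)]
      · intro h'; exact absurd (Finset.mem_univ _) h'
    · exact Finset.sum_eq_zero fun k _ => if_neg (by have := k.isLt; omega)

lemma reflect_reflect (j : Fin n) (c : Fin n → ℤ) : reflect j (reflect j c) = c := by
  funext k
  have : ¬ Adj j j := by unfold Adj; omega
  unfold reflect
  split_ifs with h h' <;> simp_all

lemma reflect_neg (j : Fin n) (c : Fin n → ℤ) : reflect j (-c) = - reflect j c := by
  funext k
  simp only [reflect, Pi.neg_apply]
  split_ifs <;> ring

lemma reflect_zc_self (i : Fin n) : reflect i (zc i) = zc i := by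
  funext k
  simp only [reflect, zc]
  split_ifs with h <;> simp_all

lemma reflect_zc_far {i j : Fin n} (h : Far i j) : reflect j (zc i) = zc i := by
  funext k
  simp only [reflect, zc]
  unfold Far at h
  split_ifs <;> simp_all <;> omega

lemma reflect_zc_adj {i j : Fin n} (h : Adj i j) : reflect i (zc j) = - reflect j (zc i) := by
  funext k
  simp only [reflect, zc, Adj, Pi.neg_apply, Fin.ext_iff] at *
  split_ifs <;> omega

lemma reflect_reflect_zc {i j : Fin n} (h : Adj i j) : reflect i (reflect j (zc i)) = - zc j := by
  rw [← neg_neg (reflect j (zc i)), ← reflect_zc_adj h, reflect_neg, reflect_reflect]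

/-- Multiplication by `∑ c_k X_k`, a transformation of degree `2`. -/
noncomputable def mulN (c : Fin n → ℤ) : 𝟭 (GrMod.{u} n) ⟶
    shiftFunctor (GrMod.{u} n) (intDeg 2) where
  app M := GrMod.mk' (M := M) (N := GrMod.sh 2 M)
    { toFun := fun m => lc c • m
      map_add' := smul_add _
      map_smul' := fun a m => by rw [← mul_smul, lc_central, mul_smul, RingHom.id_apply]; rfl }
    fun k _ hm => GrMod.gr_congr M (add_comm 2 k) (M.smul_mem (lc_mem c) hm)
  naturality _ _ f := GrMod.hom_ext fun m => ((GrMod.lin f).map_smul (lc c) m).symm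

lemma ev_mulN (c : Fin n → ℤ) (M : GrMod.{u} n) (m : M.carrier) :
    ev (toShift (mulN c) M) m = lc c • m := rfl

lemma mulN_zc (i : Fin n) : mulN.{u} (zc i) = delta i :=
  NatTrans.ext (funext fun M => GrMod.hom_ext fun m =>
    congrArg (fun a : A n => (a • (show M.carrier from m) : M.carrier)) (lc_zc i))

/-- The map `M → P_i ⊗ _iP ⊗ M` of degree `2` given by `k` times the Casimir element. -/
noncomputable def casN (i : Fin n) (k : ℤ) :
    𝟭 (GrMod.{u} n) ⟶ GrBimod.tensF (PP i) ⋙ shiftFunctor (GrMod.{u} n) (intDeg 2) where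
  app M := GrMod.mk' (M := M) (N := GrMod.sh 2 (U i M))
    { toFun := fun m => k • (GrBimod.tmul (PP i) M (casimir i) m : (U i M).carrier)
      map_add' := fun m m' => by rw [map_add, smul_add]; rfl
      map_smul' := fun a m => by
        have h : (GrBimod.tmul (PP i) M (casimir i) (a • m) : (U i M).carrier) =
            a • (GrBimod.tmul (PP i) M (casimir i) m : (U i M).carrier) :=
          (GrBimod.tmul_ract (B := PP i) (casimir i) a m).symm.trans
            ((congrArg (fun x => GrBimod.tmul (PP i) M x m) (casimir_smul i a).symm).trans
              (GrBimod.smul_tmul (B := PP i) a (casimir i) m).symm)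
        rw [h, RingHom.id_apply, smul_comm]; rfl }
    fun l _ hm => (GrMod.sh 2 (U i M)).gr l |>.zsmul_mem (mem_biGr
      (fun x m => GrBimod.tmul (PP i) M x m) (show (2 : ℤ) + l = l + 2 by ring)
        (casimir_mem i) hm) k
  naturality M N f := GrMod.hom_ext fun m => (map_zsmul (GrMod.lin ((GrBimod.tensF (PP i)).map f)) k
    (GrBimod.tmul (PP i) M (casimir i) m : (U i M).carrier)).symm

lemma ev_casN (i : Fin n) (k : ℤ) (M : GrMod.{u} n) (m : M.carrier) :
    ev (toShiftU (casN i k) M) m =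
      k • (br i M (X i • m) + X i • br i M m + ∑ j, arr j i • br i M (arr i j • m)) :=
  congrArg (k • ·) (tmul_casimir (i := i) m)

lemma casN_beta (i : Fin n) (c : Fin n → ℤ) (M : GrMod.{u} n) :
    toShiftU (casN i (c i)) M ≫ (shiftFunctor _ (intDeg 2)).map (toOne (beta i) M) =
      toShift (mulN c) M - toShift (mulN (reflect i c)) M := by
  refine ev_ext fun m => ?_
  rw [ev_sub, ev_mulN, ev_mulN, ← sub_smul]
  change GrMod.lin (betaM i M) (ev (toShiftU (casN i (c i)) M) m) = _
  rw [ev_casN, map_zsmul, map_add, map_add, map_sum, map_smul (GrMod.lin (betaM i M)), lin_betaM_br,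
    lin_betaM_br]
  simp only [map_smul (GrMod.lin (betaM i M)), lin_betaM_br]
  simp only [← mul_smul, ← Finset.sum_smul, ← add_smul, e_mul_X, X_mul_e, e_mul_arr]
  rw [← smul_assoc]
  congr 1
  have h : ∀ j, arr j i * arr i j = if Adj i j then X j else 0 := fun j => by
    split_ifs with h
    · exact arr_mul_arr h.symm
    · rw [arr_of_not h, mul_zero]
  simp only [h, lc]
  rw [← Finset.sum_sub_distrib]
  have h' : ∀ k, c k • X k - reflect i c k • X k = (if k = i then (2 * c i) • X k else 0) +
      c i • (if Adj i k then X k else 0) := fun k => by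
    have : ¬ Adj i i := by unfold Adj; omega
    unfold reflect
    split_ifs with h₁ h₂ h₂
    · exact absurd (h₁ ▸ h₂) this
    · rw [h₁]; module
    · module
    · module
  simp only [h', Finset.sum_add_distrib, ← Finset.smul_sum, Finset.sum_ite_eq', Finset.mem_univ,
    if_true, smul_add, two_mul, add_smul]

lemma beta_casN (i : Fin n) (c : Fin n → ℤ) (M : GrMod.{u} n) :
    toOne (beta i) M ≫ toShiftU (casN i (c i)) M =
      (toShift (mulN c) M).map (GrBimod.tensF (PP i)) - toShift (mulN (reflect i c)) ((GrBimod.tensF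
          (PP i)).obj M) := by
  refine U_hom_ext (N := GrMod.sh 2 (U i M)) fun m => ?_
  refine Eq.trans ?_ (ev_sub (M := (GrBimod.tensF (PP i)).obj M)
    (N := (GrBimod.tensF (PP i)).obj M) _ _ (br i M m)).symm
  change ev (toShiftU (casN i (c i)) M) (GrMod.lin (betaM i M) (br i M m)) =
    br i M (lc c • m) - lc (reflect i c) • br i M m
  rw [lin_betaM_br, ev_casN, br_e_smul]
  have h₁ : lc (reflect i c) • br i M m = - (c i • X i • br i M m) := by
    rw [← e_smul_br, ← mul_smul, lc_central, e_mul_lc, smul_assoc, e_smul_br, ← neg_smul]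
    congr 1
    simp [reflect]
  have h₂ : br i M (lc c • m) = c i • br i M (X i • m) := by
    rw [← br_e_smul, ← mul_smul, e_mul_lc, smul_assoc, map_zsmul]
  have h₃ : ∀ j, arr i j • e i • m = 0 := fun j => by
    rw [← mul_smul, arr_mul_e_self, zero_smul]
  rw [h₁, h₂, ← mul_smul, X_mul_e]
  simp only [h₃, map_zero, smul_zero, Finset.sum_const_zero, add_zero, smul_add, sub_neg_eq_add]
  rfl

/-- On complexes, `σ_i` acts on the multiplications by central elements by a reflection. -/
noncomputable def mulHomotopy (i : Fin n) (c : Fin n → ℤ) (K : CochainComplex (GrMod.{u} n) ℤ) :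
    Homotopy ((onCx (mulN c) K).map (posF (beta i)))
      (onCx (mulN (reflect i c)) ((posF (beta i)).obj K)) :=
  actHomotopy (beta i) _ _ (casN i (c i)) (casN_beta i c) (beta_casN i c) K

end Central

/-! ### The category of complexes with homogeneous chain maps -/

section Homogeneous

/-- The objects of `𝒞 n`, with homogeneous chain maps of all internal degrees as morphisms. -/
def HC (n : ℕ) : Type (u + 1) := 𝒞.{u} n

namespace HC

/-- The underlying complex. -/
def cx (K : HC.{u} n) : CochainComplex (GrMod.{u} n) ℤ := (show 𝒞.{u} n from K).obj.as

/-- Homogeneous chain maps. -/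
structure Hom (K L : HC.{u} n) where
  deg : IntDeg
  hom : ShiftedHom (cx K) (cx L) deg

noncomputable instance : CategoryStruct (HC.{u} n) where
  Hom := Hom
  id K := ⟨0, ShiftedHom.mk₀ 0 rfl (𝟙 (cx K))⟩
  comp f g := ⟨g.deg + f.deg, f.hom.comp g.hom rfl⟩

variable {K L M : HC.{u} n}

/-- A homogeneous chain map of degree `d` as a morphism. -/
def mk (K L : HC.{u} n) (d : IntDeg) (f : ShiftedHom (cx K) (cx L) d) : K ⟶ L := Hom.mk d f

lemma mk_comp {a b c : IntDeg} (f : ShiftedHom (cx K) (cx L) a) (g : ShiftedHom (cx L) (cx M) b)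
    (h : b + a = c) : mk K L a f ≫ mk L M b g = mk K M c (f.comp g h) := by
  subst h; rfl

noncomputable instance : Category (HC.{u} n) where
  id_comp {K L} f := (mk_comp _ _ (add_zero _)).trans
    (congrArg (mk K L _) (ShiftedHom.mk₀_id_comp 0 rfl f.hom))
  comp_id {K L} f := (mk_comp _ _ (zero_add _)).trans
    (congrArg (mk K L _) (ShiftedHom.comp_mk₀_id f.hom 0 rfl))
  assoc {K L M N} f g h := by
    refine Eq.trans (mk_comp (f.hom.comp g.hom rfl) h.hom (c := h.deg + (g.deg + f.deg)) rfl) ?_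
    refine Eq.trans ?_ (mk_comp f.hom (g.hom.comp h.hom rfl) (add_assoc _ _ _)).symm
    exact congrArg (mk K N _) (ShiftedHom.comp_assoc f.hom g.hom h.hom rfl rfl (add_assoc _ _ _))

/-- A chain map, as a morphism of degree `0`. -/
noncomputable def of (K L : HC.{u} n) (f : cx K ⟶ cx L) : K ⟶ L := mk K L 0 (ShiftedHom.mk₀ 0 rfl f)

lemma of_comp_mk {a : IntDeg} (f : cx K ⟶ cx L) (g : ShiftedHom (cx L) (cx M) a) :
    of K L f ≫ mk L M a g = mk K M a (f ≫ g) :=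
  (mk_comp _ _ (add_zero _)).trans (congrArg (mk K M a) (ShiftedHom.mk₀_comp 0 rfl f g))

lemma mk_comp_of {a : IntDeg} (f : ShiftedHom (cx K) (cx L) a) (g : cx L ⟶ cx M) :
    mk K L a f ≫ of L M g = mk K M a (f ≫ (shiftFunctor _ a).map g) :=
  (mk_comp _ _ (zero_add _)).trans (congrArg (mk K M a) (ShiftedHom.comp_mk₀ f 0 rfl g))

lemma of_comp_of (f : cx K ⟶ cx L) (g : cx L ⟶ cx M) : of K L f ≫ of L M g = of K M (f ≫ g) :=
  (mk_comp _ _ (add_zero _)).trans (congrArg (mk K M 0) (ShiftedHom.mk₀_comp_mk₀ f g (add_zero 0)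
      rfl rfl))

end HC

end Homogeneous

/-! ### Passage to the homotopy category -/

section Realization

variable {C : Type u} [Category.{v} C] [Preadditive C] [HasShift C IntDeg]
  [∀ d : IntDeg, (shiftFunctor C d).Additive] {a b c : IntDeg}

/-- The complex underlying an object of the bounded homotopy category. -/
def asCx (K : Kb C) : CochainComplex C ℤ := K.obj.as

/-- The morphism of the homotopy category given by a homogeneous chain map. -/
noncomputable def quotMap {K L : Kb C} (f : ShiftedHom (asCx K) (asCx L) a) :
    ShiftedHom ((bdd C).ι.obj K) ((bdd C).ι.obj L) a :=
  ShiftedHom.map f (HomotopyCategory.quotient C (ComplexShape.up ℤ))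

/-- The morphism of the bounded homotopy category given by a homogeneous chain map. -/
noncomputable def toKb {K L : Kb C} (f : ShiftedHom (asCx K) (asCx L) a) : ShiftedHom K L a :=
  ObjectProperty.homMk (show ((bdd C).ι.obj K) ⟶ ((bdd C).ι.obj (L⟦a⟧)) from
    quotMap f ≫ ((bdd C).ι.commShiftIso a).inv.app L)

lemma toKb_map_ι {K L : Kb C} (f : ShiftedHom (asCx K) (asCx L) a) :
    (toKb f).map (bdd C).ι = quotMap f := by
  have h : (bdd C).ι.map (toKb f) = quotMap f ≫ ((bdd C).ι.commShiftIso a).inv.app L := rfl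
  unfold ShiftedHom.map
  refine (congrArg (· ≫ _) h).trans ((Category.assoc _ _ _).trans ?_)
  exact (congrArg (quotMap f ≫ ·) (((bdd C).ι.commShiftIso a).inv_hom_id_app L)).trans
      (Category.comp_id _)

lemma map_ι_injective {K L : Kb C} {f g : ShiftedHom K L a}
    (h : f.map (bdd C).ι = g.map (bdd C).ι) : f = g := by
  unfold ShiftedHom.map at h
  rw [cancel_mono] at h
  exact (bdd C).ι.map_injective h

lemma toKb_comp {K L M : Kb C} (f : ShiftedHom (asCx K) (asCx L) a)
    (g : ShiftedHom (asCx L) (asCx M) b) (h : b + a = c) :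
    toKb (K := K) (L := M) (f.comp g h) = (toKb f).comp (toKb g) h := by
  apply map_ι_injective
  rw [ShiftedHom.map_comp, toKb_map_ι, toKb_map_ι, toKb_map_ι]
  exact ShiftedHom.map_comp f g h (HomotopyCategory.quotient C (ComplexShape.up ℤ))

lemma toKb_mk₀ {K L : Kb C} (f : asCx K ⟶ asCx L) (h : a = 0) :
    toKb (ShiftedHom.mk₀ a h f) = ShiftedHom.mk₀ a h (ObjectProperty.homMk
      ((HomotopyCategory.quotient C (ComplexShape.up ℤ)).map f) : K ⟶ L) := by
  apply map_ι_injective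
  rw [toKb_map_ι, ShiftedHom.map_mk₀]
  exact ShiftedHom.map_mk₀ a h f (HomotopyCategory.quotient C (ComplexShape.up ℤ))

lemma map_comp_natural {D : Type*} {E : Type*} [Category* D] [Category* E] [HasShift D IntDeg]
    [HasShift E IntDeg] {F G : D ⥤ E} [F.CommShift IntDeg] [G.CommShift IntDeg] (τ : F ⟶ G)
    [NatTrans.CommShift τ IntDeg] {X Y : D} (f : ShiftedHom X Y a) :
    f.map F ≫ (shiftFunctor E a).map (τ.app Y) = τ.app X ≫ f.map G := by
  have := f.map_naturality τ
  rwa [ShiftedHom.comp_mk₀, ShiftedHom.mk₀_comp] at this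

lemma toKb_onKb {K L : Kb C} (f : ShiftedHom (asCx K) (asCx L) a)
    (Φ : CochainComplex C ℤ ⥤ CochainComplex C ℤ) [Descends Φ] [Φ.CommShift IntDeg] :
    (toKb f).map (onKb Φ) = toKb (K := (onKb Φ).obj K) (L := (onKb Φ).obj L) (f.map Φ) := by
  apply map_ι_injective
  refine Eq.trans ?_ (toKb_map_ι (K := (onKb Φ).obj K) (L := (onKb Φ).obj L) (f.map Φ)).symm
  let τ : onKb Φ ⋙ (bdd C).ι ⟶ (bdd C).ι ⋙ onK Φ := ((bdd C).liftCompιIso ((bdd C).ι ⋙ onK Φ)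
    fun K => Descends.bounded (Φ := Φ) K.obj.as K.property).hom
  have : NatTrans.CommShift τ IntDeg := Functor.CommShift.ofComp_compatibility _ _
  have h₁ := map_comp_natural τ (toKb f)
  have h₂ : (toKb f).map (onKb Φ ⋙ (bdd C).ι) = (toKb f).map ((bdd C).ι ⋙ onK Φ) := by
    refine Eq.trans ?_ (h₁.trans (Category.id_comp _))
    exact ((congrArg (_ ≫ ·) (CategoryTheory.Functor.map_id _ _)).trans (Category.comp_id _)).symm
  have h₃ := map_comp_natural (CategoryTheory.Quotient.lift.isLift (homotopic C (ComplexShape.up ℤ))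
    (Φ ⋙ HomotopyCategory.quotient C _) fun _ _ _ _ ⟨h⟩ =>
      HomotopyCategory.eq_of_homotopy _ _ (Descends.homotopic (Φ := Φ) _ _ h).some).hom f
  have h₄ : f.map (HomotopyCategory.quotient C (ComplexShape.up ℤ) ⋙ onK Φ) =
      f.map (Φ ⋙ HomotopyCategory.quotient C (ComplexShape.up ℤ)) := by
    refine Eq.trans ?_ (h₃.trans (Category.id_comp _))
    exact ((congrArg (_ ≫ ·) (CategoryTheory.Functor.map_id _ _)).trans (Category.comp_id _)).symm
  refine (ShiftedHom.comp_map (toKb f) (onKb Φ) (bdd C).ι).symm.trans (h₂.trans ?_)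
  refine (ShiftedHom.comp_map (toKb f) (bdd C).ι (onK Φ)).trans ?_
  refine (congrArg (fun t => ShiftedHom.map t (onK Φ)) (toKb_map_ι f)).trans ?_
  refine (ShiftedHom.comp_map f (HomotopyCategory.quotient C (ComplexShape.up ℤ)) (onK
      Φ)).symm.trans ?_
  exact h₄.trans (ShiftedHom.comp_map f Φ (HomotopyCategory.quotient C (ComplexShape.up ℤ)))

lemma toKb_eq_of_homotopy {K L : Kb C} {f g : ShiftedHom (asCx K) (asCx L) a}
    (h : Homotopy f g) : toKb f = toKb g := by
  apply map_ι_injective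
  rw [toKb_map_ι, toKb_map_ι]
  exact congrArg (· ≫ _) (HomotopyCategory.eq_of_homotopy _ _ h)

lemma homotopy_of_toKb_eq {K L : Kb C} {f g : ShiftedHom (asCx K) (asCx L) a}
    (h : toKb f = toKb g) : Nonempty (Homotopy f g) := by
  have h' := congrArg (fun t => ShiftedHom.map t (bdd C).ι) h
  simp only [toKb_map_ι] at h'
  have h'' : (HomotopyCategory.quotient C (ComplexShape.up ℤ)).map f =
      (HomotopyCategory.quotient C (ComplexShape.up ℤ)).map g :=
    (cancel_mono (((HomotopyCategory.quotient C (ComplexShape.up ℤ)).commShiftIso a).hom.app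
      (asCx L))).1 h'
  exact ⟨HomotopyCategory.homotopyOfEq _ _ h''⟩

end Realization

/-! ### Braid words acting on homogeneous chain maps -/

section Words

instance (i : Fin n) : (tensR.{u} i).Additive := inferInstanceAs (posF (beta i)).Additive

instance (i : Fin n) : (tensR'.{u} i).Additive := inferInstanceAs (negF (gamma i)).Additive

/-- The value of the functor of a letter. -/
noncomputable def HC.act (s : Letter n) (K : HC.{u} n) : HC.{u} n := (letterFun s).functor.obj K

/-- The action of a letter on homogeneous chain maps. -/
noncomputable def HC.actMap : ∀ (s : Letter n) {K L : HC.{u} n}, (K ⟶ L) → (K.act s ⟶ L.act s)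
  | (i, true), K, L, f => HC.mk (K.act (i, true)) (L.act (i, true)) f.deg (f.hom.map (tensR i))
  | (i, false), K, L, f => HC.mk (K.act (i, false)) (L.act (i, false)) f.deg (f.hom.map (tensR' i))

/-- The functor of a letter, on homogeneous chain maps. -/
noncomputable def letF (s : Letter n) : HC.{u} n ⥤ HC.{u} n where
  obj := HC.act s
  map := HC.actMap s
  map_id K := by
    obtain ⟨i, b⟩ := s
    cases b
    · refine congrArg (HC.mk (K.act (i, false)) (K.act (i, false)) 0) ?_
      exact (ShiftedHom.map_mk₀ 0 rfl (𝟙 K.cx) (tensR' i)).trans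
        (congrArg _ (CategoryTheory.Functor.map_id _ _))
    · refine congrArg (HC.mk (K.act (i, true)) (K.act (i, true)) 0) ?_
      exact (ShiftedHom.map_mk₀ 0 rfl (𝟙 K.cx) (tensR i)).trans
        (congrArg _ (CategoryTheory.Functor.map_id _ _))
  map_comp {K L M} f g := by
    obtain ⟨i, b⟩ := s
    cases b
    · exact congrArg (HC.mk (K.act (i, false)) (M.act (i, false)) _)
        (ShiftedHom.map_comp f.hom g.hom rfl (tensR' i))
    · exact congrArg (HC.mk (K.act (i, true)) (M.act (i, true)) _)
        (ShiftedHom.map_comp f.hom g.hom rfl (tensR i))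

/-- The action of a braid word on homogeneous chain maps. -/
noncomputable def wordMap : ∀ (g : Word n) {K L : HC.{u} n}, (K ⟶ L) →
    ((show HC.{u} n from (wordFun g).functor.obj K) ⟶ (wordFun g).functor.obj L)
  | [], _, _, f => f
  | s :: g, _, _, f => (letF s).map (wordMap g f)

/-- The functor of a braid word, on homogeneous chain maps. -/
noncomputable def W (g : Word n) : HC.{u} n ⥤ HC.{u} n where
  obj K := (wordFun g).functor.obj K
  map := wordMap g
  map_id K := by
    induction g with
    | nil => rfl
    | cons s g ih => exact (congrArg (letF s).map ih).trans ((letF s).map_id _)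
  map_comp f f' := by
    induction g with
    | nil => rfl
    | cons s g ih => exact (congrArg (letF s).map ih).trans ((letF s).map_comp _ _)

lemma W_append (g h : Word n) : W.{u} (g ++ h) = W h ⋙ W g := by
  induction g with
  | nil => rfl
  | cons s g ih => exact congrArg (· ⋙ letF s) ih

end Words

/-! ### Homotopic homogeneous chain maps up to scalars -/

section Relation

namespace HC

variable {K L M : HC.{u} n}

noncomputable instance : SMul ℤ (K ⟶ L) := ⟨fun k f => mk K L f.deg (k • f.hom)⟩

lemma smul_comp (k : ℤ) (f : K ⟶ L) (g : L ⟶ M) : (k • f) ≫ g = k • (f ≫ g) :=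
  congrArg (mk K M _) (ShiftedHom.smul_comp k f.hom g.hom rfl)

lemma comp_smul (k : ℤ) (f : K ⟶ L) (g : L ⟶ M) : f ≫ (k • g) = k • (f ≫ g) :=
  congrArg (mk K M _) (ShiftedHom.comp_smul k f.hom g.hom rfl)

lemma smul_smul (k l : ℤ) (f : K ⟶ L) : k • l • f = (k * l) • f :=
  congrArg (mk K L _) (_root_.smul_smul k l f.hom)

lemma letF_smul (s : Letter n) (k : ℤ) (f : K ⟶ L) : (letF s).map (k • f) = k • (letF s).map f := by
  obtain ⟨i, b⟩ := s
  cases b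
  · exact congrArg (mk (K.act (i, false)) (L.act (i, false)) _)
      (ShiftedHom.map_smul k f.hom (tensR' i))
  · exact congrArg (mk (K.act (i, true)) (L.act (i, true)) _)
      (ShiftedHom.map_smul k f.hom (tensR i))

lemma W_smul (g : Word n) (k : ℤ) (f : K ⟶ L) : (W g).map (k • f) = k • (W g).map f := by
  induction g with
  | nil => rfl
  | cons s g ih => exact (congrArg (letF s).map ih).trans (letF_smul s k _)

/-- `f` is homotopic to `ε g`. -/
inductive Rel (ε : ℤ) : (K ⟶ L) → (K ⟶ L) → Prop
  | mk {d : IntDeg} (f g : ShiftedHom (cx K) (cx L) d)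
      (h : toKb (K := K) (L := L) f = toKb (K := K) (L := L) (ε •
          g)) : Rel ε (mk K L d f) (mk K L d g)

lemma toKb_smul {d : IntDeg} {f g : ShiftedHom (cx K) (cx L) d} (k : ℤ)
    (h : toKb (K := K) (L := L) f = toKb (K := K) (L := L) g) :
    toKb (K := K) (L := L) (k • f) = toKb (K := K) (L := L) (k • g) := by
  have h₁ : ∀ f : ShiftedHom (cx K) (cx L) d, k • f =
      (ShiftedHom.mk₀ 0 rfl (k • 𝟙 (cx K))).comp f (add_zero d) := fun f => by
    rw [ShiftedHom.mk₀_comp, Linear.smul_comp, Category.id_comp]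
  rw [h₁, h₁]
  refine (toKb_comp (K := K) (L := K) (M := L) _ _ _).trans (Eq.trans ?_
    (toKb_comp (K := K) (L := K) (M := L) _ _ _).symm)
  rw [h]

lemma Rel.smul_left (k : ℤ) (f : K ⟶ L) : Rel k (k • f) f := Rel.mk _ _ rfl

lemma Rel.refl (f : K ⟶ L) : Rel 1 f f := Rel.mk f.hom f.hom (by rw [_root_.one_smul])

lemma Rel.of_eq {f g : K ⟶ L} (h : f = g) : Rel 1 f g := h ▸ Rel.refl f

lemma Rel.symm {ε : ℤ} (hε : IsUnit ε) {f g : K ⟶ L} (h : Rel ε f g) : Rel ε g f := by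
  obtain ⟨f, g, h⟩ := h
  refine Rel.mk _ _ ?_
  refine Eq.trans ?_ (toKb_smul ε h).symm
  rw [_root_.smul_smul, Int.isUnit_mul_self hε, _root_.one_smul]

lemma Rel.trans {ε ε' : ℤ} {f g h : K ⟶ L} (h₁ : Rel ε f g) (h₂ : Rel ε' g h) :
    Rel (ε * ε') f h := by
  obtain ⟨f, g, h₁⟩ := h₁
  obtain ⟨_, h, h₂⟩ := h₂
  refine Rel.mk _ _ (h₁.trans ?_)
  rw [← _root_.smul_smul]
  exact toKb_smul ε h₂

lemma Rel.smul (k : ℤ) {ε : ℤ} {f g : K ⟶ L} (h : Rel ε f g) : Rel ε (k • f) (k • g) := by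
  obtain ⟨f, g, h⟩ := h
  refine Rel.mk _ _ ((toKb_smul k h).trans ?_)
  exact congrArg _ (smul_comm k ε g)

lemma Rel.comp {ε ε' : ℤ} {f f' : K ⟶ L} {g g' : L ⟶ M} (h : Rel ε f f') (h' : Rel ε' g g') :
    Rel (ε * ε') (f ≫ g) (f' ≫ g') := by
  obtain ⟨f, f', h⟩ := h
  obtain ⟨g, g', h'⟩ := h'
  refine Rel.mk _ _ ?_
  refine (toKb_comp (K := K) (L := L) (M := M) f g rfl).trans ?_
  refine (congrArg₂ (fun x y => ShiftedHom.comp x y rfl) h h').trans ?_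
  refine (toKb_comp (K := K) (L := L) (M := M) (ε • f') (ε' • g') rfl).symm.trans (congrArg _ ?_)
  refine (ShiftedHom.smul_comp ε f' (ε' • g') rfl).trans ?_
  exact (congrArg (ε • ·) (ShiftedHom.comp_smul ε' f' g' rfl)).trans (_root_.smul_smul _ _ _)

lemma Rel.letF {ε : ℤ} (s : Letter n) {f g : K ⟶ L} (h : Rel ε f g) :
    Rel ε ((letF s).map f) ((letF s).map g) := by
  obtain ⟨f, g, h⟩ := h
  obtain ⟨i, b⟩ := s
  cases b
  · refine Rel.mk (K := K.act (i, false)) (L := L.act (i, false)) _ _ ?_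
    refine (toKb_onKb (K := K) (L := L) f (tensR' i)).symm.trans ?_
    rw [h]
    refine (toKb_onKb (K := K) (L := L) (ε • g) (tensR' i)).trans ?_
    exact congrArg _ (ShiftedHom.map_smul ε g (tensR' i))
  · refine Rel.mk (K := K.act (i, true)) (L := L.act (i, true)) _ _ ?_
    refine (toKb_onKb (K := K) (L := L) f (tensR i)).symm.trans ?_
    rw [h]
    refine (toKb_onKb (K := K) (L := L) (ε • g) (tensR i)).trans ?_
    exact congrArg _ (ShiftedHom.map_smul ε g (tensR i))

lemma Rel.W {ε : ℤ} (g : Word n) {f f' : K ⟶ L} (h : Rel ε f f') :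
    Rel ε ((W g).map f) ((W g).map f') := by
  induction g with
  | nil => exact h
  | cons s g ih => exact ih.letF s

lemma Rel.deg_eq {ε : ℤ} {f g : K ⟶ L} (h : Rel ε f g) : f.deg = g.deg := by
  obtain ⟨_, _, _⟩ := h; rfl

lemma Rel.of_homotopy {d : IntDeg} {f g : ShiftedHom (cx K) (cx L) d}
    (h : Homotopy f g) : Rel 1 (HC.mk K L d f) (HC.mk K L d g) :=
  Rel.mk _ _ ((toKb_eq_of_homotopy (K := K) (L := L) h).trans (by rw [_root_.one_smul]))

lemma mk_injective {d : IntDeg} {f g : ShiftedHom (cx K) (cx L) d}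
    (h : HC.mk K L d f = HC.mk K L d g) : f = g := by
  injection h

lemma Rel.homotopy {d : IntDeg} {f g : ShiftedHom (cx K) (cx L) d} {ε : ℤ}
    (h : Rel ε (HC.mk K L d f) (HC.mk K L d g)) : Nonempty (Homotopy f (ε • g)) := by
  generalize hf : HC.mk K L d f = f' at h
  generalize hg : HC.mk K L d g = g' at h
  obtain ⟨f₀, g₀, h⟩ := h
  injection hf with hd hf'
  subst hd
  obtain rfl := eq_of_heq hf'
  obtain rfl := mk_injective hg
  exact homotopy_of_toKb_eq (K := K) (L := L) h

end HC

end Relation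

/-! ### Transformations between braid words up to homotopy and sign -/

section Words

/-- Homogeneous natural transformations, up to homotopy and an overall sign. -/
def wordRel (g h : Word n) (t t' : W.{u} g ⟶ W h) : Prop :=
  ∃ ε : ℤ, IsUnit ε ∧ ∀ K, HC.Rel ε (t.app K) (t'.app K)

lemma wordRel.refl {g h : Word n} (t : W.{u} g ⟶ W h) : wordRel g h t t :=
  ⟨1, isUnit_one, fun _ => HC.Rel.refl _⟩

lemma wordRel_equivalence (g h : Word n) : Equivalence (wordRel.{u} g h) where
  refl := wordRel.refl
  symm := fun ⟨ε, hε, h⟩ => ⟨ε, hε, fun K => (h K).symm hε⟩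
  trans := fun ⟨ε, hε, h⟩ ⟨ε', hε', h'⟩ => ⟨ε * ε', hε.mul hε', fun K => (h K).trans (h' K)⟩

/-- The action of integers on transformations. -/
noncomputable def zsmulT (k : ℤ) {g h : Word n} (t : W.{u} g ⟶ W h) : W.{u} g ⟶ W h where
  app K := k • t.app K
  naturality K L f := by rw [HC.comp_smul, HC.smul_comp, t.naturality]

/-- The transformation `t` with the word `u` placed to the left. -/
noncomputable def leftT (u : Word n) {g h : Word n} (t : W.{u} g ⟶ W h) :
    W.{u} (u ++ g) ⟶ W (u ++ h) :=
  eqToHom (W_append u g) ≫ Functor.whiskerRight t (W u) ≫ eqToHom (W_append u h).symm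

/-- The transformation `t` with the word `v` placed to the right. -/
noncomputable def rightT (v : Word n) {g h : Word n} (t : W.{u} g ⟶ W h) :
    W.{u} (g ++ v) ⟶ W (h ++ v) :=
  eqToHom (W_append g v) ≫ Functor.whiskerLeft (W v) t ≫ eqToHom (W_append h v).symm

lemma eqToHom_conj_heq {C : Type*} [Category* C] {X Y X' Y' : C} (h : X = X') (f : X' ⟶ Y')
    (h' : Y = Y') : HEq (eqToHom h ≫ f ≫ eqToHom h'.symm) f := by
  subst h h'; simp

lemma leftT_heq (u : Word n) {g h : Word n} (t : W.{u} g ⟶ W h) :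
    HEq (leftT u t) (Functor.whiskerRight t (W u)) :=
  eqToHom_conj_heq (W_append u g) _ (W_append u h)

lemma rightT_heq (v : Word n) {g h : Word n} (t : W.{u} g ⟶ W h) :
    HEq (rightT v t) (Functor.whiskerLeft (W v) t) :=
  eqToHom_conj_heq (W_append g v) _ (W_append h v)

lemma whiskerRight_heq {C : Type*} [Category* C] {F G F' G' H H' : C ⥤ C} (h₁ : F = F')
    (h₂ : G = G') (h : H = H') {t : F ⟶ G} {t' : F' ⟶ G'} (ht : HEq t t') :
    HEq (Functor.whiskerRight t H) (Functor.whiskerRight t' H') := by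
  subst h₁ h₂ h; rw [eq_of_heq ht]

lemma whiskerLeft_heq {C : Type*} [Category* C] {F G F' G' H H' : C ⥤ C} (h₁ : F = F')
    (h₂ : G = G') (h : H = H') {t : F ⟶ G} {t' : F' ⟶ G'} (ht : HEq t t') :
    HEq (Functor.whiskerLeft H t) (Functor.whiskerLeft H' t') := by
  subst h₁ h₂ h; rw [eq_of_heq ht]

lemma leftT_append (u v : Word n) {g h : Word n} (t : W.{u} g ⟶ W h) :
    HEq (leftT (u ++ v) t) (leftT u (leftT v t)) :=
  (leftT_heq _ _).trans ((whiskerRight_heq rfl rfl (W_append u v) HEq.rfl).trans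
    ((whiskerRight_heq (W_append v g).symm (W_append v h).symm rfl (leftT_heq v t).symm).trans
      (leftT_heq u _).symm))

lemma rightT_append (v w : Word n) {g h : Word n} (t : W.{u} g ⟶ W h) :
    HEq (rightT (v ++ w) t) (rightT w (rightT v t)) :=
  (rightT_heq _ _).trans ((whiskerLeft_heq rfl rfl (W_append v w) HEq.rfl).trans
    ((whiskerLeft_heq (W_append g v).symm (W_append h v).symm rfl (rightT_heq v t).symm).trans
      (rightT_heq w _).symm))

lemma leftT_rightT (u v : Word n) {g h : Word n} (t : W.{u} g ⟶ W h) :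
    HEq (leftT u (rightT v t)) (rightT v (leftT u t)) :=
  (leftT_heq _ _).trans ((whiskerRight_heq (W_append g v) (W_append h v) rfl
    (rightT_heq v t)).trans ((whiskerLeft_heq (W_append u g).symm (W_append u h).symm rfl
      (leftT_heq u t).symm).trans (rightT_heq v _).symm))

lemma leftT_nil {g h : Word n} (t : W.{u} g ⟶ W h) : HEq (leftT [] t) t := leftT_heq _ _

lemma rightT_nil {g h : Word n} (t : W.{u} g ⟶ W h) : HEq (rightT [] t) t := rightT_heq _ _

lemma leftT_id (u g : Word n) : leftT u (𝟙 (W.{u} g)) = 𝟙 _ := by simp [leftT]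

lemma rightT_id (v g : Word n) : rightT v (𝟙 (W.{u} g)) = 𝟙 _ := by simp [rightT]

lemma leftT_comp (u : Word n) {g h k : Word n} (t : W.{u} g ⟶ W h) (t' : W.{u} h ⟶ W k) :
    leftT u (t ≫ t') = leftT u t ≫ leftT u t' := by simp [leftT]

lemma rightT_comp (v : Word n) {g h k : Word n} (t : W.{u} g ⟶ W h) (t' : W.{u} h ⟶ W k) :
    rightT v (t ≫ t') = rightT v t ≫ rightT v t' := by simp [rightT]

lemma exchangeT {u u' v v' : Word n} (t : W.{u} u ⟶ W u') (t' : W.{u} v ⟶ W v') :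
    rightT v t ≫ leftT u' t' = leftT u t' ≫ rightT v' t := by
  simp only [leftT, rightT, Category.assoc, eqToHom_trans_assoc, eqToHom_refl, Category.id_comp]
  refine congrArg (_ ≫ ·) ?_
  rw [← Category.assoc, ← Category.assoc]
  refine congrArg (· ≫ _) ?_
  ext K
  exact (t.naturality (t'.app K)).symm

lemma leftT_app (u : Word n) {g h : Word n} (t : W.{u} g ⟶ W h) (K : HC.{u} n) :
    HEq ((leftT u t).app K) ((W u).map (t.app K)) := by
  have key : ∀ {F G F' G' : HC.{u} n ⥤ HC.{u} n} (h₁ : F = F') (h₂ : G = G') {t : F ⟶ G}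
      {t' : F' ⟶ G'}, HEq t t' → HEq (t.app K) (t'.app K) := by
    intro F G F' G' h₁ h₂ t t' ht
    subst h₁ h₂; rw [eq_of_heq ht]
  exact key (W_append u g) (W_append u h) (leftT_heq u t)

lemma rightT_app (v : Word n) {g h : Word n} (t : W.{u} g ⟶ W h) (K : HC.{u} n) :
    HEq ((rightT v t).app K) (t.app ((W v).obj K)) := by
  have key : ∀ {F G F' G' : HC.{u} n ⥤ HC.{u} n} (h₁ : F = F') (h₂ : G = G') {t : F ⟶ G}
      {t' : F' ⟶ G'}, HEq t t' → HEq (t.app K) (t'.app K) := by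
    intro F G F' G' h₁ h₂ t t' ht
    subst h₁ h₂; rw [eq_of_heq ht]
  exact key (W_append g v) (W_append h v) (rightT_heq v t)

lemma HC.Rel.heq {ε : ℤ} {K L K' L' : HC.{u} n} (hK : K = K') (hL : L = L') {f g : K ⟶ L}
    {f' g' : K' ⟶ L'} (hf : HEq f f') (hg : HEq g g') (h : HC.Rel ε f g) : HC.Rel ε f' g' := by
  subst hK hL; rwa [← eq_of_heq hf, ← eq_of_heq hg]

lemma W_append_obj (g h : Word n) (K : HC.{u} n) :
    (W (g ++ h)).obj K = (W g).obj ((W h).obj K) := by rw [W_append]; rfl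

lemma wordRel.leftT (u : Word n) {g h : Word n} {t t' : W.{u} g ⟶ W h} (H : wordRel g h t t') :
    wordRel _ _ (leftT u t) (leftT u t') := by
  obtain ⟨ε, hε, H⟩ := H
  exact ⟨ε, hε, fun K => HC.Rel.heq (W_append_obj u g K).symm (W_append_obj u h K).symm
    (leftT_app u t K).symm (leftT_app u t' K).symm ((H K).W u)⟩

lemma wordRel.rightT (v : Word n) {g h : Word n} {t t' : W.{u} g ⟶ W h} (H : wordRel g h t t') :
    wordRel _ _ (rightT v t) (rightT v t') := by
  obtain ⟨ε, hε, H⟩ := H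
  exact ⟨ε, hε, fun K => HC.Rel.heq (W_append_obj g v K).symm (W_append_obj h v K).symm
    (rightT_app v t K).symm (rightT_app v t' K).symm (H _)⟩

lemma wordRel.comp {g h k : Word n} {t t' : W.{u} g ⟶ W h} {s s' : W.{u} h ⟶ W k}
    (H : wordRel g h t t') (H' : wordRel h k s s') : wordRel _ _ (t ≫ s) (t' ≫ s') := by
  obtain ⟨ε, hε, H⟩ := H
  obtain ⟨ε', hε', H'⟩ := H'
  exact ⟨ε * ε', hε.mul hε', fun K => (H K).comp (H' K)⟩

lemma wordRel.zsmul (k : ℤ) {g h : Word n} {t t' : W.{u} g ⟶ W h} (H : wordRel g h t t') :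
    wordRel _ _ (zsmulT k t) (zsmulT k t') := by
  obtain ⟨ε, hε, H⟩ := H
  exact ⟨ε, hε, fun K => (H K).smul k⟩

lemma zsmulT_leftT (k : ℤ) (u : Word n) {g h : Word n} (t : W.{u} g ⟶ W h) :
    leftT u (zsmulT k t) = zsmulT k (leftT u t) := by
  have h₁ : ∀ {F G : HC.{u} n ⥤ HC.{u} n} (h₁ : W (u ++ g) = F) (h₂ : G = W (u ++ h))
      (s s' : F ⟶ G), (∀ K, s'.app K = k • s.app K) →
      eqToHom h₁ ≫ s' ≫ eqToHom h₂ = zsmulT k (eqToHom h₁ ≫ s ≫ eqToHom h₂) := by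
    intro F G h₁ h₂ s s' H
    subst h₁ h₂
    simp only [eqToHom_refl, Category.id_comp, Category.comp_id]
    ext K; exact H K
  exact h₁ _ _ _ _ fun K => HC.W_smul u k (t.app K)

lemma zsmulT_rightT (k : ℤ) (v : Word n) {g h : Word n} (t : W.{u} g ⟶ W h) :
    rightT v (zsmulT k t) = zsmulT k (rightT v t) := by
  have h₁ : ∀ {F G : HC.{u} n ⥤ HC.{u} n} (h₁ : W (g ++ v) = F) (h₂ : G = W (h ++ v))
      (s s' : F ⟶ G), (∀ K, s'.app K = k • s.app K) →
      eqToHom h₁ ≫ s' ≫ eqToHom h₂ = zsmulT k (eqToHom h₁ ≫ s ≫ eqToHom h₂) := by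
    intro F G h₁ h₂ s s' H
    subst h₁ h₂
    simp only [eqToHom_refl, Category.id_comp, Category.comp_id]
    ext K; exact H K
  exact h₁ _ _ _ _ fun K => rfl

/-- The category whose objects are braid words and whose morphisms are homogeneous natural
transformations between their functors, up to homotopy and an overall sign. -/
structure Sg (n : ℕ) : Type u where
  /-- The braid word. -/
  word : Word n

/-- The equivalence relation `wordRel` as a setoid. -/
def wordSetoid (g h : Word n) : Setoid (W.{u} g ⟶ W h) := ⟨wordRel g h, wordRel_equivalence g h⟩

/-- The class of a transformation. -/
def cls {g h : Word n} (t : W.{u} g ⟶ W h) : Quotient (wordSetoid g h) := Quotient.mk _ t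

noncomputable instance : Category (Sg.{u} n) where
  Hom g h := Quotient (wordSetoid.{u} g.word h.word)
  id g := cls (𝟙 (W g.word))
  comp := Quotient.map₂ (· ≫ ·) fun _ _ h _ _ h' => wordRel.comp h h'
  id_comp := by rintro g h ⟨t⟩; exact congrArg cls (Category.id_comp t)
  comp_id := by rintro g h ⟨t⟩; exact congrArg cls (Category.comp_id t)
  assoc := by rintro g h k l ⟨t⟩ ⟨s⟩ ⟨r⟩; exact congrArg cls (Category.assoc t s r)

end Words

namespace Sg

/-- Morphisms of `Sg n` between two words. -/
abbrev Hm (g h : Word n) := (⟨g⟩ : Sg.{u} n) ⟶ ⟨h⟩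

/-- The class of a transformation. -/
def ofT {g h : Word n} (t : W.{u} g ⟶ W h) : Hm.{u} g h := cls t

lemma ofT_surjective {g h : Word n} (f : Hm.{u} g h) : ∃ t, ofT t = f := Quotient.exists_rep f

lemma ofT_eq_iff {g h : Word n} (t t' : W.{u} g ⟶ W h) : ofT t = ofT t' ↔ wordRel g h t t' :=
  ⟨fun h => Quotient.exact h, fun h => Quotient.sound h⟩

lemma ofT_comp {g h k : Word n} (t : W.{u} g ⟶ W h) (s : W.{u} h ⟶ W k) :
    ofT (t ≫ s) = ofT t ≫ ofT s := rfl

lemma ofT_id (g : Word n) : ofT (𝟙 (W.{u} g)) = 𝟙 _ := rfl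

/-- Placing the word `u` to the left. -/
noncomputable def lft (u : Word n) {g h : Word n} : Hm.{u} g h → Hm.{u} (u ++ g) (u ++ h) :=
  Quotient.map (leftT u) fun _ _ h => wordRel.leftT u h

/-- Placing the word `v` to the right. -/
noncomputable def rgt (v : Word n) {g h : Word n} : Hm.{u} g h → Hm.{u} (g ++ v) (h ++ v) :=
  Quotient.map (rightT v) fun _ _ h => wordRel.rightT v h

noncomputable instance (g h : Sg.{u} n) : SMul ℤ (g ⟶ h) :=
  ⟨fun k => Quotient.map (zsmulT k) fun _ _ h => wordRel.zsmul k h⟩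

variable {g h k u v : Word n}

lemma smul_ofT (m : ℤ) (t : W.{u} g ⟶ W h) : m • ofT t = ofT (zsmulT m t) := rfl

lemma lft_id (u g : Word n) : lft.{u} u (𝟙 (⟨g⟩ : Sg.{u} n)) = 𝟙 _ := congrArg ofT (leftT_id u g)

lemma rgt_id (v g : Word n) : rgt.{u} v (𝟙 (⟨g⟩ : Sg.{u} n)) = 𝟙 _ := congrArg ofT (rightT_id v g)

lemma lft_comp (u : Word n) (f : Hm.{u} g h) (f' : Hm.{u} h k) : lft u (f ≫ f') = lft u f ≫
    lft u f' := by
  obtain ⟨t, rfl⟩ := ofT_surjective f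
  obtain ⟨s, rfl⟩ := ofT_surjective f'
  exact congrArg ofT (leftT_comp u t s)

lemma rgt_comp (u : Word n) (f : Hm.{u} g h) (f' : Hm.{u} h k) : rgt u (f ≫ f') = rgt u f ≫
    rgt u f' := by
  obtain ⟨t, rfl⟩ := ofT_surjective f
  obtain ⟨s, rfl⟩ := ofT_surjective f'
  exact congrArg ofT (rightT_comp u t s)

lemma exchange {g g' h h' : Word n} (f : Hm.{u} g g') (f' : Hm.{u} h h') :
    rgt h f ≫ lft g' f' = lft g f' ≫ rgt h' f := by
  obtain ⟨t, rfl⟩ := ofT_surjective f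
  obtain ⟨s, rfl⟩ := ofT_surjective f'
  exact congrArg ofT (exchangeT t s)

lemma ofT_heq {g h g' h' : Word n} (hg : g = g') (hh : h = h') {t : W.{u} g ⟶ W h}
    {t' : W.{u} g' ⟶ W h'} (H : HEq t t') : HEq (ofT t) (ofT t') := by
  subst hg hh; rw [eq_of_heq H]

lemma lft_append (u v : Word n) (f : Hm.{u} g h) : HEq (lft (u ++ v) f) (lft u (lft v f)) := by
  obtain ⟨t, rfl⟩ := ofT_surjective f
  exact ofT_heq (List.append_assoc _ _ _) (List.append_assoc _ _ _) (leftT_append u v t)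

lemma rgt_append (u v : Word n) (f : Hm.{u} g h) : HEq (rgt (u ++ v) f) (rgt v (rgt u f)) := by
  obtain ⟨t, rfl⟩ := ofT_surjective f
  exact ofT_heq (List.append_assoc _ _ _).symm (List.append_assoc _ _ _).symm (rightT_append u v t)

lemma lft_rgt (u v : Word n) (f : Hm.{u} g h) : HEq (lft u (rgt v f)) (rgt v (lft u f)) := by
  obtain ⟨t, rfl⟩ := ofT_surjective f
  exact ofT_heq (List.append_assoc _ _ _).symm (List.append_assoc _ _ _).symm (leftT_rightT u v t)

lemma lft_nil (f : Hm.{u} g h) : lft [] f = f := by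
  obtain ⟨t, rfl⟩ := ofT_surjective f
  exact eq_of_heq (ofT_heq rfl rfl (leftT_nil t))

lemma rgt_nil (f : Hm.{u} g h) : HEq (rgt [] f) f := by
  obtain ⟨t, rfl⟩ := ofT_surjective f
  exact ofT_heq (List.append_nil _) (List.append_nil _) (rightT_nil t)

lemma lft_smul (m : ℤ) (u : Word n) (f : Hm.{u} g h) : lft u (m • f) = m • lft u f := by
  obtain ⟨t, rfl⟩ := ofT_surjective f
  exact congrArg ofT (zsmulT_leftT m u t)

lemma rgt_smul (m : ℤ) (u : Word n) (f : Hm.{u} g h) : rgt u (m • f) = m • rgt u f := by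
  obtain ⟨t, rfl⟩ := ofT_surjective f
  exact congrArg ofT (zsmulT_rightT m u t)

lemma smul_comp (m : ℤ) (f : Hm.{u} g h) (f' : Hm.{u} h k) : (m • f) ≫ f' = m • (f ≫ f') := by
  obtain ⟨t, rfl⟩ := ofT_surjective f
  obtain ⟨s, rfl⟩ := ofT_surjective f'
  exact congrArg ofT (NatTrans.ext (funext fun K => HC.smul_comp m (t.app K) (s.app K)))

lemma comp_smul (m : ℤ) (f : Hm.{u} g h) (f' : Hm.{u} h k) : f ≫ (m • f') = m • (f ≫ f') := by
  obtain ⟨t, rfl⟩ := ofT_surjective f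
  obtain ⟨s, rfl⟩ := ofT_surjective f'
  exact congrArg ofT (NatTrans.ext (funext fun K => HC.comp_smul m (t.app K) (s.app K)))

lemma smul_smul (m m' : ℤ) (f : Hm.{u} g h) : m • m' • f = (m * m') • f := by
  obtain ⟨t, rfl⟩ := ofT_surjective f
  exact congrArg ofT (NatTrans.ext (funext fun K => HC.smul_smul m m' (t.app K)))

lemma unit_smul {m : ℤ} (hm : IsUnit m) (f : Hm.{u} g h) : m • f = f := by
  obtain ⟨t, rfl⟩ := ofT_surjective f
  exact (ofT_eq_iff _ _).2 ⟨m, hm, fun K => HC.Rel.smul_left m (t.app K)⟩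

end Sg

instance : Nonempty (HC.{u} n) :=
  ⟨⟨(ObjectProperty.ContainsZero.exists_zero (P := bdd (GrMod.{u} n))).choose,
    (ObjectProperty.ContainsZero.exists_zero (P := bdd (GrMod.{u} n))).choose_spec.2⟩⟩

/-- The degree of a homogeneous natural transformation. -/
noncomputable def degT {g h : Word n} (t : W.{u} g ⟶ W h) : IntDeg :=
  (t.app (Classical.arbitrary _)).deg

lemma wordMap_deg (g : Word n) {K L : HC.{u} n} (f : K ⟶ L) : ((W g).map f).deg = f.deg := by
  induction g with
  | nil => rfl
  | cons s g ih =>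
    obtain ⟨i, b⟩ := s
    cases b <;> exact ih

lemma app_deg {g h : Word n} (t : W.{u} g ⟶ W h) (K : HC.{u} n) : (t.app K).deg = degT t := by
  have h₁ := congrArg HC.Hom.deg (t.naturality (HC.mk K (Classical.arbitrary _) 0 0))
  have h₂ : degT t + 0 = 0 + (t.app K).deg := by
    refine Eq.trans ?_ (h₁.trans ?_)
    · exact congrArg (degT t + ·) (wordMap_deg g (HC.mk K (Classical.arbitrary _) 0 0)).symm
    · exact congrArg (· + (t.app K).deg) (wordMap_deg h (HC.mk K (Classical.arbitrary _) 0 0))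
  rw [add_zero, zero_add] at h₂
  exact h₂.symm

namespace Sg

variable {g h k u v : Word n}

/-- The degree of a morphism. -/
noncomputable def deg (f : Hm.{u} g h) : IntDeg :=
  Quotient.lift (s := wordSetoid g h) degT
    (fun _ _ H => (H.choose_spec.2 (Classical.arbitrary _)).deg_eq) f

lemma deg_id (g : Word n) : deg (𝟙 (⟨g⟩ : Sg.{u} n)) = 0 := rfl

lemma deg_comp (f : Hm.{u} g h) (f' : Hm.{u} h k) : deg (f ≫ f') = deg f' + deg f := by
  obtain ⟨t, rfl⟩ := ofT_surjective f
  obtain ⟨s, rfl⟩ := ofT_surjective f'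
  rfl

lemma heq_deg {K L K' L' : HC.{u} n} (hK : K = K') (hL : L = L') {f : K ⟶ L} {f' : K' ⟶ L'}
    (hf : HEq f f') : f.deg = f'.deg := by
  subst hK hL; rw [eq_of_heq hf]

lemma deg_lft (w : Word n) (f : Hm.{u} g h) : deg (lft w f) = deg f := by
  obtain ⟨t, rfl⟩ := ofT_surjective f
  exact (heq_deg (W_append_obj w g _) (W_append_obj w h _) (leftT_app w t _)).trans
    (wordMap_deg w _)

lemma deg_rgt (w : Word n) (f : Hm.{u} g h) : deg (rgt w f) = deg f := by
  obtain ⟨t, rfl⟩ := ofT_surjective f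
  exact (heq_deg (W_append_obj g w _) (W_append_obj h w _) (rightT_app w t _)).trans
    (app_deg t _)

end Sg

/-! ### The elementary transformations -/

section Elementary

open HC (cx)

/-- A transformation of degree `d` between word functors, from its values. -/
noncomputable def natOfDeg {g h : Word n} (d : IntDeg)
    (f : ∀ K, ShiftedHom ((W.{u} g).obj K).cx ((W h).obj K).cx d)
    (nat : ∀ {K L : HC.{u} n} (φ : K ⟶ L), ∃ (a : ShiftedHom ((W g).obj K).cx ((W g).obj L).cx
        φ.deg)
      (b : ShiftedHom ((W h).obj K).cx ((W h).obj L).cx φ.deg),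
      (W g).map φ = HC.mk _ _ φ.deg a ∧ (W h).map φ = HC.mk _ _ φ.deg b ∧
        a.comp (f L) rfl = (f K).comp b (add_comm φ.deg d)) : W.{u} g ⟶ W h where
  app K := HC.mk _ _ d (f K)
  naturality K L φ := by
    obtain ⟨a, b, ha, hb, hab⟩ := nat φ
    rw [ha, hb]
    refine (HC.mk_comp _ _ rfl).trans ?_
    rw [hab]
    exact (HC.mk_comp _ _ _).symm

/-- A transformation of degree `0` between word functors, from its values. -/
noncomputable def natOf {g h : Word n} (f : ∀ K, ((W.{u} g).obj K).cx ⟶ ((W h).obj K).cx)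
    (nat : ∀ {K L : HC.{u} n} (φ : K ⟶ L), ∃ (a : ShiftedHom ((W g).obj K).cx ((W g).obj L).cx
        φ.deg)
      (b : ShiftedHom ((W h).obj K).cx ((W h).obj L).cx φ.deg),
      (W g).map φ = HC.mk _ _ φ.deg a ∧ (W h).map φ = HC.mk _ _ φ.deg b ∧
        a ≫ (shiftFunctor _ φ.deg).map (f L) = f K ≫ b) : W.{u} g ⟶ W h where
  app K := HC.of _ _ (f K)
  naturality K L φ := by
    obtain ⟨a, b, ha, hb, hab⟩ := nat φ
    rw [ha, hb]
    refine (HC.mk_comp_of _ _).trans ?_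
    rw [hab]
    exact (HC.of_comp_mk _ _).symm

/-- The creation of a pair of inverse letters. -/
noncomputable def createT : ∀ (i : Fin n) (a : Bool), W.{u} [] ⟶ W [(i, a), (i, !a)]
  | i, true => natOf (fun K => (pairData i).create K.cx)
      fun φ => ⟨_, _, rfl, rfl, ((pairData i).create_natural φ.hom).symm⟩
  | i, false => natOf (fun K => (pairData' i).create K.cx)
      fun φ => ⟨_, _, rfl, rfl, ((pairData' i).create_natural φ.hom).symm⟩

/-- The cancellation of a pair of inverse letters. -/
noncomputable def cancelT : ∀ (i : Fin n) (a : Bool), W.{u} [(i, a), (i, !a)] ⟶ W []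
  | i, true => natOf (fun K => (pairData i).cancel K.cx)
      fun φ => ⟨_, _, rfl, rfl, ((pairData i).cancel_natural φ.hom).symm⟩
  | i, false => natOf (fun K => (pairData' i).cancel K.cx)
      fun φ => ⟨_, _, rfl, rfl, ((pairData' i).cancel_natural φ.hom).symm⟩

/-- The exchange of two distant positive letters. -/
noncomputable def farT {i j : Fin n} (h : Far i j) :
    W.{u} [(i, true), (j, true)] ⟶ W [(j, true), (i, true)] :=
  natOf (fun K => far (beta i) (beta j) K.cx (far_zero h))
    fun φ => ⟨_, _, rfl, rfl, (far_natural (beta i) (beta j) (far_zero h) φ.hom).symm⟩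

/-- The braid move of positive letters. -/
noncomputable def braidT {i j : Fin n} (h : Adj i j) :
    W.{u} [(i, true), (j, true), (i, true)] ⟶ W [(j, true), (i, true), (j, true)] :=
  natOf (fun K => (braidData h).braid K.cx)
    fun φ => ⟨_, _, rfl, rfl, ((braidData h).braid_natural φ.hom).symm⟩

/-- The insertion of a positive letter. -/
noncomputable def wOneT (i : Fin n) : W.{u} [] ⟶ W [(i, true)] :=
  natOf (fun K => (cw₁ i).app K.cx)
    fun φ => ⟨_, _, rfl, rfl, (incK_natural (beta i) φ.hom).symm⟩

lemma cw₂_app_f (i : Fin n) (K : CochainComplex (GrMod.{u} n) ℤ) (p : ℤ) :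
    ((cw₂ i).app K).f p = prK' (gamma i) K p := cocone_fst_f _ p

/-- The removal of a negative letter. -/
noncomputable def wTwoT (i : Fin n) : W.{u} [(i, false)] ⟶ W [] :=
  natOf (fun K => (cw₂ i).app K.cx) fun φ => ⟨_, _, rfl, rfl, cmp_ext fun p => by
    have h := hsq_prK' φ.hom (gamma i) p
    rw [← cw₂_app_f, ← cw₂_app_f] at h
    exact h.symm⟩


lemma cw₃_cmp (i : Fin n) (K : CochainComplex (GrMod.{u} n) ℤ) (p : ℤ) :
    cmp (L := K) (d := intDeg 2) ((cw₃ i).app K) p =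
      prK (beta i) K p ≫ toShift (mulN (zc i)) (K.X p) := by
  rw [mulN_zc]
  have h : CochainComplex.HomComplex.δ (-1) 0 0 =
      CochainComplex.HomComplex.Cochain.ofHom ((extTo (beta i)).app K ≫ (cdelta i).app K) := by
    rw [CochainComplex.HomComplex.δ_zero, cbeta_cdelta,
      CochainComplex.HomComplex.Cochain.ofHom_zero]
  refine pos_ext (beta i) rfl ?_ ?_
  · rw [inU_prK_assoc]
    exact CochainComplex.mappingCone.inl_v_desc_f _ 0 ((cdelta i).app K) h _ _ _
  · rw [inK_prK_assoc]
    exact CochainComplex.mappingCone.inr_f_desc_f _ 0 ((cdelta i).app K) h p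

lemma cw₄_cmp (i : Fin n) (K : CochainComplex (GrMod.{u} n) ℤ) (p : ℤ) :
    cmp (K := K) (L := (tensR' i).obj K) (d := intDeg 2) ((cw₄ i).app K) p =
      toShift (mulN (zc i)) (K.X p) ≫ (shiftFunctor _ (intDeg 2)).map (inK' (gamma i) K p) := by
  rw [mulN_zc]
  refine (congrArg₂ (· ≫ ·) (cocone_lift_f _ _ _ p)
    (commShift_negF_f (gamma i) K (intDeg 2) p)).trans ?_
  refine (Category.assoc _ _ _).trans (congrArg (((cdelta i).app K).f p ≫ ·) ?_)
  refine (inl_coneComm (extFrom (gamma i)) (intDeg 2) K (p + -1) p rfl).trans ?_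
  exact (congrArg (· ≫ _) (commShift_id_f K (intDeg 2) p)).trans (Category.id_comp _)

lemma ev_toShift_comp {M N : GrMod.{u} n} (c : Fin n → ℤ) (f : M ⟶ N) (m : M.carrier) :
    ev (N := N) (toShift (mulN c) M ≫ (shiftFunctor _ (intDeg 2)).map f) m =
      lc c • GrMod.lin f m := map_smul (GrMod.lin f) _ _

lemma hsq_lin {M N M' N' : GrMod.{u} n} {d : IntDeg} {f : ShiftedHom M N d}
    {f' : ShiftedHom M' N' d} {a : M ⟶ M'} {b : N ⟶ N'} (h : HSq a f f' b) (m : M.carrier) :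
    ev f' (GrMod.lin a m) = GrMod.lin b (ev f m) := congrArg (fun t => ev (N := N') t m) h

/-- The removal of a positive letter, of degree `2`. -/
noncomputable def wThreeT (i : Fin n) : W.{u} [(i, true)] ⟶ W [] :=
  natOfDeg (intDeg 2) (fun K => (cw₃ i).app K.cx)
    fun {K L} φ => ⟨_, _, rfl, rfl, cmp_ext fun p => by
      refine (cmp_comp _ _ rfl p).trans (Eq.trans ?_ (cmp_comp _ _ (add_comm _ _) p).symm)
      refine (congrArg (fun t => ShiftedHom.comp _ t _) (cw₃_cmp i L.cx p)).trans (Eq.trans ?_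
        (congrArg (fun t => ShiftedHom.comp t _ _) (cw₃_cmp i K.cx p)).symm)
      refine ev_ext fun m => ?_
      refine (ev_comp _ _ rfl m).trans (Eq.trans ?_ (ev_comp _ _ (add_comm _ _) m).symm)
      refine Eq.trans ?_ (map_smul (ev (cmp φ.hom p)) (lc (zc i)) _).symm
      exact congrArg (lc (zc i) • ·) (hsq_lin (hsq_prK φ.hom (beta i) p) m).symm⟩

/-- The insertion of a negative letter, of degree `2`. -/
noncomputable def wFourT (i : Fin n) : W.{u} [] ⟶ W [(i, false)] :=
  natOfDeg (intDeg 2) (fun K => (cw₄ i).app K.cx)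
    fun {K L} φ => ⟨_, _, rfl, rfl, cmp_ext fun p => by
      refine (cmp_comp _ _ rfl p).trans (Eq.trans ?_ (cmp_comp _ _ (add_comm _ _) p).symm)
      refine (congrArg (fun t => ShiftedHom.comp _ t _) (cw₄_cmp i L.cx p)).trans (Eq.trans ?_
        (congrArg (fun t => ShiftedHom.comp t _ _) (cw₄_cmp i K.cx p)).symm)
      refine ev_ext fun m => ?_
      refine (ev_comp _ _ rfl m).trans (Eq.trans ?_ (ev_comp _ _ (add_comm _ _) m).symm)
      refine (ev_toShift_comp _ _ _).trans (Eq.trans ?_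
        (congrArg _ (ev_toShift_comp (zc i) (inK' (gamma i) K.cx p) m)).symm)
      refine Eq.trans ?_ (map_smul (ev (cmp (φ.hom.map (negF (gamma i))) p)) (lc (zc i)) _).symm
      exact congrArg (lc (zc i) • ·) (hsq_lin (hsq_inK' φ.hom (gamma i) p) m).symm⟩

/-- Multiplication by `∑ c_k X_k` on the values of the functor of a word. -/
noncomputable def mulT (c : Fin n → ℤ) (g : Word n) : W.{u} g ⟶ W g :=
  Functor.whiskerLeft (W g) (natOfDeg (g := []) (h := []) (intDeg 2) (fun K => onCx (mulN c) K.cx)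
    fun {K L} φ => ⟨_, _, rfl, rfl, cmp_ext fun p => by
      refine (cmp_comp _ _ rfl p).trans (Eq.trans ?_ (cmp_comp _ _ (add_comm _ _) p).symm)
      refine ev_ext fun m => ?_
      refine (ev_comp _ _ rfl m).trans (Eq.trans ?_ (ev_comp _ _ (add_comm _ _) m).symm)
      exact (map_smul (ev (cmp φ.hom p)) (lc c) m).symm⟩)

lemma mulT_app (c : Fin n → ℤ) (g : Word n) (K : HC.{u} n) :
    (mulT c g).app K = HC.mk ((W g).obj K) ((W g).obj K) (intDeg 2) (onCx (mulN c) ((W g).obj K).cx)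
        :=
  rfl

lemma mulT_natural (c : Fin n → ℤ) {g h : Word n} (t : W.{u} g ⟶ W h) :
    mulT c g ≫ t = t ≫ mulT c h := by
  ext K
  exact ((mulT c []).naturality (t.app K)).symm

end Elementary

/-! ### Relations between the elementary transformations -/

section Relations

lemma createT_cancelT (i : Fin n) (a : Bool) : createT.{u} i a ≫ cancelT i a = 𝟙 _ := by
  ext K
  cases a
  · exact (HC.of_comp_of (M := K) _ _).trans (congrArg (HC.of K K) ((pairData' i).create_cancel
      K.cx))
  · exact (HC.of_comp_of (M := K) _ _).trans (congrArg (HC.of K K) ((pairData i).create_cancel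
      K.cx))

lemma HC.Rel.of_homotopy_of {K L : HC.{u} n} {f g : K.cx ⟶ L.cx} (h : Homotopy f g) :
    HC.Rel 1 (HC.of K L f) (HC.of K L g) :=
  HC.Rel.of_homotopy (h.compRight _)

lemma cancelT_createT (i : Fin n) (a : Bool) : wordRel _ _ (cancelT.{u} i a ≫ createT i a) (𝟙 _) :=
    by
  refine ⟨1, isUnit_one, fun K => ?_⟩
  cases a
  · refine (HC.Rel.of_eq (HC.of_comp_of (L := K) _ _)).trans (ε' := 1) ?_
    exact HC.Rel.of_homotopy_of ((pairData' i).cancelCreate K.cx)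
  · refine (HC.Rel.of_eq (HC.of_comp_of (L := K) _ _)).trans (ε' := 1) ?_
    exact HC.Rel.of_homotopy_of ((pairData i).cancelCreate K.cx)

lemma farT_farT {i j : Fin n} (h : Far i j) : farT.{u} h ≫ farT h.symm = 𝟙 _ := by
  ext K
  exact (HC.of_comp_of _ _).trans (congrArg (HC.of _ _)
    (far_far (beta i) (beta j) K.cx (far_zero h) (far_zero h.symm)))

lemma leftT_singleton_app (s : Letter n) {g h : Word n} (t : W.{u} g ⟶ W h) (K : HC.{u} n) :
    (leftT [s] t).app K = (letF s).map (t.app K) := eq_of_heq (leftT_app [s] t K)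

lemma letF_of_true (i : Fin n) {K L : HC.{u} n} (f : K.cx ⟶ L.cx) :
    (letF (i, true)).map (HC.of K L f) =
      HC.of ((letF (i, true)).obj K) ((letF (i, true)).obj L) ((tensR i).map f) :=
  congrArg (HC.mk (K.act (i, true)) (L.act (i, true)) 0) (ShiftedHom.map_mk₀ 0 rfl f (tensR i))

lemma letF_of_false (i : Fin n) {K L : HC.{u} n} (f : K.cx ⟶ L.cx) :
    (letF (i, false)).map (HC.of K L f) =
      HC.of ((letF (i, false)).obj K) ((letF (i, false)).obj L) ((tensR' i).map f) :=
  congrArg (HC.mk (K.act (i, false)) (L.act (i, false)) 0) (ShiftedHom.map_mk₀ 0 rfl f (tensR' i))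

/-- The braid transformation respects the insertion of letters. -/
lemma wOneT_braidT {i j : Fin n} (h : Adj i j) :
    rightT [(j, true), (i, true)] (wOneT.{u} i) ≫ braidT h =
      leftT [(j, true), (i, true)] (wOneT j) := by
  ext K
  refine (congrArg (· ≫ _) (eq_of_heq (rightT_app [(j, true), (i, true)] (wOneT i) K))).trans ?_
  refine Eq.trans ?_ (eq_of_heq (leftT_app [(j, true), (i, true)] (wOneT j) K)).symm
  refine (HC.of_comp_of _ _).trans ?_
  refine Eq.trans (congrArg (HC.of _ _) ((braidData h).incK_braid K.cx)) ?_
  exact ((congrArg (letF (j, true)).map (letF_of_true i (K := K)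
    (L := (letF (j, true)).obj K) ((cw₁ j).app K.cx))).trans
    (letF_of_true j (K := (letF (i, true)).obj K) (L := (letF (i, true)).obj ((letF (j,
        true)).obj K))
      ((tensR i).map ((cw₁ j).app K.cx)))).symm

lemma wTwoT_eq (i : Fin n) :
    leftT [(i, false)] (wOneT.{u} i) ≫ cancelT i false = wTwoT i := by
  ext K
  refine (congrArg (· ≫ _) ((leftT_singleton_app _ _ K).trans
    (letF_of_false i (K := K) (L := (letF (i, true)).obj K) ((cw₁ i).app K.cx)))).trans ?_
  refine (HC.of_comp_of _ _).trans (congrArg (HC.of _ _) ?_)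
  have key : ∀ (K : CochainComplex (GrMod.{u} n) ℤ), (negF (gamma i)).map (incK (beta i) K) ≫
      (pairData' i).cancel K = (cw₂ i).app K := fun K => by
    refine HomologicalComplex.hom_ext _ _ fun p => ?_
    refine Eq.trans ?_ (cw₂_app_f i K p).symm
    rw [HomologicalComplex.comp_f, (pairData' i).cancel_f K (show p - 1 + 1 = p by omega)]
    refine neg_ext (gamma i) (show p - 1 + 1 = p by omega) ?_ ?_
    · refine (square_comp (inK'_map (gamma i) (incK (beta i) K) p) _).trans ?_
      rw [inK'_prK']
      simp only [PairData'.cancelF, Preadditive.comp_add, inK'_prK'_assoc, inK'_prU'_assoc,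
        add_zero]
      exact inK_prK (beta i) K p
    · refine (square_comp (inU'_map (gamma i) (incK (beta i) K) _) _).trans ?_
      rw [inU'_prK']
      simp only [PairData'.cancelF, Preadditive.comp_add, inU'_prK'_assoc, inU'_prU'_assoc,
        zero_add]
      exact map_inK_prU_assoc (beta i) K _ _ _
  exact key K.cx

lemma toShift_mulN_U {i : Fin n} {c : Fin n → ℤ} (hc : c i = 0) (M : GrMod.{u} n) :
    toShift (mulN c) (U i M) = 0 := by
  refine U_hom_ext (N := GrMod.sh 2 (U i M)) fun m => ?_
  refine (ev_mulN c (U i M) (br i M m)).trans ?_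
  rw [← e_smul_br, ← mul_smul, lc_central, e_mul_lc, hc, zero_smul, zero_smul]
  rfl

lemma zc_self (i : Fin n) : zc i i = 0 := by simp [zc]

lemma wThreeT_wOneT (i : Fin n) : wThreeT.{u} i ≫ wOneT i = mulT (zc i) [(i, true)] := by
  ext K
  refine (HC.mk_comp_of _ _).trans (congrArg (HC.mk _ _ _) (cmp_ext fun p => ?_))
  refine (congrArg (fun x => x ≫ (shiftFunctor _ (intDeg 2)).map (inK (beta i) K.cx p))
    (cw₃_cmp i K.cx p)).trans ((Category.assoc _ _ _).trans ?_)
  refine pos_ext (beta i) rfl ?_ ?_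
  · refine (inU_prK_assoc (beta i) K.cx rfl _).trans ?_
    refine Eq.symm ((toShift_nat (mulN (zc i)) (inU (beta i) K.cx rfl)).trans ?_)
    exact (congrArg (· ≫ _) (toShift_mulN_U (zc_self i) _)).trans zero_comp
  · refine (inK_prK_assoc (beta i) K.cx p _).trans ?_
    exact (toShift_nat (mulN (zc i)) (inK (beta i) K.cx p)).symm

lemma wFourT_wTwoT (i : Fin n) : wFourT.{u} i ≫ wTwoT i = mulT (zc i) [] := by
  ext K
  refine (HC.mk_comp_of _ _).trans (congrArg (HC.mk _ _ _) (cmp_ext fun p => ?_))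
  refine (congrArg₂ (fun x y => x ≫ (shiftFunctor _ (intDeg 2)).map y) (cw₄_cmp i K.cx p)
    (cw₂_app_f i K.cx p)).trans ?_
  refine (Category.assoc _ _ _).trans ?_
  refine (congrArg (_ ≫ ·) (map_inK'_prK' (gamma i) K.cx (shiftFunctor _ (intDeg 2)) p)).trans ?_
  exact Category.comp_id _

lemma leftT_mulT (i : Fin n) (c : Fin n → ℤ) (g : Word n) :
    wordRel _ _ (leftT [(i, true)] (mulT.{u} c g)) (mulT (reflect i c) ((i, true) :: g)) := by
  refine ⟨1, isUnit_one, fun K => ?_⟩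
  rw [leftT_singleton_app]
  exact HC.Rel.of_homotopy (K := ((W g).obj K).act (i, true)) (L := ((W g).obj K).act (i, true))
    (mulHomotopy i c ((W g).obj K).cx)

end Relations

/-! ### Test objects -/

section Modules

/-- The isomorphism between the underlying group of the graded module `A_n` and `A_n`. -/
def downHom (n : ℕ) : ULift.{u} (A n) →+ A n := AddEquiv.ulift.toAddMonoidHom

/-- The inverse of `downHom`. -/
def upHom (n : ℕ) : A n →+ ULift.{u} (A n) := AddEquiv.ulift.symm.toAddMonoidHom

/-- The graded module `A_n`. -/
noncomputable def freeMod (n : ℕ) : GrMod.{u} n where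
  carrier := ULift.{u} (A n)
  gr k := (grA n k).comap (downHom n)
  internal := isInternal_retract (DirectSum.Decomposition.isInternal (grA n)) _
    (downHom n) (upHom n) (fun _ => rfl)
    (fun _ _ hx => hx) fun _ _ hx => hx
  smul_mem {_ _ _ _} ha hx := SetLike.mul_mem_graded (A := grA n) ha (show downHom n _ ∈ _ from hx)

/-- The underlying group of the simple graded module at the vertex `i`. -/
def SimpleCarrier (_ : Fin n) : Type u := ULift.{u} ℤ

instance (i : Fin n) : AddCommGroup (SimpleCarrier.{u} i) :=
    inferInstanceAs (AddCommGroup (ULift ℤ))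

noncomputable instance (i : Fin n) : Module (A n) (SimpleCarrier.{u} i) :=
  Module.compHom (ULift.{u} ℤ) (aug i)

/-- The simple graded module at the vertex `i`, in degree `0`, with underlying group `ℤ`. -/
noncomputable def simpleMod (i : Fin n) : GrMod.{u} n where
  carrier := SimpleCarrier i
  gr k := if k = 0 then ⊤ else ⊥
  internal := isInternal_of_decomp _ (DirectSum.of (fun k : ℤ =>
      ((if k = 0 then ⊤ else ⊥ : AddSubgroup (SimpleCarrier.{u} i)))) 0 |>.comp
        (AddMonoidHom.codRestrict (AddMonoidHom.id _) _ fun x => by simp))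
    (fun x => by rw [AddMonoidHom.comp_apply, DirectSum.coeAddMonoidHom_of]; rfl)
    (fun k x hx => by
      by_cases hk : k = 0
      · subst hk; rfl
      · rw [if_neg hk, AddSubgroup.mem_bot] at hx
        subst hx
        rw [map_zero]
        exact (map_zero (DirectSum.of _ k)).symm)
  smul_mem {k l a x} ha hx := by
    by_cases hl : l = 0
    · by_cases hk : k = 0
      · rw [if_pos (by omega)]; trivial
      · have : a • x = 0 := by
          have h : a • x = (aug i a • (show ULift.{u} ℤ from x) : ULift.{u} ℤ) := rfl
          rw [h, aug_of_mem i hk ha, zero_smul]; rfl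
        rw [this]; exact zero_mem _
    · rw [if_neg hl, AddSubgroup.mem_bot] at hx
      rw [hx, smul_zero]; exact zero_mem _

end Modules

section Disc

variable (p : ℤ)

/-- The contractible complex `A_n = A_n` in cohomological degrees `p` and `p + 1`. -/
noncomputable def discCx (n : ℕ) (p : ℤ) : CochainComplex (GrMod.{u} n) ℤ :=
  HomologicalComplex.double (𝟙 (freeMod n)) (show (ComplexShape.up ℤ).Rel p (p + 1) from rfl)

/-- The disc complex as a bounded complex. -/
noncomputable def disc (n : ℕ) (p : ℤ) : HC.{u} n :=
  (⟨(HomotopyCategory.quotient _ _).obj (discCx n p), p, p + 1, fun i hi =>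
    HomologicalComplex.isZero_double_X (𝟙 (freeMod.{u} n))
      (show (ComplexShape.up ℤ).Rel p (p + 1) from rfl) i (by omega) (by omega)⟩ : 𝒞.{u} n)

lemma ne_succ : p ≠ p + 1 := by omega

/-- The lower term of a disc. -/
noncomputable def discLow : (disc.{u} n p).cx.X p ≅ freeMod n :=
  HomologicalComplex.doubleXIso₀ (𝟙 (freeMod.{u} n))
    (show (ComplexShape.up ℤ).Rel p (p + 1) from rfl)

/-- The upper term of a disc. -/
noncomputable def discHigh : (disc.{u} n p).cx.X (p + 1) ≅ freeMod n :=
  HomologicalComplex.doubleXIso₁ (𝟙 (freeMod.{u} n))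
    (show (ComplexShape.up ℤ).Rel p (p + 1) from rfl) (ne_succ p)

/-- The generator of the graded module `A_n`. -/
def freeGen : (freeMod.{u} n).carrier := ULift.up (1 : A n)

lemma freeGen_mem : freeGen.{u} (n := n) ∈ (freeMod n).gr 0 := SetLike.one_mem_graded (grA n)

lemma exists_smul_freeGen {k : ℤ} {x : (freeMod.{u} n).carrier} (hx : x ∈ (freeMod n).gr k) :
    ∃ a ∈ grA n k, x = a • freeGen :=
  ⟨ULift.down x, hx, (ULift.ext _ _ (mul_one (ULift.down x))).symm⟩

lemma smul_freeGen_injective {a b : A n} (h : a • freeGen.{u} (n := n) = b • freeGen) : a = b := by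
  have := congrArg ULift.down h
  exact (mul_one a).symm.trans (this.trans (mul_one b))

section Transport

variable {M : GrMod.{u} n} (f : M ≅ freeMod n)

lemma lin_inv_hom (x : (freeMod.{u} n).carrier) : GrMod.lin f.hom (GrMod.lin f.inv x) = x := by
  rw [← GrMod.lin_comp, Iso.inv_hom_id]; rfl

lemma lin_hom_inv (x : M.carrier) : GrMod.lin f.inv (GrMod.lin f.hom x) = x := by
  rw [← GrMod.lin_comp, Iso.hom_inv_id]; rfl

lemma exists_smul_inv_freeGen {k : ℤ} {x : M.carrier} (hx : x ∈ M.gr k) :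
    ∃ a ∈ grA n k, x = a • GrMod.lin f.inv freeGen := by
  obtain ⟨a, ha, h⟩ := exists_smul_freeGen (GrMod.lin_mem f.hom hx)
  refine ⟨a, ha, ?_⟩
  rw [← map_smul, ← h, lin_hom_inv]

lemma smul_inv_freeGen_injective {a b : A n}
    (h : a • GrMod.lin f.inv freeGen = b • GrMod.lin f.inv freeGen) : a = b := by
  refine smul_freeGen_injective.{u} ?_
  have := congrArg (GrMod.lin f.hom) h
  rwa [map_smul, map_smul, lin_inv_hom] at this

end Transport

/-- The generator of a disc in its lower degree. -/
noncomputable def genLow : ((disc.{u} n p).cx.X p).carrier := GrMod.lin (discLow p).inv freeGen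

/-- The generator of a disc in its upper degree. -/
noncomputable def genHigh : ((disc.{u} n p).cx.X (p + 1)).carrier :=
  GrMod.lin (discHigh p).inv freeGen

lemma d_genLow : GrMod.lin ((disc.{u} n p).cx.d p (p + 1)) (genLow p) = genHigh p := by
  have h : (disc.{u} n p).cx.d p (p + 1) = (discLow p).hom ≫ 𝟙 _ ≫ (discHigh p).inv :=
    HomologicalComplex.double_d (𝟙 (freeMod.{u} n))
      (show (ComplexShape.up ℤ).Rel p (p + 1) from rfl) (ne_succ p)
  rw [h, GrMod.lin_comp, genLow, lin_inv_hom, Category.id_comp]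
  rfl

lemma genLow_mem : genLow.{u} (n := n) p ∈ ((disc.{u} n p).cx.X p).gr 0 :=
  GrMod.lin_mem _ freeGen_mem

lemma exists_smul_genLow {k : ℤ} {x : ((disc.{u} n p).cx.X p).carrier}
    (hx : x ∈ ((disc.{u} n p).cx.X p).gr k) : ∃ a ∈ grA n k, x = a • genLow p :=
  exists_smul_inv_freeGen _ hx

lemma exists_smul_genHigh {k : ℤ} {x : ((disc.{u} n p).cx.X (p + 1)).carrier}
    (hx : x ∈ ((disc.{u} n p).cx.X (p + 1)).gr k) : ∃ a ∈ grA n k, x = a • genHigh p :=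
  exists_smul_inv_freeGen _ hx

lemma smul_genLow_injective {a b : A n} (h : a • genLow.{u} (n := n) p = b • genLow p) : a = b :=
  smul_inv_freeGen_injective _ h

lemma smul_genHigh_injective {a b : A n} (h : a • genHigh.{u} (n := n) p = b • genHigh p) : a = b :=
  smul_inv_freeGen_injective _ h

lemma isZero_disc_X_pred {q : ℤ} (h : q + 1 = p) : IsZero ((disc.{u} n p).cx.X q) :=
  HomologicalComplex.isZero_double_X (𝟙 (freeMod.{u} n))
    (show (ComplexShape.up ℤ).Rel p (p + 1) from rfl) q (by omega) (by omega)

/-- The map from the free module given by a homogeneous element. -/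
noncomputable def fromFree {M : GrMod.{u} n} {d : ℤ} {m : M.carrier} (hm : m ∈ M.gr d) :
    ShiftedHom (freeMod n) M (intDeg d) :=
  GrMod.mk' (M := freeMod n) (N := GrMod.sh d M)
    ((LinearMap.toSpanSingleton (A n) M.carrier m).comp ULift.moduleEquiv.toLinearMap)
    fun _ (x : ULift (A n)) hx => M.smul_mem (a := x.down) hx hm

lemma exists_disc_map {K : HC.{u} n} {p : ℤ} {d : ℤ} {m : (K.cx.X p).carrier}
    (hm : m ∈ (K.cx.X p).gr d) :
    ∃ φ : ShiftedHom (disc.{u} n p).cx K.cx (intDeg d), ev (cmp φ p) (genLow p) = m ∧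
      ev (cmp φ (p + 1)) (genHigh p) = GrMod.lin (K.cx.d p (p + 1)) m := by
  let φ₀ : freeMod n ⟶ ((shiftFunctor (CochainComplex (GrMod.{u} n) ℤ) (intDeg d)).obj K.cx).X p :=
    fromFree hm
  let d₀ := ((shiftFunctor (CochainComplex (GrMod.{u} n) ℤ) (intDeg d)).obj K.cx).d p (p + 1)
  let φ : discCx n p ⟶ (shiftFunctor (CochainComplex (GrMod.{u} n) ℤ) (intDeg d)).obj K.cx :=
    HomologicalComplex.mkHomFromDouble _ (ne_succ p) φ₀ (φ₀ ≫ d₀) (by rw [Category.id_comp])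
      (fun k _ => by rw [Category.assoc, HomologicalComplex.d_comp_d, comp_zero])
  have h₀ : φ.f p = (discLow p).hom ≫ φ₀ := HomologicalComplex.mkHomFromDouble_f₀ _ _ _ _ _ _
  have h₁ : φ.f (p + 1) = (discHigh p).hom ≫ φ₀ ≫ d₀ :=
    HomologicalComplex.mkHomFromDouble_f₁ _ _ _ _ _ _
  have h₂ : GrMod.lin φ₀ freeGen = m := one_smul (A n) m
  refine ⟨φ, ?_, ?_⟩
  · refine (congrArg (fun t => GrMod.lin t (genLow p)) h₀).trans ?_
    rw [GrMod.lin_comp, genLow, lin_inv_hom, h₂]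
  · refine (congrArg (fun t => GrMod.lin t (genHigh p)) h₁).trans ?_
    rw [GrMod.lin_comp, genHigh, lin_inv_hom, GrMod.lin_comp, h₂]
    rfl

end Disc

/-! ### Transformations from the identity functor -/

section Values

open HC (cx)

lemma exists_values {g h : Word n} (t : W.{u} g ⟶ W h) {d : IntDeg} (hd : degT t = d) :
    ∃ T : ∀ K, ShiftedHom ((W.{u} g).obj K).cx ((W h).obj K).cx d,
      ∀ K, t.app K = HC.mk ((W g).obj K) ((W h).obj K) d (T K) := by
  have : ∀ K, ∃ T : ShiftedHom ((W.{u} g).obj K).cx ((W h).obj K).cx d,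
      t.app K = HC.mk ((W g).obj K) ((W h).obj K) d T := fun K => by
    have h₁ := (app_deg t K).trans hd
    generalize t.app K = f at h₁
    obtain ⟨e, f⟩ := f
    change e = d at h₁
    subst h₁
    exact ⟨f, rfl⟩
  choose T hT using this
  exact ⟨T, hT⟩

lemma values_natural {h : Word n} (t : W.{u} [] ⟶ W h) {d : IntDeg}
    {T : ∀ K, ShiftedHom K.cx ((W.{u} h).obj K).cx d}
    (hT : ∀ K, t.app K = HC.mk K ((W h).obj K) d (T K)) {e : IntDeg} {K L : HC.{u} n}
    (φ : ShiftedHom K.cx L.cx e) (F : ShiftedHom ((W h).obj K).cx ((W h).obj L).cx e)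
    (hF : (W h).map (HC.mk K L e φ) = HC.mk ((W h).obj K) ((W h).obj L) e F) (p : ℤ)
    (m : (K.cx.X p).carrier) :
    ev (cmp (T L) p) (ev (cmp φ p) m) = ev (cmp F p) (ev (cmp (T K) p) m) := by
  have h₁ : HC.mk K L e φ ≫ t.app L = t.app K ≫ (W h).map (HC.mk K L e φ) :=
    t.naturality (HC.mk K L e φ)
  rw [hF, hT, hT] at h₁
  have h₂ := (HC.mk_comp φ (T L) rfl).symm.trans (h₁.trans (HC.mk_comp (T K) F (add_comm e d)))
  have h₃ := congrArg (fun f => ev (cmp f p) m) (HC.mk_injective h₂)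
  refine Eq.trans ?_ (h₃.trans ?_)
  · exact ((congrArg (fun f => ev f m) (cmp_comp φ (T L) rfl p)).trans (ev_comp _ _ _ m)).symm
  · exact (congrArg (fun f => ev f m) (cmp_comp (T K) F _ p)).trans (ev_comp _ _ _ m)

lemma ev_cmp_d {K L : CochainComplex (GrMod.{u} n) ℤ} {d : IntDeg} (f : ShiftedHom K L d) (p q : ℤ)
    (m : (K.X p).carrier) :
    ev (cmp f q) (GrMod.lin (K.d p q) m) = GrMod.lin (L.d p q) (ev (cmp f p) m) :=
  hsq_lin (M := K.X p) (M' := K.X q) (N := L.X p) (N' := L.X q) (cmp_comm f p q).symm m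

/-- Natural endomorphisms of the terms of all complexes are multiplications by central elements. -/
lemma exists_central_of_natural (d : ℤ)
    (s : ∀ (K : HC.{u} n) (p : ℤ), (K.cx.X p).carrier →ₗ[A n] (K.cx.X p).carrier)
    (hdeg : ∀ K p k, ∀ x ∈ (K.cx.X p).gr k, s K p x ∈ (K.cx.X p).gr (k + d))
    (hnat : ∀ {e : IntDeg} {K L : HC.{u} n} (φ : ShiftedHom K.cx L.cx e) (p : ℤ)
      (m : (K.cx.X p).carrier), s L p (ev (cmp φ p) m) = ev (cmp φ p) (s K p m))
    (hd : ∀ K p m, s K (p + 1) (GrMod.lin (K.cx.d p (p + 1)) m) =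
      GrMod.lin (K.cx.d p (p + 1)) (s K p m)) :
    ∃ a ∈ grA n d, (∀ b, a * b = b * a) ∧ ∀ K p m, s K p m = a • m := by
  -- The lower term of a disc is free on one generator, and every homogeneous element of `K.X p` is
  -- the image of this generator under a map from the disc.
  have h₀ : ∀ p, ∃ a ∈ grA n d, s (disc n p) p (genLow p) = a • genLow p := fun p => by
    have := hdeg _ _ _ _ (genLow_mem.{u} (n := n) p)
    rw [zero_add] at this
    exact exists_smul_genLow p this
  choose a ha hs using h₀
  have formula : ∀ K p m, s K p m = a p • m := fun K p m => by
    induction m using isInternal_induction (K.cx.X p).internal with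
    | h0 => rw [map_zero, smul_zero]
    | hadd x y h₁ h₂ => rw [map_add, smul_add, h₁, h₂]
    | hom k m hm =>
      obtain ⟨φ, hφ, -⟩ := exists_disc_map hm
      rw [← hφ, hnat, hs, map_smul]
  -- `s` is linear over `A n`, so the multiplication by `a p` commutes with `A n`.
  have hcomm : ∀ p b, a p * b = b * a p := fun p b => by
    refine smul_genLow_injective.{u} p ?_
    rw [mul_smul, mul_smul, ← hs p, ← map_smul, formula]
  -- The differential of the disc is an isomorphism and commutes with `s`.
  have hsucc : ∀ p, a p = a (p + 1) := fun p => by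
    refine smul_genHigh_injective.{u} p ?_
    rw [← formula, ← d_genLow, hd, formula, map_smul]
  have hconst : ∀ p, a p = a 0 := fun p => by
    induction p using Int.induction_on with
    | zero => rfl
    | succ i ih => rw [← hsucc, ih]
    | pred i ih => rw [hsucc, sub_add_cancel, ih]
  exact ⟨a 0, ha 0, hcomm 0, fun K p m => (formula K p m).trans (by rw [hconst p])⟩

/-- Endomorphisms of the identity functor are multiplications by central elements. -/
lemma exists_central (t : W.{u} (n := n) [] ⟶ W []) {d : ℤ} (hd : degT t = intDeg d) :
    ∃ a ∈ grA n d, (∀ b, a * b = b * a) ∧ ∃ T : ∀ K : HC.{u} n, ShiftedHom K.cx K.cx (intDeg d),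
      (∀ K, t.app K = HC.mk K K (intDeg d) (T K)) ∧ ∀ K p m, ev (cmp (T K) p) m = a • m := by
  obtain ⟨T, hT⟩ := exists_values t hd
  obtain ⟨a, ha, hc, h⟩ := exists_central_of_natural.{u} d (fun K p => ev (cmp (T K) p))
    (fun K p k x hx => ev_mem (cmp (T K) p) hx)
    (fun φ p m => values_natural t hT φ φ rfl p m) (fun K p m => ev_cmp_d (T K) p (p + 1) m)
  exact ⟨a, ha, hc, T, hT, h⟩

lemma eq_zsmul_id (t : W.{u} (n := n) [] ⟶ W []) (hd : degT t = 0) :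
    ∃ k : ℤ, t = zsmulT k (𝟙 _) := by
  obtain ⟨a, ha, hc, T, hT, h⟩ := exists_central t (d := 0) hd
  obtain ⟨k, rfl⟩ := exists_int_of_central ha hc
  refine ⟨k, ?_⟩
  ext K
  refine (hT K).trans ?_
  refine congrArg (HC.mk K K 0) (cmp_ext fun p => ev_ext fun m => ?_)
  refine (h K p m).trans ?_
  refine Eq.trans ?_ (congrArg (k • ·) ((congrArg (fun f => ev f m)
    (cmp_mk₀ (𝟙 K.cx) rfl p)).trans (ev_mk₀ _ _ m))).symm
  exact Int.cast_smul_eq_zsmul (A n) k m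

lemma grA_neg {a : A n} {k : ℤ} (hk : k < 0) (ha : a ∈ grA n k) : a = 0 := by
  have key : ∀ a : A n, GradedRing.proj (grA n) k a = 0 := by
    intro a
    have hp : ∀ {l : ℤ} {x : A n}, x ∈ grA n l → l ≠ k → GradedRing.proj (grA n) k x = 0 :=
      fun hx hl => by
        rw [GradedRing.proj_apply, DirectSum.decompose_of_mem_ne _ hx hl]
    induction a using A_span_induction with
    | h0 => simp
    | hadd a b h₁ h₂ => rw [map_add, h₁, h₂, add_zero]
    | hneg a h => rw [map_neg, h, neg_zero]
    | he i => exact hp (e_mem i) (by omega)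
    | hX i => exact hp (X_mem i) (by omega)
    | ha i j h => exact hp (arr_mem i j) (by omega)
  rw [← key a, GradedRing.proj_apply, DirectSum.decompose_of_mem_same _ ha]

lemma eq_zero_of_isZero {M : GrMod.{u} n} (h : IsZero M) (x : M.carrier) : x = 0 :=
  congrArg (fun f => GrMod.lin f x) ((IsZero.iff_id_eq_zero M).1 h)

/-- An element of degree `0` of `P_i ⊗ _iP ⊗ M` is of the form `(i) ⊗ (i) ⊗ m` if `M` vanishes in
negative degrees. -/
lemma eq_br_of_mem {i : Fin n} {M : GrMod.{u} n} {v : (U i M).carrier} (hv : v ∈ (U i M).gr 0)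
    (hM : ∀ k < 0, ∀ x ∈ M.gr k, x = 0) : v = br i M (cX i M (X i • v)) := by
  have h₁ : cX i M v = 0 := hM _ (by norm_num) _ (cX_mem hv)
  have h₂ : ∀ j, cX i M (arr i j • v) = 0 := fun j =>
    hM _ (by norm_num) _ (cX_mem ((U i M).smul_mem (arr_mem i j) hv))
  conv_lhs => rw [Tens_expand v]
  simp [h₁, h₂]

lemma eq_zero_of_smul_eq {i : Fin n} {M : GrMod.{u} n} {d : IntDeg} (f : ShiftedHom M M d)
    {v : (U i M).carrier} (hv : v = br i M (cX i M (X i • v)))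
    (h : X i • v = ev (f.map (GrBimod.tensF (PP i))) v) : v = 0 := by
  have h₁ : cX i M (X i • v) = 0 := by
    refine (congrArg (cX i M) (h.trans (congrArg _ hv))).trans ?_
    refine (congrArg (cX i M) (ev_map_br i f _)).trans (cX_br _)
  rw [hv, h₁, map_zero]

/-- The values of transformations `Id → R_i` of degree `0` have no component in `P_i ⊗ _iP`. -/
lemma prU_eq_zero (i : Fin n) {T : ∀ K : HC.{u} n,
    ShiftedHom K.cx ((posF (beta i)).obj K.cx) (intDeg 0)}
    (hT : ∀ {e : IntDeg} {K L : HC.{u} n} (φ : ShiftedHom K.cx L.cx e) (p : ℤ)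
      (m : (K.cx.X p).carrier), ev (cmp (T L) p) (ev (cmp φ p) m) = ev (cmp (φ.map (posF (beta i))) p) (ev (cmp (T K) p) m))
    (K : HC.{u} n) (p : ℤ) (m : (K.cx.X p).carrier) :
    GrMod.lin (prU (beta i) K.cx (p := p) rfl) (ev (cmp (T K) p) m) = 0 := by
  have hv : GrMod.lin (prU (beta i) (disc.{u} n p).cx (p := p) rfl)
      (ev (cmp (T (disc n p)) p) (genLow p)) = 0 := by
    obtain ⟨v, hv⟩ : ∃ v : (U i ((disc.{u} n p).cx.X (p + 1))).carrier,
        v = GrMod.lin (prU (beta i) (disc.{u} n p).cx (p := p) rfl)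
          (ev (cmp (T (disc n p)) p) (genLow p)) := ⟨_, rfl⟩
    refine hv.symm.trans ?_
    have hv₀ : v ∈ (U i ((disc.{u} n p).cx.X (p + 1))).gr 0 := by
      have := GrMod.lin_mem (prU (beta i) (disc.{u} n p).cx (p := p) rfl)
        (ev_mem (cmp (T (disc n p)) p) (genLow_mem p))
      rw [hv]
      exact GrMod.gr_congr _ (add_zero 0) this
    -- In degree `0` only the multiples of `(i) ⊗ (i)` survive in `P_i ⊗ _iP ⊗ A_n`.
    have hv₁ := eq_br_of_mem hv₀ (fun k hk x hx => by
      obtain ⟨a, ha, rfl⟩ := exists_smul_genHigh p hx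
      rw [grA_neg hk ha, zero_smul])
    -- The endomorphism of the disc which sends the generator to `X_i` times itself acts on `v` from
    -- the inside, while `X_i` acts from the outside; they agree only on `0`.
    obtain ⟨φ, hφ, -⟩ := exists_disc_map (K := disc.{u} n p) (p := p) (m := X i • genLow p)
      (GrMod.smul_mem _ (X_mem i) (genLow_mem p))
    have h₁ : X i • v = ev ((cmp φ (p + 1)).map (GrBimod.tensF (PP i))) v := by
      rw [hv]
      refine (map_smul (GrMod.lin (prU (beta i) (disc.{u} n p).cx (p := p) rfl)) _ _).symm.trans ?_
      rw [← map_smul, ← hφ, hT φ p]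
      exact (hsq_lin (hsq_prU φ (beta i) (p := p) rfl) _).symm
    exact eq_zero_of_smul_eq (cmp φ (p + 1)) hv₁ h₁
  induction m using isInternal_induction (K.cx.X p).internal with
  | h0 => rw [map_zero, map_zero]
  | hadd x y h₁ h₂ => rw [map_add, map_add, h₁, h₂, add_zero]
  | hom k m hm =>
    obtain ⟨φ, hφ, -⟩ := exists_disc_map hm
    rw [← hφ, hT]
    refine (hsq_lin (hsq_prU φ (beta i) (p := p) rfl) _).symm.trans ?_
    refine (congrArg _ hv).trans (map_zero _)

/-- The transformations `Id → R_i` of degree `0` are the multiples of `w₁`. -/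
lemma eq_zsmul_wOneT (i : Fin n) (t : W.{u} [] ⟶ W [(i, true)]) (hd : degT t = 0) :
    ∃ k : ℤ, t = zsmulT k (wOneT i) := by
  obtain ⟨T, hT⟩ := exists_values t hd
  have hnat : ∀ {e : IntDeg} {K L : HC.{u} n} (φ : ShiftedHom K.cx L.cx e) (p : ℤ)
      (m : (K.cx.X p).carrier),
      ev (cmp (T L) p) (ev (cmp φ p) m) = ev (cmp (φ.map (posF (beta i))) p) (ev (cmp (T K) p) m) :=
    fun φ p m => values_natural t hT φ (φ.map (posF (beta i))) rfl p m
  have hin : ∀ K p m, ev (cmp (T K) p) m = GrMod.lin (inK (beta i) K.cx p)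
      (GrMod.lin (prK (beta i) K.cx p) (ev (cmp (T K) p) m)) := fun K p m => by
    have h := congrArg (fun f => GrMod.lin f (ev (cmp (T K) p) m))
      (pos_split (beta i) K.cx (p := p) rfl)
    refine Eq.trans h.symm ?_
    refine (GrMod.lin_add _ _ _).trans ?_
    refine (congrArg₂ (· + ·) ((congrArg (GrMod.lin (inU (beta i) K.cx rfl))
      (prU_eq_zero i hnat K p m)).trans (map_zero _)) rfl).trans (zero_add _)
  have hpr : ∀ K p m, GrMod.lin (prK (beta i) K p) (GrMod.lin (inK (beta i) K p) m) = m :=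
    fun K p m => congrArg (fun f => GrMod.lin f m) (inK_prK (beta i) K p)
  obtain ⟨a, ha, hc, h⟩ := exists_central_of_natural.{u} 0
    (fun K p => (GrMod.lin (prK (beta i) K.cx p)).comp (ev (cmp (T K) p)))
    (fun K p k x hx => GrMod.lin_mem (prK (beta i) K.cx p) (ev_mem (cmp (T K) p) hx))
    (fun {e K L} φ p m => by
      refine (congrArg (GrMod.lin _) (hnat φ p m)).trans ?_
      exact (hsq_lin (hsq_prK φ (beta i) p) _).symm)
    (fun K p m => by
      refine (hpr _ _ _).symm.trans ((congrArg _ ?_).trans (hpr _ _ _))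
      refine (hin K (p + 1) _).symm.trans ((ev_cmp_d (T K) p (p + 1) m).trans ?_)
      refine (congrArg _ (hin K p m)).trans ?_
      exact congrArg (fun f => GrMod.lin f (GrMod.lin (prK (beta i) K.cx p) (ev (cmp (T K) p) m)))
        (inK_d (beta i) K.cx p (p + 1)))
  obtain ⟨k, rfl⟩ := exists_int_of_central ha hc
  refine ⟨k, ?_⟩
  ext K
  refine (hT K).trans ?_
  refine congrArg (HC.mk K ((W [(i, true)]).obj K) 0) (cmp_ext fun p => ev_ext fun m => ?_)
  refine (hin K p m).trans ((congrArg _ (h K p m)).trans ?_)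
  refine Eq.trans ?_ (congrArg (k • ·) ((congrArg (fun f => ev f m)
    (cmp_mk₀ (incK (beta i) K.cx) rfl p)).trans (ev_mk₀ _ _ m))).symm
  refine (congrArg _ (Int.cast_smul_eq_zsmul (A n) k m)).trans ?_
  exact map_zsmul (GrMod.lin (inK (beta i) K.cx p)) k m

end Values

/-! ### Complexes concentrated in degree zero -/

section Concentrated

open ZeroObject

/-- The terms of the complex with a module in cohomological degree `0`. -/
noncomputable def concX (M : GrMod.{u} n) : ℤ → GrMod.{u} n
  | .ofNat 0 => M
  | _ => 0

/-- The complex with a module in cohomological degree `0`. -/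
noncomputable def concCx (M : GrMod.{u} n) : CochainComplex (GrMod.{u} n) ℤ where
  X := concX M
  d _ _ := 0

lemma isZero_concX (M : GrMod.{u} n) {p : ℤ} (hp : p ≠ 0) : IsZero (concX M p) := by
  match p, hp with
  | .ofNat (k + 1), _ => exact isZero_zero _
  | .negSucc k, _ => exact isZero_zero _

/-- A module in cohomological degree `0`, as a bounded complex. -/
noncomputable def conc (M : GrMod.{u} n) : HC.{u} n :=
  (⟨(HomotopyCategory.quotient _ _).obj (concCx M), 0, 0, fun _ hi =>
    isZero_concX M (by omega)⟩ : 𝒞.{u} n)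

/-- Homotopic maps from a module in degree `0` agree if its maps to degree `-1` of the target are
killed by the differential. -/
lemma cmp_eq_of_homotopy {M : GrMod.{u} n} {L : HC.{u} n} {d : IntDeg}
    {f g : ShiftedHom (conc M).cx L.cx d} (h : Homotopy f g)
    (hL : ∀ x : ShiftedHom M (L.cx.X (-1)) d, x ≫ (shiftFunctor _ d).map (L.cx.d (-1) 0) = 0) :
    cmp f 0 = cmp g 0 := by
  refine (h.comm 0).trans ?_
  have h₁ : dNext 0 h.hom = 0 := by
    rw [dNext_eq h.hom (show (ComplexShape.up ℤ).Rel 0 1 from rfl)]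
    exact zero_comp
  have h₂ : prevD 0 h.hom = 0 := by
    rw [prevD_eq h.hom (show (ComplexShape.up ℤ).Rel (-1) 0 from rfl)]
    exact hL (h.hom 0 (-1))
  rw [h₁, h₂, zero_add, zero_add]
  rfl

end Concentrated

/-! ### Transformations from the identity to `R_i'` -/

section RightInverse

/-- Transformations of positive degree to `R_i'` are determined by their composition with the
projection to the identity. -/
lemma wordRel_of_comp_wTwoT (i : Fin n) {t t' : W.{u} [] ⟶ W [(i, false)]} {d : ℤ}
    (hd : degT t = intDeg d) (hd' : degT t' = intDeg d)
    (h : wordRel [] [] (t ≫ wTwoT i) (t' ≫ wTwoT i)) : wordRel [] [(i, false)] t t' := by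
  have key : ∀ t : W.{u} [] ⟶ W [(i, false)], degT t = intDeg d → ∃ a : A n,
      ∃ T : ∀ K : HC.{u} n, ShiftedHom K.cx ((negF (gamma i)).obj K.cx) (intDeg d),
      ∃ T' : ∀ K : HC.{u} n, ShiftedHom K.cx K.cx (intDeg d),
        (∀ K, t.app K = HC.mk K ((W [(i, false)]).obj K) (intDeg d) (T K)) ∧
        (∀ K, (t ≫ wTwoT i).app K = HC.mk K K (intDeg d) (T' K)) ∧
        (∀ K p m, ev (cmp (T' K) p) m = a • m) ∧
        ∀ K p m, ev (cmp (T K) p) m = GrMod.lin (inK' (gamma i) K.cx p) (a • m) := by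
    intro t hd
    obtain ⟨T, hT⟩ : ∃ T : ∀ K : HC.{u} n, ShiftedHom K.cx ((negF (gamma i)).obj K.cx) (intDeg d),
        ∀ K, t.app K = HC.mk K ((W [(i, false)]).obj K) (intDeg d) (T K) := exists_values t hd
    have hnat : ∀ {e : IntDeg} {K L : HC.{u} n} (φ : ShiftedHom K.cx L.cx e) (p : ℤ)
        (m : (K.cx.X p).carrier),
        ev (cmp (T L) p) (ev (cmp φ p) m) =
          ev (cmp (φ.map (negF (gamma i))) p) (ev (cmp (T K) p) m) :=
      fun φ p m => values_natural t hT φ (φ.map (negF (gamma i))) rfl p m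
    have hd₂ : degT (t ≫ wTwoT i) = intDeg d :=
      (Sg.deg_comp (Sg.ofT t) (Sg.ofT (wTwoT i))).trans ((zero_add (degT t)).trans hd)
    obtain ⟨a, -, -, T', hT', ha⟩ := exists_central (t ≫ wTwoT i) hd₂
    refine ⟨a, T, T', hT, hT', ha, fun K p m => ?_⟩
    have hpr : ev (cmp (T' K) p) m = GrMod.lin (prK' (gamma i) K.cx p) (ev (cmp (T K) p) m) := by
      have h₁ : (t ≫ wTwoT i).app K = HC.mk K K (intDeg d)
          (T K ≫ (shiftFunctor _ (intDeg d)).map (show (negF (gamma i)).obj K.cx ⟶ K.cx from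
            (cw₂ i).app K.cx)) :=
        (congrArg (· ≫ (wTwoT i).app K) (hT K)).trans
          (HC.mk_comp_of (K := K) (L := (W [(i, false)]).obj K) (M := K) (T K)
            (show (negF (gamma i)).obj K.cx ⟶ K.cx from (cw₂ i).app K.cx))
      have h₂ := HC.mk_injective ((hT' K).symm.trans h₁)
      refine (congrArg (fun f => ev (cmp f p) m) h₂).trans ?_
      exact congrArg (fun f => GrMod.lin f (ev (cmp (T K) p) m)) (cw₂_app_f i K.cx p)
    -- Lower terms of discs have no predecessors, so there is nothing in `P_i ⊗ _iP ⊗ K^{p-1}`.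
    have hU : ∀ (K : HC.{u} n) (p : ℤ) (m : (K.cx.X p).carrier), GrMod.lin
        (prU' (gamma i) K.cx (q := p) (sub_add_cancel p 1)) (ev (cmp (T K) p) m) = 0 := by
      intro K p m
      induction m using isInternal_induction (K.cx.X p).internal with
      | h0 => rw [map_zero, map_zero]
      | hadd x y h₁ h₂ => rw [map_add, map_add, h₁, h₂, add_zero]
      | hom k m hm =>
        obtain ⟨φ, hφ, -⟩ := exists_disc_map hm
        rw [← hφ, hnat]
        refine (hsq_lin (hsq_prU' φ (gamma i) (q := p) (sub_add_cancel p 1)) _).symm.trans ?_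
        refine (congrArg _ (eq_zero_of_isZero (Functor.map_isZero _
          (isZero_disc_X_pred p (sub_add_cancel p 1))) _)).trans (map_zero _)
    have hs := congrArg (fun f => GrMod.lin f (ev (cmp (T K) p) m))
      (neg_split (gamma i) K.cx (q := p) (sub_add_cancel p 1))
    refine Eq.trans hs.symm ((GrMod.lin_add _ _ _).trans ?_)
    refine (congrArg₂ (· + ·) rfl ((congrArg (GrMod.lin (inU' (gamma i) K.cx (sub_add_cancel p 1)))
      (hU K p m)).trans (map_zero _))).trans ((add_zero _).trans ?_)
    exact congrArg (GrMod.lin (inK' (gamma i) K.cx p)) (hpr.symm.trans (ha K p m))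
  obtain ⟨a, T, S, hT, hS, ha, hTa⟩ := key t hd
  obtain ⟨a', T', S', hT', hS', ha', hTa'⟩ := key t' hd'
  obtain ⟨ε, hε, h⟩ := h
  -- On the complex `A_n` in degree `0` homotopic maps are equal, which compares `a` and `a'`.
  have h₁ := h (conc (freeMod n))
  rw [hS, hS'] at h₁
  obtain ⟨h₁⟩ := HC.Rel.homotopy h₁
  have h₂ := cmp_eq_of_homotopy (L := conc (freeMod n)) h₁ fun x =>
    (congrArg (x ≫ ·) (Functor.map_zero _ _ _)).trans comp_zero
  have h₃ := congrArg (fun f => ev f freeGen) h₂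
  have h₄ : a = ε • a' := by
    refine smul_freeGen_injective.{u} ?_
    rw [smul_assoc]
    refine (ha _ 0 _).symm.trans (h₃.trans ?_)
    exact congrArg (ε • ·) (ha' (conc (freeMod n)) 0 freeGen)
  refine ⟨ε, hε, fun K => ?_⟩
  have h₅ : t.app K = ε • t'.app K := by
    rw [hT, hT']
    refine congrArg (HC.mk K ((W [(i, false)]).obj K) (intDeg d)) (cmp_ext fun p => ev_ext fun m =>
        ?_)
    refine (hTa K p m).trans ?_
    rw [h₄, smul_assoc]
    refine (map_zsmul (GrMod.lin (inK' (gamma i) K.cx p)) ε _).trans ?_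
    exact (congrArg (ε • ·) (hTa' K p m)).symm
  rw [h₅]
  exact HC.Rel.smul_left ε _

end RightInverse

/-! ### Transformations without torsion -/

section Torsion

variable {i : Fin n}

/-- Conditions on a complex which force homotopic maps from the simple module at `i`, in
cohomological degree `0`, to be equal; they persist under the functors of positive letters. -/
structure Tame (i : Fin n) (K : CochainComplex (GrMod.{u} n) ℤ)
    (ι : simpleMod i ⟶ K.X 0) : Prop where
  zero : ∀ p, 0 < p → IsZero (K.X p)
  neg : ∀ f : simpleMod i ⟶ K.X (-1), f = 0
  low : ∀ k < 0, ∀ x ∈ (K.X 0).gr k, x = 0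
  split : ∃ r : K.X 0 ⟶ simpleMod i, ι ≫ r = 𝟙 _

lemma mem_simpleMod (x : (simpleMod.{u} i).carrier) : x ∈ (simpleMod i).gr 0 := by
  change x ∈ (if (0 : ℤ) = 0 then ⊤ else ⊥ : AddSubgroup (SimpleCarrier.{u} i))
  rw [if_pos rfl]; trivial

lemma X_smul_simpleMod (j : Fin n) (x : (simpleMod.{u} i).carrier) : X j • x = 0 := by
  have h : X j • x = (aug i (X j) • (show ULift.{u} ℤ from x) : ULift.{u} ℤ) := rfl
  rw [h, aug_X, zero_smul]; rfl

lemma Tame.conc (i : Fin n) : Tame i (conc.{u} (simpleMod i)).cx (𝟙 _) where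
  zero p hp := isZero_concX _ (by omega)
  neg f := (isZero_concX (simpleMod i) (by norm_num)).eq_of_tgt _ _
  low k hk x hx := by
    have hx : x ∈ (if k = 0 then ⊤ else ⊥ : AddSubgroup (SimpleCarrier.{u} i)) := hx
    rw [if_neg (by omega)] at hx
    exact AddSubgroup.mem_bot.1 hx
  split := ⟨𝟙 _, Category.comp_id _⟩

lemma Tame.pos {K : CochainComplex (GrMod.{u} n) ℤ} {ι : simpleMod i ⟶ K.X 0} (h : Tame i K ι)
    (j : Fin n) : Tame i ((posF (beta j)).obj K) (ι ≫ inK (beta j) K 0) where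
  zero p hp := by
    refine (IsZero.iff_id_eq_zero _).2 ((pos_split (beta j) K (p := p) rfl).symm.trans ?_)
    rw [(h.zero p hp).eq_of_tgt (prK (beta j) K p) 0,
      (Functor.map_isZero _ (h.zero (p + 1) (by omega))).eq_of_tgt (prU (beta j) K (p := p) rfl) 0,
      zero_comp, zero_comp, add_zero]
  neg f := by
    have h₁ : f ≫ prK (beta j) K (-1) = 0 := h.neg _
    -- `X_j` kills the simple module, but it is injective on the elements `(j) ⊗ (j) ⊗ m`.
    have h₂ : f ≫ prU (beta j) K (p := -1) (q := 0) rfl = 0 := by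
      refine GrMod.hom_ext fun x => ?_
      obtain ⟨v, hv⟩ : ∃ v : (U j (K.X 0)).carrier,
        v = GrMod.lin (f ≫ prU (beta j) K (p := -1) (q := 0) rfl) x := ⟨_, rfl⟩
      have hv₀ : v ∈ (U j (K.X 0)).gr 0 := by
        rw [hv]; exact GrMod.lin_mem _ (mem_simpleMod x)
      have hv₁ : X j • v = 0 := by
        rw [hv]
        refine (map_smul (GrMod.lin (f ≫ prU (beta j) K (p := -1) (q := 0) rfl)) _ _).symm.trans ?_
        rw [X_smul_simpleMod, map_zero]
        rfl
      refine hv.symm.trans ((eq_br_of_mem hv₀ h.low).trans ?_)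
      rw [hv₁, map_zero, map_zero]; rfl
    refine (Category.comp_id f).symm.trans ?_
    refine (congrArg (f ≫ ·) (pos_split (beta j) K (p := -1) (q := 0) rfl).symm).trans ?_
    rw [Preadditive.comp_add]
    refine (congrArg₂ (· + ·) ((Category.assoc _ _ _).symm.trans (congrArg (· ≫ _) h₂))
      ((Category.assoc _ _ _).symm.trans (congrArg (· ≫ _) h₁))).trans ?_
    rw [zero_comp, zero_comp, add_zero]
  low k hk x hx := by
    have h₁ := congrArg (fun f => GrMod.lin f x) (pos_split (beta j) K (p := 0) rfl)
    refine h₁.symm.trans ((GrMod.lin_add _ _ _).trans ?_)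
    refine (congrArg₂ (· + ·) (congrArg (GrMod.lin (inU (beta j) K rfl))
      (eq_zero_of_isZero (Functor.map_isZero _ (h.zero 1 one_pos)) _))
      (congrArg (GrMod.lin (inK (beta j) K 0)) (h.low k hk _ (GrMod.lin_mem (prK (beta j) K 0)
          hx)))).trans ?_
    rw [map_zero, map_zero, add_zero]
  split := by
    obtain ⟨r, hr⟩ := h.split
    exact ⟨prK (beta j) K 0 ≫ r, by rw [Category.assoc, inK_prK_assoc, hr]⟩

lemma Tame.pos_conc (i : Fin n) : Tame i ((posF (beta i)).obj (BraidCob.conc.{u} (simpleMod i)).cx)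
    (inK (beta i) (BraidCob.conc.{u} (simpleMod i)).cx 0) :=
  Eq.mp (congrArg (Tame i _) (Category.id_comp _)) ((Tame.conc i).pos i)

/-- Proportional maps from the simple module have proportional factors, if the target is tame. -/
lemma Tame.eq_mul {L : HC.{u} n} {f : (BraidCob.conc.{u} (simpleMod i)).cx ⟶ L.cx}
    (hf : Tame i L.cx (f.f 0)) {k l ε : ℤ}
    (h : HC.Rel ε (k • HC.of (BraidCob.conc (simpleMod i)) L f)
      (l • HC.of (BraidCob.conc (simpleMod i)) L f)) : k = ε * l := by
  have h₁ : Nonempty (Homotopy (k • ShiftedHom.mk₀ (0 : IntDeg) rfl f)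
      (ε • l • ShiftedHom.mk₀ (0 : IntDeg) rfl f)) :=
    HC.Rel.homotopy (d := 0) h
  obtain ⟨h₁⟩ := h₁
  have h₂ := cmp_eq_of_homotopy h₁ fun x => by
    have hx : x ≫ (shiftFunctorZero (GrMod.{u} n) IntDeg).hom.app (L.cx.X (-1)) = 0 := hf.neg _
    have hx' : x = 0 := by
      refine (Category.comp_id _).symm.trans ?_
      refine (congrArg (x ≫ ·)
        ((shiftFunctorZero (GrMod.{u} n) IntDeg).hom_inv_id_app (L.cx.X (-1))).symm).trans ?_
      refine (Category.assoc _ _ _).symm.trans ?_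
      exact (congrArg (· ≫ _) hx).trans zero_comp
    rw [hx']
    exact zero_comp
  obtain ⟨r, hr⟩ := hf.split
  have hfr : ∀ x : (simpleMod.{u} i).carrier, GrMod.lin r (GrMod.lin (f.f 0) x) = x := fun x =>
    congrArg (fun f => GrMod.lin f x) hr
  have h₄ : ∀ x : (simpleMod.{u} i).carrier,
      ev (cmp (ShiftedHom.mk₀ (0 : IntDeg) rfl f) 0) x = GrMod.lin (f.f 0) x := fun x =>
    (congrArg (fun f => ev f x) (cmp_mk₀ f rfl 0)).trans (ev_mk₀ _ _ _)
  have h₃ : ∀ x : (simpleMod.{u} i).carrier, k • x = ε • l • x := fun x => by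
    have h₅ : k • ev (cmp (ShiftedHom.mk₀ (0 : IntDeg) rfl f) 0) x =
        ε • l • ev (cmp (ShiftedHom.mk₀ (0 : IntDeg) rfl f) 0) x := congrArg (fun f => ev f x) h₂
    have h₆ := congrArg (GrMod.lin r) h₅
    have h₇ := h₄ x
    refine (congrArg (k • ·) ((congrArg (GrMod.lin r) h₇).trans (hfr x))).symm.trans ?_
    refine (map_zsmul (GrMod.lin r) k _).symm.trans (h₆.trans ?_)
    refine (map_zsmul (GrMod.lin r) ε _).trans (congrArg (ε • ·) ?_)
    refine (map_zsmul (GrMod.lin r) l _).trans (congrArg (l • ·) ?_)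
    exact (congrArg (GrMod.lin r) h₇).trans (hfr x)
  have h₈ : (k • (1 : ℤ)) = ε • l • (1 : ℤ) := congrArg ULift.down (h₃ (ULift.up (1 : ℤ)))
  simpa using h₈

/-- Multiples of a transformation from the identity functor agree up to sign only if the factors
do, if the value at a simple module is tame. -/
lemma eq_or_eq_neg_of_tame {g : Word n} {t : W.{u} [] ⟶ W g}
    {f : (conc.{u} (simpleMod i)).cx ⟶ ((W g).obj (conc (simpleMod i))).cx}
    (ht : t.app (conc (simpleMod i)) = HC.of (conc (simpleMod i)) ((W g).obj (conc (simpleMod i)))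
        f)
    (hf : Tame i ((W g).obj (conc (simpleMod i))).cx (f.f 0)) {k l : ℤ}
    (h : wordRel [] g (zsmulT k t) (zsmulT l t)) : k = l ∨ k = -l := by
  obtain ⟨ε, hε, h⟩ := h
  have h₁ : HC.Rel ε (k • t.app (conc (simpleMod i))) (l • t.app (conc (simpleMod i))) :=
    h (conc (simpleMod i))
  rw [ht] at h₁
  have h₇ := hf.eq_mul h₁
  rcases Int.isUnit_iff.1 hε with rfl | rfl
  · left; rw [h₇, one_mul]
  · right; rw [h₇, neg_one_mul]

/-- The insertion of the letters `σ_i`, `σ_j`, `σ_i`, one after the other. -/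
noncomputable def wOneT₃ (i j : Fin n) : W.{u} [] ⟶ W [(i, true), (j, true), (i, true)] :=
  wOneT i ≫ rightT [(i, true)] (wOneT j) ≫ rightT [(j, true), (i, true)] (wOneT i)

lemma id_nontorsion (i : Fin n) {k l : ℤ}
    (h : wordRel.{u} ([] : Word n) [] (zsmulT k (𝟙 _)) (zsmulT l (𝟙 _))) : k = l ∨ k = -l :=
  eq_or_eq_neg_of_tame (i := i) (g := []) (t := 𝟙 _) (f := 𝟙 _) rfl (Tame.conc i) h

lemma wOneT_nontorsion (i : Fin n) {k l : ℤ}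
    (h : wordRel.{u} _ _ (zsmulT k (wOneT i)) (zsmulT l (wOneT i))) : k = l ∨ k = -l := by
  refine eq_or_eq_neg_of_tame (i := i) (g := [(i, true)]) (t := wOneT i)
    (f := incK (beta i) (conc (simpleMod i)).cx) rfl ?_ h
  exact Tame.pos_conc i

lemma wOneT₃_nontorsion (i j : Fin n) {k l : ℤ}
    (h : wordRel.{u} _ _ (zsmulT k (wOneT₃ i j)) (zsmulT l (wOneT₃ i j))) : k = l ∨ k = -l := by
  let S : HC.{u} n := conc (simpleMod i)
  let S₁ : HC.{u} n := (letF (i, true)).obj S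
  let S₂ : HC.{u} n := (letF (j, true)).obj S₁
  let S₃ : HC.{u} n := (letF (i, true)).obj S₂
  let f₁ : S.cx ⟶ S₁.cx := incK (beta i) S.cx
  let f₂ : S₁.cx ⟶ S₂.cx := incK (beta j) S₁.cx
  let f₃ : S₂.cx ⟶ S₃.cx := incK (beta i) S₂.cx
  refine eq_or_eq_neg_of_tame (i := i) (g := [(i, true), (j, true), (i, true)]) (t := wOneT₃ i j)
    (f := f₁ ≫ f₂ ≫ f₃) ?_ ?_ h
  · have h₂ : (rightT [(i, true)] (wOneT.{u} j)).app S = HC.of S₁ S₂ f₂ :=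
      eq_of_heq (rightT_app [(i, true)] (wOneT j) S)
    have h₃ : (rightT [(j, true), (i, true)] (wOneT.{u} i)).app S = HC.of S₂ S₃ f₃ :=
      eq_of_heq (rightT_app [(j, true), (i, true)] (wOneT i) S)
    refine Eq.trans (b := HC.of S S₁ f₁ ≫ HC.of S₁ S₂ f₂ ≫ HC.of S₂ S₃ f₃) ?_ ?_
    · exact congrArg (HC.of S S₁ f₁ ≫ ·) (congrArg₂ (· ≫ ·) h₂ h₃)
    · rw [HC.of_comp_of, HC.of_comp_of]
      rfl
  · exact Eq.mp (congrArg (Tame i _) (Category.assoc _ _ _)) (((Tame.pos_conc.{u} i).pos j).pos i)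

end Torsion

/-! ### Generators of the transformations of degree zero -/

namespace Sg

variable {g h k g' h' : Word n}

lemma one_smul (f : Hm.{u} g h) : (1 : ℤ) • f = f := unit_smul isUnit_one f

/-- Transport of morphisms along equalities of words. -/
def castH (hg : g = g') (hh : h = h') (f : Hm.{u} g h) : Hm.{u} g' h' := by
  subst hg hh; exact f

lemma castH_heq (hg : g = g') (hh : h = h') (f : Hm.{u} g h) : HEq (castH hg hh f) f := by
  subst hg hh; rfl

lemma castH_eq_of_heq (hg : g = g') (hh : h = h') {f : Hm.{u} g h} {f' : Hm.{u} g' h'}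
    (H : HEq f f') : castH hg hh f = f' := eq_of_heq ((castH_heq hg hh f).trans H)

lemma deg_castH (hg : g = g') (hh : h = h') (f : Hm.{u} g h) : deg (castH hg hh f) = deg f := by
  subst hg hh; rfl

/-- Invertible of degree `0`. -/
structure IsIso₀ (f : Hm.{u} g h) : Prop where
  iso : IsIso f
  deg_eq : deg f = 0

lemma IsIso₀.deg_inv {f : Hm.{u} g h} (hf : IsIso₀ f) : deg (h := g) (haveI := hf.iso; inv f) = 0 :=
    by
  have := hf.iso
  have h₁ := deg_comp f (inv f)
  rw [IsIso.hom_inv_id, deg_id, hf.deg_eq, add_zero] at h₁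
  exact h₁.symm

lemma IsIso₀.exists_inv {f : Hm.{u} g h} (hf : IsIso₀ f) :
    ∃ f' : Hm.{u} h g, IsIso₀ f' ∧ f ≫ f' = 𝟙 _ ∧ f' ≫ f = 𝟙 _ := by
  have := hf.iso
  exact ⟨inv f, ⟨inferInstance, hf.deg_inv⟩, IsIso.hom_inv_id f, IsIso.inv_hom_id f⟩

lemma IsIso₀.mk' {f : Hm.{u} g h} (f' : Hm.{u} h g) (h₁ : f ≫ f' = 𝟙 _) (h₂ : f' ≫ f = 𝟙 _)
    (hd : deg f = 0) : IsIso₀ f := ⟨⟨f', h₁, h₂⟩, hd⟩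

lemma IsIso₀.id (g : Word n) : IsIso₀ (𝟙 (⟨g⟩ : Sg.{u} n)) := ⟨inferInstance, deg_id g⟩

lemma IsIso₀.comp {f : Hm.{u} g h} {f' : Hm.{u} h k} (hf : IsIso₀ f) (hf' : IsIso₀ f') :
    IsIso₀ (f ≫ f') := by
  have := hf.iso; have := hf'.iso
  exact ⟨inferInstance, by rw [deg_comp, hf.deg_eq, hf'.deg_eq, add_zero]⟩

lemma IsIso₀.lft (u : Word n) {f : Hm.{u} g h} (hf : IsIso₀ f) : IsIso₀ (lft u f) := by
  obtain ⟨f', -, h₁, h₂⟩ := hf.exists_inv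
  exact .mk' (Sg.lft u f') (by rw [← lft_comp, h₁, lft_id]) (by rw [← lft_comp, h₂, lft_id])
    ((deg_lft u f).trans hf.deg_eq)

lemma IsIso₀.rgt (u : Word n) {f : Hm.{u} g h} (hf : IsIso₀ f) : IsIso₀ (rgt u f) := by
  obtain ⟨f', -, h₁, h₂⟩ := hf.exists_inv
  exact .mk' (Sg.rgt u f') (by rw [← rgt_comp, h₁, rgt_id]) (by rw [← rgt_comp, h₂, rgt_id])
    ((deg_rgt u f).trans hf.deg_eq)

lemma IsIso₀.castH (hg : g = g') (hh : h = h') {f : Hm.{u} g h} (hf : IsIso₀ f) :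
    IsIso₀ (castH hg hh f) := by
  subst hg hh; exact hf

lemma isIso₀_create (i : Fin n) (a : Bool) : IsIso₀ (ofT (createT.{u} i a)) := by
  refine .mk' (ofT (cancelT i a)) ?_ ?_ ?_
  · exact congrArg ofT (createT_cancelT i a)
  · exact (ofT_eq_iff _ _).2 (cancelT_createT i a)
  · cases a <;> rfl

/-- The generators: transformations `f` of degree `0` such that every transformation of degree `0`
is `m f` for an integer `m`, which is unique up to sign. -/
structure Gen (f : Hm.{u} g h) : Prop where
  deg_eq : deg f = 0
  span : ∀ f' : Hm.{u} g h, deg f' = 0 → ∃ m : ℤ, f' = m • f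
  free : ∀ k l : ℤ, k • f = l • f → k = l ∨ k = -l

lemma Gen.unique {f f' : Hm.{u} g h} (hf : Gen f) (hf' : Gen f') : f = f' := by
  obtain ⟨m, hm⟩ := hf.span f' hf'.deg_eq
  obtain ⟨m', hm'⟩ := hf'.span f hf.deg_eq
  have h₁ : (1 : ℤ) • f = (m' * m) • f := by rw [one_smul, ← smul_smul, ← hm, ← hm']
  have h₂ : IsUnit (m' * m) := by
    rcases hf.free _ _ h₁ with h | h
    · rw [← h]; exact isUnit_one
    · rw [show m' * m = -1 by omega]; exact isUnit_one.neg
  rw [hm, unit_smul (isUnit_of_mul_isUnit_right h₂)]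

lemma Gen.comp_iso {f : Hm.{u} g h} (hf : Gen f) {e : Hm.{u} h k} (he : IsIso₀ e) :
    Gen (f ≫ e) := by
  obtain ⟨e', he', h₁, h₂⟩ := he.exists_inv
  refine ⟨by rw [deg_comp, hf.deg_eq, he.deg_eq, add_zero], fun f' hf' => ?_, fun k l hkl => ?_⟩
  · obtain ⟨m, hm⟩ := hf.span (f' ≫ e') (by rw [deg_comp, hf', he'.deg_eq, add_zero])
    exact ⟨m, by rw [← smul_comp, ← hm, Category.assoc, h₂, Category.comp_id]⟩
  · refine hf.free k l ?_
    have := congrArg (· ≫ e') hkl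
    simpa only [smul_comp, Category.assoc, h₁, Category.comp_id] using this

lemma Gen.iso_comp {f : Hm.{u} g h} (hf : Gen f) {e : Hm.{u} k g} (he : IsIso₀ e) :
    Gen (e ≫ f) := by
  obtain ⟨e', he', h₁, h₂⟩ := he.exists_inv
  refine ⟨by rw [deg_comp, hf.deg_eq, he.deg_eq, add_zero], fun f' hf' => ?_, fun k l hkl => ?_⟩
  · obtain ⟨m, hm⟩ := hf.span (e' ≫ f') (by rw [deg_comp, hf', he'.deg_eq, add_zero])
    exact ⟨m, by rw [← comp_smul, ← hm, ← Category.assoc, h₁, Category.id_comp]⟩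
  · refine hf.free k l ?_
    have := congrArg (e' ≫ ·) hkl
    simpa only [comp_smul, ← Category.assoc, h₂, Category.id_comp] using this

/-! ### Placing letters to the left and to the right is fully faithful -/

/-- The inverse letter. -/
def bar (s : Letter n) : Letter n := (s.1, !s.2)

/-- The creation of a letter and its inverse. -/
noncomputable def pairH (s : Letter n) : Hm.{u} [] [s, bar s] := ofT (createT s.1 s.2)

lemma isIso₀_pairH (s : Letter n) : IsIso₀ (pairH.{u} s) := isIso₀_create s.1 s.2

lemma bar_bar (s : Letter n) : bar (bar s) = s := by
  obtain ⟨i, a⟩ := s; simp [bar]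

lemma exists_pair (s : Letter n) : ∃ c : Hm.{u} [] [bar s, s], IsIso₀ c := by
  have : ∃ c : Hm.{u} [] [bar s, bar (bar s)], IsIso₀ c := ⟨_, isIso₀_pairH (bar s)⟩
  rwa [bar_bar] at this

lemma lft_two (s t : Letter n) (f : Hm.{u} g h) : lft [s] (lft [t] f) = lft [s, t] f :=
  (eq_of_heq (lft_append [s] [t] f)).symm

lemma lft_cons (s : Letter n) (w : Word n) (f : Hm.{u} g h) : lft (s :: w) f = lft [s] (lft w f) :=
  eq_of_heq (lft_append [s] w f)

/-- `f` is recovered from its image under two inverse letters. -/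
lemma conj_lft {s t : Letter n} (c : Hm.{u} [] [s, t]) (f : Hm.{u} g h) :
    rgt g c ≫ lft [s, t] f = f ≫ rgt h c := by
  have := exchange c f
  rwa [lft_nil] at this

lemma lft_injective (s : Letter n) {f f' : Hm.{u} g h} (H : lft [s] f = lft [s] f') : f = f' := by
  obtain ⟨c, hc⟩ := exists_pair.{u} s
  have := (hc.rgt h).iso
  rw [← cancel_mono (rgt h c), ← conj_lft, ← conj_lft, ← lft_two, ← lft_two, H]

lemma lft_surjective (s : Letter n) (f : Hm.{u} (s :: g) (s :: h)) :
    ∃ f₀ : Hm.{u} g h, f = lft [s] f₀ := by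
  obtain ⟨c, hc⟩ := exists_pair.{u} s
  obtain ⟨d, -, h₁, h₂⟩ := (hc.rgt h).exists_inv
  -- Conjugating `s⁻¹ f` by the creation of `s⁻¹ s` gives a candidate; it is enough to compare its
  -- image with that of `f` after placing `s⁻¹`.
  let F : Hm.{u} (bar s :: s :: g) (bar s :: s :: h) := lft [bar s] f
  refine ⟨rgt g c ≫ F ≫ d, ?_⟩
  have := (hc.rgt g).iso
  refine lft_injective (g := s :: g) (h := s :: h) (bar s) ?_
  change F = lft [bar s] (lft [s] _)
  rw [lft_two, ← cancel_epi (rgt g c), conj_lft, Category.assoc, Category.assoc]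
  exact (congrArg (_ ≫ ·) ((congrArg (F ≫ ·) h₂).trans (Category.comp_id F))).symm

lemma Gen.lft_letter {f : Hm.{u} g h} (hf : Gen f) (s : Letter n) : Gen (lft [s] f) := by
  refine ⟨(deg_lft _ f).trans hf.deg_eq, fun f' hf' => ?_, fun k l hkl => ?_⟩
  · obtain ⟨f₀, rfl⟩ := lft_surjective s f'
    obtain ⟨m, rfl⟩ := hf.span f₀ ((deg_lft _ f₀).symm.trans hf')
    exact ⟨m, lft_smul m _ f⟩
  · rw [← lft_smul, ← lft_smul] at hkl
    exact hf.free k l (lft_injective s hkl)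

lemma Gen.lft {f : Hm.{u} g h} (hf : Gen f) (w : Word n) : Gen (lft w f) := by
  induction w with
  | nil => rw [lft_nil]; exact hf
  | cons s w ih => rw [lft_cons]; exact ih.lft_letter s

lemma comp_heq {a b c a' b' c' : Word n} (ha : a = a') (hb : b = b') (hc : c = c')
    {f : Hm.{u} a b} {f' : Hm.{u} a' b'} {e : Hm.{u} b c} {e' : Hm.{u} b' c'} (H : HEq f f')
    (H' : HEq e e') : HEq (f ≫ e) (f' ≫ e') := by
  subst ha hb hc; rw [eq_of_heq H, eq_of_heq H']

lemma rgt_two (s t : Letter n) (f : Hm.{u} g h) : HEq (rgt [t] (rgt [s] f)) (rgt [s, t] f) :=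
  (rgt_append [s] [t] f).symm

/-- `f` is recovered from its image under two inverse letters. -/
lemma conj_rgt {s t : Letter n} (c : Hm.{u} [] [s, t]) (f : Hm.{u} g h) :
    castH (List.append_nil g) rfl (lft g c) ≫ rgt [s, t] f =
      f ≫ castH (List.append_nil h) rfl (lft h c) := by
  have h₁ := exchange f c
  refine eq_of_heq (HEq.trans ?_ ((heq_of_eq h₁.symm).trans ?_))
  · exact comp_heq (List.append_nil g).symm rfl rfl (castH_heq _ _ _) HEq.rfl
  · exact comp_heq (List.append_nil g) (List.append_nil h) rfl (rgt_nil f) (castH_heq _ _ _).symm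

lemma rgt_heq_congr {v : Word n} (hg : g = g') (hh : h = h') {f : Hm.{u} g h} {f' : Hm.{u} g' h'}
    (H : HEq f f') : HEq (rgt v f) (rgt v f') := by
  subst hg hh; rw [eq_of_heq H]

lemma rgt_injective (s : Letter n) {f f' : Hm.{u} g h} (H : rgt [s] f = rgt [s] f') : f = f' := by
  have hc := isIso₀_pairH.{u} s
  have := ((hc.lft h).castH (List.append_nil h) rfl).iso
  rw [← cancel_mono (castH (List.append_nil h) rfl (lft h (pairH s))), ← conj_rgt, ← conj_rgt]
  refine congrArg (_ ≫ ·) (eq_of_heq ?_)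
  refine (rgt_two s (bar s) f).symm.trans (HEq.trans ?_ (rgt_two s (bar s) f'))
  rw [H]

lemma rgt_surjective (s : Letter n) (f : Hm.{u} (g ++ [s]) (h ++ [s])) :
    ∃ f₀ : Hm.{u} g h, f = rgt [s] f₀ := by
  have hc := isIso₀_pairH.{u} s
  obtain ⟨d, -, h₁, h₂⟩ := ((hc.lft h).castH (List.append_nil h) rfl).exists_inv
  let F : Hm.{u} (g ++ [s, bar s]) (h ++ [s, bar s]) :=
    castH (List.append_assoc g [s] [bar s]) (List.append_assoc h [s] [bar s]) (rgt [bar s] f)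
  refine ⟨castH (List.append_nil g) rfl (lft g (pairH s)) ≫ F ≫ d, ?_⟩
  have := ((hc.lft g).castH (List.append_nil g) rfl).iso
  refine rgt_injective (bar s) (eq_of_heq ?_)
  refine HEq.trans ?_ (rgt_two s (bar s) _).symm
  refine (castH_heq (List.append_assoc g [s] [bar s]) (List.append_assoc h [s] [bar s])
      _).symm.trans
    (heq_of_eq ?_)
  change F = _
  rw [← cancel_epi (castH (List.append_nil g) rfl (lft g (pairH s))), conj_rgt, Category.assoc,
    Category.assoc]
  exact (congrArg (_ ≫ ·) ((congrArg (F ≫ ·) h₂).trans (Category.comp_id F))).symm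

lemma Gen.rgt_letter {f : Hm.{u} g h} (hf : Gen f) (s : Letter n) : Gen (rgt [s] f) := by
  refine ⟨(deg_rgt _ f).trans hf.deg_eq, fun f' hf' => ?_, fun k l hkl => ?_⟩
  · obtain ⟨f₀, rfl⟩ := rgt_surjective s f'
    obtain ⟨m, rfl⟩ := hf.span f₀ ((deg_rgt _ f₀).symm.trans hf')
    exact ⟨m, rgt_smul m _ f⟩
  · rw [← rgt_smul, ← rgt_smul] at hkl
    exact hf.free k l (rgt_injective s hkl)

lemma Gen.of_heq (hg : g = g') (hh : h = h') {f : Hm.{u} g h} {f' : Hm.{u} g' h'} (H : HEq f f')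
    (hf : Gen f) : Gen f' := by
  subst hg hh; rwa [← eq_of_heq H]

lemma Gen.rgt {f : Hm.{u} g h} (hf : Gen f) (w : Word n) : Gen (rgt w f) := by
  induction w generalizing g h with
  | nil => exact hf.of_heq (List.append_nil g).symm (List.append_nil h).symm (rgt_nil f).symm
  | cons s w ih =>
    exact (ih (hf.rgt_letter s)).of_heq (List.append_assoc g [s] w) (List.append_assoc h [s] w)
      (rgt_append [s] w f).symm

lemma gen_id_nil (i : Fin n) : Gen (𝟙 (⟨[]⟩ : Sg.{u} n)) := by
  refine ⟨deg_id _, fun f' hf' => ?_, fun k l hkl => ?_⟩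
  · obtain ⟨t, rfl⟩ := ofT_surjective f'
    obtain ⟨k, rfl⟩ := eq_zsmul_id t hf'
    exact ⟨k, rfl⟩
  · rw [← ofT_id, smul_ofT, smul_ofT, ofT_eq_iff] at hkl
    exact id_nontorsion i hkl

/-- Here `i` serves only to exclude `n = 0`, where all complexes are contractible. -/
lemma gen_id (i : Fin n) (g : Word n) : Gen (𝟙 (⟨g⟩ : Sg.{u} n)) := by
  have h₁ := ((gen_id_nil.{u} i).lft g).of_heq (List.append_nil g) (List.append_nil g)
    (f' := 𝟙 (⟨g⟩ : Sg.{u} n)) (by rw [lft_id]; rw [List.append_nil])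
  exact h₁

lemma IsIso₀.gen (i : Fin n) {f : Hm.{u} g h} (hf : IsIso₀ f) : Gen f := by
  have := (gen_id i g).comp_iso hf
  rwa [Category.id_comp] at this

/-- Invertible transformations of degree `0` are unique up to sign. -/
lemma IsIso₀.unique (i : Fin n) {f f' : Hm.{u} g h} (hf : IsIso₀ f) (hf' : IsIso₀ f') : f = f' :=
  (hf.gen i).unique (hf'.gen i)

end Sg

/-! ### Invertible transformations for the moves between equal braids -/

namespace Sg

variable {g h k g' h' : Word n}

/-- The functors of two words are isomorphic by an invertible transformation of degree `0`. -/
def Equiv₀ (g h : Word n) : Prop := ∃ f : Hm.{u} g h, IsIso₀ f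

lemma Equiv₀.symm (H : Equiv₀.{u} g h) : Equiv₀.{u} h g := by
  obtain ⟨f, hf⟩ := H
  obtain ⟨f', hf', -⟩ := hf.exists_inv
  exact ⟨f', hf'⟩

lemma Equiv₀.trans (H : Equiv₀.{u} g h) (H' : Equiv₀.{u} h k) : Equiv₀.{u} g k := by
  obtain ⟨f, hf⟩ := H
  obtain ⟨f', hf'⟩ := H'
  exact ⟨_, hf.comp hf'⟩

lemma Equiv₀.lft (w : Word n) (H : Equiv₀.{u} g h) : Equiv₀.{u} (w ++ g) (w ++ h) := by
  obtain ⟨f, hf⟩ := H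
  exact ⟨_, hf.lft w⟩

lemma Equiv₀.rgt (w : Word n) (H : Equiv₀.{u} g h) : Equiv₀.{u} (g ++ w) (h ++ w) := by
  obtain ⟨f, hf⟩ := H
  exact ⟨_, hf.rgt w⟩

lemma equiv₀_pair (s : Letter n) : Equiv₀.{u} [] [s, bar s] := ⟨_, isIso₀_pairH s⟩

lemma equiv₀_pair' (s : Letter n) : Equiv₀.{u} [] [bar s, s] := exists_pair s

/-- From `s x ≅ y t` one obtains `s⁻¹ y ≅ x t⁻¹`. -/
lemma Equiv₀.rotate {s t : Letter n} {x y : Word n} (H : Equiv₀.{u} (s :: x) (y ++ [t])) :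
    Equiv₀.{u} (bar s :: y) (x ++ [bar t]) := by
  have h₁ : Equiv₀.{u} (bar s :: y ++ []) (bar s :: y ++ [t, bar t]) := (equiv₀_pair t).lft _
  have h₂ : Equiv₀.{u} (bar s :: s :: x ++ [bar t]) (bar s :: y ++ [t] ++ [bar t]) :=
    (H.lft [bar s]).rgt [bar t]
  have h₃ : Equiv₀.{u} (x ++ [bar t]) (bar s :: s :: x ++ [bar t]) :=
    ((equiv₀_pair' s).rgt x).rgt [bar t]
  rw [List.append_nil] at h₁
  rw [List.append_assoc (bar s :: y)] at h₂
  exact h₁.trans (h₃.trans h₂).symm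

lemma equiv₀_far_pos {i j : Fin n} (h : Far i j) :
    Equiv₀.{u} [(i, true), (j, true)] [(j, true), (i, true)] :=
  ⟨ofT (farT h), .mk' (ofT (farT h.symm)) (congrArg ofT (farT_farT h))
    (congrArg ofT (farT_farT h.symm)) rfl⟩

lemma equiv₀_far {i j : Fin n} (h : Far i j) (a b : Bool) :
    Equiv₀.{u} [(i, a), (j, b)] [(j, b), (i, a)] := by
  have h₁ : ∀ {i j : Fin n}, Far i j → Equiv₀.{u} [(i, false), (j, true)] [(j, true), (i, false)] :=
    fun {i j} h => Equiv₀.rotate (s := (i, true)) (t := (i, true)) (x := [(j, true)])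
      (y := [(j, true)]) (equiv₀_far_pos h)
  cases a <;> cases b
  · exact Equiv₀.rotate (s := (i, true)) (t := (i, true)) (x := [(j, false)])
      (y := [(j, false)]) (h₁ h.symm).symm
  · exact h₁ h
  · exact (h₁ h.symm).symm
  · exact equiv₀_far_pos h

/-- The insertion of the letters `σ_i`, `σ_j`, `σ_i` determines the braid transformation. -/
lemma wOneT₃_braidT {i j : Fin n} (h : Adj i j) :
    ofT (wOneT₃.{u} i j) ≫ ofT (braidT h) = ofT (wOneT₃ j i) := by
  have e₁ : ofT (wOneT.{u} i) ≫ ofT (rightT [(i, true)] (wOneT j)) =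
      ofT (wOneT j) ≫ ofT (leftT [(j, true)] (wOneT i)) := by
    have := exchange (ofT (wOneT.{u} j)) (ofT (wOneT i))
    rw [lft_nil] at this
    exact (this.symm.trans (congrArg (· ≫ _) (eq_of_heq (rgt_nil (ofT (wOneT.{u} j))))))
  have e₂ : ofT (rightT [(j, true), (i, true)] (wOneT.{u} i)) ≫ ofT (braidT h) =
      ofT (leftT [(j, true), (i, true)] (wOneT j)) := congrArg ofT (wOneT_braidT h)
  have e₃ : (ofT (wOneT.{u} i) ≫ ofT (rightT [(i, true)] (wOneT j))) ≫
      ofT (leftT [(j, true), (i, true)] (wOneT j)) = ofT (wOneT₃ j i) := by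
    have := exchange (ofT (wOneT.{u} i) ≫ ofT (rightT [(i, true)] (wOneT j))) (ofT (wOneT.{u} j))
    rw [lft_nil] at this
    refine (congrArg (· ≫ _) (eq_of_heq (rgt_nil _)).symm).trans (this.trans ?_)
    refine (congrArg (ofT (wOneT j) ≫ ·) (rgt_comp [(j, true)] (ofT (wOneT.{u} i))
      (ofT (rightT [(i, true)] (wOneT j))))).trans ?_
    exact congrArg (ofT (wOneT j) ≫ ofT (rightT [(j, true)] (wOneT i)) ≫ ·)
      (eq_of_heq (rgt_append [(i, true)] [(j, true)] (ofT (wOneT j))).symm)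
  refine Eq.trans (Category.assoc (ofT (wOneT.{u} i)) (ofT (rightT [(i, true)] (wOneT j)) ≫
    ofT (rightT [(j, true), (i, true)] (wOneT i))) (ofT (braidT h))) ?_
  refine Eq.trans (congrArg (ofT (wOneT i) ≫ ·) ((Category.assoc _ _ _).trans
    (congrArg (ofT (rightT [(i, true)] (wOneT j)) ≫ ·) e₂))) ?_
  exact (Category.assoc _ _ _).symm.trans e₃

/-- The braid transformations are mutually inverse up to sign: the composition is a multiple `k` of
the identity, and `k = ±1` because it fixes a transformation without torsion. -/
lemma braidT_braidT {i j : Fin n} (h : Adj i j) :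
    ofT (braidT.{u} h) ≫ ofT (braidT h.symm) = 𝟙 _ := by
  obtain ⟨k, hk⟩ := (gen_id.{u} i [(i, true), (j, true), (i, true)]).span
    (ofT (braidT.{u} h) ≫ ofT (braidT h.symm)) rfl
  have h₁ : k • ofT (wOneT₃.{u} i j) = (1 : ℤ) • ofT (wOneT₃ i j) := by
    rw [one_smul]
    refine Eq.trans ?_ (wOneT₃_braidT.{u} h.symm)
    rw [← wOneT₃_braidT h, Category.assoc, hk, comp_smul, Category.comp_id]
  have h₂ := wOneT₃_nontorsion.{u} i j ((ofT_eq_iff _ _).1 h₁)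
  rw [hk, unit_smul (Int.isUnit_iff.2 h₂)]

lemma equiv₀_braid_pos {i j : Fin n} (h : Adj i j) :
    Equiv₀.{u} [(i, true), (j, true), (i, true)] [(j, true), (i, true), (j, true)] :=
  ⟨ofT (braidT h), .mk' (ofT (braidT h.symm)) (braidT_braidT h) (braidT_braidT h.symm) rfl⟩

lemma equiv₀_braid {i j : Fin n} (h : Adj i j) {a b c : Bool} (hs : Mixed a b c) :
    Equiv₀.{u} [(i, a), (j, b), (i, c)] [(j, c), (i, b), (j, a)] := by
  have h₁ : ∀ {i j : Fin n}, Adj i j →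
      Equiv₀.{u} [(i, false), (j, true), (i, true)] [(j, true), (i, true), (j, false)] :=
    fun {i j} h => Equiv₀.rotate (s := (i, true)) (t := (j, true)) (x := [(j, true), (i, true)])
      (y := [(j, true), (i, true)]) (equiv₀_braid_pos h)
  have h₂ : ∀ {i j : Fin n}, Adj i j →
      Equiv₀.{u} [(i, false), (j, false), (i, true)] [(j, true), (i, false), (j, false)] :=
    fun {i j} h => Equiv₀.rotate (s := (i, true)) (t := (j, true)) (x := [(j, true), (i, false)])
      (y := [(j, false), (i, true)]) (h₁ h.symm).symm
  have h₃ : Equiv₀.{u} [(i, false), (j, false), (i, false)] [(j, false), (i, false), (j, false)] :=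
    Equiv₀.rotate (s := (i, true)) (t := (j, true)) (x := [(j, false), (i, false)])
      (y := [(j, false), (i, false)]) (h₂ h.symm).symm
  revert hs
  cases a <;> cases b <;> cases c <;> intro hs
  · exact h₃
  · exact h₂ h
  · simp [Mixed] at hs
  · exact h₁ h
  · exact (h₂ h.symm).symm
  · simp [Mixed] at hs
  · exact (h₁ h.symm).symm
  · exact equiv₀_braid_pos h

/-! ### Transformations of degree two -/

/-- The class of the multiplication by `∑ c_k X_k`. -/
noncomputable def mulH (c : Fin n → ℤ) (g : Word n) : Hm.{u} g g := ofT (mulT c g)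

lemma mulH_comp (c : Fin n → ℤ) (f : Hm.{u} g h) : mulH c g ≫ f = f ≫ mulH c h := by
  obtain ⟨t, rfl⟩ := ofT_surjective f
  exact congrArg ofT (mulT_natural c t)

/-- In `Sg n` the sign of the multiplication is lost. -/
lemma mulH_neg (c : Fin n → ℤ) (g : Word n) : mulH.{u} (-c) g = mulH c g := by
  refine (ofT_eq_iff _ _).2 ⟨-1, isUnit_one.neg, fun K => ?_⟩
  have h₁ : (mulT (-c) g).app K = (-1 : ℤ) • (mulT c g).app K := by
    rw [mulT_app, mulT_app]
    refine congrArg (HC.mk ((W g).obj K) ((W g).obj K) (intDeg 2)) (cmp_ext fun p => ev_ext fun m =>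
        ?_)
    have : lc (-c) = -lc c := by simp [lc]
    change lc (-c) • m = (-1 : ℤ) • (lc c • m)
    rw [this, neg_smul, neg_one_zsmul]
  rw [h₁]
  exact HC.Rel.smul_left _ _

lemma rgt_mulH (c : Fin n → ℤ) (g v : Word n) : rgt v (mulH.{u} c g) = mulH c (g ++ v) := by
  refine congrArg ofT ?_
  ext K
  refine eq_of_heq ((rightT_app v (mulT c g) K).trans ?_)
  rw [mulT_app, mulT_app, W_append_obj]

lemma lft_mulH_pos (i : Fin n) (c : Fin n → ℤ) (g : Word n) :
    lft [(i, true)] (mulH.{u} c g) = mulH (reflect i c) ((i, true) :: g) :=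
  (ofT_eq_iff _ _).2 (leftT_mulT i c g)

/-- Moving the multiplication past a letter reflects its coefficients. -/
lemma lft_mulH (s : Letter n) (c : Fin n → ℤ) (g : Word n) :
    lft [s] (mulH.{u} c g) = mulH (reflect s.1 c) (s :: g) := by
  obtain ⟨i, _ | _⟩ := s
  -- For `σ_i⁻¹` the formula follows from that for `σ_i`, since reflections are involutions.
  · refine lft_injective (i, true) ?_
    have hc := (isIso₀_pairH.{u} (i, true)).rgt g
    have := hc.iso
    rw [lft_two]
    refine (cancel_epi (rgt g (pairH (i, true)))).1 ?_
    refine (conj_lft (pairH (i, true)) (mulH c g)).trans ?_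
    refine (mulH_comp c (rgt g (pairH (i, true)))).trans (congrArg (_ ≫ ·) ?_)
    refine Eq.trans ?_ (lft_mulH_pos i (reflect i c) ((i, false) :: g)).symm
    rw [reflect_reflect]
    rfl
  · exact lft_mulH_pos i c g

/-- The reflections of the letters of a word. -/
def reflectW (w : Word n) (c : Fin n → ℤ) : Fin n → ℤ := w.foldr (fun s c => reflect s.1 c) c

/-- The transformations `f` of degree `2` which are divisors of the multiplication by `∑ c_k X_k`
and are determined by this property. -/
structure Divisor (c : Fin n → ℤ) (f : Hm.{u} g h) : Prop where
  deg_eq : deg f = intDeg 2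
  exists_gen : ∃ p : Hm.{u} h g, Gen p ∧ f ≫ p = mulH c g ∧
    ∀ f' f'' : Hm.{u} g h, deg f' = intDeg 2 → deg f'' = intDeg 2 → f' ≫ p = f'' ≫ p → f' = f''

namespace Divisor

variable {c : Fin n → ℤ} {f : Hm.{u} g h}

lemma unique {f' : Hm.{u} g h} (hf : Divisor c f) (hf' : Divisor c f') : f = f' := by
  obtain ⟨p, hp, h₁, hi⟩ := hf.exists_gen
  obtain ⟨p', hp', h₁', -⟩ := hf'.exists_gen
  obtain rfl := hp.unique hp'
  exact hi f f' hf.deg_eq hf'.deg_eq (h₁.trans h₁'.symm)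

lemma neg (hf : Divisor c f) : Divisor (-c) f := by
  obtain ⟨p, hp, h₁, hi⟩ := hf.exists_gen
  exact ⟨hf.deg_eq, p, hp, by rw [h₁, mulH_neg], hi⟩

lemma comp_iso (hf : Divisor c f) {e : Hm.{u} h k} (he : IsIso₀ e) : Divisor c (f ≫ e) := by
  obtain ⟨p, hp, h₁, hi⟩ := hf.exists_gen
  obtain ⟨e', he', e₁, e₂⟩ := he.exists_inv
  refine ⟨by rw [deg_comp, he.deg_eq, zero_add, hf.deg_eq], e' ≫ p, hp.iso_comp he', ?_,
    fun f' f'' h' h'' H => ?_⟩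
  · rw [Category.assoc, ← Category.assoc e, e₁, Category.id_comp, h₁]
  · have := hi (f' ≫ e') (f'' ≫ e') (by rw [deg_comp, he'.deg_eq, zero_add, h'])
      (by rw [deg_comp, he'.deg_eq, zero_add, h'']) (by simpa only [Category.assoc] using H)
    simpa only [Category.assoc, e₂, Category.comp_id] using congrArg (· ≫ e) this

lemma iso_comp (hf : Divisor c f) {e : Hm.{u} k g} (he : IsIso₀ e) : Divisor c (e ≫ f) := by
  obtain ⟨p, hp, h₁, hi⟩ := hf.exists_gen
  obtain ⟨e', he', e₁, e₂⟩ := he.exists_inv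
  refine ⟨by rw [deg_comp, he.deg_eq, add_zero, hf.deg_eq], p ≫ e', hp.comp_iso he', ?_,
    fun f' f'' h' h'' H => ?_⟩
  · rw [Category.assoc, ← Category.assoc f, h₁, mulH_comp, ← Category.assoc, e₁, Category.id_comp]
  · have := hi (e' ≫ f') (e' ≫ f'') (by rw [deg_comp, he'.deg_eq, add_zero, h'])
      (by rw [deg_comp, he'.deg_eq, add_zero, h'']) (by
        have := congrArg (fun t => e' ≫ t ≫ e) H
        simpa only [Category.assoc, e₂, Category.comp_id] using this)
    have h₃ := congrArg (e ≫ ·) this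
    simpa only [← Category.assoc, e₁, Category.id_comp] using h₃

lemma lft_letter (hf : Divisor c f) (s : Letter n) : Divisor (reflect s.1 c) (lft [s] f) := by
  obtain ⟨p, hp, h₁, hi⟩ := hf.exists_gen
  refine ⟨(deg_lft _ f).trans hf.deg_eq, Sg.lft [s] p, hp.lft [s], ?_, fun f' f'' h' h'' H => ?_⟩
  · rw [← lft_comp, h₁, lft_mulH]; rfl
  · obtain ⟨f', rfl⟩ := lft_surjective s f'
    obtain ⟨f'', rfl⟩ := lft_surjective s f''
    rw [← lft_comp, ← lft_comp] at H
    rw [hi f' f'' ((deg_lft _ f').symm.trans h') ((deg_lft _ f'').symm.trans h'') (lft_injective s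
        H)]

lemma rgt_letter (hf : Divisor c f) (s : Letter n) : Divisor c (rgt [s] f) := by
  obtain ⟨p, hp, h₁, hi⟩ := hf.exists_gen
  refine ⟨(deg_rgt _ f).trans hf.deg_eq, Sg.rgt [s] p, hp.rgt [s], ?_, fun f' f'' h' h'' H => ?_⟩
  · rw [← rgt_comp, h₁, rgt_mulH]
  · obtain ⟨f', rfl⟩ := rgt_surjective s f'
    obtain ⟨f'', rfl⟩ := rgt_surjective s f''
    rw [← rgt_comp, ← rgt_comp] at H
    rw [hi f' f'' ((deg_rgt _ f').symm.trans h') ((deg_rgt _ f'').symm.trans h'') (rgt_injective s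
        H)]

lemma of_heq (hg : g = g') (hh : h = h') {f' : Hm.{u} g' h'} (H : HEq f f')
    (hf : Divisor c f) : Divisor c f' := by
  subst hg hh; rwa [← eq_of_heq H]

lemma lft (hf : Divisor c f) (w : Word n) : Divisor (reflectW w c) (lft w f) := by
  induction w with
  | nil => rw [lft_nil]; exact hf
  | cons s w ih => rw [lft_cons]; exact ih.lft_letter s

lemma rgt (hf : Divisor c f) (w : Word n) : Divisor c (rgt w f) := by
  induction w generalizing g h with
  | nil => exact hf.of_heq (List.append_nil g).symm (List.append_nil h).symm (rgt_nil f).symm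
  | cons s w ih =>
    exact (ih (hf.rgt_letter s)).of_heq (List.append_assoc g [s] w) (List.append_assoc h [s] w)
      (rgt_append [s] w f).symm

end Divisor

lemma gen_wOne (i : Fin n) : Gen (ofT (wOneT.{u} i)) := by
  refine ⟨rfl, fun f' hf' => ?_, fun k l hkl => wOneT_nontorsion i ((ofT_eq_iff _ _).1 hkl)⟩
  obtain ⟨t, rfl⟩ := ofT_surjective f'
  obtain ⟨k, rfl⟩ := eq_zsmul_wOneT i t hf'
  exact ⟨k, rfl⟩

lemma lft_wOne_cancel (i : Fin n) :
    lft [(i, false)] (ofT (wOneT.{u} i)) ≫ ofT (cancelT i false) = ofT (wTwoT i) :=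
  congrArg ofT (wTwoT_eq i)

lemma isIso₀_cancel (i : Fin n) : IsIso₀ (ofT (cancelT.{u} i false)) := by
  refine .mk' (ofT (createT i false)) ?_ ?_ rfl
  · exact (ofT_eq_iff _ _).2 (cancelT_createT i false)
  · exact congrArg ofT (createT_cancelT i false)

lemma gen_wTwo (i : Fin n) : Gen (ofT (wTwoT.{u} i)) := by
  rw [← lft_wOne_cancel]
  exact ((gen_wOne i).lft [(i, false)]).comp_iso (isIso₀_cancel i)

lemma comp_wTwo_injective (i : Fin n) {f f' : Hm.{u} [] [(i, false)]} {d : ℤ}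
    (hf : deg f = intDeg d) (hf' : deg f' = intDeg d) (H : f ≫ ofT (wTwoT i) = f' ≫ ofT (wTwoT i)) : f = f' := by
  obtain ⟨t, rfl⟩ := ofT_surjective f
  obtain ⟨t', rfl⟩ := ofT_surjective f'
  exact (ofT_eq_iff _ _).2 (wordRel_of_comp_wTwoT i hf hf' ((ofT_eq_iff _ _).1 H))

lemma divisor_wFour (i : Fin n) : Divisor (zc i) (ofT (wFourT.{u} i)) :=
  ⟨rfl, ofT (wTwoT i), gen_wTwo i, congrArg ofT (wFourT_wTwoT i),
    fun _ _ h' h'' H => comp_wTwo_injective i h' h'' H⟩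

/-- By adjunction between `R_i'` and `R_i` this reduces to the same fact for the insertion of `σ_i⁻¹`.
-/
lemma divisor_wThree (i : Fin n) : Divisor (zc i) (ofT (wThreeT.{u} i)) := by
  refine ⟨rfl, ofT (wOneT i), gen_wOne i, congrArg ofT (wThreeT_wOneT i), fun f f' hf hf' H => ?_⟩
  have hc := isIso₀_create.{u} i false
  have := hc.iso
  have key : ∀ f : Hm.{u} [(i, true)] [],
      (ofT (createT.{u} i false) ≫ lft [(i, false)] f) ≫ ofT (wTwoT i) =
        ofT (createT i false) ≫ lft [(i, false)] (f ≫ ofT (wOneT i)) ≫ ofT (cancelT i false) :=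
    fun f => by
      rw [← lft_wOne_cancel, lft_comp, Category.assoc, Category.assoc]
  have hd : ∀ f : Hm.{u} [(i, true)] [], deg f = intDeg 2 →
      deg (ofT (createT.{u} i false) ≫ lft [(i, false)] f) = intDeg 2 := fun f hf => by
    rw [deg_comp, deg_lft, hf]; rfl
  have h₁ := comp_wTwo_injective i (hd f hf) (hd f' hf') (by rw [key, key, H])
  exact lft_injective (i, false) ((cancel_epi (ofT (createT.{u} i false))).1 h₁)

end Sg

/-! ### The transformations of movies -/

namespace Sg

variable {g h k g' h' : Word n}

/-- Either a generator in degree `0` or a divisor of the multiplication by `∑ c_k X_k`. -/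
def Elem : Option (Fin n → ℤ) → Hm.{u} g h → Prop
  | none, f => Gen f
  | some c, f => Divisor c f

namespace Elem

variable {o : Option (Fin n → ℤ)} {f f' : Hm.{u} g h}

lemma unique (hf : Elem o f) (hf' : Elem o f') : f = f' := by
  cases o with
  | none => exact Gen.unique hf hf'
  | some c => exact Divisor.unique hf hf'

lemma neg (hf : Elem o f) : Elem (o.map Neg.neg) f := by
  cases o with
  | none => exact hf
  | some c => exact Divisor.neg hf

lemma comp_iso (hf : Elem o f) {e : Hm.{u} h k} (he : IsIso₀ e) : Elem o (f ≫ e) := by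
  cases o with
  | none => exact Gen.comp_iso hf he
  | some c => exact Divisor.comp_iso hf he

lemma iso_comp (hf : Elem o f) {e : Hm.{u} k g} (he : IsIso₀ e) : Elem o (e ≫ f) := by
  cases o with
  | none => exact Gen.iso_comp hf he
  | some c => exact Divisor.iso_comp hf he

lemma lft (hf : Elem o f) (w : Word n) : Elem (o.map (reflectW w)) (lft w f) := by
  cases o with
  | none => exact Gen.lft hf w
  | some c => exact Divisor.lft hf w

lemma rgt (hf : Elem o f) (w : Word n) : Elem o (rgt w f) := by
  cases o with
  | none => exact Gen.rgt hf w
  | some c => exact Divisor.rgt hf w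

lemma castH (hg : g = g') (hh : h = h') (hf : Elem o f) : Elem o (castH hg hh f) := by
  subst hg hh; exact hf

end Elem

end Sg

/-- The number of branch points of a move. -/
def Move.branches : ∀ {x y : Word n}, Move x y → ℕ
  | _, _, .birth _ _ => 1
  | _, _, .death _ _ => 1
  | _, _, _ => 0

lemma Move.branches_inv {x y : Word n} (m : Move x y) : m.inv.branches = m.branches := by
  cases m <;> rfl

/-- The root `c` such that the transformation of a negative branch point divides the multiplication
by `∑ c_k X_k`; `none` for the other moves. -/
def Move.vec : ∀ {x y : Word n}, Move x y → Option (Fin n → ℤ)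
  | _, _, .birth i a => if a then none else some (zc i)
  | _, _, .death i a => if a then some (zc i) else none
  | _, _, _ => none

/-- The number of branch points of a movie. -/
def Movie.branches : ∀ {u v : Word n}, Movie u v → ℕ
  | _, _, .nil => 0
  | _, _, .cons s S => s.move.branches + S.branches

section

open Sg

/-- The transformation of a move. For the moves of type I it is an arbitrary invertible
transformation of degree `0`, which is unique up to sign. -/
noncomputable def mvT : ∀ {x y : Word n}, Move x y → Hm.{u} x y
  | _, _, .create i (a := a) (b := b) h => (show Equiv₀ [] [(i, a), (i, b)] by
      obtain rfl : b = !a := by cases a <;> cases b <;> simp_all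
      exact equiv₀_pair (i, a)).choose
  | _, _, .cancel i (a := a) (b := b) h => (show Equiv₀ [(i, a), (i, b)] [] by
      obtain rfl : b = !a := by cases a <;> cases b <;> simp_all
      exact (equiv₀_pair (i, a)).symm).choose
  | _, _, .far h a b => (equiv₀_far h a b).choose
  | _, _, .braid h hs => (equiv₀_braid h hs).choose
  | _, _, .birth i true => ofT (wOneT i)
  | _, _, .birth i false => ofT (wFourT i)
  | _, _, .death i true => ofT (wThreeT i)
  | _, _, .death i false => ofT (wTwoT i)

lemma isIso₀_mvT {x y : Word n} (m : Move x y) (hm : m.branches = 0) : IsIso₀ (mvT.{u} m) := by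
  cases m with
  | birth i a => cases hm
  | death i a => cases hm
  | _ => exact Exists.choose_spec (p := IsIso₀) _

lemma elem_mvT {x y : Word n} (m : Move x y) (hm : m.branches = 1) : Elem m.vec (mvT.{u} m) := by
  cases m with
  | birth i a =>
    cases a
    · exact divisor_wFour i
    · exact gen_wOne i
  | death i a =>
    cases a
    · exact gen_wTwo i
    · exact divisor_wThree i
  | _ => cases hm

lemma deg_mvT {x y : Word n} (m : Move x y) : deg (mvT.{u} m) = intDeg (2 * (m.neg : ℤ)) := by
  cases m with
  | birth i a => cases a <;> rfl
  | death i a => cases a <;> rfl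
  | create i h => exact (isIso₀_mvT (.create i h) rfl).deg_eq
  | cancel i h => exact (isIso₀_mvT (.cancel i h) rfl).deg_eq
  | far h a b => exact (isIso₀_mvT (.far h a b) rfl).deg_eq
  | braid h hs => exact (isIso₀_mvT (.braid h hs) rfl).deg_eq

/-- The transformation of a step. -/
noncomputable def stepT {x y : Word n} (s : Step x y) : Hm.{u} x y :=
  castH s.src.symm s.tgt.symm (rgt s.post (lft s.pre (mvT s.move)))

lemma isIso₀_stepT {x y : Word n} (s : Step x y) (hm : s.move.branches = 0) :
    IsIso₀ (stepT.{u} s) :=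
  (((isIso₀_mvT _ hm).lft _).rgt _).castH _ _

lemma elem_stepT {x y : Word n} (s : Step x y) (hm : s.move.branches = 1) :
    Elem (s.move.vec.map (reflectW s.pre)) (stepT.{u} s) :=
  (((elem_mvT _ hm).lft _).rgt _).castH _ _

lemma deg_stepT {x y : Word n} (s : Step x y) : deg (stepT.{u} s) = intDeg (2 * (s.move.neg : ℤ)) :=
  (deg_castH _ _ _).trans ((deg_rgt _ _).trans ((deg_lft _ _).trans (deg_mvT _)))

lemma stepT_left (g : Word n) {x y : Word n} (s : Step x y) :
    stepT.{u} (s.left g) = lft g (stepT s) := by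
  obtain ⟨pre, post, old, new, m, rfl, rfl⟩ := s
  refine castH_eq_of_heq _ _ ?_
  refine HEq.trans ?_ (lft_rgt g post (lft pre (mvT m))).symm
  exact rgt_heq_congr (List.append_assoc _ _ _) (List.append_assoc _ _ _) (lft_append g pre (mvT m))

lemma stepT_right {x y : Word n} (s : Step x y) (g : Word n) :
    stepT.{u} (s.right g) = rgt g (stepT s) := by
  obtain ⟨pre, post, old, new, m, rfl, rfl⟩ := s
  exact castH_eq_of_heq _ _ (rgt_append post g (lft pre (mvT m)))

/-- The transformation of a movie. -/
noncomputable def mT : ∀ {x y : Word n}, Movie x y → Hm.{u} x y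
  | x, _, .nil => 𝟙 (⟨x⟩ : Sg n)
  | _, _, .cons s S => stepT s ≫ mT S

lemma mT_single {x y : Word n} (s : Step x y) : mT.{u} (.single s) = stepT s := Category.comp_id _

lemma mT_comp : ∀ {x y z : Word n} (S : Movie x y) (T : Movie y z), mT.{u} (S.comp T) = mT S ≫ mT T
  | _, _, _, .nil, _ => (Category.id_comp _).symm
  | _, _, _, .cons s S, T =>
    (congrArg (stepT s ≫ ·) (mT_comp S T)).trans (Category.assoc _ _ _).symm

lemma mT_left (g : Word n) : ∀ {x y : Word n} (S : Movie x y), mT.{u} (S.left g) = lft g (mT S)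
  | _, _, .nil => (lft_id _ _).symm
  | _, _, .cons s S => by
    refine Eq.trans ?_ (lft_comp g (stepT s) (mT S)).symm
    rw [← stepT_left, ← mT_left]
    rfl

lemma mT_right (g : Word n) : ∀ {x y : Word n} (S : Movie x y), mT.{u} (S.right g) = rgt g (mT S)
  | _, _, .nil => (rgt_id _ _).symm
  | _, _, .cons s S => by
    refine Eq.trans ?_ (rgt_comp g (stepT s) (mT S)).symm
    rw [← stepT_right, ← mT_right]
    rfl

lemma deg_mT : ∀ {x y : Word n} (S : Movie x y), deg (mT.{u} S) = intDeg (2 * (S.neg : ℤ))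
  | _, _, .nil => deg_id _
  | _, _, .cons s S => by
    refine (deg_comp (stepT s) (mT S)).trans ?_
    rw [deg_stepT, deg_mT S]
    have : (Movie.cons s S).neg = s.move.neg + S.neg := rfl
    rw [this, Nat.cast_add, mul_add, add_comm]
    rfl

lemma isIso₀_mT : ∀ {x y : Word n} (S : Movie x y), S.branches = 0 → IsIso₀ (mT.{u} S)
  | _, _, .nil, _ => IsIso₀.id _
  | _, _, .cons s S, H => (isIso₀_stepT s (Nat.eq_zero_of_add_eq_zero_right H)).comp
      (isIso₀_mT S (Nat.eq_zero_of_add_eq_zero_left H))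

namespace Movie

lemma branches_comp : ∀ {x y z : Word n} (S : Movie x y) (T : Movie y z),
    (S.comp T).branches = S.branches + T.branches
  | _, _, _, .nil, T => (Nat.zero_add _).symm
  | _, _, _, .cons s S, T => by
    change s.move.branches + (S.comp T).branches = s.move.branches + S.branches + T.branches
    rw [branches_comp S T, Nat.add_assoc]

lemma branches_inv : ∀ {x y : Word n} (S : Movie x y), S.inv.branches = S.branches
  | _, _, .nil => rfl
  | _, _, .cons s S => by
    change (S.inv.comp (single s.inv)).branches = s.move.branches + S.branches
    rw [branches_comp, branches_inv S, Nat.add_comm, ← s.move.branches_inv]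
    rfl

lemma inv_comp : ∀ {x y z : Word n} (S : Movie x y) (T : Movie y z),
    (S.comp T).inv = T.inv.comp S.inv
  | _, _, _, .nil, T => T.inv.comp_nil.symm
  | _, _, _, .cons s S, T => by
    change (S.comp T).inv.comp (single s.inv) = T.inv.comp (S.inv.comp (single s.inv))
    rw [inv_comp S T, comp_assoc]

/-- The movie consists of one branch point, with the root `o` if it is negative, and of moves
without branch points. -/
inductive Branch : ∀ {x y : Word n}, Movie x y → Option (Fin n → ℤ) → Prop
  | one (pre post : Word n) {x y : Word n} {m : Move x y} (hm : m.branches = 1) :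
      Branch (one pre m post) (m.vec.map (reflectW pre))
  | comp {x y z : Word n} {S : Movie x y} {T : Movie y z} {o : Option (Fin n → ℤ)}
      (h : Branch S o) (hT : T.branches = 0) : Branch (S.comp T) o
  | pure_comp {x y z : Word n} {S : Movie x y} {T : Movie y z} {o : Option (Fin n → ℤ)}
      (hS : S.branches = 0) (h : Branch T o) : Branch (S.comp T) o

lemma Branch.elem {x y : Word n} {S : Movie x y} {o : Option (Fin n → ℤ)} (H : Branch S o) :
    Elem o (mT.{u} S) := by
  induction H with
  | @one pre post _ _ m hm =>
    refine Eq.subst (motive := Elem _) (mT_single _).symm ?_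
    exact elem_stepT ⟨pre, post, _, _, m, rfl, rfl⟩ hm
  | comp h hT ih => rw [mT_comp]; exact ih.comp_iso (isIso₀_mT _ hT)
  | pure_comp hS h ih => rw [mT_comp]; exact ih.iso_comp (isIso₀_mT _ hS)

/-- Movies without branch points between the same words have the same transformation. -/
lemma mT_eq_of_branches (i : Fin n) {x y : Word n} {S T : Movie x y} (hS : S.branches = 0)
    (hT : T.branches = 0) : mT.{u} S = mT T ∧ mT.{u} S.inv = mT T.inv :=
  ⟨(isIso₀_mT S hS).unique i (isIso₀_mT T hT),
    (isIso₀_mT S.inv (S.branches_inv.trans hS)).unique i (isIso₀_mT T.inv (T.branches_inv.trans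
        hT))⟩

/-- Movies with one branch point have the same transformation if their roots agree up to sign. -/
lemma Branch.eq {x y : Word n} {S T : Movie x y} {o o' : Option (Fin n → ℤ)} (hS : Branch S o)
    (hT : Branch T o') (h : o = o' ∨ o = o'.map Neg.neg) : mT.{u} S = mT T := by
  rcases h with rfl | rfl
  · exact hS.elem.unique hT.elem
  · exact hS.elem.unique hT.elem.neg

open Move in
/-- Both sides of a movie move, and their reverses, have the same transformation, up to sign. -/
lemma _root_.BraidCob.MovieMove.mT_eq {x y : Word n} {S T : Movie x y} (H : MovieMove S T) :
    mT.{u} S = mT T ∧ mT.{u} S.inv = mT T.inv := by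
  cases H with
  | create_cancel i h => exact mT_eq_of_branches i rfl rfl
  | cancel_create i h => exact mT_eq_of_branches i rfl rfl
  | far_far h => exact mT_eq_of_branches (by assumption) rfl rfl
  | braid_braid h hs => exact mT_eq_of_branches (by assumption) rfl rfl
  | zigzag i h => exact mT_eq_of_branches i rfl rfl
  | far_far_far => exact mT_eq_of_branches (by assumption) rfl rfl
  | far_pair => exact mT_eq_of_branches (by assumption) rfl rfl
  | far_braid => exact mT_eq_of_branches (by assumption) rfl rfl
  | braid_pair_right => exact mT_eq_of_branches (by assumption) rfl rfl
  | braid_pair_left => exact mT_eq_of_branches (by assumption) rfl rfl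
  | tetra => exact mT_eq_of_branches (by assumption) rfl rfl
  | @birth_far i j hij a b =>
    -- The reflection at `i` fixes the root of a distant letter.
    constructor
    · refine (Branch.comp (.one [] [(j, b)] rfl) rfl).eq (.one [(j, b)] [] rfl) (Or.inl ?_)
      cases a
      · exact congrArg some (reflect_zc_far hij).symm
      · rfl
    · rw [inv_comp]
      refine (Branch.pure_comp rfl (.one [] [(j, b)] (m := death i a) rfl)).eq
        (.one [(j, b)] [] (m := death i a) rfl) (Or.inl ?_)
      cases a
      · rfl
      · exact congrArg some (reflect_zc_far hij).symm
  | @create_death_right i a a' h =>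
    obtain rfl : a = !a' := by cases a <;> cases a' <;> simp_all
    -- The reflection at `i` fixes its own root `X_{i-1} - X_{i+1}`.
    constructor
    · refine (Branch.pure_comp rfl (.one [(i, !a')] [] rfl)).eq (.one [] [] rfl) (Or.inl ?_)
      cases a'
      · rfl
      · exact congrArg some (reflect_zc_self i)
    · rw [inv_comp]
      refine (Branch.comp (.one [(i, !a')] [] (m := birth i a') rfl) rfl).eq
        (.one [] [] (m := death i (!a')) rfl) (Or.inl ?_)
      cases a'
      · exact congrArg some (reflect_zc_self i)
      · rfl
  | @create_death_left i a a' h =>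
    obtain rfl : a = !a' := by cases a <;> cases a' <;> simp_all
    constructor
    · refine (Branch.pure_comp rfl (.one [] [(i, a')] (m := death i (!a')) rfl)).eq
        (.one [] [] (m := birth i a') rfl) (Or.inl ?_)
      cases a' <;> rfl
    · rw [inv_comp]
      refine (Branch.comp (.one [] [(i, a')] (m := birth i (!a')) rfl) rfl).eq
        (.one [] [] (m := death i a') rfl) (Or.inl ?_)
      cases a' <;> rfl
  | @birth_braid i j hij a c =>
    -- For adjacent `i`, `j` the reflections at `j` and `i` take the root of `i` to that of `j`.
    constructor
    · refine (Branch.comp (.one [(i, a), (j, a)] [] rfl) rfl).eq (.one [] [(i, a), (j, a)] rfl)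
        (Or.inr ?_)
      cases c
      · exact congrArg some (reflect_reflect_zc hij)
      · rfl
    · rw [inv_comp]
      refine (Branch.pure_comp rfl (.one [(i, a), (j, a)] [] (m := death i c) rfl)).eq
        (.one [] [(i, a), (j, a)] (m := death j c) rfl) (Or.inr ?_)
      cases c
      · rfl
      · exact congrArg some (reflect_reflect_zc hij)
  | @create_birth_braid i j hij a a' b h hs =>
    -- For adjacent `i`, `j` the reflection at `i` of the root of `j` agrees up to sign with the
    -- reflection at `j` of the root of `i`.
    constructor
    · have hS := Branch.pure_comp (S := Movie.one [] (create i h) []) rfl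
        (.comp (T := Movie.one [] (braid hij hs) []) (.one [(i, a)] [(i, a')] (m :=
            birth j b) rfl) rfl)
      have hT := Branch.pure_comp (S := Movie.one [] (create j h.symm) []) rfl
        (.one [(j, a')] [(j, a)] (m := birth i b) rfl)
      refine hS.eq hT (Or.inr ?_)
      cases b
      · exact congrArg some (reflect_zc_adj hij)
      · rfl
    · rw [inv_comp, inv_comp, inv_comp]
      refine (Branch.comp (.pure_comp rfl (.one [(i, a)] [(i, a')] (m := death j b) rfl)) rfl).eq
        (Branch.comp (.one [(j, a')] [(j, a)] (m := death i b) rfl) rfl) (Or.inr ?_)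
      cases b
      · rfl
      · exact congrArg some (reflect_zc_adj hij)
  | @locality x x' y y' s t =>
    have key : ∀ {x x' y y' : Word n} (s : Step x x') (t : Step y y'),
        mT.{u} ((single (s.right y)).comp (single (t.left x'))) =
          mT ((single (t.left x)).comp (single (s.right y'))) := fun {x x' y y'} s t => by
      rw [mT_comp, mT_comp, mT_single, mT_single, mT_single, mT_single, stepT_right, stepT_right,
        stepT_left, stepT_left]
      exact exchange (stepT s) (stepT t)
    exact ⟨key s t, (key s.inv t.inv).symm⟩

end Movie

/-- Movies which are equal up to movie moves have the same transformation, up to sign. -/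
lemma MovieEq.mT_eq {x y : Word n} {S T : Movie x y} (H : MovieEq S T) : mT.{u} S = mT T := by
  induction H with
  | of_move h => exact h.mT_eq.1
  | of_inv h => exact h.mT_eq.2
  | refl S => rfl
  | symm _ ih => exact ih.symm
  | trans _ _ ih ih' => exact ih.trans ih'
  | comp _ _ ih ih' => rw [mT_comp, mT_comp, ih, ih']
  | left g _ ih => rw [mT_left, mT_left, ih]
  | right g _ ih => rw [mT_right, mT_right, ih]

end

/-! ### Realization in the homotopy category -/

section Realization

/-- The homogeneous natural transformation `α` of functors on `𝒞 n` is given by the homogeneous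
chain maps `t`. -/
def Realizes {F G : 𝒞.{u} n ⥤ 𝒞.{u} n} (t : ∀ K : HC.{u} n, (show HC n from F.obj K) ⟶ G.obj K)
    (α : HNat F G) : Prop :=
  ∀ K : HC.{u} n, ∃ f : ShiftedHom (HC.cx (F.obj K)) (HC.cx (G.obj K)) α.deg,
    t K = HC.mk _ _ α.deg f ∧ α.nat.app K = toKb (K := F.obj K) (L := G.obj K) f

lemma toKb_neg {K L : 𝒞.{u} n} {d : IntDeg} (f : ShiftedHom (asCx K) (asCx L) d) :
    toKb (-f) = (show K ⟶ L⟦d⟧ from -toKb f) := by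
  refine ObjectProperty.hom_ext _ ?_
  change (_ ≫ _) ≫ _ = -((_ ≫ _) ≫ _)
  refine (congrArg (fun x => (x ≫ _) ≫ _)
    ((HomotopyCategory.quotient (GrMod.{u} n) (ComplexShape.up ℤ)).map_neg (f := f))).trans ?_
  exact (congrArg (· ≫ _) (Preadditive.neg_comp _ _)).trans (Preadditive.neg_comp _ _)

lemma Realizes.eqUpToSign {F G : 𝒞.{u} n ⥤ 𝒞.{u} n}
    {t t' : ∀ K : HC.{u} n, (show HC n from F.obj K) ⟶ G.obj K} {α β : HNat F G}
    (hα : Realizes t α) (hβ : Realizes t' β) {ε : ℤ} (hε : IsUnit ε)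
    (H : ∀ K, HC.Rel ε (t K) (t' K)) : HNat.EqUpToSign α β := by
  obtain ⟨d, α⟩ := α
  obtain ⟨d', β⟩ := β
  have hd : d = d' := by
    let baseCx : HC.{u} n := Classical.arbitrary _
    obtain ⟨f, hf, -⟩ := hα baseCx
    obtain ⟨f', hf', -⟩ := hβ baseCx
    have h := (H baseCx).deg_eq
    rw [hf, hf'] at h
    exact h
  subst hd
  have key : ∀ K : HC.{u} n, α.app K = ε • β.app K := fun K => by
    obtain ⟨f, hf, h₁⟩ := hα K
    obtain ⟨f', hf', h₂⟩ := hβ K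
    have h := H K
    rw [hf, hf'] at h
    obtain ⟨h⟩ := h.homotopy
    refine h₁.trans ((toKb_eq_of_homotopy (K := F.obj K) (L := G.obj K) h).trans ?_)
    refine Eq.trans ?_ (congrArg (ε • ·) h₂.symm)
    rcases Int.isUnit_iff.1 hε with rfl | rfl
    · rw [one_smul, one_smul]
    · rw [neg_one_zsmul, neg_one_zsmul]
      exact toKb_neg _
  rcases Int.isUnit_iff.1 hε with rfl | rfl
  · refine Or.inl (congrArg _ (NatTrans.ext (funext fun K => (key K).trans (one_smul _ _))))
  · refine Or.inr (congrArg _ (NatTrans.ext (funext fun K => (key K).trans ?_)))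
    exact neg_one_zsmul _

lemma Realizes.comp {F G H : 𝒞.{u} n ⥤ 𝒞.{u} n}
    {t : ∀ K : HC.{u} n, (show HC n from F.obj K) ⟶ G.obj K}
    {s : ∀ K : HC.{u} n, (show HC n from G.obj K) ⟶ H.obj K} {α : HNat F G} {β : HNat G H}
    (hα : Realizes t α) (hβ : Realizes s β) : Realizes (fun K => t K ≫ s K) (α.comp β) := fun K =>
        by
  obtain ⟨f, hf, h₁⟩ := hα K
  obtain ⟨f', hf', h₂⟩ := hβ K
  refine ⟨f.comp f' rfl, ?_, ?_⟩
  · change t K ≫ s K = _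
    rw [hf, hf']; rfl
  · refine Eq.trans ?_ (toKb_comp (K := F.obj K) (L := G.obj K) (M := H.obj K) f f' rfl).symm
    exact congrArg₂ (fun x y => ShiftedHom.comp x y rfl) h₁ h₂

lemma realizes_ofNat {F G : 𝒞.{u} n ⥤ 𝒞.{u} n} (τ : F ⟶ G)
    (f : ∀ K : HC.{u} n, HC.cx (F.obj K) ⟶ HC.cx (G.obj K))
    (h : ∀ K : HC.{u} n, τ.app K = ObjectProperty.homMk
      ((HomotopyCategory.quotient _ (ComplexShape.up ℤ)).map (f K))) :
    Realizes (fun K => HC.of (F.obj K) (G.obj K) (f K)) (HNat.ofNat τ) := fun K =>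
  ⟨_, rfl, (congrArg (ShiftedHom.mk₀ 0 rfl) (h K)).trans
    (toKb_mk₀ (K := F.obj K) (L := G.obj K) (f K) rfl).symm⟩

/-- The transformations given by the equality of two objects. -/
lemma realizes_eqToHom {F G : 𝒞.{u} n ⥤ 𝒞.{u} n} (τ : F ⟶ G) (h : ∀ K, F.obj K = G.obj K)
    (hτ : ∀ K, τ.app K = eqToHom (h K)) :
    Realizes (fun K => eqToHom (show (show HC n from F.obj K) = G.obj K from h K)) (HNat.ofNat τ) :=
        by
  have key : ∀ {X Y : HC.{u} n} (h : X = Y), ∃ f : X.cx ⟶ Y.cx, eqToHom h = HC.of X Y f ∧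
      eqToHom (show (show 𝒞.{u} n from X) = Y from h) = ObjectProperty.homMk
      ((HomotopyCategory.quotient _ (ComplexShape.up ℤ)).map f) := by
    rintro X _ rfl
    refine ⟨𝟙 _, rfl, ObjectProperty.hom_ext _ ?_⟩
    exact ((HomotopyCategory.quotient _ (ComplexShape.up ℤ)).map_id X.cx).symm
  choose f h₁ h₂ using fun K : HC.{u} n => key (X := F.obj K) (Y := G.obj K) (h K)
  have := realizes_ofNat τ f fun K => (hτ K).trans (h₂ K)
  intro K
  obtain ⟨a, ha, ha'⟩ := this K
  exact ⟨a, (h₁ K).trans ha, ha'⟩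

lemma realizes_id (F : 𝒞.{u} n ⥤ 𝒞.{u} n) :
    Realizes (fun K => 𝟙 (show HC n from F.obj K)) (HNat.ofNat (𝟙 F)) :=
  realizes_eqToHom (𝟙 F) (fun _ => rfl) fun _ => rfl

lemma exists_wordMap (g : Word n) {K L : HC.{u} n} {d : IntDeg} (f : ShiftedHom K.cx L.cx d) :
    ∃ f' : ShiftedHom ((W g).obj K).cx ((W g).obj L).cx d,
      (W g).map (HC.mk K L d f) = HC.mk _ _ d f' ∧
      (toKb (K := K) (L := L) f).map (wordFun g).functor =
        toKb (K := (wordFun g).functor.obj K) (L := (wordFun g).functor.obj L) f' := by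
  induction g with
  | nil => exact ⟨f, rfl, ShiftedHom.id_map _⟩
  | cons s g ih =>
    obtain ⟨f', h₁, h₂⟩ := ih
    have h₃ := ShiftedHom.comp_map (toKb (K := K) (L := L) f) (wordFun g).functor
      (letterFun s).functor
    obtain ⟨i, b⟩ := s
    cases b
    · exact ⟨f'.map (tensR' i), congrArg (letF (i, false)).map h₁,
        h₃.trans ((congrArg (fun x => ShiftedHom.map x (onKb (tensR' i))) h₂).trans
          (toKb_onKb (K := (wordFun g).functor.obj K) (L := (wordFun g).functor.obj L) f' _))⟩
    · exact ⟨f'.map (tensR i), congrArg (letF (i, true)).map h₁,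
        h₃.trans ((congrArg (fun x => ShiftedHom.map x (onKb (tensR i))) h₂).trans
          (toKb_onKb (K := (wordFun g).functor.obj K) (L := (wordFun g).functor.obj L) f' _))⟩

lemma Realizes.whiskerRight {F F' : 𝒞.{u} n ⥤ 𝒞.{u} n}
    {t : ∀ K : HC.{u} n, (show HC n from F.obj K) ⟶ F'.obj K} {α : HNat F F'} (hα : Realizes t α)
    (g : Word n) : Realizes (F := F ⋙ (wordFun g).functor) (G := F' ⋙ (wordFun g).functor)
      (fun K => (W g).map (t K)) (α.whiskerRight (wordFun g).functor) := fun K => by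
  obtain ⟨f, hf, h₁⟩ := hα K
  obtain ⟨f', h₂, h₃⟩ := exists_wordMap g f
  refine ⟨f', ?_, ?_⟩
  · refine (congrArg (W g).map hf).trans h₂
  · exact (congrArg (fun x => ShiftedHom.map x (wordFun g).functor) h₁).trans h₃

lemma Realizes.whiskerLeft {G G' : 𝒞.{u} n ⥤ 𝒞.{u} n}
    {t : ∀ K : HC.{u} n, (show HC n from G.obj K) ⟶ G'.obj K} {β : HNat G G'} (hβ : Realizes t β)
    (F : 𝒞.{u} n ⥤ 𝒞.{u} n) : Realizes (F := F ⋙ G) (G := F ⋙ G')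
      (fun K => t (F.obj K)) (HNat.whiskerLeft F β) := fun K => hβ (F.obj K)

lemma wordFun_append_obj (g h : Word n) (K : 𝒞.{u} n) : (wordFun (g ++ h)).functor.obj K =
    ((wordFun h).functor ⋙ (wordFun g).functor).obj K := W_append_obj g h K

lemma wordFunMul_hom_app (h g : Word n) (K : 𝒞.{u} n) :
    (wordFunMul h g).hom.app K = eqToHom (wordFun_append_obj g h K) := by
  induction g with
  | nil => rfl
  | cons s g ih =>
    refine (Category.comp_id _).trans ?_
    refine (congrArg (letterFun s).functor.map ih).trans ?_
    exact eqToHom_map (letterFun s).functor _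

lemma realizes_mulIso (g h : BC n) :
    Realizes.{u} (fun K => eqToHom (W_append_obj g.word h.word K)) (mulIso g h).hom :=
  realizes_eqToHom _ (fun K => wordFun_append_obj g.word h.word K) fun K => wordFunMul_hom_app _ _ K

/-- Every transformation of homogeneous chain maps gives a homogeneous natural transformation on the
homotopy category. -/
lemma exists_realizes {g h : Word n} (t : W.{u} g ⟶ W h) :
    ∃ α : HNat (wordFun.{u} g).functor (wordFun h).functor, α.deg = degT t ∧
      Realizes (fun K => t.app K) α := by
  obtain ⟨f, hf⟩ := exists_values t rfl
  refine ⟨⟨degT t, ⟨fun K => toKb (K := (wordFun g).functor.obj K) (L := (wordFun h).functor.obj K)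
    (f K), fun K L φ => ?_⟩⟩, rfl, fun K => ⟨f K, hf K, rfl⟩⟩
  obtain ⟨ψ, hψ⟩ : ∃ ψ : HC.cx K ⟶ HC.cx L, φ = ObjectProperty.homMk
      ((HomotopyCategory.quotient _ (ComplexShape.up ℤ)).map ψ) := by
    obtain ⟨φ⟩ := φ
    obtain ⟨ψ, rfl⟩ := (HomotopyCategory.quotient _ _).map_surjective φ
    exact ⟨ψ, rfl⟩
  have h₀ : toKb (K := K) (L := L) (ShiftedHom.mk₀ 0 rfl ψ) = ShiftedHom.mk₀ (0 : IntDeg) rfl φ :=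
    (toKb_mk₀ (K := K) (L := L) ψ rfl).trans (congrArg _ hψ.symm)
  obtain ⟨a, ha, ha'⟩ := exists_wordMap g (K := K) (L := L) (ShiftedHom.mk₀ (0 : IntDeg) rfl ψ)
  obtain ⟨b, hb, hb'⟩ := exists_wordMap h (K := K) (L := L) (ShiftedHom.mk₀ (0 : IntDeg) rfl ψ)
  replace ha' := (ShiftedHom.map_mk₀ 0 rfl φ (wordFun g).functor).symm.trans
    ((congrArg (fun x => ShiftedHom.map x (wordFun g).functor) h₀.symm).trans ha')
  replace hb' := (ShiftedHom.map_mk₀ 0 rfl φ (wordFun h).functor).symm.trans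
    ((congrArg (fun x => ShiftedHom.map x (wordFun h).functor) h₀.symm).trans hb')
  have nat := t.naturality (HC.mk K L 0 (ShiftedHom.mk₀ 0 rfl ψ))
  rw [ha, hb, hf K, hf L] at nat
  have nat' := HC.mk_injective ((HC.mk_comp a (f L) (add_zero _)).symm.trans
    (nat.trans (HC.mk_comp (f K) b (zero_add _))))
  have h₁ := (toKb_comp (K := (wordFun g).functor.obj K) (L := (wordFun g).functor.obj L)
    (M := (wordFun h).functor.obj L) a (f L) (add_zero _)).symm.trans ((congrArg _ nat').trans
      (toKb_comp (K := (wordFun g).functor.obj K) (L := (wordFun h).functor.obj K)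
        (M := (wordFun h).functor.obj L) (f K) b (zero_add _)))
  refine (ShiftedHom.mk₀_comp 0 rfl _ _).symm.trans (Eq.trans ?_
    (h₁.trans (Eq.trans ?_ (ShiftedHom.comp_mk₀ _ 0 rfl _))))
  · exact congrArg (fun x => ShiftedHom.comp x _ (add_zero _)) ha'
  · exact congrArg (fun x => ShiftedHom.comp _ x (zero_add _)) hb'.symm

lemma natKbSh_app {C : Type u} [Category.{v} C] [Preadditive C] [HasShift C IntDeg]
    [∀ d : IntDeg, (shiftFunctor C d).Additive] {Φ Ψ : CochainComplex C ℤ ⥤ CochainComplex C ℤ}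
    [Descends Φ] [Descends Ψ] (d : IntDeg) (τ : Φ ⟶ Ψ ⋙ shiftFunctor (CochainComplex C ℤ) d)
    (K : Kb C) : (natKbSh d τ).app K =
      toKb (K := (onKb Φ).obj K) (L := (onKb Ψ).obj K) (τ.app (asCx K)) :=
  ObjectProperty.hom_ext _ (Category.assoc _ _ _).symm

lemma realizes_wOne (i : Fin n) :
    Realizes (fun K => (wOneT.{u} i).app K) ((emptyIso n).hom ≫ w₁ i ≫ (σIso i).inv) := by
  refine Eq.subst (motive := Realizes _) ?_ (realizes_ofNat (F := (wordFun []).functor)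
    (G := (wordFun [(i, true)]).functor)
    ((idKb (GrMod.{u} n)).inv ≫ natKb (cw₁ i)) (fun K => (cw₁ i).app K.cx) fun K => ?_)
  · refine Eq.trans ?_ (HNat.id_comp (HNat.comp (w₁ i)
      (HNat.ofNat (Functor.leftUnitor (R i).functor).inv))).symm
    refine Eq.trans ?_ (HNat.ofNat_comp _ _).symm
    exact congrArg HNat.ofNat (Category.comp_id _).symm
  · exact Category.id_comp _

lemma realizes_wTwo (i : Fin n) :
    Realizes (fun K => (wTwoT.{u} i).app K) ((σIso' i).hom ≫ w₂ i ≫ (emptyIso n).inv) := by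
  refine Eq.subst (motive := Realizes _) ?_ (realizes_ofNat (F := (wordFun [(i, false)]).functor)
    (G := (wordFun []).functor)
    (natKb (cw₂ i) ≫ (idKb (GrMod.{u} n)).hom) (fun K => (cw₂ i).app K.cx) fun K => ?_)
  · refine Eq.trans ?_ (congrArg (HNat.comp (HNat.ofNat (Functor.leftUnitor (R' i).functor).hom))
      (HNat.comp_id (w₂ i)).symm)
    refine Eq.trans ?_ (HNat.ofNat_comp _ _).symm
    exact congrArg HNat.ofNat (Category.id_comp _).symm
  · exact Category.comp_id _

lemma realizes_wThree (i : Fin n) :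
    Realizes (fun K => (wThreeT.{u} i).app K) ((σIso i).hom ≫ w₃ i ≫ (emptyIso n).inv) := by
  have h : Realizes (F := (wordFun [(i, true)]).functor) (G := (wordFun []).functor)
      (fun K => (wThreeT i).app K) (w₃ i) := fun K => by
    refine ⟨(cw₃ i).app K.cx, rfl, ?_⟩
    refine (congrArg (_ ≫ ·) ((shiftFunctor (𝒞.{u} n) (intDeg 2)).map_id _)).trans ?_
    exact (Category.comp_id _).trans (natKbSh_app (intDeg 2) (cw₃ i) K)
  refine Eq.subst (motive := Realizes _) ?_ h
  refine Eq.trans ?_ (congrArg (HNat.comp (HNat.ofNat (Functor.leftUnitor (R i).functor).hom))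
    (HNat.comp_id (w₃ i)).symm)
  exact (HNat.id_comp (w₃ i)).symm

lemma realizes_wFour (i : Fin n) :
    Realizes (fun K => (wFourT.{u} i).app K) ((emptyIso n).hom ≫ w₄ i ≫ (σIso' i).inv) := by
  have h : Realizes (F := (wordFun []).functor) (G := (wordFun [(i, false)]).functor)
      (fun K => (wFourT i).app K) (w₄ i) := fun K => by
    refine ⟨(cw₄ i).app K.cx, rfl, ?_⟩
    exact (Category.id_comp _).trans (natKbSh_app (intDeg 2) (cw₄ i) K)
  refine Eq.subst (motive := Realizes _) ?_ h
  refine Eq.trans ?_ (HNat.id_comp (HNat.comp (w₄ i)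
    (HNat.ofNat (Functor.leftUnitor (R' i).functor).inv))).symm
  exact (HNat.comp_id (w₄ i)).symm

end Realization

/-! ### The projective monoidal functor -/

section Functor

open Sg

/-- The class, up to sign and homotopy, of the transformation of a cobordism. -/
noncomputable def cobH {g h : BC n} (S : g ⟶ h) : Hm.{u} g.word h.word :=
  Quot.lift mT (fun _ _ H => MovieEq.mT_eq H) S

/-- The homogeneous natural transformation `α` represents the class `f`. -/
def Represents {g h : Word n} (f : Hm.{u} g h)
    (α : HNat (wordFun.{u} g).functor (wordFun h).functor) : Prop :=
  ∃ t, ofT t = f ∧ Realizes (fun K => t.app K) α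

lemma Represents.unique {g h : Word n} {f : Hm.{u} g h}
    {α β : HNat (wordFun.{u} g).functor (wordFun h).functor} (hα : Represents f α)
    (hβ : Represents f β) : HNat.EqUpToSign α β := by
  obtain ⟨t, ht, hα⟩ := hα
  obtain ⟨t', ht', hβ⟩ := hβ
  obtain ⟨ε, hε, H⟩ := (ofT_eq_iff t t').1 (ht.trans ht'.symm)
  exact hα.eqUpToSign hβ hε H

lemma exists_represents {g h : Word n} (f : Hm.{u} g h) :
    ∃ α : HNat (wordFun.{u} g).functor (wordFun h).functor, α.deg = deg f ∧ Represents f α := by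
  obtain ⟨t, rfl⟩ := ofT_surjective f
  obtain ⟨α, hα, h⟩ := exists_realizes t
  exact ⟨α, hα, t, rfl, h⟩

/-- The natural transformation of a cobordism. -/
noncomputable def cobMap {g h : BC n} (S : g ⟶ h) : wordFun.{u} g.word ⟶ wordFun.{u} h.word :=
  (exists_represents (cobH S)).choose

lemma deg_cobMap {g h : BC n} (S : g ⟶ h) : HNat.deg (cobMap.{u} S) = deg (cobH.{u} S) :=
  (exists_represents (cobH S)).choose_spec.1

lemma represents_cobMap {g h : BC n} (S : g ⟶ h) : Represents (cobH.{u} S) (cobMap S) :=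
  (exists_represents (cobH S)).choose_spec.2

lemma cobH_comp {g h k : BC n} (S : g ⟶ h) (T : h ⟶ k) : cobH.{u} (S ≫ T) = cobH S ≫ cobH T := by
  obtain ⟨S, rfl⟩ := Quot.exists_rep S
  obtain ⟨T, rfl⟩ := Quot.exists_rep T
  exact mT_comp S T

lemma cobH_tensor {g₂ h₂ g₁ h₁ : BC n} (S₂ : g₂ ⟶ h₂) (S₁ : g₁ ⟶ h₁) :
    cobH.{u} (BC.tensor S₂ S₁) = rgt g₁.word (cobH S₂) ≫ lft h₂.word (cobH S₁) := by
  obtain ⟨S₂, rfl⟩ := Quot.exists_rep S₂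
  obtain ⟨S₁, rfl⟩ := Quot.exists_rep S₁
  refine (mT_comp (S₂.right g₁.word) (S₁.left h₂.word)).trans ?_
  rw [mT_right, mT_left]
  rfl

lemma leftT_rightT_app {u u' v v' : Word n} (t : W.{u} u ⟶ W u') (t' : W.{u} v ⟶ W v')
    (K : HC.{u} n) : (rightT v t ≫ leftT u' t').app K ≫ eqToHom (W_append_obj u' v' K) =
      eqToHom (W_append_obj u v K) ≫ (W u).map (t'.app K) ≫ t.app ((W v').obj K) := by
  rw [exchangeT]
  simp [leftT, rightT, eqToHom_app]

lemma cobMap_tensor {g₂ h₂ g₁ h₁ : BC n} (S₂ : g₂ ⟶ h₂) (S₁ : g₁ ⟶ h₁) :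
    HNat.EqUpToSign (cobMap.{u} (BC.tensor S₂ S₁) ≫ (mulIso h₂ h₁).hom)
      ((mulIso g₂ g₁).hom ≫ GrEnd.hcomp (cobMap S₁) (cobMap S₂)) := by
  obtain ⟨t, ht, hr⟩ := represents_cobMap.{u} (BC.tensor S₂ S₁)
  obtain ⟨t₁, ht₁, hr₁⟩ := represents_cobMap.{u} S₁
  obtain ⟨t₂, ht₂, hr₂⟩ := represents_cobMap.{u} S₂
  have e₁ : ofT t = ofT (rightT g₁.word t₂ ≫ leftT h₂.word t₁) := by
    rw [ht, cobH_tensor, ← ht₁, ← ht₂]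
    rfl
  obtain ⟨ε, hε, H⟩ := (ofT_eq_iff _ _).1 e₁
  have l := hr.comp (realizes_mulIso h₂ h₁)
  have r := (realizes_mulIso g₂ g₁).comp ((hr₁.whiskerRight g₂.word).comp
    (hr₂.whiskerLeft (wordFun h₁.word).functor))
  refine l.eqUpToSign r hε fun K => ?_
  have e₂ := (H K).comp (HC.Rel.refl (eqToHom (W_append_obj h₂.word h₁.word K)))
  rw [mul_one] at e₂
  exact Eq.subst (motive := HC.Rel ε _) (leftT_rightT_app t₂ t₁ K) e₂

/-- The projective monoidal functor of braid cobordisms. -/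
noncomputable def cobFunctor (n : ℕ) : ProjMonoidalFunctor.{u} n where
  map := cobMap
  map_id g := (represents_cobMap (𝟙 g)).unique ⟨_, ofT_id g.word, realizes_id _⟩
  map_comp S T := by
    obtain ⟨s, hs, hs'⟩ := represents_cobMap.{u} S
    obtain ⟨t, ht, ht'⟩ := represents_cobMap.{u} T
    exact (represents_cobMap (S ≫ T)).unique
      ⟨s ≫ t, by rw [cobH_comp, ← hs, ← ht, ofT_comp], hs'.comp ht'⟩
  map_tensor := cobMap_tensor

lemma mT_one {x y : Word n} (m : Move x y) : HEq (mT.{u} (Movie.one [] m [])) (mvT m) := by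
  refine (heq_of_eq (mT_single _)).trans ((castH_heq _ _ _).trans ((rgt_nil _).trans ?_))
  exact heq_of_eq (lft_nil (mvT m))

lemma cobFunctor_birth (i : Fin n) : HNat.EqUpToSign ((cobFunctor.{u} n).map (BC.birth i))
    ((emptyIso n).hom ≫ w₁ i ≫ (σIso i).inv) :=
  (represents_cobMap (BC.birth i)).unique
    ⟨wOneT i, (eq_of_heq (mT_one (.birth i true))).symm, realizes_wOne i⟩

lemma cobFunctor_death' (i : Fin n) : HNat.EqUpToSign ((cobFunctor.{u} n).map (BC.death' i))
    ((σIso' i).hom ≫ w₂ i ≫ (emptyIso n).inv) :=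
  (represents_cobMap (BC.death' i)).unique
    ⟨wTwoT i, (eq_of_heq (mT_one (.death i false))).symm, realizes_wTwo i⟩

lemma cobFunctor_death (i : Fin n) : HNat.EqUpToSign ((cobFunctor.{u} n).map (BC.death i))
    ((σIso i).hom ≫ w₃ i ≫ (emptyIso n).inv) :=
  (represents_cobMap (BC.death i)).unique
    ⟨wThreeT i, (eq_of_heq (mT_one (.death i true))).symm, realizes_wThree i⟩

lemma cobFunctor_birth' (i : Fin n) : HNat.EqUpToSign ((cobFunctor.{u} n).map (BC.birth' i))
    ((emptyIso n).hom ≫ w₄ i ≫ (σIso' i).inv) :=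
  (represents_cobMap (BC.birth' i)).unique
    ⟨wFourT i, (eq_of_heq (mT_one (.birth i false))).symm, realizes_wFour i⟩

end Functor

/-! ### Exactness -/

section Exactness

open HomologicalComplex

variable {C : Type u} [Category.{v} C] [Preadditive C]

/-- A decomposition of the terms of `Φ K` as `A (K^{p+e+1}) ⊕ B (K^{p+e})`, for additive
functors `A` and `B` of the terms of `K`, in which the differential of `Φ K` consists of those of `K`,
with signs, and of a transformation `A ⟶ B`. The degrees `p + e + 1` and `p + e` enter through
equations, so that the inclusions can be used for degrees which agree only propositionally. -/
structure TermDecomp (Φ : CochainComplex C ℤ ⥤ CochainComplex C ℤ) where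
  /-- the shift of the cohomological degree -/
  e : ℤ
  /-- the functor for the first summand -/
  A : C ⥤ C
  /-- the functor for the second summand -/
  B : C ⥤ C
  addA : A.Additive
  addB : B.Additive
  /-- the component of the differential between the two summands -/
  θ : A ⟶ B
  /-- the inclusion of the first summand -/
  iA : ∀ (K : CochainComplex C ℤ) {p q : ℤ}, p + e + 1 = q → (A.obj (K.X q) ⟶ (Φ.obj K).X p)
  /-- the inclusion of the second summand -/
  iB : ∀ (K : CochainComplex C ℤ) {p q : ℤ}, p + e = q → (B.obj (K.X q) ⟶ (Φ.obj K).X p)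
  /-- the projection to the first summand -/
  pA : ∀ (K : CochainComplex C ℤ) {p q : ℤ}, p + e + 1 = q → ((Φ.obj K).X p ⟶ A.obj (K.X q))
  /-- the projection to the second summand -/
  pB : ∀ (K : CochainComplex C ℤ) {p q : ℤ}, p + e = q → ((Φ.obj K).X p ⟶ B.obj (K.X q))
  iA_pA : ∀ (K : CochainComplex C ℤ) {p q : ℤ} (h : p + e + 1 = q), iA K h ≫ pA K h = 𝟙 _
  iA_pB : ∀ (K : CochainComplex C ℤ) {p q q' : ℤ} (h : p + e + 1 = q) (h' : p + e = q'),
    iA K h ≫ pB K h' = 0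
  iB_pA : ∀ (K : CochainComplex C ℤ) {p q q' : ℤ} (h : p + e + 1 = q) (h' : p + e = q'),
    iB K h' ≫ pA K h = 0
  iB_pB : ∀ (K : CochainComplex C ℤ) {p q : ℤ} (h : p + e = q), iB K h ≫ pB K h = 𝟙 _
  split : ∀ (K : CochainComplex C ℤ) {p q q' : ℤ} (h : p + e + 1 = q) (h' : p + e = q'),
    pA K h ≫ iA K h + pB K h' ≫ iB K h' = 𝟙 _
  iA_d : ∀ (K : CochainComplex C ℤ) {p p' q q' : ℤ} (h : p + e + 1 = q) (hp : p + 1 = p')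
    (h' : p' + e + 1 = q'), iA K h ≫ (Φ.obj K).d p p' =
      θ.app (K.X q) ≫ iB K (show p' + e = q by lia) +
        (e + 1).negOnePow • A.map (K.d q q') ≫ iA K h'
  iB_d : ∀ (K : CochainComplex C ℤ) {p p' q q' : ℤ} (h : p + e = q) (_hp : p + 1 = p')
    (h' : p' + e = q'), iB K h ≫ (Φ.obj K).d p p' = e.negOnePow • B.map (K.d q q') ≫ iB K h'
  iA_map : ∀ {K L : CochainComplex C ℤ} (f : K ⟶ L) {p q : ℤ} (h : p + e + 1 = q),
    iA K h ≫ (Φ.map f).f p = A.map (f.f q) ≫ iA L h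
  iB_map : ∀ {K L : CochainComplex C ℤ} (f : K ⟶ L) {p q : ℤ} (h : p + e = q),
    iB K h ≫ (Φ.map f).f p = B.map (f.f q) ≫ iB L h

namespace TermDecomp

variable {Φ : CochainComplex C ℤ ⥤ CochainComplex C ℤ} (P : TermDecomp Φ)

instance : P.A.Additive := P.addA
instance : P.B.Additive := P.addB

lemma ext_hom (K : CochainComplex C ℤ) {p q q' : ℤ} (h : p + P.e + 1 = q) (h' : p + P.e =
    q') {Y : C}
    {f g : (Φ.obj K).X p ⟶ Y} (h₁ : P.iA K h ≫ f = P.iA K h ≫ g)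
    (h₂ : P.iB K h' ≫ f = P.iB K h' ≫ g) : f = g := by
  rw [← Category.id_comp f, ← Category.id_comp g, ← P.split K h h']
  simp only [Preadditive.add_comp, Category.assoc, h₁, h₂]

/-- The morphism from a term of `Φ K` with given values on the two summands. -/
def desc (K : CochainComplex C ℤ) (p : ℤ) {Y : C} (f : P.A.obj (K.X (p + P.e + 1)) ⟶ Y)
    (g : P.B.obj (K.X (p + P.e)) ⟶ Y) : (Φ.obj K).X p ⟶ Y := P.pA K rfl ≫ f + P.pB K rfl ≫ g

lemma iA_desc (K : CochainComplex C ℤ) (p : ℤ) {Y : C} (f : P.A.obj (K.X (p + P.e + 1)) ⟶ Y)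
    (g : P.B.obj (K.X (p + P.e)) ⟶ Y) : P.iA K rfl ≫ P.desc K p f g = f := by
  rw [desc, Preadditive.comp_add, ← Category.assoc, ← Category.assoc, P.iA_pA, P.iA_pB,
    Category.id_comp, zero_comp, add_zero]

lemma iB_desc (K : CochainComplex C ℤ) (p : ℤ) {Y : C} (f : P.A.obj (K.X (p + P.e + 1)) ⟶ Y)
    (g : P.B.obj (K.X (p + P.e)) ⟶ Y) : P.iB K rfl ≫ P.desc K p f g = g := by
  rw [desc, Preadditive.comp_add, ← Category.assoc, ← Category.assoc, P.iB_pA, P.iB_pB,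
    Category.id_comp, zero_comp, zero_add]

lemma iA_cast (K : CochainComplex C ℤ) {p p' q q' : ℤ} (h : p + P.e + 1 = q) (hq : q' = q)
    (hp : p = p') (h' : p' + P.e + 1 = q') :
    P.A.map (K.XIsoOfEq hq).hom ≫ P.iA K h ≫ ((Φ.obj K).XIsoOfEq hp).hom = P.iA K h' := by
  subst hq hp
  simp

lemma iB_cast (K : CochainComplex C ℤ) {p p' q q' : ℤ} (h : p + P.e = q) (hq : q' = q)
    (hp : p = p') (h' : p' + P.e = q') :
    P.B.map (K.XIsoOfEq hq).hom ≫ P.iB K h ≫ ((Φ.obj K).XIsoOfEq hp).hom = P.iB K h' := by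
  subst hq hp
  simp

/-- The first summand of a term of `(Φ K)⟦a⟧`. -/
def iAs (a : ℤ) (K : CochainComplex C ℤ) {p q : ℤ} (h : p + P.e + 1 = q) :
    P.A.obj ((K⟦a⟧).X q) ⟶ ((Φ.obj K)⟦a⟧).X p := P.iA K (p := p + a) (q := q + a) (by lia)

/-- The second summand of a term of `(Φ K)⟦a⟧`. -/
def iBs (a : ℤ) (K : CochainComplex C ℤ) {p q : ℤ} (h : p + P.e = q) :
    P.B.obj ((K⟦a⟧).X q) ⟶ ((Φ.obj K)⟦a⟧).X p := P.iB K (p := p + a) (q := q + a) (by lia)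

lemma ext_shift (a : ℤ) (K : CochainComplex C ℤ) {p q q' : ℤ} (h : p + P.e + 1 = q)
    (h' : p + P.e = q') {Y : C} {f g : ((Φ.obj K)⟦a⟧).X p ⟶ Y}
    (h₁ : P.iAs a K h ≫ f = P.iAs a K h ≫ g) (h₂ : P.iBs a K h' ≫ f = P.iBs a K h' ≫ g) : f = g :=
  P.ext_hom K (p := p + a) (q := q + a) (q' := q' + a) (by lia) (by lia) h₁ h₂

/-- The components of `Φ (K⟦a⟧) ≅ (Φ K)⟦a⟧`, with signs on the two summands. -/
def shF (a : ℤ) (K : CochainComplex C ℤ) (p : ℤ) : (Φ.obj (K⟦a⟧)).X p ⟶ ((Φ.obj K)⟦a⟧).X p :=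
  P.desc (K⟦a⟧) p ((a * (P.e + 1)).negOnePow • P.iAs a K rfl) ((a * P.e).negOnePow • P.iBs a K rfl)

lemma iA_shF (a : ℤ) (K : CochainComplex C ℤ) {p q : ℤ} (h : p + P.e + 1 = q) :
    P.iA (K⟦a⟧) h ≫ P.shF a K p = (a * (P.e + 1)).negOnePow • P.iAs a K h := by
  subst h; exact P.iA_desc _ _ _ _

lemma iB_shF (a : ℤ) (K : CochainComplex C ℤ) {p q : ℤ} (h : p + P.e = q) :
    P.iB (K⟦a⟧) h ≫ P.shF a K p = (a * P.e).negOnePow • P.iBs a K h := by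
  subst h; exact P.iB_desc _ _ _ _

/-- The inverse of `shF`. -/
def shInv (a : ℤ) (K : CochainComplex C ℤ) (p : ℤ) : ((Φ.obj K)⟦a⟧).X p ⟶ (Φ.obj (K⟦a⟧)).X p :=
  P.pA K (show p + a + P.e + 1 = p + P.e + 1 + a by lia) ≫
      ((a * (P.e + 1)).negOnePow • P.iA (K⟦a⟧) (p := p) rfl) +
    P.pB K (show p + a + P.e = p + P.e + a by lia) ≫
      ((a * P.e).negOnePow • P.iB (K⟦a⟧) (p := p) rfl)

lemma iAs_shInv (a : ℤ) (K : CochainComplex C ℤ) {p q : ℤ} (h : p + P.e + 1 = q) :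
    P.iAs a K h ≫ P.shInv a K p = (a * (P.e + 1)).negOnePow • P.iA (K⟦a⟧) h := by
  subst h
  refine (Preadditive.comp_add _ _ _ _ _ _).trans ?_
  refine (congrArg₂ (· + ·) (Category.assoc _ _ _).symm (Category.assoc _ _ _).symm).trans ?_
  refine (congrArg₂ (· + ·) (congrArg (· ≫ _) (P.iA_pA K _)) (congrArg (· ≫ _)
    (P.iA_pB K _ _))).trans ?_
  exact (congrArg₂ (· + ·) (Category.id_comp _) zero_comp).trans (add_zero _)

lemma iBs_shInv (a : ℤ) (K : CochainComplex C ℤ) {p q : ℤ} (h : p + P.e = q) :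
    P.iBs a K h ≫ P.shInv a K p = (a * P.e).negOnePow • P.iB (K⟦a⟧) h := by
  subst h
  refine (Preadditive.comp_add _ _ _ _ _ _).trans ?_
  refine (congrArg₂ (· + ·) (Category.assoc _ _ _).symm (Category.assoc _ _ _).symm).trans ?_
  refine (congrArg₂ (· + ·) (congrArg (· ≫ _) (P.iB_pA K _ _)) (congrArg (· ≫ _)
    (P.iB_pB K _))).trans ?_
  exact (congrArg₂ (· + ·) zero_comp (Category.id_comp _)).trans (zero_add _)

lemma units_smul_self {X Y : C} (m : ℤ) (f : X ⟶ Y) : m.negOnePow • m.negOnePow • f = f := by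
  rw [smul_smul, Int.units_mul_self, one_smul]

lemma units_smul_comm {X Y : C} (x y : ℤˣ) (f : X ⟶ Y) : x • y • f = y • x • f := by
  rw [smul_smul, mul_comm, smul_smul]

lemma comp_two_smul {X Y Z T : C} (i : X ⟶ Y) (f : Y ⟶ Z) (g : Z ⟶ T) (j : X ⟶ Z) (k : X ⟶ T)
    (m : ℤ) (h₁ : i ≫ f = m.negOnePow • j) (h₂ : j ≫ g = m.negOnePow • k) : i ≫ f ≫ g = k := by
  rw [← Category.assoc, h₁, Linear.units_smul_comp, h₂, units_smul_self]

/-- The components of `Φ (K⟦a⟧) ≅ (Φ K)⟦a⟧` are isomorphisms. -/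
def shXIso (a : ℤ) (K : CochainComplex C ℤ) (p : ℤ) :
    (Φ.obj (K⟦a⟧)).X p ≅ ((Φ.obj K)⟦a⟧).X p where
  hom := P.shF a K p
  inv := P.shInv a K p
  hom_inv_id := P.ext_hom (K⟦a⟧) rfl rfl
    ((comp_two_smul _ _ _ _ _ _ (P.iA_shF a K rfl) (P.iAs_shInv a K rfl)).trans
      (Category.comp_id _).symm)
    ((comp_two_smul _ _ _ _ _ _ (P.iB_shF a K rfl) (P.iBs_shInv a K rfl)).trans
      (Category.comp_id _).symm)
  inv_hom_id := P.ext_shift a K rfl rfl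
    ((comp_two_smul _ _ _ _ _ _ (P.iAs_shInv a K rfl) (P.iA_shF a K rfl)).trans
      (Category.comp_id _).symm)
    ((comp_two_smul _ _ _ _ _ _ (P.iBs_shInv a K rfl) (P.iB_shF a K rfl)).trans
      (Category.comp_id _).symm)

lemma iAs_d (a : ℤ) (K : CochainComplex C ℤ) {p p' q q' : ℤ} (h : p + P.e + 1 = q)
    (hp : p + 1 = p') (h' : p' + P.e + 1 = q') : P.iAs a K h ≫ ((Φ.obj K)⟦a⟧).d p p' =
      a.negOnePow • (P.θ.app ((K⟦a⟧).X q) ≫ P.iBs a K (show p' + P.e = q by lia)) +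
        (P.e + 1).negOnePow • P.A.map ((K⟦a⟧).d q q') ≫ P.iAs a K h' := by
  have h₁ : ((Φ.obj K)⟦a⟧).d p p' = a.negOnePow • (Φ.obj K).d (p + a) (p' + a) := rfl
  have h₂ : P.A.map ((K⟦a⟧).d q q') = a.negOnePow • P.A.map (K.d (q + a) (q' + a)) :=
    P.A.map_units_smul _ _
  rw [h₁, h₂]
  refine (Linear.comp_units_smul _ _ _).trans ?_
  refine (congrArg (a.negOnePow • ·) (P.iA_d K (p := p + a) (p' := p' + a) (q := q + a)
    (q' := q' + a) (by lia) (by lia) (by lia))).trans ?_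
  exact (smul_add _ _ _).trans (congrArg₂ (· + ·) rfl ((units_smul_comm _ _ _).trans
    (congrArg _ (Linear.units_smul_comp _ _ _).symm)))

lemma iBs_d (a : ℤ) (K : CochainComplex C ℤ) {p p' q q' : ℤ} (h : p + P.e = q)
    (hp : p + 1 = p') (h' : p' + P.e = q') : P.iBs a K h ≫ ((Φ.obj K)⟦a⟧).d p p' =
      P.e.negOnePow • P.B.map ((K⟦a⟧).d q q') ≫ P.iBs a K h' := by
  have h₁ : ((Φ.obj K)⟦a⟧).d p p' = a.negOnePow • (Φ.obj K).d (p + a) (p' + a) := rfl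
  have h₂ : P.B.map ((K⟦a⟧).d q q') = a.negOnePow • P.B.map (K.d (q + a) (q' + a)) :=
    P.B.map_units_smul _ _
  rw [h₁, h₂]
  refine (Linear.comp_units_smul _ _ _).trans ?_
  refine (congrArg (a.negOnePow • ·) (P.iB_d K (p := p + a) (p' := p' + a) (q := q + a)
    (q' := q' + a) (by lia) (by lia) (by lia))).trans ?_
  exact (units_smul_comm _ _ _).trans (congrArg _ (Linear.units_smul_comp _ _ _).symm)

lemma shF_comm (a : ℤ) (K : CochainComplex C ℤ) (p p' : ℤ) (hp : p + 1 = p') :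
    P.shF a K p ≫ ((Φ.obj K)⟦a⟧).d p p' = (Φ.obj (K⟦a⟧)).d p p' ≫ P.shF a K p' := by
  have hs : (a * (P.e + 1)).negOnePow * a.negOnePow = (a * P.e).negOnePow := by
    rw [mul_add, mul_one, Int.negOnePow_add, mul_assoc, Int.units_mul_self, mul_one]
  refine P.ext_hom (K⟦a⟧) rfl rfl ?_ ?_
  · rw [← Category.assoc, ← Category.assoc, iA_shF, Linear.units_smul_comp,
      P.iAs_d a K rfl hp rfl, P.iA_d (K⟦a⟧) rfl hp rfl, Preadditive.add_comp,
      Linear.units_smul_comp, Category.assoc, Category.assoc, iA_shF, iB_shF,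
      Linear.comp_units_smul, Linear.comp_units_smul, smul_add, smul_smul, hs, smul_comm]
  · rw [← Category.assoc, ← Category.assoc, iB_shF, Linear.units_smul_comp,
      P.iBs_d a K rfl hp rfl, P.iB_d (K⟦a⟧) rfl hp rfl,
      Linear.units_smul_comp, Category.assoc, iB_shF, Linear.comp_units_smul, smul_comm]

/-- `Φ (K⟦a⟧) ≅ (Φ K)⟦a⟧`. -/
def shIso (a : ℤ) : shiftFunctor (CochainComplex C ℤ) a ⋙ Φ ≅ Φ ⋙
    shiftFunctor (CochainComplex C ℤ) a :=
  NatIso.ofComponents (fun K => Hom.isoOfComponents (P.shXIso a K) fun p p' hp =>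
      P.shF_comm a K p p' hp)
    fun {K L} f => by
      ext p
      refine P.ext_hom (K⟦a⟧) rfl rfl ?_ ?_
      · change P.iA (K⟦a⟧) rfl ≫ (Φ.map (f⟦a⟧')).f p ≫ P.shF a L p =
          P.iA (K⟦a⟧) rfl ≫ P.shF a K p ≫ (Φ.map f).f (p + a)
        refine (Category.assoc _ _ _).symm.trans ((congrArg (· ≫ _) (P.iA_map _ _)).trans ?_)
        refine (Category.assoc _ _ _).trans ((congrArg (_ ≫ ·) (P.iA_shF a L rfl)).trans ?_)
        refine Eq.trans ?_ (Category.assoc _ _ _)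
        refine Eq.trans ?_ (congrArg (· ≫ _) (P.iA_shF a K rfl)).symm
        refine (Linear.comp_units_smul _ _ _).trans
          (Eq.trans ?_ (Linear.units_smul_comp _ _ _).symm)
        exact congrArg _ (P.iA_map f _).symm
      · change P.iB (K⟦a⟧) rfl ≫ (Φ.map (f⟦a⟧')).f p ≫ P.shF a L p =
          P.iB (K⟦a⟧) rfl ≫ P.shF a K p ≫ (Φ.map f).f (p + a)
        refine (Category.assoc _ _ _).symm.trans ((congrArg (· ≫ _) (P.iB_map _ _)).trans ?_)
        refine (Category.assoc _ _ _).trans ((congrArg (_ ≫ ·) (P.iB_shF a L rfl)).trans ?_)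
        refine Eq.trans ?_ (Category.assoc _ _ _)
        refine Eq.trans ?_ (congrArg (· ≫ _) (P.iB_shF a K rfl)).symm
        refine (Linear.comp_units_smul _ _ _).trans
          (Eq.trans ?_ (Linear.units_smul_comp _ _ _).symm)
        exact congrArg _ (P.iB_map f _).symm

lemma comp_smul_chain {X Y₀ Y₁ Y₂ Y₃ Z₁ Z₃ : C} (x y : ℤˣ) {i : X ⟶ Y₀} {f : Y₀ ⟶ Y₁} {g : Y₁ ⟶ Y₂}
    {h : Y₂ ⟶ Y₃} {k : Y₃ ⟶ Z₃} (j : X ⟶ Z₁) {i₁ : Z₁ ⟶ Y₁} {i₂ : Z₁ ⟶ Y₂} {i₃ : Z₁ ⟶ Y₃}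
    {i₄ : X ⟶ Z₃} (h₁ : i ≫ f = j ≫ i₁) (h₂ : i₁ ≫ g = x • i₂) (h₃ : i₂ ≫ h = y • i₃)
    (h₄ : j ≫ i₃ ≫ k = i₄) : i ≫ f ≫ g ≫ h ≫ k = (x * y) • i₄ := by
  rw [← Category.assoc, h₁, Category.assoc, ← Category.assoc i₁, h₂, Linear.units_smul_comp,
    ← Category.assoc i₂, h₃, Linear.units_smul_comp, smul_smul, Linear.comp_units_smul, h₄]

/-- The functor commutes with the shift of the cohomological degree. -/
@[reducible]
noncomputable def commShift : Φ.CommShift ℤ where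
  commShiftIso := P.shIso
  commShiftIso_zero := by
    ext K p
    refine P.ext_hom (K⟦(0 : ℤ)⟧) rfl rfl ?_ ?_
    · refine (P.iA_shF 0 K rfl).trans ?_
      rw [zero_mul, Int.negOnePow_zero, one_smul]
      refine Eq.trans ?_ (congrArg (fun t => P.iA (K⟦(0 : ℤ)⟧) rfl ≫ Hom.f t p)
        (Functor.CommShift.isoZero_hom_app (A := ℤ) Φ K)).symm
      refine Eq.trans ?_ (Category.assoc _ _ _)
      refine Eq.trans ?_ (congrArg (· ≫ _) (P.iA_map
        ((shiftFunctorZero (CochainComplex C ℤ) ℤ).hom.app K) _)).symm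
      refine Eq.trans ?_ (Category.assoc _ _ _).symm
      exact (P.iA_cast K (p := p) (p' := p + 0) (q := p + P.e + 1) rfl (by lia) (by lia) _).symm
    · refine (P.iB_shF 0 K rfl).trans ?_
      rw [zero_mul, Int.negOnePow_zero, one_smul]
      refine Eq.trans ?_ (congrArg (fun t => P.iB (K⟦(0 : ℤ)⟧) rfl ≫ Hom.f t p)
        (Functor.CommShift.isoZero_hom_app (A := ℤ) Φ K)).symm
      refine Eq.trans ?_ (Category.assoc _ _ _)
      refine Eq.trans ?_ (congrArg (· ≫ _) (P.iB_map
        ((shiftFunctorZero (CochainComplex C ℤ) ℤ).hom.app K) _)).symm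
      refine Eq.trans ?_ (Category.assoc _ _ _).symm
      exact (P.iB_cast K (p := p) (p' := p + 0) (q := p + P.e) rfl (by lia) (by lia) _).symm
  commShiftIso_add a b := by
    ext K p
    refine P.ext_hom (K⟦(a + b : ℤ)⟧) rfl rfl ?_ ?_
    · refine (P.iA_shF (a + b) K rfl).trans ?_
      refine Eq.trans ?_ (congrArg (fun t => P.iA (K⟦(a + b : ℤ)⟧) rfl ≫ Hom.f t p)
        (Functor.CommShift.isoAdd_hom_app (P.shIso a) (P.shIso b) K)).symm
      refine Eq.trans ?_ (comp_smul_chain (b * (P.e + 1)).negOnePow (a * (P.e + 1)).negOnePow _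
        (P.iA_map ((shiftFunctorAdd (CochainComplex C ℤ) a b).hom.app K) rfl)
        (P.iA_shF b (K⟦a⟧) rfl)
        (P.iA_shF a K (p := p + b) (q := p + P.e + 1 + b) (by lia)) (P.iA_cast K
          (p := p + b + a) (p' := p + (a + b)) (q := p + P.e + 1 + b + a) (by lia) (by lia)
          (by lia) (by lia))).symm
      exact congrArg (· • _) (show ((a + b) * (P.e + 1)).negOnePow = _ by
        rw [add_mul, Int.negOnePow_add, mul_comm])
    · refine (P.iB_shF (a + b) K rfl).trans ?_
      refine Eq.trans ?_ (congrArg (fun t => P.iB (K⟦(a + b : ℤ)⟧) rfl ≫ Hom.f t p)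
        (Functor.CommShift.isoAdd_hom_app (P.shIso a) (P.shIso b) K)).symm
      refine Eq.trans ?_ (comp_smul_chain (b * P.e).negOnePow (a * P.e).negOnePow _
        (P.iB_map ((shiftFunctorAdd (CochainComplex C ℤ) a b).hom.app K) rfl)
        (P.iB_shF b (K⟦a⟧) rfl)
        (P.iB_shF a K (p := p + b) (q := p + P.e + b) (by lia)) (P.iB_cast K
          (p := p + b + a) (p' := p + (a + b)) (q := p + P.e + b + a) (by lia) (by lia)
          (by lia) (by lia))).symm
      exact congrArg (· • _) (show ((a + b) * P.e).negOnePow = _ by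
        rw [add_mul, Int.negOnePow_add, mul_comm])

/-- The component of `Φ` of a family of morphisms between the terms of two complexes. -/
def mapX {K L : CochainComplex C ℤ} (u : ∀ q, K.X q ⟶ L.X q) (p : ℤ) :
    (Φ.obj K).X p ⟶ (Φ.obj L).X p :=
  P.desc K p (P.A.map (u _) ≫ P.iA L rfl) (P.B.map (u _) ≫ P.iB L rfl)

section

variable {K L M : CochainComplex C ℤ}

lemma iA_mapX (u : ∀ q, K.X q ⟶ L.X q) {p q : ℤ} (h : p + P.e + 1 = q) :
    P.iA K h ≫ P.mapX u p = P.A.map (u q) ≫ P.iA L h := by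
  subst h; exact P.iA_desc _ _ _ _

lemma iB_mapX (u : ∀ q, K.X q ⟶ L.X q) {p q : ℤ} (h : p + P.e = q) :
    P.iB K h ≫ P.mapX u p = P.B.map (u q) ≫ P.iB L h := by
  subst h; exact P.iB_desc _ _ _ _

lemma mapX_comp (u : ∀ q, K.X q ⟶ L.X q) (v : ∀ q, L.X q ⟶ M.X q) (p : ℤ) :
    P.mapX u p ≫ P.mapX v p = P.mapX (fun q => u q ≫ v q) p := by
  refine P.ext_hom K rfl rfl ?_ ?_
  · rw [← Category.assoc, iA_mapX, Category.assoc, iA_mapX, iA_mapX, Functor.map_comp,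
      Category.assoc]
  · rw [← Category.assoc, iB_mapX, Category.assoc, iB_mapX, iB_mapX, Functor.map_comp,
      Category.assoc]

lemma mapX_add (u v : ∀ q, K.X q ⟶ L.X q) (p : ℤ) :
    P.mapX u p + P.mapX v p = P.mapX (fun q => u q + v q) p := by
  refine P.ext_hom K rfl rfl ?_ ?_
  · rw [Preadditive.comp_add, iA_mapX, iA_mapX, iA_mapX, Functor.map_add, Preadditive.add_comp]
  · rw [Preadditive.comp_add, iB_mapX, iB_mapX, iB_mapX, Functor.map_add, Preadditive.add_comp]

lemma mapX_id (p : ℤ) : P.mapX (fun q => 𝟙 (K.X q)) p = 𝟙 _ := by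
  refine P.ext_hom K rfl rfl ?_ ?_
  · rw [iA_mapX, CategoryTheory.Functor.map_id, Category.id_comp, Category.comp_id]
  · rw [iB_mapX, CategoryTheory.Functor.map_id, Category.id_comp, Category.comp_id]

lemma map_f_eq (f : K ⟶ L) (p : ℤ) : (Φ.map f).f p = P.mapX f.f p :=
  P.ext_hom K rfl rfl ((P.iA_map f rfl).trans (P.iA_mapX f.f rfl).symm)
    ((P.iB_map f rfl).trans (P.iB_mapX f.f rfl).symm)

/-- The transformation between the two summands does not contribute to `s ≫ d ≫ r` when
`s ≫ r = 0`. -/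
lemma iA_mapX_d_mapX (u : ∀ q, K.X q ⟶ L.X q) (v : ∀ q, L.X q ⟶ M.X q) (huv : ∀ q, u q ≫ v q = 0)
    {p p' q q' : ℤ} (h : p + P.e + 1 = q) (hp : p + 1 = p') (h' : p' + P.e + 1 = q') :
    P.iA K h ≫ P.mapX u p ≫ (Φ.obj L).d p p' ≫ P.mapX v p' =
      (P.e + 1).negOnePow • P.A.map (u q ≫ L.d q q' ≫ v q') ≫ P.iA M h' := by
  rw [← Category.assoc, iA_mapX, Category.assoc, ← Category.assoc (P.iA L h), P.iA_d L h hp h',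
    Preadditive.add_comp, Category.assoc, iB_mapX, Preadditive.comp_add, ← Category.assoc,
    P.θ.naturality, Category.assoc, ← Category.assoc (P.B.map _), ← Functor.map_comp, huv,
    Functor.map_zero, zero_comp, comp_zero, zero_add, Linear.units_smul_comp, Category.assoc,
    iA_mapX, Linear.comp_units_smul, Functor.map_comp, Functor.map_comp]
  simp only [Category.assoc]

lemma iB_mapX_d_mapX (u : ∀ q, K.X q ⟶ L.X q) (v : ∀ q, L.X q ⟶ M.X q)
    {p p' q q' : ℤ} (h : p + P.e = q) (hp : p + 1 = p') (h' : p' + P.e = q') :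
    P.iB K h ≫ P.mapX u p ≫ (Φ.obj L).d p p' ≫ P.mapX v p' =
      P.e.negOnePow • P.B.map (u q ≫ L.d q q' ≫ v q') ≫ P.iB M h' := by
  rw [← Category.assoc, iB_mapX, Category.assoc, ← Category.assoc (P.iB L h), P.iB_d L h hp h',
    Linear.units_smul_comp, Category.assoc,
    iB_mapX, Linear.comp_units_smul, Functor.map_comp, Functor.map_comp]
  simp only [Category.assoc]

end

section

variable [Φ.Additive] (S : ShortComplex (CochainComplex C ℤ))
  (σ : ∀ n, (S.map (eval C (ComplexShape.up ℤ) n)).Splitting)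

/-- The splitting of the terms of the image under `Φ` of a degreewise split short complex. -/
noncomputable def splitting (p : ℤ) : ((S.map Φ).map (eval C (ComplexShape.up ℤ) p)).Splitting where
  r := P.mapX (fun q => (σ q).r) p
  s := P.mapX (fun q => (σ q).s) p
  f_r := (congrArg (· ≫ P.mapX (K := S.X₂) (L := S.X₁) (fun q => (σ q).r) p)
    (P.map_f_eq S.f p)).trans ((P.mapX_comp (K := S.X₁) (L := S.X₂) (M := S.X₁) _ _ _).trans
      ((congrArg (fun t => P.mapX (K := S.X₁) (L := S.X₁) t p)
        (funext fun q => (σ q).f_r)).trans (P.mapX_id p)))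
  s_g := (congrArg (P.mapX (K := S.X₃) (L := S.X₂) (fun q => (σ q).s) p ≫ ·)
    (P.map_f_eq S.g p)).trans ((P.mapX_comp (K := S.X₃) (L := S.X₂) (M := S.X₃) _ _ _).trans
      ((congrArg (fun t => P.mapX (K := S.X₃) (L := S.X₃) t p)
        (funext fun q => (σ q).s_g)).trans (P.mapX_id p)))
  id := (congrArg₂ (· + ·) ((congrArg (P.mapX (K := S.X₂) (L := S.X₁) (fun q => (σ q).r) p ≫ ·)
    (P.map_f_eq S.f p)).trans (P.mapX_comp (K := S.X₂) (L := S.X₁) (M := S.X₂) _ _ _))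
    ((congrArg (· ≫ P.mapX (K := S.X₃) (L := S.X₂) (fun q => (σ q).s) p)
    (P.map_f_eq S.g p)).trans (P.mapX_comp (K := S.X₂) (L := S.X₃) (M := S.X₂) _ _ _))).trans
      ((P.mapX_add (K := S.X₂) (L := S.X₂) _ _ _).trans
      ((congrArg (fun t => P.mapX (K := S.X₂) (L := S.X₂) t p)
        (funext fun q => (σ q).id)).trans (P.mapX_id p)))

/-- `Φ` is compatible with the connecting morphisms of degreewise split short complexes. -/
lemma map_homOfDegreewiseSplit :
    Φ.map (CochainComplex.homOfDegreewiseSplit S σ) ≫ (P.shIso 1).hom.app S.X₁ =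
      CochainComplex.homOfDegreewiseSplit (S.map Φ) (P.splitting S σ) := by
  ext p
  have hf : ∀ q, (CochainComplex.homOfDegreewiseSplit S σ).f q =
      (show S.X₃.X q ⟶ S.X₂.X q from (σ q).s) ≫ S.X₂.d q (q + 1) ≫
      (show S.X₂.X (q + 1) ⟶ S.X₁.X (q + 1) from (σ (q + 1)).r) :=
    fun q => CochainComplex.homOfDegreewiseSplit_f S σ q
  have hf' : (CochainComplex.homOfDegreewiseSplit (S.map Φ) (P.splitting S σ)).f p =
      P.mapX (K := S.X₃) (L := S.X₂) (fun q => (σ q).s) p ≫ (Φ.obj S.X₂).d p (p + 1) ≫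
        P.mapX (K := S.X₂) (L := S.X₁) (fun q => (σ q).r) (p + 1) :=
    CochainComplex.homOfDegreewiseSplit_f (S.map Φ) (P.splitting S σ) p
  refine Eq.trans ?_ hf'.symm
  refine P.ext_hom S.X₃ rfl rfl ?_ ?_
  · refine Eq.trans ?_ (P.iA_mapX_d_mapX (K := S.X₃) (L := S.X₂) (M := S.X₁) _ _
      (fun q => (σ q).s_r) rfl rfl (q' := p + P.e + 1 + 1) (by lia)).symm
    refine (Category.assoc _ _ _).symm.trans ((congrArg (· ≫ _) (P.iA_map _ _)).trans ?_)
    refine (Category.assoc _ _ _).trans ((congrArg (_ ≫ ·) (P.iA_shF 1 S.X₁ rfl)).trans ?_)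
    refine (Linear.comp_units_smul _ _ _).trans ?_
    rw [one_mul, hf]
    rfl
  · refine Eq.trans ?_ (P.iB_mapX_d_mapX (K := S.X₃) (L := S.X₂) (M := S.X₁) _ _
      rfl rfl (q' := p + P.e + 1) (by lia)).symm
    refine (Category.assoc _ _ _).symm.trans ((congrArg (· ≫ _) (P.iB_map _ _)).trans ?_)
    refine (Category.assoc _ _ _).trans ((congrArg (_ ≫ ·) (P.iB_shF 1 S.X₁ rfl)).trans ?_)
    refine (Linear.comp_units_smul _ _ _).trans ?_
    rw [one_mul, hf]
    rfl

end

end TermDecomp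

end Exactness

section Exactness

open HomologicalComplex Pretriangulated

variable {C : Type u} [Category.{v} C] [Preadditive C]

noncomputable instance (Φ : CochainComplex C ℤ ⥤ CochainComplex C ℤ) [Descends Φ]
    [Φ.CommShift ℤ] : (onK Φ).CommShift ℤ :=
  CategoryTheory.Quotient.liftCommShift _ _ _ _

noncomputable instance (Φ : CochainComplex C ℤ ⥤ CochainComplex C ℤ) [Descends Φ]
    [Φ.CommShift ℤ] : (onKb Φ).CommShift ℤ :=
  Functor.CommShift.ofComp ((bdd C).liftCompιIso ((bdd C).ι ⋙ onK Φ) fun K =>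
    Descends.bounded (Φ := Φ) K.obj.as K.property) ℤ

/-- `Φ` on complexes and on the homotopy category. -/
noncomputable def quotientCompOnK (Φ : CochainComplex C ℤ ⥤ CochainComplex C ℤ) [Descends Φ] :
    HomotopyCategory.quotient C (ComplexShape.up ℤ) ⋙ onK Φ ≅
      Φ ⋙ HomotopyCategory.quotient C (ComplexShape.up ℤ) :=
  CategoryTheory.Quotient.lift.isLift (homotopic C (ComplexShape.up ℤ))
    (Φ ⋙ HomotopyCategory.quotient C _) fun _ _ _ _ ⟨h⟩ =>
      HomotopyCategory.eq_of_homotopy _ _ (Descends.homotopic (Φ := Φ) _ _ h).some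

instance (Φ : CochainComplex C ℤ ⥤ CochainComplex C ℤ) [Descends Φ] [Φ.CommShift ℤ] :
    NatTrans.CommShift (quotientCompOnK Φ).hom ℤ :=
  CategoryTheory.Quotient.liftCommShift_compatibility _ _ _ _

variable [HasZeroObject C] [HasBinaryBiproducts C]

/-- A functor whose terms decompose preserves the triangles of degreewise split short complexes,
and hence is exact on the homotopy category. -/
lemma TermDecomp.isTriangulated_onK {Φ : CochainComplex C ℤ ⥤ CochainComplex C ℤ} [Descends Φ]
    [Φ.Additive] (P : TermDecomp Φ) :
    letI := P.commShift
    (onK Φ).IsTriangulated := by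
  let := P.commShift
  refine ⟨fun T hT => ?_⟩
  rw [HomotopyCategory.distinguished_iff_iso_trianglehOfDegreewiseSplit] at hT
  obtain ⟨S, σ, ⟨e⟩⟩ := hT
  rw [HomotopyCategory.distinguished_iff_iso_trianglehOfDegreewiseSplit]
  have h : Φ.mapTriangle.obj (CochainComplex.triangleOfDegreewiseSplit S σ) =
      CochainComplex.triangleOfDegreewiseSplit (S.map Φ) (P.splitting S σ) :=
    congrArg (Triangle.mk (Φ.map S.f) (Φ.map S.g)) (P.map_homOfDegreewiseSplit S σ)
  refine ⟨S.map Φ, P.splitting S σ, ⟨(onK Φ).mapTriangle.mapIso e ≪≫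
    (Functor.mapTriangleCompIso (HomotopyCategory.quotient C (ComplexShape.up ℤ))
      (onK Φ)).symm.app (CochainComplex.triangleOfDegreewiseSplit S σ) ≪≫
    (Functor.mapTriangleIso (quotientCompOnK Φ)).app _ ≪≫
    (Functor.mapTriangleCompIso Φ (HomotopyCategory.quotient C (ComplexShape.up ℤ))).app _ ≪≫
    (HomotopyCategory.quotient C (ComplexShape.up ℤ)).mapTriangle.mapIso (eqToIso h)⟩⟩

lemma isTriangulated_onKb (Φ : CochainComplex C ℤ ⥤ CochainComplex C ℤ) [Descends Φ]
    [Φ.CommShift ℤ] [(onK Φ).IsTriangulated] : (onKb Φ).IsTriangulated := by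
  let e : onKb Φ ⋙ (bdd C).ι ≅ (bdd C).ι ⋙ onK Φ := (bdd C).liftCompιIso ((bdd C).ι ⋙ onK Φ)
    fun K => Descends.bounded (Φ := Φ) K.obj.as K.property
  have : NatTrans.CommShift e.hom ℤ := Functor.CommShift.ofComp_compatibility _ _
  rw [Functor.isTriangulated_iff_comp_right e]
  infer_instance

section

variable {U : C ⥤ C} [U.Additive]

/-- The terms `U K^{p+1} ⊕ K^p` of the cone of `β_K : U K → K`. -/
noncomputable def posDecomp (β : U ⟶ 𝟭 C) : TermDecomp (posF β) where
  e := 0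
  A := U
  B := 𝟭 C
  addA := inferInstance
  addB := inferInstance
  θ := β
  iA K p q h := inU β K (by lia)
  iB K p q h := (K.XIsoOfEq (show q = p by lia)).hom ≫ inK β K p
  pA K p q h := prU β K (by lia)
  pB K p q h := prK β K p ≫ (K.XIsoOfEq (show p = q by lia)).hom
  iA_pA K p q h := inU_prU β K _
  iA_pB K p q q' h h' := by rw [← Category.assoc, inU_prK, zero_comp]
  iB_pA K p q q' h h' := by rw [Category.assoc, inK_prU, comp_zero]
  iB_pB K p q h := by
    obtain rfl : q = p := by lia
    simp [inK_prK]
  split K p q q' h h' := by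
    obtain rfl : q' = p := by lia
    simp [pos_split]
  iA_d K p p' q q' h hp h' := by
    obtain rfl : q = p' := by lia
    have := inU_d β K hp (show q + 1 = q' by lia)
    simpa [sub_eq_add_neg] using this
  iB_d K p p' q q' h hp h' := by
    obtain rfl : q = p := by lia
    obtain rfl : q' = p' := by lia
    simp [inK_d]
  iA_map f p q h := inU_map β f _
  iB_map f p q h := by
    obtain rfl : q = p := by lia
    simp [inK_map]

/-- The terms `K^p ⊕ U K^{p-1}` of the desuspended cone of `γ_K : K → U K`. -/
noncomputable def negDecomp (γ : 𝟭 C ⟶ U) : TermDecomp (negF γ) where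
  e := -1
  A := 𝟭 C
  B := U
  addA := inferInstance
  addB := inferInstance
  θ := -γ
  iA K p q h := (K.XIsoOfEq (show q = p by lia)).hom ≫ inK' γ K p
  iB K p q h := inU' γ K (by lia)
  pA K p q h := prK' γ K p ≫ (K.XIsoOfEq (show p = q by lia)).hom
  pB K p q h := prU' γ K (by lia)
  iA_pA K p q h := by
    obtain rfl : q = p := by lia
    rw [XIsoOfEq_rfl, Iso.refl_hom]
    exact (congrArg₂ (· ≫ ·) (Category.id_comp _) (Category.comp_id _)).trans (inK'_prK' γ K q)
  iA_pB K p q q' h h' := by rw [Category.assoc, inK'_prU', comp_zero]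
  iB_pA K p q q' h h' := by rw [← Category.assoc, inU'_prK', zero_comp]
  iB_pB K p q h := inU'_prU' γ K _
  split K p q q' h h' := by
    obtain rfl : q = p := by lia
    rw [XIsoOfEq_rfl, Iso.refl_hom]
    exact (congrArg (· + _) (congrArg₂ (· ≫ ·) (Category.comp_id _) (Category.id_comp _))).trans
      (neg_split γ K (show q' + 1 = q by lia))
  iA_d K p p' q q' h hp h' := by
    obtain rfl : q = p := by lia
    obtain rfl : q' = p' := by lia
    rw [XIsoOfEq_rfl, XIsoOfEq_rfl, Iso.refl_hom, Iso.refl_hom, neg_add_cancel,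
      Int.negOnePow_zero, one_smul]
    refine (congrArg (· ≫ _) (Category.id_comp _)).trans ((inK'_d γ K hp).trans ?_)
    rw [sub_eq_add_neg, add_comm]
    exact congrArg₂ (· + ·) (Preadditive.neg_comp _ _).symm
      (congrArg (K.d q q' ≫ ·) (Category.id_comp _).symm)
  iB_d K p p' q q' h hp h' := by
    refine (inU'_d γ K (show q + 1 = p by lia) hp).trans ?_
    obtain rfl : q' = p := by lia
    rw [Int.negOnePow_neg, Int.negOnePow_one, Units.neg_smul, one_smul]
  iA_map f p q h := by
    obtain rfl : q = p := by lia
    rw [XIsoOfEq_rfl, XIsoOfEq_rfl, Iso.refl_hom, Iso.refl_hom]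
    exact (congrArg (· ≫ _) (Category.id_comp _)).trans ((inK'_map γ f q).trans
      (congrArg (f.f q ≫ ·) (Category.id_comp _).symm))
  iB_map f p q h := inU'_map γ f _

end

end Exactness

/-- The functors of the letters are exact. -/
lemma letterFun_isTriangulated : ∀ s : Letter n, ∃ _ : (letterFun.{u} s).functor.CommShift ℤ,
    (letterFun.{u} s).functor.IsTriangulated
  | (i, true) => by
    let : (tensR.{u} i).CommShift ℤ := (posDecomp (beta i)).commShift
    have : (onK (tensR.{u} i)).IsTriangulated := (posDecomp (beta i)).isTriangulated_onK
    exact ⟨(inferInstance : (onKb (tensR.{u} i)).CommShift ℤ), isTriangulated_onKb (tensR.{u} i)⟩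
  | (i, false) => by
    let : (tensR'.{u} i).CommShift ℤ := (negDecomp (gamma i)).commShift
    have : (onK (tensR'.{u} i)).IsTriangulated := (negDecomp (gamma i)).isTriangulated_onK
    exact ⟨(inferInstance : (onKb (tensR'.{u} i)).CommShift ℤ), isTriangulated_onKb (tensR'.{u} i)⟩

/-- The functors of braid words are exact. -/
lemma wordFun_isTriangulated : ∀ g : Word n, ∃ _ : (wordFun.{u} g).functor.CommShift ℤ,
    (wordFun.{u} g).functor.IsTriangulated
  | [] => ⟨(inferInstance : (𝟭 (𝒞.{u} n)).CommShift ℤ),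
      (inferInstance : (𝟭 (𝒞.{u} n)).IsTriangulated)⟩
  | s :: g => by
    obtain ⟨_, _⟩ := letterFun_isTriangulated.{u} s
    obtain ⟨_, _⟩ := wordFun_isTriangulated g
    exact ⟨(inferInstance : ((wordFun.{u} g).functor ⋙ (letterFun.{u} s).functor).CommShift ℤ),
      (inferInstance : ((wordFun.{u} g).functor ⋙ (letterFun.{u} s).functor).IsTriangulated)⟩

end BraidCob

theorem theorem1p1 (n : ℕ) :
    (∀ g : BraidCob.Word n, ∃ _ : (BraidCob.wordFun.{u} g).functor.CommShift ℤ,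
      (BraidCob.wordFun.{u} g).functor.IsTriangulated) ∧
    ∃ F : BraidCob.ProjMonoidalFunctor.{u} n,
      (∀ (g h : BraidCob.BC n) (S : BraidCob.Movie g.word h.word),
        (F.map (BraidCob.BC.ofMovie S)).deg = BraidCob.intDeg (2 * (S.neg : ℤ))) ∧
      ∀ i : Fin n,
        BraidCob.HNat.EqUpToSign (F.map (BraidCob.BC.birth i))
          ((BraidCob.emptyIso n).hom ≫ BraidCob.w₁ i ≫ (BraidCob.σIso i).inv) ∧
        BraidCob.HNat.EqUpToSign (F.map (BraidCob.BC.death' i))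
          ((BraidCob.σIso' i).hom ≫ BraidCob.w₂ i ≫ (BraidCob.emptyIso n).inv) ∧
        BraidCob.HNat.EqUpToSign (F.map (BraidCob.BC.death i))
          ((BraidCob.σIso i).hom ≫ BraidCob.w₃ i ≫ (BraidCob.emptyIso n).inv) ∧
        BraidCob.HNat.EqUpToSign (F.map (BraidCob.BC.birth' i))
          ((BraidCob.emptyIso n).hom ≫ BraidCob.w₄ i ≫ (BraidCob.σIso' i).inv) :=
  ⟨BraidCob.wordFun_isTriangulated, BraidCob.cobFunctor n,
    fun _ _ S => (BraidCob.deg_cobMap (BraidCob.BC.ofMovie S)).trans (BraidCob.deg_mT S),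
    fun i => ⟨BraidCob.cobFunctor_birth i, BraidCob.cobFunctor_death' i,
      BraidCob.cobFunctor_death i, BraidCob.cobFunctor_birth' i⟩⟩
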